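/- **Setting.** Simplicial complexes are finite and geometric. Two complexes are PL homeomorphic if they have simplicially isomorphic subdivisions. A closed combinatorial $d$-manifold is a complex in which the link of every vertex is PL homeomorphic to the boundary of the $d$-simplex. A closed PL $d$-manifold $M$ is a space with a homeomorphism $|K|\cong M$ from a closed combinatorial $d$-manifold $K$. Its Euler characteristic is $\chi(M)=\sum_i(-1)^i f_i(K)$, where $f_i(K)$ is the number of $i$-simplices of $K$. For connected $M$, $m(M)$ is the rank (minimal number of generators) of its fundamental group. A *balanced triangulation* of $M$ is a combinatorial $d$-manifold $\Delta$ that is PL homeomorphic to $K$, with a colouring $\kappa$ of its vertices by $0,1,\dots,d$ such that no two vertices of a simplex have the same colour. The *dual graph* $\Lambda(\Delta)$ has the facets of $\Delta$ as vertices; two facets are joined by an edge when they share a $(d-1)$-simplex, and the edge gets the colour that is missing on the shared simplex. For a cyclic permutation $\varepsilon=(\varepsilon_0,\dots,\varepsilon_d)$ of the colours, $\Lambda(\Delta)$ embeds regularly in a closed surface $F_\varepsilon$: the embedding is a cell structure on $F_\varepsilon$ whose vertices and edges are those of $\Lambda(\Delta)$ and which has exactly one face for each cycle of $\Lambda(\Delta)$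 bi-coloured by $\varepsilon_k,\varepsilon_{k+1}$, $k\in\mathbb Z_{d+1}$. So $\chi(F_\varepsilon)$ is the number of facets, minus the number of edges of $\Lambda(\Delta)$, plus the number of these bi-coloured cycles. Put $$\rho_\varepsilon(\Delta)=1-\tfrac12\chi(F_\varepsilon),$$ which is the genus of $F_\varepsilon$ if it is orientable and half its genus if not. The *balanced genus* is $$\mathcal G(\Delta)=\min_\varepsilon\rho_\varepsilon(\Delta),\qquad \mathcal G_M=\min\{\mathcal G(\Delta):\Delta\text{ a balanced triangulation of }M\}.$$ **Theorem.** Let $M$ be a closed connected PL $4$-manifold that is not homeomorphic to the $4$-sphere. Then the fundamental group of $M$ is finitely generated and $$\mathcal G_M\ \ge\ 2\chi(M)+5\,m(M)+11 .$$ -/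

import Mathlib

open Geometry

noncomputable section

namespace BalancedGenus

section Complexes

variable {E F : Type*} [AddCommGroup E] [Module ℝ E] [AddCommGroup F] [Module ℝ F]

/-- `K'` is a (finite) subdivision of `K`: it has the same underlying space and each of its
simplices lies in a simplex of `K`. -/
def IsSubdivision (K' K : SimplicialComplex ℝ E) : Prop :=
  K'.faces.Finite ∧ K'.space = K.space ∧
    ∀ s ∈ K'.faces, ∃ t ∈ K.faces, convexHull ℝ (s : Set E) ⊆ convexHull ℝ (t : Set E)

open Classical in
/-- `K` and `L` are simplicially isomorphic: some bijection between their vertex sets sends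
faces to faces in both directions. -/
def SimpliciallyIsomorphic (K : SimplicialComplex ℝ E) (L : SimplicialComplex ℝ F) : Prop :=
  ∃ f : E → F, Set.BijOn f K.vertices L.vertices ∧
    ∀ s : Finset E, (s : Set E) ⊆ K.vertices → (s ∈ K.faces ↔ s.image f ∈ L.faces)

/-- `K` and `L` are PL homeomorphic: they have simplicially isomorphic subdivisions. -/
def PLHomeomorphic (K : SimplicialComplex ℝ E) (L : SimplicialComplex ℝ F) : Prop :=
  ∃ (K' : SimplicialComplex ℝ E) (L' : SimplicialComplex ℝ F),
    IsSubdivision K' K ∧ IsSubdivision L' L ∧ SimpliciallyIsomorphic K' L'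

open Classical in
/-- The link of the vertex `v` in `K`. -/
def link (K : SimplicialComplex ℝ E) (v : E) : SimplicialComplex ℝ E where
  faces := {s | s ∈ K.faces ∧ v ∉ s ∧ insert v s ∈ K.faces}
  isRelLowerSet_faces := by
    rintro s ⟨hs, hv, hvs⟩
    refine ⟨SimplicialComplex.nonempty_of_mem_faces hs, fun t hts ht => ?_⟩
    exact ⟨K.down_closed hs hts ht, fun h => hv (hts h),
      K.down_closed hvs (Finset.insert_subset_insert v hts) (Finset.insert_nonempty v t)⟩
  indep := fun hs => K.indep hs.1
  inter_subset_convexHull := fun hs ht => K.inter_subset_convexHull hs.1 ht.1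

theorem affineIndependent_single (n : ℕ) : AffineIndependent ℝ
    (fun v : Set.range (fun i : Fin (n + 1) => (Pi.single i (1 : ℝ) : Fin (n + 1) → ℝ)) =>
      (v : Fin (n + 1) → ℝ)) := by
  have e : (fun i : Fin (n + 1) => (Pi.single i (1 : ℝ) : Fin (n + 1) → ℝ)) =
      Pi.basisFun ℝ (Fin (n + 1)) := by
    funext i; simp
  rw [e]
  exact (Pi.basisFun ℝ (Fin (n + 1))).linearIndependent.affineIndependent.range

/-- The boundary complex of the standard `n`-simplex, whose vertices are the `n + 1` standard
basis vectors of `ℝⁿ⁺¹`; it is the standard PL sphere of dimension `n - 1`. -/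
def simplexBoundary (n : ℕ) : SimplicialComplex ℝ (Fin (n + 1) → ℝ) where
  faces := {s | s.Nonempty ∧ (s : Set (Fin (n + 1) → ℝ)) ⊂
      Set.range (fun i : Fin (n + 1) => (Pi.single i (1 : ℝ) : Fin (n + 1) → ℝ))}
  isRelLowerSet_faces := by
    rintro s ⟨hs, hss⟩
    exact ⟨hs, fun t hts ht => ⟨ht, lt_of_le_of_lt (Finset.coe_subset.2 hts) hss⟩⟩
  indep := by
    rintro s ⟨-, hs⟩
    exact (affineIndependent_single n).mono hs.subset
  inter_subset_convexHull := by
    classical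
    rintro s t ⟨-, hs⟩ ⟨-, ht⟩
    have hu : ((s ∪ t : Finset (Fin (n + 1) → ℝ)) : Set (Fin (n + 1) → ℝ)) ⊆
        Set.range (fun i : Fin (n + 1) => (Pi.single i (1 : ℝ) : Fin (n + 1) → ℝ)) := by
      rw [Finset.coe_union]; exact Set.union_subset hs.subset ht.subset
    have h : AffineIndependent ℝ ((↑) : ↥(s ∪ t) → (Fin (n + 1) → ℝ)) :=
      (affineIndependent_single n).mono hu
    have := h.convexHull_inter (s := s ∪ t) (t₁ := s) (t₂ := t)
      Finset.subset_union_left Finset.subset_union_right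
    rw [← this]

/-- A finite simplicial complex is a closed combinatorial (PL) `d`-manifold if the link of every
vertex is a PL `(d - 1)`-sphere. -/
def IsCombinatorialManifold (d : ℕ) (K : SimplicialComplex ℝ E) : Prop :=
  K.faces.Finite ∧ ∀ v ∈ K.vertices, PLHomeomorphic (link K v) (simplexBoundary d)

/-- The Euler characteristic `∑ᵢ (-1)ⁱ fᵢ` of a finite simplicial complex; a face with `k`
vertices has dimension `k - 1`. -/
def eulerChar (K : SimplicialComplex ℝ E) : ℤ :=
  ∑ᶠ s ∈ K.faces, (-1 : ℤ) ^ (s.card - 1)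

/-- `κ` is a proper colouring of the vertices of `Δ` with the colours `0, …, d`: no two vertices
of a simplex have the same colour. -/
def IsBalancedColoring {d : ℕ} (Δ : SimplicialComplex ℝ E) (κ : E → Fin (d + 1)) : Prop :=
  ∀ s ∈ Δ.faces, Set.InjOn κ (s : Set E)

open Classical in
/-- The dual graph of a `d`-dimensional complex: its vertices are the facets, two of which are
adjacent when they share a `(d - 1)`-simplex, that is, `d` common vertices. -/
def dualGraph (d : ℕ) (Δ : SimplicialComplex ℝ E) : SimpleGraph Δ.facets where
  Adj σ τ := σ ≠ τ ∧ (σ.1 ∩ τ.1).card = d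
  symm.symm := fun σ τ h => ⟨h.1.symm, by rw [Finset.inter_comm]; exact h.2⟩
  loopless.irrefl := fun _ h => h.1 rfl

open Classical in
/-- The edge `{σ, τ}` of the dual graph has colour `c`: the vertices of `σ ∩ τ` carry exactly
the colours different from `c`. -/
def EdgeHasColor {d : ℕ} {Δ : SimplicialComplex ℝ E} (κ : E → Fin (d + 1)) (σ τ : Δ.facets)
    (c : Fin (d + 1)) : Prop :=
  (σ.1 ∩ τ.1).image κ = Finset.univ.erase c

open Classical in
/-- The subgraph of the dual graph formed by the edges of colours `i` and `j`. For a closed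
manifold and `i ≠ j` its connected components are the bi-coloured cycles with colours `i`, `j`. -/
def bicoloredGraph {d : ℕ} (Δ : SimplicialComplex ℝ E) (κ : E → Fin (d + 1))
    (i j : Fin (d + 1)) : SimpleGraph Δ.facets where
  Adj σ τ := (dualGraph d Δ).Adj σ τ ∧ (EdgeHasColor κ σ τ i ∨ EdgeHasColor κ σ τ j)
  symm.symm := fun σ τ h => ⟨h.1.symm, by
    simpa only [EdgeHasColor, Finset.inter_comm τ.1 σ.1] using h.2⟩
  loopless.irrefl := fun σ h => (dualGraph d Δ).irrefl h.1

/-- The Euler characteristic of the closed surface `F_ε` into which the dual graph embeds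
regularly with respect to the cyclic permutation `ε = (ε₀, …, ε_d)` of the colours. The cells of
`F_ε` are the vertices and the edges of the dual graph and one disc for each bi-coloured cycle
with colours `ε_k`, `ε_{k+1}`, where `k` is taken modulo `d + 1`. -/
def surfaceEulerChar {d : ℕ} (Δ : SimplicialComplex ℝ E) (κ : E → Fin (d + 1))
    (ε : Equiv.Perm (Fin (d + 1))) : ℤ :=
  (Nat.card Δ.facets : ℤ) - (Nat.card (dualGraph d Δ).edgeSet : ℤ)
    + ∑ k : Fin (d + 1),
        (Nat.card (bicoloredGraph Δ κ (ε k) (ε (k + 1))).ConnectedComponent : ℤ)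

/-- The balanced `ε`-genus `ρ_ε = 1 - χ(F_ε) / 2`: the genus of `F_ε` if it is orientable, half
of its genus if not. -/
def epsilonGenus {d : ℕ} (Δ : SimplicialComplex ℝ E) (κ : E → Fin (d + 1))
    (ε : Equiv.Perm (Fin (d + 1))) : ℝ :=
  1 - (surfaceEulerChar Δ κ ε : ℝ) / 2

/-- The balanced genus of a balanced complex `(Δ, κ)`: the minimum of the finitely many numbers
`ρ_ε`. -/
def complexGenus {d : ℕ} (Δ : SimplicialComplex ℝ E) (κ : E → Fin (d + 1)) : ℝ :=
  Finset.univ.inf' Finset.univ_nonempty (epsilonGenus Δ κ)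

end Complexes

/-- A closed PL `d`-manifold structure on the space `M`: a homeomorphism to `M` from the
underlying space of a finite combinatorial `d`-manifold in some `ℝᴺ`. -/
structure PLStructure (d : ℕ) (M : Type*) [TopologicalSpace M] where
  ambientDim : ℕ
  complex : SimplicialComplex ℝ (EuclideanSpace ℝ (Fin ambientDim))
  isManifold : IsCombinatorialManifold d complex
  homeo : complex.space ≃ₜ M

namespace PLStructure

variable {d : ℕ} {M : Type*} [TopologicalSpace M]

/-- The Euler characteristic of `M`, computed from the given triangulation. -/
def euler (P : PLStructure d M) : ℤ := eulerChar P.complex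

/-- `(Δ, κ)` is a balanced triangulation of the PL manifold `M`. -/
structure IsBalancedTriangulation (P : PLStructure d M) {n : ℕ}
    (Δ : SimplicialComplex ℝ (EuclideanSpace ℝ (Fin n)))
    (κ : EuclideanSpace ℝ (Fin n) → Fin (d + 1)) : Prop where
  isManifold : IsCombinatorialManifold d Δ
  plHomeomorphic : PLHomeomorphic Δ P.complex
  isBalanced : IsBalancedColoring Δ κ

/-- The balanced genus of the PL manifold `M`: the minimum of the balanced genera of its balanced
triangulations. It is taken in the extended reals, so that no junk value can occur. -/
def balancedGenus (P : PLStructure d M) : EReal :=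
  ⨅ (n : ℕ) (Δ : SimplicialComplex ℝ (EuclideanSpace ℝ (Fin n)))
    (κ : EuclideanSpace ℝ (Fin n) → Fin (d + 1)) (_ : P.IsBalancedTriangulation Δ κ),
    ((complexGenus Δ κ : ℝ) : EReal)

end PLStructure

end BalancedGenus

end

/-! Fix a balanced triangulation, let f_S be the number of its simplices with colour set S, and
recolour so that ε is the standard cyclic order (`epsilonGenus_comp`). The dual graph is 5-regular
and the bi-coloured cycles of colours k, k+1 correspond to the triangles with the other three
colours, so χ(F_ε) is a linear form in the f_S. The Euler relations of the vertex links, with an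
upper bound for the Euler characteristics of the edge links obtained from linear algebra over the
field with two elements (`IsChamberSystem.link_inequality`), turn it into ρ_ε = 1 + 2χ + ∑ₖ
(f_{k,k+2} - f_k - f_{k+2}); see `surface_formula` and `epsilonGenus_one`. The theorem follows from
f_{ab} ≥ f_a + f_b + m + 2 for a ≠ b (`faceCount_add_rank_le`), applied to the five pairs {k, k+2}.

For this bound let G be the graph of the edges with colours a, b. The fundamental group is the
holonomy group of a cocycle on the edges of the triangulation (`exists_cocycle`). Closed walks can
be pushed into G, so G is connected and already has full holonomy (`IsChamberSystem.edgeHol_full`),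
and a spanning tree gives m ≤ f_{ab} - f_a - f_b + 1 (`rank_add_card_le`). Three more edges have to
be saved. The link of each triangle with the other three colours is a cycle in G. All its edges are
joined to one vertex, hence its holonomy is trivial and any one of its edges is redundant
(`IsChamberSystem.edgeHol_eliminate`). If there are three such cycles, the second not contained in
the first and the third not contained in the union of the first two, then three edges can be removed
and the bound holds.

Otherwise all link cycles coincide, or any two distinct ones cover G. In the second case each edge
is labelled by the unique cycle that misses it, and all vertices of G have degree 2 or 3. If at
least three vertices have degree 3 then f_{ab} ≥ f_a + f_b + 2 by parity, while the group is trivial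
because two cycles with a common neighbour cover G. What remains is a circle or a theta graph,
treated together as `IsSpindle`. In explicit coordinates the whole complex is then the suspension of
the link of a pole (`IsSpindle.nonempty_homeomorph_sphere`), that is a 4-sphere, which is excluded.

The combinatorics needs consequences of the hypothesis on vertex links. Normality (purity, two
facets at each wall, strongly connected stars) is shown to be invariant under subdivision in both
directions, and the Euler characteristic depends only on the underlying space because it is a
valuation on compact convex sets. -/

namespace BalancedGenus

/-! ### Barycentric weights, open simplices, and convex sets covered by flats. -/

section AffineLemmas

open Classical Set

theorem sum_extend {E : Type*} {s t : Finset E} (hst : s ⊆ t) (w : E → ℝ) :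
    ∑ v ∈ t, (if v ∈ s then w v else 0) = ∑ v ∈ s, w v := by
  rw [← Finset.sum_subset hst (f := fun v => if v ∈ s then w v else 0)
    (fun v _ hv => by simp [hv])]
  exact Finset.sum_congr rfl fun v hv => by simp [hv]

variable {E : Type*} [AddCommGroup E] [Module ℝ E]

/-- The points of the simplex `s` all of whose barycentric coordinates are positive. -/
def openHull (s : Finset E) : Set E :=
  {x | ∃ w : E → ℝ, (∀ v ∈ s, 0 < w v) ∧ ∑ v ∈ s, w v = 1 ∧ ∑ v ∈ s, w v • v = x}

theorem openHull_subset_convexHull (s : Finset E) : openHull s ⊆ convexHull ℝ (s : Set E) := by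
  rintro x ⟨w, hw, h1, hx⟩
  exact Finset.mem_convexHull'.2 ⟨w, fun v hv => (hw v hv).le, h1, hx⟩

theorem nonempty_of_mem_openHull {s : Finset E} {x : E} (hx : x ∈ openHull s) : s.Nonempty := by
  obtain ⟨w, -, h1, -⟩ := hx
  by_contra h
  rw [Finset.not_nonempty_iff_eq_empty] at h
  simp [h] at h1

theorem exists_mem_openHull_of_mem_convexHull {t : Finset E} {x : E}
    (hx : x ∈ convexHull ℝ (t : Set E)) : ∃ s ⊆ t, x ∈ openHull s := by
  obtain ⟨w, h0, h1, hx⟩ := Finset.mem_convexHull'.1 hx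
  refine ⟨t.filter fun v => 0 < w v, Finset.filter_subset _ _, w,
    fun v hv => (Finset.mem_filter.1 hv).2, ?_, ?_⟩
  · rw [← h1]
    refine Finset.sum_subset (Finset.filter_subset _ _) fun v hv hv' => ?_
    have := h0 v hv
    simp only [Finset.mem_filter, hv, true_and, not_lt] at hv'
    exact le_antisymm hv' this
  · rw [← hx]
    refine Finset.sum_subset (Finset.filter_subset _ _) fun v hv hv' => ?_
    have := h0 v hv
    simp only [Finset.mem_filter, hv, true_and, not_lt] at hv'
    rw [le_antisymm hv' this, zero_smul]

theorem weights_unique {s : Finset E} (hs : AffineIndependent ℝ ((↑) : s → E)) {w w' : E → ℝ}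
    (h1 : ∑ v ∈ s, w v = ∑ v ∈ s, w' v) (h2 : ∑ v ∈ s, w v • v = ∑ v ∈ s, w' v • v) :
    ∀ v ∈ s, w v = w' v := by
  intro v hv
  have := (affineIndependent_iff (k := ℝ)).1 hs Finset.univ (fun v => w v - w' v) ?_ ?_ ⟨v, hv⟩
    (Finset.mem_univ _)
  · simpa [sub_eq_zero] using this
  · rw [Finset.sum_coe_sort s (fun v => w v - w' v), Finset.sum_sub_distrib, h1, sub_self]
  · rw [Finset.sum_coe_sort s (fun v => (w v - w' v) • v)]
    simp only [sub_smul]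
    rw [Finset.sum_sub_distrib, h2, sub_self]

theorem sum_smul_extend {s t : Finset E} (hst : s ⊆ t) (w : E → ℝ) :
    ∑ v ∈ t, (if v ∈ s then w v else 0) • v = ∑ v ∈ s, w v • v := by
  rw [← Finset.sum_subset hst (f := fun v => (if v ∈ s then w v else 0) • v)
    (fun v _ hv => by simp [hv])]
  exact Finset.sum_congr rfl fun v hv => by simp [hv]

/-- A positive combination of the vertices of a simplex lies in a face only if the face is
everything. -/
theorem subset_of_mem_openHull_of_mem_convexHull {s t r : Finset E}
    (hr : AffineIndependent ℝ ((↑) : r → E)) (hs : s ⊆ r) (ht : t ⊆ r) {x : E}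
    (hx : x ∈ openHull s) (hx' : x ∈ convexHull ℝ (t : Set E)) : s ⊆ t := by
  obtain ⟨w, hw, h1, rfl⟩ := hx
  obtain ⟨w', -, h1', h2'⟩ := Finset.mem_convexHull'.1 hx'
  intro v hv
  have := weights_unique hr (w := fun v => if v ∈ s then w v else 0)
    (w' := fun v => if v ∈ t then w' v else 0)
    (by rw [sum_extend hs, sum_extend ht, h1, h1'])
    (by rw [sum_smul_extend hs, sum_smul_extend ht, h2']) v (hs hv)
  by_contra hvt
  simp only [hv, hvt, if_true, if_false] at this
  exact (hw v hv).ne' this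

theorem openHull_nonempty {s : Finset E} (hs : s.Nonempty) : (openHull s).Nonempty := by
  have : (0 : ℝ) < s.card := by exact_mod_cast hs.card_pos
  refine ⟨_, fun _ => (s.card : ℝ)⁻¹, fun _ _ => by positivity, ?_, rfl⟩
  rw [Finset.sum_const, nsmul_eq_mul, mul_inv_cancel₀ this.ne']

/-- All weights of c are positive, so any positive share of c makes every weight of the combination
positive. -/
theorem combo_mem_openHull {s : Finset E} {x c : E} (hx : x ∈ convexHull ℝ (s : Set E))
    (hc : c ∈ openHull s) {δ : ℝ} (h0 : 0 < δ) (h1 : δ ≤ 1) :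
    (1 - δ) • x + δ • c ∈ openHull s := by
  obtain ⟨w, hw, hw1, rfl⟩ := Finset.mem_convexHull'.1 hx
  obtain ⟨w', hw', hw1', rfl⟩ := hc
  refine ⟨fun v => (1 - δ) * w v + δ * w' v, fun v hv => ?_, ?_, ?_⟩
  · have := mul_nonneg (sub_nonneg.2 h1) (hw v hv)
    have := mul_pos h0 (hw' v hv)
    dsimp only
    linarith
  · rw [Finset.sum_add_distrib, ← Finset.mul_sum, ← Finset.mul_sum, hw1, hw1']; ring
  · simp only [add_smul, mul_smul]
    rw [Finset.sum_add_distrib, Finset.smul_sum, Finset.smul_sum]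

theorem convex_openHull (s : Finset E) : Convex ℝ (openHull s) := by
  intro x hx y hy a b ha hb hab
  rcases hb.eq_or_lt with rfl | hb
  · obtain rfl : a = 1 := by linarith
    simpa using hx
  · obtain rfl : a = 1 - b := by linarith
    exact combo_mem_openHull (openHull_subset_convexHull s hx) hy hb (by linarith)

theorem mem_affineSubspace_of_combo {A : AffineSubspace ℝ E} {x y : E} {δ : ℝ} (hδ : δ ≠ 0)
    (hx : x ∈ A) (h : (1 - δ) • x + δ • y ∈ A) : y ∈ A := by
  -- On the line through x and the given combination, y is the point with parameter 1/δ.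
  have := AffineMap.lineMap_mem (δ⁻¹ : ℝ) hx h
  convert this using 1
  rw [AffineMap.lineMap_apply_module]
  simp only [smul_add, smul_smul, inv_mul_cancel₀ hδ, one_smul, ← add_assoc, ← add_smul]
  have : 1 - δ⁻¹ + δ⁻¹ * (1 - δ) = 0 := by field_simp; ring
  rw [this, zero_smul, zero_add]

/-- A convex set covered by finitely many affine subspaces lies in one of them. -/
theorem exists_subset_affineSubspace {ι : Type*} (I : Finset ι) (A : ι → AffineSubspace ℝ E)
    {C : Set E} (hC : Convex ℝ C) (hne : C.Nonempty) (h : ∀ x ∈ C, ∃ i ∈ I, x ∈ A i) :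
    ∃ i ∈ I, C ⊆ A i := by
  induction I using Finset.induction_on with
  | empty => obtain ⟨x, hx⟩ := hne; obtain ⟨i, hi, -⟩ := h x hx; simp at hi
  | insert j I hj ih =>
    by_cases hCj : C ⊆ A j
    · exact ⟨j, Finset.mem_insert_self _ _, hCj⟩
    obtain ⟨y, hy, hyj⟩ := not_subset.1 hCj
    suffices ∀ x ∈ C, ∃ i ∈ I, x ∈ A i by
      obtain ⟨i, hi, hi'⟩ := ih this
      exact ⟨i, Finset.mem_insert_of_mem hi, hi'⟩
    intro z hz
    -- Infinitely many points of the segment from z to y. Any two of them span a line through both z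
    -- and y, so a flat containing two of them contains z and y.
    let f : ℕ → E := fun n => (1 - 1 / ((n : ℝ) + 2)) • z + (1 / ((n : ℝ) + 2)) • y
    have hf : ∀ n, f n ∈ C := fun n => by
      have h2 : (0 : ℝ) < (n : ℝ) + 2 := by positivity
      refine hC hz hy (sub_nonneg.2 ?_) (by positivity) (by ring)
      rw [div_le_one h2]; linarith [(Nat.cast_nonneg n : (0 : ℝ) ≤ n)]
    choose i hi hfi using fun n => h _ (hf n)
    have key : ∀ m n : ℕ, m ≠ n → ∀ B : AffineSubspace ℝ E, f m ∈ B → f n ∈ B → z ∈ B ∧ y ∈ B := by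
      intro m n hmn B hm hn
      have h2 : ((m : ℝ) + 2) ≠ 0 := by positivity
      have h3 : ((n : ℝ) + 2) ≠ 0 := by positivity
      have h4 : (m : ℝ) - n ≠ 0 := sub_ne_zero.2 (by exact_mod_cast hmn)
      have e : ∀ c : ℝ, AffineMap.lineMap (f m) (f n) c =
          (1 - ((1 - c) / ((m : ℝ) + 2) + c / ((n : ℝ) + 2))) • z +
            ((1 - c) / ((m : ℝ) + 2) + c / ((n : ℝ) + 2)) • y := by
        intro c
        rw [AffineMap.lineMap_apply_module]
        simp only [f]
        module
      constructor
      -- This is the parameter at which the line through `f m` and `f n` has weight 0 on y; the one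
      -- for y below is found in the same way from weight 1.
      · have := AffineMap.lineMap_mem (-((n : ℝ) + 2) / (m - n)) hm hn
        rw [e] at this
        have h0 : (1 - -((n : ℝ) + 2) / (m - n)) / ((m : ℝ) + 2) +
          -((n : ℝ) + 2) / (m - n) / ((n : ℝ) + 2) = 0 := by field_simp; ring
        rw [h0] at this
        simpa using this
      · have := AffineMap.lineMap_mem ((((m : ℝ) + 2) * (n + 2) - (n + 2)) / (m - n)) hm hn
        rw [e] at this
        have h0 : (1 - (((m : ℝ) + 2) * (n + 2) - (n + 2)) / (m - n)) / ((m : ℝ) + 2) +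
          (((m : ℝ) + 2) * (n + 2) - (n + 2)) / (m - n) / ((n : ℝ) + 2) = 1 := by
          field_simp; ring
        rw [h0] at this
        simpa using this
    -- If `A j` is used only finitely often, the pigeonhole principle applied to the tail gives a
    -- repeated index other than j. If it is used twice, y would lie in `A j`.
    obtain ⟨m, n, hmn, hmn'⟩ : ∃ m n : ℕ, m < n ∧ i (m + 0) = i n ∧ i m ≠ j := by
      by_cases hex : ∃ N, ∀ n ≥ N, i n ≠ j
      · obtain ⟨N, hN⟩ := hex
        obtain ⟨a, ha⟩ := Finite.exists_ne_map_eq_of_infinite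
          (fun n : ℕ => (⟨i (N + n), hi _⟩ : (insert j I : Finset ι)))
        obtain ⟨b, hab, hab'⟩ := ha
        simp only [Subtype.mk.injEq] at hab'
        rcases lt_or_gt_of_ne hab with hlt | hlt
        · exact ⟨N + a, N + b, by omega, hab', hN _ (by omega)⟩
        · exact ⟨N + b, N + a, by omega, hab'.symm, hN _ (by omega)⟩
      · push Not at hex
        obtain ⟨a, -, ha⟩ := hex 0
        obtain ⟨b, hb, hb'⟩ := hex (a + 1)
        exact absurd (key a b (by omega) (A j) (ha ▸ hfi a) (hb' ▸ hfi b)).2 hyj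
    refine ⟨i m, (Finset.mem_insert.1 (hi m)).resolve_left hmn'.2, ?_⟩
    exact (key m n hmn.ne _ (hfi m) (by have := hfi n; rwa [← hmn'.1] at this)).1

end AffineLemmas

/-! ### Carriers of points in a complex and in a subdivision. -/

section Carriers

open Classical Set

variable {E : Type*} [AddCommGroup E] [Module ℝ E] {K K' : SimplicialComplex ℝ E}

/-- The intersection axiom puts x into the hull of s ∩ t, a face of s that contains an interior
point of s. -/
theorem subset_of_mem_openHull {s t : Finset E} (hs : s ∈ K.faces) (ht : t ∈ K.faces) {x : E}
    (hx : x ∈ openHull s) (hx' : x ∈ convexHull ℝ (t : Set E)) : s ⊆ t := by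
  have h := K.inter_subset_convexHull hs ht ⟨openHull_subset_convexHull s hx, hx'⟩
  rw [← Finset.coe_inter] at h
  exact (subset_of_mem_openHull_of_mem_convexHull (K.indep hs) subset_rfl
    Finset.inter_subset_left hx h).trans Finset.inter_subset_right

theorem exists_carrier {x : E} (hx : x ∈ K.space) : ∃ s ∈ K.faces, x ∈ openHull s := by
  obtain ⟨t, ht, hxt⟩ := SimplicialComplex.mem_space_iff.1 hx
  obtain ⟨s, hst, hxs⟩ := exists_mem_openHull_of_mem_convexHull hxt
  exact ⟨s, K.down_closed ht hst (nonempty_of_mem_openHull hxs), hxs⟩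

/-- Some t₁ of K contains s, and x lies in the hull of t₁ ∩ t. In the coordinates of t₁, the weight
of x at a vertex outside t is a positive combination of the non-negative weights of the vertices of
s. It vanishes, so each of these weights does. -/
theorem IsSubdivision.convexHull_subset (h : IsSubdivision K' K) {s t : Finset E}
    (hs : s ∈ K'.faces) (ht : t ∈ K.faces) {x : E} (hx : x ∈ openHull s)
    (hx' : x ∈ convexHull ℝ (t : Set E)) :
    convexHull ℝ (s : Set E) ⊆ convexHull ℝ (t : Set E) := by
  obtain ⟨t₁, ht₁, hst₁⟩ := h.2.2 s hs
  have hx₁ := K.inter_subset_convexHull ht₁ ht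
    ⟨hst₁ (openHull_subset_convexHull s hx), hx'⟩
  rw [← Finset.coe_inter] at hx₁
  refine convexHull_min (fun v hv => ?_) (convex_convexHull _ _)
  have hb : ∀ u ∈ s, ∃ b : E → ℝ, (∀ y ∈ t₁, 0 ≤ b y) ∧ ∑ y ∈ t₁, b y = 1 ∧
      ∑ y ∈ t₁, b y • y = u := fun u hu =>
    Finset.mem_convexHull'.1 (hst₁ (subset_convexHull ℝ _ hu))
  choose! b hb0 hb1 hb2 using hb
  obtain ⟨w, hw, hw1, hwx⟩ := hx
  obtain ⟨c, hc0, hc1, hc2⟩ := Finset.mem_convexHull'.1 hx₁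
  have hu := weights_unique (K.indep ht₁) (w := fun y => ∑ u ∈ s, w u * b u y)
    (w' := fun y => if y ∈ t₁ ∩ t then c y else 0) ?_ ?_
  · have hz : ∀ y ∈ t₁, y ∉ t → b v y = 0 := by
      intro y hy hyt
      have := hu y hy
      simp only [Finset.mem_inter, hy, hyt, and_false, if_false] at this
      have h0 := (Finset.sum_eq_zero_iff_of_nonneg
        (fun u hu => mul_nonneg (hw u hu).le (hb0 u hu y hy))).1 this v hv
      exact (mul_eq_zero.1 h0).resolve_left (hw v hv).ne'
    have hv' : v ∈ convexHull ℝ ((t₁ ∩ t : Finset E) : Set E) := by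
      refine Finset.mem_convexHull'.2 ⟨b v,
        fun y hy => hb0 v hv y (Finset.mem_inter.1 hy).1, ?_, ?_⟩
      · rw [← hb1 v hv]
        exact Finset.sum_subset Finset.inter_subset_left fun y hy hy' =>
          hz y hy fun hyt => hy' (Finset.mem_inter.2 ⟨hy, hyt⟩)
      · conv_rhs => rw [← hb2 v hv]
        refine Finset.sum_subset Finset.inter_subset_left fun y hy hy' => ?_
        rw [hz y hy fun hyt => hy' (Finset.mem_inter.2 ⟨hy, hyt⟩), zero_smul]
    exact convexHull_mono (by simp) hv'
  · rw [sum_extend Finset.inter_subset_left, hc1, Finset.sum_comm, ← hw1]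
    refine Finset.sum_congr rfl fun u hu => ?_
    rw [← Finset.mul_sum, hb1 u hu, mul_one]
  · rw [sum_smul_extend Finset.inter_subset_left, hc2, ← hwx]
    simp only [Finset.sum_smul]
    rw [Finset.sum_comm]
    refine Finset.sum_congr rfl fun u hu => ?_
    simp only [mul_smul]
    rw [← Finset.smul_sum, hb2 u hu]

theorem card_le_of_convexHull_subset {s t : Finset E} (hs : AffineIndependent ℝ ((↑) : s → E))
    (h : convexHull ℝ (s : Set E) ⊆ convexHull ℝ (t : Set E)) : s.card ≤ t.card :=
  hs.card_le_card_of_subset_affineSpan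
    (((subset_convexHull ℝ _).trans h).trans (convexHull_subset_affineSpan _))

end Carriers

/-! ### Normal pseudomanifolds; the local structure of a subdivision near a point. -/

section Normality

open Classical Set Relation

/-- A complex of dimension `k` is a normal pseudomanifold if it is pure, each of its
`(k - 1)`-simplices lies in exactly two facets, and the star of each simplex is strongly
connected. -/
structure IsNormal {E : Type*} [AddCommGroup E] [Module ℝ E] (k : ℕ)
    (K : SimplicialComplex ℝ E) : Prop where
  card_le : ∀ s ∈ K.faces, s.card ≤ k + 1
  pure : ∀ s ∈ K.faces, ∃ t ∈ K.faces, s ⊆ t ∧ t.card = k + 1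
  panel : ∀ s ∈ K.faces, s.card = k → ∃ t₁ ∈ K.faces, ∃ t₂ ∈ K.faces, s ⊆ t₁ ∧ s ⊆ t₂ ∧
    t₁.card = k + 1 ∧ t₂.card = k + 1 ∧ t₁ ≠ t₂ ∧
    ∀ t ∈ K.faces, s ⊆ t → t.card = k + 1 → t = t₁ ∨ t = t₂
  conn : ∀ s ∈ K.faces, ∀ t ∈ K.faces, ∀ t' ∈ K.faces, s ⊆ t → s ⊆ t' → t.card = k + 1 →
    t'.card = k + 1 → ReflTransGen
      (fun u w => w ∈ K.faces ∧ s ⊆ w ∧ w.card = k + 1 ∧ k ≤ (u ∩ w).card) t t'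

variable {E : Type*} [NormedAddCommGroup E] [NormedSpace ℝ E] {K K' : SimplicialComplex ℝ E}

/-- The finitely many closed simplices that miss x stay away from a neighbourhood of x. -/
theorem exists_ball (hK : K.faces.Finite) (x : E) :
    ∃ ε > 0, ∀ t ∈ K.faces, ∀ y ∈ convexHull ℝ (t : Set E), dist y x < ε →
      x ∈ convexHull ℝ (t : Set E) := by
  have hfin : {t ∈ K.faces | x ∉ convexHull ℝ (t : Set E)}.Finite := hK.subset (sep_subset _ _)
  have ho : IsOpen (⋂ t ∈ {t ∈ K.faces | x ∉ convexHull ℝ (t : Set E)},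
      (convexHull ℝ (t : Set E))ᶜ) :=
    hfin.isOpen_biInter fun t _ => (t.finite_toSet.isClosed_convexHull ℝ).isOpen_compl
  obtain ⟨ε, hε, hb⟩ := Metric.isOpen_iff.1 ho x (mem_iInter₂.2 fun t ht => ht.2)
  refine ⟨ε, hε, fun t ht y hy hd => ?_⟩
  by_contra hx
  exact (mem_iInter₂.1 (hb (Metric.mem_ball.2 hd)) t ⟨ht, hx⟩) hy

theorem exists_small (x c : E) {ε : ℝ} (hε : 0 < ε) :
    ∃ δ : ℝ, 0 < δ ∧ δ ≤ 1 ∧ dist ((1 - δ) • x + δ • c) x < ε := by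
  refine ⟨min 1 (ε / (2 * (‖c - x‖ + 1))), by positivity, min_le_left _ _, ?_⟩
  rw [dist_eq_norm]
  have e : ∀ δ : ℝ, (1 - δ) • x + δ • c - x = δ • (c - x) := fun δ => by module
  rw [e, norm_smul, Real.norm_of_nonneg (by positivity)]
  calc _ ≤ ε / (2 * (‖c - x‖ + 1)) * ‖c - x‖ := by gcongr; exact min_le_right _ _
    _ < ε := by
      rw [div_mul_eq_mul_div, div_lt_iff₀ (by positivity)]
      nlinarith [norm_nonneg (c - x)]

/-- The part of an open simplex near a point of the closed simplex. -/
def nearPart (t : Finset E) (x : E) (ε : ℝ) : Set E := openHull t ∩ Metric.ball x ε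

theorem convex_nearPart (t : Finset E) (x : E) (ε : ℝ) : Convex ℝ (nearPart t x ε) :=
  (convex_openHull t).inter (convex_ball x ε)

theorem nearPart_nonempty {t : Finset E} {x : E} (hx : x ∈ convexHull ℝ (t : Set E)) {ε : ℝ}
    (hε : 0 < ε) : (nearPart t x ε).Nonempty := by
  have hne : t.Nonempty := by
    by_contra h
    rw [Finset.not_nonempty_iff_eq_empty] at h
    simp [h] at hx
  obtain ⟨c, hc⟩ := openHull_nonempty hne
  obtain ⟨δ, h0, h1, hd⟩ := exists_small x c hε
  exact ⟨_, combo_mem_openHull hx hc h0 h1, hd⟩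

/-- The near part is relatively open in t: a point y of it can be moved a little towards any vertex
v, and a flat containing both positions contains v. -/
theorem subset_of_nearPart_subset {t : Finset E} {x : E} (hx : x ∈ convexHull ℝ (t : Set E))
    {ε : ℝ} (hε : 0 < ε) {A : AffineSubspace ℝ E} (h : nearPart t x ε ⊆ A) : (t : Set E) ⊆ A := by
  obtain ⟨y, hy, hyx⟩ := nearPart_nonempty hx hε
  intro v hv
  obtain ⟨δ, h0, h1, hd⟩ := exists_small y v (sub_pos.2 (Metric.mem_ball.1 hyx))
  -- Halving δ ≤ 1 makes the share of v strictly less than 1, so the moved point keeps a positive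
  -- share of y and stays in the open simplex.
  have hd2 : δ / 2 ≠ 0 := by positivity
  refine mem_affineSubspace_of_combo hd2 (h ⟨hy, hyx⟩) (h ⟨?_, ?_⟩)
  · have := combo_mem_openHull (subset_convexHull ℝ _ hv) hy
      (δ := 1 - δ / 2) (by linarith) (by linarith)
    convert this using 1
    module
  · rw [Metric.mem_ball]
    refine (dist_triangle _ y _).trans_lt ?_
    have : dist ((1 - δ / 2) • y + (δ / 2) • v) y ≤ dist ((1 - δ) • y + δ • v) y := by
      have e : ∀ δ : ℝ, (1 - δ) • y + δ • v - y = δ • (v - y) := fun δ => by module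
      rw [dist_eq_norm, dist_eq_norm, e, e, norm_smul, norm_smul]
      gcongr
      rw [Real.norm_of_nonneg (by positivity), Real.norm_of_nonneg h0.le]
      linarith
    linarith

/-- A simplex `t` of `K` is covered near each of its points by simplices of the subdivision `K'`
of the same dimension. -/
theorem IsSubdivision.exists_face_of_mem (h : IsSubdivision K' K) {t : Finset E}
    (ht : t ∈ K.faces) {x : E} (hx : x ∈ convexHull ℝ (t : Set E)) :
    ∃ s ∈ K'.faces, s.card = t.card ∧ x ∈ convexHull ℝ (s : Set E) ∧
      convexHull ℝ (s : Set E) ⊆ convexHull ℝ (t : Set E) := by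
  obtain ⟨ε, hε, hb⟩ := exists_ball h.1 x
  -- Near x the open simplex is covered by the simplices of K' through x inside t. The flat of one
  -- of them contains the near part, hence all vertices of t, and independence of t compares the
  -- dimensions.
  obtain ⟨s, hs, hsub⟩ := exists_subset_affineSubspace
    (h.1.toFinset.filter fun s : Finset E => x ∈ convexHull ℝ (s : Set E) ∧
      convexHull ℝ (s : Set E) ⊆ convexHull ℝ (t : Set E))
    (fun s : Finset E => affineSpan ℝ (s : Set E)) (convex_nearPart t x ε) (nearPart_nonempty hx hε) (by
      rintro y ⟨hy, hyx⟩
      have hyt := openHull_subset_convexHull t hy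
      obtain ⟨s, hs, hys⟩ := exists_carrier (K := K') (x := y)
        (by rw [h.2.1]; exact SimplicialComplex.convexHull_subset_space ht hyt)
      refine ⟨s, ?_, convexHull_subset_affineSpan _ (openHull_subset_convexHull s hys)⟩
      simp only [Finset.mem_filter, Finite.mem_toFinset]
      exact ⟨hs, hb s hs y (openHull_subset_convexHull s hys) hyx,
        h.convexHull_subset hs ht hys hyt⟩)
  simp only [Finset.mem_filter, Finite.mem_toFinset] at hs
  refine ⟨s, hs.1, le_antisymm (card_le_of_convexHull_subset (K'.indep hs.1) hs.2.2) ?_, hs.2⟩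
  exact (K.indep ht).card_le_card_of_subset_affineSpan (subset_of_nearPart_subset hx hε hsub)

/-- If x were in a proper face of s, the whole of s' would be contained in that face, which has too
few vertices. -/
theorem mem_openHull_of_card_eq (h : IsSubdivision K' K) {s s' : Finset E} (hs : s ∈ K.faces)
    (hs' : s' ∈ K'.faces) (hc : s'.card = s.card)
    (hsub : convexHull ℝ (s' : Set E) ⊆ convexHull ℝ (s : Set E)) {x : E}
    (hx : x ∈ openHull s') : x ∈ openHull s := by
  obtain ⟨s₁, hs₁, hx₁⟩ := exists_mem_openHull_of_mem_convexHull
    (hsub (openHull_subset_convexHull s' hx))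
  have hf : s₁ ∈ K.faces := K.down_closed hs hs₁ (nonempty_of_mem_openHull hx₁)
  have := card_le_of_convexHull_subset (K'.indep hs')
    (h.convexHull_subset hs' hf hx (openHull_subset_convexHull _ hx₁))
  rwa [Finset.eq_of_subset_of_card_le hs₁ (hc ▸ this)] at hx₁

/-- Two simplices of a complex with a common codimension one face which lie on the same side of
that face are equal. -/
theorem eq_of_same_side {s t₁ t₂ : Finset E} (hs : s.Nonempty) (ht₁ : t₁ ∈ K.faces)
    (ht₂ : t₂ ∈ K.faces) (h₁ : s ⊆ t₁) (h₂ : s ⊆ t₂) {a : E} (ha : a ∉ s) (hta : t₁ = insert a s)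
    (hc : t₂.card = t₁.card) {b : E} (hb : b ∈ t₂) {μ : E → ℝ}
    (hμ1 : ∑ v ∈ t₁, μ v = 1) (hμb : ∑ v ∈ t₁, μ v • v = b) (hμ : 0 < μ a) : t₁ = t₂ := by
  obtain ⟨c, w, hw, hw1, rfl⟩ := openHull_nonempty hs
  -- Starting from an interior point of s, a small step η towards b keeps the weights on s positive
  -- and creates a positive weight at a. The point reached is interior to t₁ and lies in t₂.
  obtain ⟨η, hη0, hη1, hη⟩ : ∃ η : ℝ, 0 < η ∧ η < 1 ∧ ∀ v ∈ s, 0 < (1 - η) * w v + η * μ v := by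
    have : ∀ᶠ η : ℝ in nhdsWithin 0 (Ioi 0), ∀ v ∈ s, 0 < (1 - η) * w v + η * μ v := by
      refine (Filter.eventually_all_finset s).2 fun v hv => ?_
      refine Filter.Eventually.filter_mono nhdsWithin_le_nhds ?_
      have hcont : Continuous fun η : ℝ => (1 - η) * w v + η * μ v := by fun_prop
      refine hcont.continuousAt.eventually_const_lt ?_
      simpa using hw v hv
    have h2 : ∀ᶠ η : ℝ in nhdsWithin 0 (Ioi 0), η ∈ Ioo (0 : ℝ) 1 :=
      Ioo_mem_nhdsGT one_pos
    obtain ⟨η, h3, h4⟩ := (this.and h2).exists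
    exact ⟨η, h4.1, h4.2, h3⟩
  have hy₁ : (1 - η) • (∑ v ∈ s, w v • v) + η • b ∈ openHull t₁ := by
    refine ⟨fun v => (1 - η) * (if v ∈ s then w v else 0) + η * μ v, fun v hv => ?_, ?_, ?_⟩
    · rw [hta, Finset.mem_insert] at hv
      rcases hv with rfl | hv
      · simpa [ha] using mul_pos hη0 hμ
      · simpa [hv] using hη v hv
    · rw [Finset.sum_add_distrib, ← Finset.mul_sum, ← Finset.mul_sum, sum_extend h₁, hw1, hμ1]
      ring
    · simp only [add_smul, mul_smul]
      rw [Finset.sum_add_distrib, ← Finset.smul_sum, ← Finset.smul_sum, sum_smul_extend h₁, hμb]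
  have hy₂ : (1 - η) • (∑ v ∈ s, w v • v) + η • b ∈ convexHull ℝ (t₂ : Set E) := by
    refine convex_convexHull ℝ _ ?_ (subset_convexHull ℝ _ hb) (by linarith) hη0.le (by ring)
    exact convexHull_mono (Finset.coe_subset.2 h₂)
      (Finset.mem_convexHull'.2 ⟨w, fun v hv => (hw v hv).le, hw1, rfl⟩)
  exact Finset.eq_of_subset_of_card_le (subset_of_mem_openHull ht₁ ht₂ hy₁ hy₂) hc.le

theorem exists_apex {V : Type*} {s t : Finset V} (hst : s ⊆ t) (hc : t.card = s.card + 1) :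
    ∃ a, a ∉ s ∧ t = insert a s := by
  obtain ⟨a, ha⟩ := Finset.card_eq_one.1
    (by rw [Finset.card_sdiff_of_subset hst, hc]; omega : (t \ s).card = 1)
  have : a ∈ t \ s := by rw [ha]; exact Finset.mem_singleton_self a
  refine ⟨a, (Finset.mem_sdiff.1 this).2, ?_⟩
  rw [← Finset.sdiff_union_of_subset hst, ha, Finset.insert_eq]

/-- The coordinates of a point in the affine hull of a simplex. -/
theorem exists_weights_of_mem_affineSpan {t : Finset E} {b : E}
    (hb : b ∈ affineSpan ℝ (t : Set E)) :
    ∃ μ : E → ℝ, ∑ v ∈ t, μ v = 1 ∧ ∑ v ∈ t, μ v • v = b := by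
  have hb' : b ∈ affineSpan ℝ (Set.range ((↑) : t → E)) := by simpa using hb
  obtain ⟨w, hw, hwb⟩ := eq_affineCombination_of_mem_affineSpan_of_fintype hb'
  rw [Finset.affineCombination_eq_linear_combination _ _ _ hw] at hwb
  refine ⟨fun v => if h : v ∈ t then w ⟨v, h⟩ else 0, ?_, ?_⟩
  · rw [← hw, ← Finset.sum_coe_sort t]
    exact Finset.sum_congr rfl fun v _ => by simp
  · rw [hwb, ← Finset.sum_coe_sort t]
    exact Finset.sum_congr rfl fun v _ => by simp

/-- Two simplices of `K'` with a common codimension one face `s'`, contained in the same simplex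
`t` of `K`, where `s'` lies in a codimension one face of `t`, are equal. -/
theorem eq_of_same_side_of_face {s t : Finset E} {s' t₁ t₂ : Finset E}
    (ht : t ∈ K.faces) (hs' : s'.Nonempty)
    (ht₁ : t₁ ∈ K'.faces) (ht₂ : t₂ ∈ K'.faces) (hst : s ⊆ t) (hc : t.card = s.card + 1)
    (hc' : s'.card = s.card) (hc₁ : t₁.card = s'.card + 1) (hc₂ : t₂.card = s'.card + 1)
    (h₁ : s' ⊆ t₁) (h₂ : s' ⊆ t₂) (hss : convexHull ℝ (s' : Set E) ⊆ convexHull ℝ (s : Set E))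
    (hct₁ : convexHull ℝ (t₁ : Set E) ⊆ convexHull ℝ (t : Set E))
    (hct₂ : convexHull ℝ (t₂ : Set E) ⊆ convexHull ℝ (t : Set E)) : t₁ = t₂ := by
  obtain ⟨a, ha, rfl⟩ := exists_apex hst hc
  obtain ⟨a₁, ha₁, rfl⟩ := exists_apex h₁ hc₁
  obtain ⟨a₂, ha₂, rfl⟩ := exists_apex h₂ hc₂
  have hcoord : ∀ u ∈ convexHull ℝ ((insert a s : Finset E) : Set E),
      ∃ l : E → ℝ, 0 ≤ l a ∧ ∑ y ∈ insert a s, l y = 1 ∧ ∑ y ∈ insert a s, l y • y = u := by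
    intro u hu
    obtain ⟨l, h0, h1, h2⟩ := Finset.mem_convexHull'.1 hu
    exact ⟨l, h0 a (Finset.mem_insert_self _ _), h1, h2⟩
  have hflat : ∀ u ∈ s', ∃ l : E → ℝ, l a = 0 ∧ ∑ y ∈ insert a s, l y = 1 ∧
      ∑ y ∈ insert a s, l y • y = u := by
    intro u hu
    obtain ⟨l, h0, h1, h2⟩ := Finset.mem_convexHull'.1 (hss (subset_convexHull ℝ _ hu))
    exact ⟨fun y => if y ∈ s then l y else 0, by simp [ha],
      by rw [sum_extend hst, h1], by rw [sum_smul_extend hst, h2]⟩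
  -- The weight at a measures the distance from s inside t. If it vanished at the apex b, the
  -- simplex on b and s' would lie in the flat of s, whose dimension is too small.
  have hpos : ∀ b : E, b ∉ s' → insert b s' ∈ K'.faces →
      convexHull ℝ ((insert b s' : Finset E) : Set E) ⊆
        convexHull ℝ ((insert a s : Finset E) : Set E) →
      ∃ l : E → ℝ, 0 < l a ∧ ∑ y ∈ insert a s, l y = 1 ∧ ∑ y ∈ insert a s, l y • y = b := by
    intro b hb hbf hbc
    obtain ⟨l, h0, h1, h2⟩ := hcoord b
      (hbc (subset_convexHull ℝ _ (Finset.mem_insert_self b s')))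
    refine ⟨l, lt_of_le_of_ne h0 fun h => ?_, h1, h2⟩
    have : ((insert b s' : Finset E) : Set E) ⊆ affineSpan ℝ (s : Set E) := by
      intro v hv
      rcases Finset.mem_insert.1 (Finset.mem_coe.1 hv) with rfl | hv
      · rw [Finset.sum_insert ha, ← h, zero_add] at h1
        rw [Finset.sum_insert ha, ← h, zero_smul, zero_add] at h2
        rw [← h2]
        have hm := affineCombination_mem_affineSpan (k := ℝ) (s := (Finset.univ : Finset s))
          (w := fun v => l v) (by rw [Finset.sum_coe_sort s l, h1]) ((↑) : s → E)
        rw [Finset.affineCombination_eq_linear_combination _ _ _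
          (by rw [Finset.sum_coe_sort s l, h1]), Finset.sum_coe_sort s (fun v => l v • v)] at hm
        simpa using hm
      · exact convexHull_subset_affineSpan _ (hss (subset_convexHull ℝ _ hv))
    have := (K'.indep hbf).card_le_card_of_subset_affineSpan this
    rw [Finset.card_insert_of_notMem hb] at this
    omega
  obtain ⟨l₁, hl₁, hl₁1, hl₁2⟩ := hpos a₁ ha₁ ht₁ hct₁
  obtain ⟨l₂, hl₂, hl₂1, hl₂2⟩ := hpos a₂ ha₂ ht₂ hct₂
  -- Both simplices have full dimension in t and therefore span the same flat.
  have hspan : a₂ ∈ affineSpan ℝ ((insert a₁ s' : Finset E) : Set E) := by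
    have hle : affineSpan ℝ (Set.range ((↑) : {y // y ∈ insert a₁ s'} → E)) ≤
        affineSpan ℝ ((insert a s : Finset E) : Set E) := by
      rw [Subtype.range_coe_subtype, Finset.setOfPred_mem]
      exact affineSpan_le.2 (((subset_convexHull ℝ _).trans hct₁).trans
        (convexHull_subset_affineSpan _))
    have hfr : Module.finrank ℝ (affineSpan ℝ ((insert a s : Finset E) : Set E)).direction =
        s.card := by
      have := (K.indep ht).finrank_vectorSpan (n := s.card) (by simp [ha])
      rwa [Subtype.range_coe_subtype, Finset.setOfPred_mem, ← direction_affineSpan] at this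
    have : FiniteDimensional ℝ (affineSpan ℝ ((insert a s : Finset E) : Set E)).direction := by
      rw [direction_affineSpan]
      exact finiteDimensional_vectorSpan_of_finite ℝ (Finset.finite_toSet _)
    have heq := (K'.indep ht₁).affineSpan_eq_of_le_of_card_eq_finrank_add_one hle
      (by rw [hfr, Fintype.card_coe, hc₁, hc'])
    rw [Subtype.range_coe_subtype, Finset.setOfPred_mem] at heq
    rw [heq]
    exact convexHull_subset_affineSpan _
      (hct₂ (subset_convexHull ℝ _ (Finset.mem_insert_self _ _)))
  obtain ⟨μ, hμ1, hμ2⟩ := exists_weights_of_mem_affineSpan hspan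
  refine eq_of_same_side hs' ht₁ ht₂ h₁ h₂ ha₁ rfl (by rw [hc₁, hc₂])
    (Finset.mem_insert_self a₂ s') hμ1 hμ2 ?_
  choose! l hl0 hl1 hl2 using hflat
  -- Comparing weights at a: only a₁ contributes, so the coefficient of a₁ in a₂ is a quotient of
  -- two positive numbers.
  have key := weights_unique (K.indep ht) (w := l₂)
    (w' := fun y => μ a₁ * l₁ y + ∑ v ∈ s', μ v * l v y) ?_ ?_ a (Finset.mem_insert_self a s)
  · rw [Finset.sum_eq_zero fun v hv => by rw [hl0 v hv, mul_zero], add_zero] at key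
    rw [key] at hl₂
    exact pos_of_mul_pos_left hl₂ hl₁.le
  · rw [hl₂1, Finset.sum_add_distrib, ← Finset.mul_sum, hl₁1, Finset.sum_comm, mul_one]
    rw [Finset.sum_insert ha₁] at hμ1
    rw [← hμ1]
    congr 1
    refine Finset.sum_congr rfl fun v hv => ?_
    rw [← Finset.mul_sum, hl1 v hv, mul_one]
  · simp only [add_smul, mul_smul, Finset.sum_smul]
    rw [hl₂2, Finset.sum_add_distrib, ← Finset.smul_sum, hl₁2, Finset.sum_comm, ← hμ2,
      Finset.sum_insert ha₁]
    congr 1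
    refine Finset.sum_congr rfl fun v hv => ?_
    rw [← Finset.smul_sum, hl2 v hv]

end Normality

/-! ### Normality passes from a subdivision to the complex and back. -/

section SubdivisionInvariance

open Classical Set Relation

variable {E : Type*} [NormedAddCommGroup E] [NormedSpace ℝ E] {K K' : SimplicialComplex ℝ E}

theorem IsSubdivision.exists_lift (h : IsSubdivision K' K) {t s' : Finset E} (ht : t ∈ K.faces)
    (hs' : s' ∈ K'.faces) {x : E} (hx : x ∈ openHull s') (hxt : x ∈ convexHull ℝ (t : Set E)) :
    ∃ t' ∈ K'.faces, t'.card = t.card ∧ s' ⊆ t' ∧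
      convexHull ℝ (t' : Set E) ⊆ convexHull ℝ (t : Set E) := by
  obtain ⟨t', ht', hc, hxt', hsub⟩ := h.exists_face_of_mem ht hxt
  exact ⟨t', ht', hc, subset_of_mem_openHull hs' ht' hx hxt', hsub⟩

/-- Two simplices of K meet in the hull of their common vertices. This turns adjacency of facets of
the subdivision into adjacency, or equality, of the facets containing them. -/
theorem card_le_card_inter {s' t u : Finset E} (hs' : s' ∈ K'.faces) (ht : t ∈ K.faces)
    (hu : u ∈ K.faces) (h₁ : convexHull ℝ (s' : Set E) ⊆ convexHull ℝ (t : Set E))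
    (h₂ : convexHull ℝ (s' : Set E) ⊆ convexHull ℝ (u : Set E)) : s'.card ≤ (t ∩ u).card := by
  refine card_le_of_convexHull_subset (K'.indep hs') ?_
  rw [Finset.coe_inter, ← K.convexHull_inter_convexHull ht hu]
  exact subset_inter h₁ h₂

theorem eq_of_card_le_card_inter {V : Type*} {t u : Finset V} {k : ℕ} (ht : t.card = k)
    (hu : u.card = k) (h : k ≤ (t ∩ u).card) : t = u :=
  (Finset.eq_of_subset_of_card_le Finset.inter_subset_left (by rwa [ht])).symm.trans
    (Finset.eq_of_subset_of_card_le Finset.inter_subset_right (by rwa [hu]))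

theorem mem_convexHull_of_subset {s t : Finset E} (hst : s ⊆ t) {x : E} (hx : x ∈ openHull s) :
    x ∈ convexHull ℝ (t : Set E) :=
  convexHull_mono (Finset.coe_subset.2 hst) (openHull_subset_convexHull s hx)

theorem IsSubdivision.exists_facet {k : ℕ} (h : IsSubdivision K' K)
    (hc : ∀ t ∈ K.faces, t.card ≤ k + 1) {t' : Finset E} (ht' : t' ∈ K'.faces)
    (hk : t'.card = k + 1) : ∃ t ∈ K.faces, t.card = k + 1 ∧
      convexHull ℝ (t' : Set E) ⊆ convexHull ℝ (t : Set E) := by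
  obtain ⟨t, ht, hsub⟩ := h.2.2 t' ht'
  exact ⟨t, ht, le_antisymm (hc t ht)
    (hk ▸ card_le_of_convexHull_subset (K'.indep ht') hsub), hsub⟩

theorem sum_mem_affineSpan {s : Finset E} {w : E → ℝ} (hw : ∑ v ∈ s, w v = 1) :
    ∑ v ∈ s, w v • v ∈ affineSpan ℝ (s : Set E) := by
  have hm := affineCombination_mem_affineSpan (k := ℝ) (s := (Finset.univ : Finset s))
    (w := fun v => w v) (by rw [Finset.sum_coe_sort s w, hw]) ((↑) : s → E)
  rw [Finset.affineCombination_eq_linear_combination _ _ _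
    (by rw [Finset.sum_coe_sort s w, hw]), Finset.sum_coe_sort s (fun v => w v • v)] at hm
  simpa using hm

/-- From an interior point of a simplex one can move a little away from any other point of it. -/
theorem exists_reflection {s : Finset E} {x a : E} (hx : x ∈ openHull s)
    (ha : a ∈ convexHull ℝ (s : Set E)) {ε : ℝ} (hε : 0 < ε) :
    ∃ δ : ℝ, 0 < δ ∧ (1 + δ) • x - δ • a ∈ convexHull ℝ (s : Set E) ∧
      dist ((1 + δ) • x - δ • a) x < ε := by
  obtain ⟨w, hw, hw1, hwx⟩ := hx
  obtain ⟨c, hc0, hc1, hca⟩ := Finset.mem_convexHull'.1 ha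
  have h1 : ∀ᶠ δ : ℝ in nhdsWithin 0 (Ioi 0), ∀ v ∈ s, 0 < (1 + δ) * w v - δ * c v := by
    refine (Filter.eventually_all_finset s).2 fun v hv => ?_
    refine Filter.Eventually.filter_mono nhdsWithin_le_nhds ?_
    have hcont : Continuous fun δ : ℝ => (1 + δ) * w v - δ * c v := by fun_prop
    refine hcont.continuousAt.eventually_const_lt ?_
    simpa using hw v hv
  have h2 : ∀ᶠ δ : ℝ in nhdsWithin 0 (Ioi 0), dist ((1 + δ) • x - δ • a) x < ε := by
    refine Filter.Eventually.filter_mono nhdsWithin_le_nhds ?_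
    have hcont : Continuous fun δ : ℝ => dist ((1 + δ) • x - δ • a) x := by fun_prop
    refine hcont.continuousAt.eventually_lt_const ?_
    simpa using hε
  obtain ⟨δ, ⟨h3, h4⟩, h5⟩ := ((h1.and h2).and self_mem_nhdsWithin).exists
  refine ⟨δ, h5, Finset.mem_convexHull'.2 ⟨_, fun v hv => (h3 v hv).le, ?_, ?_⟩, h4⟩
  · rw [Finset.sum_sub_distrib, ← Finset.mul_sum, ← Finset.mul_sum, hw1, hc1]; ring
  · simp only [sub_smul, mul_smul]
    rw [Finset.sum_sub_distrib, ← Finset.smul_sum, ← Finset.smul_sum, hwx, hca]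

/-- A complex with a normal subdivision is normal. -/
theorem IsSubdivision.isNormal_of_subdivision {k : ℕ} (h : IsSubdivision K' K)
    (hK' : IsNormal k K') : IsNormal k K := by
  have hcard : ∀ s ∈ K.faces, s.card ≤ k + 1 := by
    intro s hs
    obtain ⟨x, hx⟩ := openHull_nonempty (K.nonempty_of_mem_faces hs)
    obtain ⟨s', hs', hc, -⟩ := h.exists_face_of_mem hs (openHull_subset_convexHull s hx)
    exact hc ▸ hK'.card_le s' hs'
  have hspace : ∀ s ∈ K.faces, ∀ x ∈ openHull s, ∃ s' ∈ K'.faces, x ∈ openHull s' := by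
    intro s hs x hx
    refine exists_carrier ?_
    rw [h.2.1]
    exact SimplicialComplex.convexHull_subset_space hs (openHull_subset_convexHull s hx)
  refine ⟨hcard, ?_, ?_, ?_⟩
  · intro s hs
    obtain ⟨x, hx⟩ := openHull_nonempty (K.nonempty_of_mem_faces hs)
    obtain ⟨s', hs', hx'⟩ := hspace s hs x hx
    obtain ⟨t', ht', hst', hct'⟩ := hK'.pure s' hs'
    obtain ⟨t, ht, hct, hsub⟩ := h.exists_facet hcard ht' hct'
    exact ⟨t, ht, subset_of_mem_openHull hs ht hx (hsub (mem_convexHull_of_subset hst' hx')), hct⟩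
  · intro s hs hsk
    obtain ⟨y, hy⟩ := openHull_nonempty (K.nonempty_of_mem_faces hs)
    obtain ⟨s', hs', hc', -, hsub'⟩ := h.exists_face_of_mem hs (openHull_subset_convexHull s hy)
    obtain ⟨x, hx'⟩ := openHull_nonempty (K'.nonempty_of_mem_faces hs')
    have hx := mem_openHull_of_card_eq h hs hs' hc' hsub' hx'
    obtain ⟨t₁', ht₁', t₂', ht₂', hs₁, hs₂, hc₁, hc₂, hne, huniq⟩ :=
      hK'.panel s' hs' (hc'.trans hsk)
    obtain ⟨t₁, ht₁, hct₁, hsub₁⟩ := h.exists_facet hcard ht₁' hc₁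
    obtain ⟨t₂, ht₂, hct₂, hsub₂⟩ := h.exists_facet hcard ht₂' hc₂
    have h₁ := subset_of_mem_openHull hs ht₁ hx (hsub₁ (mem_convexHull_of_subset hs₁ hx'))
    have h₂ := subset_of_mem_openHull hs ht₂ hx (hsub₂ (mem_convexHull_of_subset hs₂ hx'))
    refine ⟨t₁, ht₁, t₂, ht₂, h₁, h₂, hct₁, hct₂, ?_, ?_⟩
    -- Two facets of K' at the wall s' inside one facet of K would lie on the same side of s'.
    · rintro rfl
      exact hne (eq_of_same_side_of_face ht₁ (K'.nonempty_of_mem_faces hs') ht₁' ht₂' h₁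
        (by rw [hct₁, hsk]) hc' (by rw [hc₁, hc', hsk]) (by rw [hc₂, hc', hsk]) hs₁ hs₂ hsub'
        hsub₁ hsub₂)
    · intro t ht hst hct
      obtain ⟨t', ht', hct', hst', hsubt⟩ := h.exists_lift ht hs' hx' (mem_convexHull_of_subset hst hx)
      rcases huniq t' ht' hst' (hct'.trans hct) with rfl | rfl
      · exact .inl (eq_of_card_le_card_inter hct hct₁
          (hc₁ ▸ card_le_card_inter ht' ht ht₁ hsubt hsub₁))
      · exact .inr (eq_of_card_le_card_inter hct hct₂
          (hc₂ ▸ card_le_card_inter ht' ht ht₂ hsubt hsub₂))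
  · intro s hs t ht u hu hst hsu hct hcu
    obtain ⟨x, hx⟩ := openHull_nonempty (K.nonempty_of_mem_faces hs)
    obtain ⟨s', hs', hx'⟩ := hspace s hs x hx
    obtain ⟨t', ht', hct', hst', hsubt⟩ := h.exists_lift ht hs' hx' (mem_convexHull_of_subset hst hx)
    obtain ⟨u', hu', hcu', hsu', hsubu⟩ := h.exists_lift hu hs' hx' (mem_convexHull_of_subset hsu hx)
    rw [hct] at hct'
    rw [hcu] at hcu'
    have hch := hK'.conn s' hs' t' ht' u' hu' hst' hsu' hct' hcu'
    -- A chain in K' is followed by the facets of K that contain its members. Consecutive members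
    -- share a wall contained in both of these facets, so the latter are adjacent or equal.
    suffices ∀ w', ReflTransGen
        (fun u w => w ∈ K'.faces ∧ s' ⊆ w ∧ w.card = k + 1 ∧ k ≤ (u ∩ w).card) t' w' →
        (w' ∈ K'.faces ∧ s' ⊆ w' ∧ w'.card = k + 1) ∧ ∀ w ∈ K.faces, w.card = k + 1 →
          convexHull ℝ (w' : Set E) ⊆ convexHull ℝ (w : Set E) → ReflTransGen
          (fun u w => w ∈ K.faces ∧ s ⊆ w ∧ w.card = k + 1 ∧ k ≤ (u ∩ w).card) t w from
      (this u' hch).2 u hu hcu hsubu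
    intro w' hw'
    induction hw' with
    | refl =>
      refine ⟨⟨ht', hst', hct'⟩, fun w hw hcw hsubw => ?_⟩
      rw [eq_of_card_le_card_inter hcw hct (hct' ▸ card_le_card_inter ht' hw ht hsubw hsubt)]
    | @tail a' b' _ hab ih =>
      obtain ⟨hb', hsb', hcb', hk⟩ := hab
      obtain ⟨⟨ha', hsa', hca'⟩, ih⟩ := ih
      refine ⟨⟨hb', hsb', hcb'⟩, fun b hb hcb hsubb => ?_⟩
      obtain ⟨a, ha, hca, hsuba⟩ := h.exists_facet hcard ha' hca'
      refine (ih a ha hca hsuba).tail ⟨hb, ?_, hcb, ?_⟩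
      · exact subset_of_mem_openHull hs hb hx (hsubb (mem_convexHull_of_subset hsb' hx'))
      · have hf : a' ∩ b' ∈ K'.faces := K'.down_closed ha' Finset.inter_subset_left
          ((K'.nonempty_of_mem_faces hs').mono (Finset.subset_inter hsa' hsb'))
        exact hk.trans (card_le_card_inter hf ha hb
          ((convexHull_mono (by simp)).trans hsuba) ((convexHull_mono (by simp)).trans hsubb))

/-- Two facets of the subdivision through the same simplex `s'`, lying in the same facet of `K`,
are joined by a chain of adjacent facets through `s'`. -/
theorem IsSubdivision.chain_of_subset {k : ℕ} (h : IsSubdivision K' K)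
    (hpure : ∀ s ∈ K'.faces, ∃ t ∈ K'.faces, s ⊆ t ∧ t.card = k + 1)
    {s' u w t : Finset E} (hs' : s' ∈ K'.faces) (ht : t ∈ K.faces) (hu : u ∈ K'.faces)
    (hw : w ∈ K'.faces) (hsu : s' ⊆ u) (hsw : s' ⊆ w) (hcu : u.card = k + 1) (hcw : w.card = k + 1)
    (hut : convexHull ℝ (u : Set E) ⊆ convexHull ℝ (t : Set E))
    (hwt : convexHull ℝ (w : Set E) ⊆ convexHull ℝ (t : Set E)) :
    ReflTransGen (fun u w => w ∈ K'.faces ∧ s' ⊆ w ∧ w.card = k + 1 ∧ k ≤ (u ∩ w).card) u w := by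
  obtain ⟨x, hx⟩ := openHull_nonempty (K'.nonempty_of_mem_faces hs')
  obtain ⟨ε, hε, hb⟩ := exists_ball h.1 x
  have hxu := mem_convexHull_of_subset hsu hx
  have hxw := mem_convexHull_of_subset hsw hx
  obtain ⟨y₁, hy₁, hy₁x⟩ := nearPart_nonempty hxu hε
  -- General position: y₂ avoids the flats spanned by y₁ and a face of codimension at least two.
  -- Otherwise the near part of w would lie in one such flat, which at most k points span. The
  -- segment from y₁ to y₂ thus misses these faces, except possibly at y₁.
  obtain ⟨y₂, ⟨hy₂, hy₂x⟩, hgen⟩ : ∃ y₂ ∈ nearPart w x ε, ∀ f ∈ K'.faces, f.card + 1 ≤ k →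
      y₂ ∉ affineSpan ℝ ((insert y₁ f : Finset E) : Set E) := by
    by_contra! hcon
    obtain ⟨f, hf, hsub⟩ := exists_subset_affineSubspace
      (h.1.toFinset.filter fun f : Finset E => f.card + 1 ≤ k)
      (fun f : Finset E => affineSpan ℝ ((insert y₁ f : Finset E) : Set E))
      (convex_nearPart w x ε) (nearPart_nonempty hxw hε) (by
        intro y hy
        obtain ⟨f, hf, hfk, hyf⟩ := hcon y hy
        exact ⟨f, by simpa using ⟨hf, hfk⟩, hyf⟩)
    simp only [Finset.mem_filter] at hf
    have := (K'.indep hw).card_le_card_of_subset_affineSpan (subset_of_nearPart_subset hxw hε hsub)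
    have := Finset.card_insert_le y₁ f
    omega
  let R : Finset E → Finset E → Prop :=
    fun u w => w ∈ K'.faces ∧ s' ⊆ w ∧ w.card = k + 1 ∧ k ≤ (u ∩ w).card
  let P : Finset E → Prop := fun f => f ∈ K'.faces ∧ s' ⊆ f ∧ f.card = k + 1
  change ReflTransGen R u w
  by_contra hnot
  -- The facets reachable from u and the unreachable ones form two closed sets covering the
  -- connected segment. At a common point two facets meet in a wall, which carries the chain from
  -- one class to the other.
  let A : Set E := ⋃ f ∈ {f | P f ∧ ReflTransGen R u f}, convexHull ℝ (f : Set E)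
  let B : Set E := ⋃ f ∈ {f | P f ∧ ¬ ReflTransGen R u f}, convexHull ℝ (f : Set E)
  have hclosed : ∀ Q : Finset E → Prop,
      IsClosed (⋃ f ∈ {f | P f ∧ Q f}, convexHull ℝ (f : Set E)) := fun Q =>
    (h.1.subset fun f hf => hf.1.1).isClosed_biUnion
      fun f _ => f.finite_toSet.isClosed_convexHull ℝ
  have hseg : segment ℝ y₁ y₂ ⊆ A ∪ B := by
    intro z hz
    have hzx : z ∈ Metric.ball x ε := (convex_ball x ε).segment_subset hy₁x hy₂x hz
    have hzt : z ∈ convexHull ℝ (t : Set E) := (convex_convexHull ℝ _).segment_subset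
      (hut (openHull_subset_convexHull u hy₁)) (hwt (openHull_subset_convexHull w hy₂)) hz
    obtain ⟨f, hf, hzf⟩ := exists_carrier (K := K') (x := z)
      (by rw [h.2.1]; exact SimplicialComplex.convexHull_subset_space ht hzt)
    have hsf : s' ⊆ f := subset_of_mem_openHull hs' hf hx
      (hb f hf z (openHull_subset_convexHull f hzf) hzx)
    obtain ⟨f', hf', hff', hcf'⟩ := hpure f hf
    have hzf' := mem_convexHull_of_subset hff' hzf
    by_cases hr : ReflTransGen R u f'
    · exact .inl (mem_biUnion (show f' ∈ {f | P f ∧ ReflTransGen R u f} from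
        ⟨⟨hf', hsf.trans hff', hcf'⟩, hr⟩) hzf')
    · exact .inr (mem_biUnion (show f' ∈ {f | P f ∧ ¬ ReflTransGen R u f} from
        ⟨⟨hf', hsf.trans hff', hcf'⟩, hr⟩) hzf')
  obtain ⟨z, hz, hzA, hzB⟩ := isPreconnected_closed_iff.1
    (convex_segment (𝕜 := ℝ) y₁ y₂).isPreconnected A B (hclosed _) (hclosed _) hseg
    ⟨y₁, left_mem_segment ℝ _ _, mem_biUnion (show u ∈ {f | P f ∧ ReflTransGen R u f} from
      ⟨⟨hu, hsu, hcu⟩, .refl⟩) (openHull_subset_convexHull u hy₁)⟩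
    ⟨y₂, right_mem_segment ℝ _ _, mem_biUnion (show w ∈ {f | P f ∧ ¬ ReflTransGen R u f} from
      ⟨⟨hw, hsw, hcw⟩, hnot⟩) (openHull_subset_convexHull w hy₂)⟩
  obtain ⟨a, ⟨⟨ha, hsa, hca⟩, hra⟩, hza⟩ := mem_iUnion₂.1 hzA
  obtain ⟨b, ⟨⟨hb', hsb, hcb⟩, hrb⟩, hzb⟩ := mem_iUnion₂.1 hzB
  refine hrb (hra.tail ⟨hb', hsb, hcb, ?_⟩)
  by_contra hlt
  have hzab : z ∈ convexHull ℝ ((a ∩ b : Finset E) : Set E) := by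
    rw [Finset.coe_inter, ← K'.convexHull_inter_convexHull ha hb']
    exact ⟨hza, hzb⟩
  have hab : a ∩ b ∈ K'.faces := K'.down_closed ha Finset.inter_subset_left
    ((K'.nonempty_of_mem_faces hs').mono (Finset.subset_inter hsa hsb))
  rw [segment_eq_image] at hz
  obtain ⟨θ, -, hθ⟩ := hz
  -- At the starting point genericity says nothing, but y₁ is interior to the facet u, which cannot
  -- lie in a ∩ b.
  by_cases h0 : θ = 0
  · simp only [h0, sub_zero, one_smul, zero_smul, add_zero] at hθ
    subst hθ
    have := Finset.card_le_card (subset_of_mem_openHull hu hab hy₁ hzab)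
    omega
  · refine hgen _ hab (by omega) (mem_affineSubspace_of_combo (x := y₁) h0
      (subset_affineSpan ℝ _ (by simp)) ?_)
    dsimp only at hθ
    rw [hθ]
    exact affineSpan_mono ℝ (by simp) (convexHull_subset_affineSpan _ hzab)

/-- A subdivision of a normal complex is normal. -/
theorem IsSubdivision.isNormal {k : ℕ} (h : IsSubdivision K' K)
    (hK : IsNormal k K) : IsNormal k K' := by
  have hpure : ∀ s ∈ K'.faces, ∃ t ∈ K'.faces, s ⊆ t ∧ t.card = k + 1 := by
    intro s' hs'
    obtain ⟨x, hx⟩ := openHull_nonempty (K'.nonempty_of_mem_faces hs')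
    obtain ⟨u, hu, hsu⟩ := h.2.2 s' hs'
    obtain ⟨t, ht, hut, hct⟩ := hK.pure u hu
    obtain ⟨t', ht', hct', hst', -⟩ := h.exists_lift ht hs' hx
      (convexHull_mono (Finset.coe_subset.2 hut) (hsu (openHull_subset_convexHull s' hx)))
    exact ⟨t', ht', hst', hct'.trans hct⟩
  refine ⟨?_, hpure, ?_, ?_⟩
  · intro s' hs'
    obtain ⟨u, hu, hsu⟩ := h.2.2 s' hs'
    exact (card_le_of_convexHull_subset (K'.indep hs') hsu).trans (hK.card_le u hu)
  · intro s' hs' hsk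
    obtain ⟨x, hx⟩ := openHull_nonempty (K'.nonempty_of_mem_faces hs')
    obtain ⟨s, hs, hxs⟩ := exists_carrier (K := K) (x := x)
      (by rw [← h.2.1]
          exact SimplicialComplex.convexHull_subset_space hs' (openHull_subset_convexHull s' hx))
    have hsub := h.convexHull_subset hs' hs hx (openHull_subset_convexHull s hxs)
    have hks : k ≤ s.card := hsk ▸ card_le_of_convexHull_subset (K'.indep hs') hsub
    have hne := K'.nonempty_of_mem_faces hs'
    rcases hks.eq_or_lt with hks | hks
    -- The wall lies in a wall s of K: each of the two facets at s contributes exactly one facet at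
    -- s'.
    · obtain ⟨t₁, ht₁, t₂, ht₂, hs₁, hs₂, hc₁, hc₂, hne', huniq⟩ := hK.panel s hs hks.symm
      obtain ⟨t₁', ht₁', hct₁', hst₁', hsub₁⟩ := h.exists_lift ht₁ hs' hx
        (mem_convexHull_of_subset hs₁ hxs)
      obtain ⟨t₂', ht₂', hct₂', hst₂', hsub₂⟩ := h.exists_lift ht₂ hs' hx
        (mem_convexHull_of_subset hs₂ hxs)
      refine ⟨t₁', ht₁', t₂', ht₂', hst₁', hst₂', hct₁'.trans hc₁, hct₂'.trans hc₂, ?_, ?_⟩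
      · rintro rfl
        exact hne' (eq_of_card_le_card_inter hc₁ hc₂
          (hc₁ ▸ hct₁' ▸ card_le_card_inter ht₁' ht₁ ht₂ hsub₁ hsub₂))
      · intro t' ht' hst' hct'
        obtain ⟨t, ht, hct, hsubt⟩ := h.exists_facet hK.card_le ht' hct'
        have hst : s ⊆ t := subset_of_mem_openHull hs ht hxs
          (hsubt (mem_convexHull_of_subset hst' hx))
        rcases huniq t ht hst hct with rfl | rfl
        · exact .inl (eq_of_same_side_of_face ht hne ht' ht₁' hst (by omega) (by omega)
            (by omega) (by omega) hst' hst₁' hsub hsubt hsub₁)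
        · exact .inr (eq_of_same_side_of_face ht hne ht' ht₂' hst (by omega) (by omega)
            (by omega) (by omega) hst' hst₂' hsub hsubt hsub₂)
    -- The wall crosses the interior of a facet s of K. All facets of K' at s' lie in s and span the
    -- same flat, and the sign of the weight at one apex a₁ tells the two sides apart.
    · have hcs : s.card = k + 1 := le_antisymm (hK.card_le s hs) hks
      obtain ⟨t₁, ht₁, hst₁, hct₁⟩ := hpure s' hs'
      have hin : ∀ t ∈ K'.faces, s' ⊆ t → t.card = k + 1 →
          convexHull ℝ (t : Set E) ⊆ convexHull ℝ (s : Set E) := by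
        intro t ht hst hct
        obtain ⟨u, hu, hcu, hsubu⟩ := h.exists_facet hK.card_le ht hct
        have : s ⊆ u := subset_of_mem_openHull hs hu hxs
          (hsubu (mem_convexHull_of_subset hst hx))
        rwa [Finset.eq_of_subset_of_card_le this (by omega)]
      obtain ⟨a₁, ha₁, rfl⟩ := exists_apex hst₁ (by omega)
      have hspan : ∀ t ∈ K'.faces, s' ⊆ t → t.card = k + 1 → ∀ b ∈ t, ∀ u ∈ K'.faces, s' ⊆ u →
          u.card = k + 1 → b ∈ affineSpan ℝ (u : Set E) := by
        intro t ht hst hct b hbt u hu hsu hcu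
        have hle : affineSpan ℝ (Set.range ((↑) : {y // y ∈ u} → E)) ≤
            affineSpan ℝ (s : Set E) := by
          rw [Subtype.range_coe_subtype, Finset.setOfPred_mem]
          exact affineSpan_le.2 (((subset_convexHull ℝ _).trans (hin u hu hsu hcu)).trans
            (convexHull_subset_affineSpan _))
        have hfr : Module.finrank ℝ (affineSpan ℝ (s : Set E)).direction = k := by
          have := (K.indep hs).finrank_vectorSpan (n := k) (by simp [hcs])
          rwa [Subtype.range_coe_subtype, Finset.setOfPred_mem, ← direction_affineSpan] at this
        have : FiniteDimensional ℝ (affineSpan ℝ (s : Set E)).direction := by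
          rw [direction_affineSpan]
          exact finiteDimensional_vectorSpan_of_finite ℝ (Finset.finite_toSet _)
        have heq := (K'.indep hu).affineSpan_eq_of_le_of_card_eq_finrank_add_one hle
          (by rw [hfr, Fintype.card_coe, hcu])
        rw [Subtype.range_coe_subtype, Finset.setOfPred_mem] at heq
        rw [heq]
        exact convexHull_subset_affineSpan _
          (hin t ht hst hct (subset_convexHull ℝ _ hbt))
      obtain ⟨t₂, ht₂, hst₂, hct₂, hne₂⟩ : ∃ t₂ ∈ K'.faces, s' ⊆ t₂ ∧ t₂.card = k + 1 ∧
          insert a₁ s' ≠ t₂ := by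
        obtain ⟨ε, hε, hb⟩ := exists_ball h.1 x
        -- Moving from x away from a₁ gives a point of s near x whose weight at a₁ is -δ. A facet
        -- carrying it contains s' and differs from the first one.
        obtain ⟨δ, hδ, hys, hyx⟩ := exists_reflection hxs
          (hin _ ht₁ hst₁ hct₁ (subset_convexHull ℝ _ (Finset.mem_insert_self a₁ s'))) hε
        obtain ⟨f, hf, hyf⟩ := exists_carrier (K := K') (x := (1 + δ) • x - δ • a₁)
          (by rw [h.2.1]; exact SimplicialComplex.convexHull_subset_space hs hys)
        obtain ⟨f', hf', hff', hcf'⟩ := hpure f hf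
        refine ⟨f', hf', (subset_of_mem_openHull hs' hf hx
          (hb f hf _ (openHull_subset_convexHull f hyf) hyx)).trans hff', hcf', ?_⟩
        rintro rfl
        obtain ⟨c, hc0, hc1, hc2⟩ := Finset.mem_convexHull'.1 (mem_convexHull_of_subset hff' hyf)
        obtain ⟨w, -, hw1, rfl⟩ := hx
        have := weights_unique (K'.indep hf') (w := c)
          (w' := fun v => (1 + δ) * (if v ∈ s' then w v else 0) - δ * (if v = a₁ then 1 else 0))
          (by rw [hc1, Finset.sum_sub_distrib, ← Finset.mul_sum, ← Finset.mul_sum,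
                sum_extend hst₁, hw1]; simp)
          (by simp only [sub_smul, mul_smul]
              rw [hc2, Finset.sum_sub_distrib, ← Finset.smul_sum, ← Finset.smul_sum,
                sum_smul_extend hst₁]; simp) a₁ (Finset.mem_insert_self _ _)
        simp only [ha₁, if_false, if_true] at this
        have := hc0 a₁ (Finset.mem_insert_self _ _)
        linarith
      have hcoord : ∀ b, b ∉ s' → insert b s' ∈ K'.faces → insert a₁ s' ≠ insert b s' →
          ∃ μ : E → ℝ, ∑ v ∈ insert a₁ s', μ v = 1 ∧ ∑ v ∈ insert a₁ s', μ v • v = b ∧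
            μ a₁ < 0 := by
        intro b hb hbf hbne
        have hcb : (insert b s').card = k + 1 := by rw [Finset.card_insert_of_notMem hb, hsk]
        obtain ⟨μ, hμ1, hμ2⟩ := exists_weights_of_mem_affineSpan
          (hspan _ hbf (Finset.subset_insert _ _) hcb b (Finset.mem_insert_self _ _) _ ht₁ hst₁ hct₁)
        refine ⟨μ, hμ1, hμ2, ?_⟩
        rcases lt_trichotomy (μ a₁) 0 with h0 | h0 | h0
        · exact h0
        · rw [Finset.sum_insert ha₁, h0, zero_add] at hμ1
          rw [Finset.sum_insert ha₁, h0, zero_smul, zero_add] at hμ2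
          have hle : ((insert b s' : Finset E) : Set E) ⊆ affineSpan ℝ (s' : Set E) := by
            intro v hv
            rcases Finset.mem_insert.1 (Finset.mem_coe.1 hv) with rfl | hv
            · exact hμ2 ▸ sum_mem_affineSpan hμ1
            · exact subset_affineSpan ℝ _ hv
          have := (K'.indep hbf).card_le_card_of_subset_affineSpan hle
          omega
        · exact absurd (eq_of_same_side hne ht₁ hbf hst₁ (Finset.subset_insert _ _) ha₁ rfl
            (by omega) (Finset.mem_insert_self _ _) hμ1 hμ2 h0) hbne
      obtain ⟨a₂, ha₂, rfl⟩ := exists_apex hst₂ (by omega)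
      refine ⟨_, ht₁, _, ht₂, hst₁, hst₂, hct₁, hct₂, hne₂, fun t ht hst hct => ?_⟩
      obtain ⟨a₃, ha₃, rfl⟩ := exists_apex hst (by omega)
      by_cases hne₃ : insert a₁ s' = insert a₃ s'
      · exact .inl hne₃.symm
      right
      obtain ⟨μ, hμ1, hμ2, hμ⟩ := hcoord a₂ ha₂ ht₂ hne₂
      obtain ⟨ν, hν1, hν2, hν⟩ := hcoord a₃ ha₃ ht hne₃
      rw [Finset.sum_insert ha₁] at hμ1 hμ2 hν1 hν2
      -- The weights of a₃ with respect to a₂ and s' come from eliminating a₁ between the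
      -- expressions of a₂ and a₃. The weight at a₂ is a quotient of two negative numbers.
      refine (eq_of_same_side hne ht₂ ht hst₂ hst ha₂ rfl (by omega) (Finset.mem_insert_self _ _)
        (μ := fun v => if v = a₂ then ν a₁ / μ a₁ else ν v - ν a₁ / μ a₁ * μ v) ?_ ?_ ?_).symm
      · rw [Finset.sum_insert ha₂, Finset.sum_congr rfl fun v hv => if_neg (ne_of_mem_of_not_mem hv ha₂),
          Finset.sum_sub_distrib, ← Finset.mul_sum, if_pos rfl, eq_sub_of_add_eq' hμ1,
          eq_sub_of_add_eq' hν1]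
        field_simp [hμ.ne]
        ring
      · rw [Finset.sum_insert ha₂, if_pos rfl, Finset.sum_congr rfl fun v hv => by
          rw [if_neg (ne_of_mem_of_not_mem hv ha₂), sub_smul, mul_smul]]
        rw [Finset.sum_sub_distrib, ← Finset.smul_sum, eq_sub_of_add_eq' hμ2,
          eq_sub_of_add_eq' hν2]
        have : (ν a₁ / μ a₁) * μ a₁ = ν a₁ := div_mul_cancel₀ _ hμ.ne
        rw [smul_sub, smul_smul, this]
        module
      · simpa using div_pos_of_neg_of_neg hν hμ
  · intro s' hs' t' ht' u' hu' hst' hsu' hct' hcu'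
    obtain ⟨x, hx⟩ := openHull_nonempty (K'.nonempty_of_mem_faces hs')
    obtain ⟨s, hs, hxs⟩ := exists_carrier (K := K) (x := x)
      (by rw [← h.2.1]
          exact SimplicialComplex.convexHull_subset_space hs' (openHull_subset_convexHull s' hx))
    obtain ⟨t, ht, hct, hsubt⟩ := h.exists_facet hK.card_le ht' hct'
    obtain ⟨u, hu, hcu, hsubu⟩ := h.exists_facet hK.card_le hu' hcu'
    have hst := subset_of_mem_openHull hs ht hxs (hsubt (mem_convexHull_of_subset hst' hx))
    have hsu := subset_of_mem_openHull hs hu hxs (hsubu (mem_convexHull_of_subset hsu' hx))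
    have hch := hK.conn s hs t ht u hu hst hsu hct hcu
    suffices ∀ w, ReflTransGen
        (fun u w => w ∈ K.faces ∧ s ⊆ w ∧ w.card = k + 1 ∧ k ≤ (u ∩ w).card) t w →
        (w ∈ K.faces ∧ s ⊆ w ∧ w.card = k + 1) ∧ ∀ w' ∈ K'.faces, s' ⊆ w' → w'.card = k + 1 →
          convexHull ℝ (w' : Set E) ⊆ convexHull ℝ (w : Set E) → ReflTransGen
          (fun u w => w ∈ K'.faces ∧ s' ⊆ w ∧ w.card = k + 1 ∧ k ≤ (u ∩ w).card) t' w' from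
      (this u hch).2 u' hu' hsu' hcu' hsubu
    intro w hw
    induction hw with
    | refl =>
      exact ⟨⟨ht, hst, hct⟩, fun w' hw' hsw' hcw' hsubw => h.chain_of_subset hpure hs' ht ht' hw'
        hst' hsw' hct' hcw' hsubt hsubw⟩
    | @tail a b _ hab ih =>
      obtain ⟨hb, hsb, hcb, hk⟩ := hab
      obtain ⟨⟨ha, hsa, hca⟩, ih⟩ := ih
      refine ⟨⟨hb, hsb, hcb⟩, fun w' hw' hsw' hcw' hsubw => ?_⟩
      rcases hk.eq_or_lt with hk | hk
      -- To cross the wall a ∩ b of K, take a wall of K' inside it that contains s', and facets of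
      -- K' on both sides of it. Inside a and inside b, `IsSubdivision.chain_of_subset` connects the
      -- rest.
      · have hr : a ∩ b ∈ K.faces := K.down_closed ha Finset.inter_subset_left
          ((K.nonempty_of_mem_faces hs).mono (Finset.subset_inter hsa hsb))
        obtain ⟨r', hr', hcr', hsr', hsubr⟩ := h.exists_lift hr hs' hx
          (mem_convexHull_of_subset (Finset.subset_inter hsa hsb) hxs)
        obtain ⟨y, hy⟩ := openHull_nonempty (K'.nonempty_of_mem_faces hr')
        have hyr := hsubr (openHull_subset_convexHull r' hy)
        obtain ⟨a', ha', hca', hra', hsuba⟩ := h.exists_lift ha hr' hy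
          (convexHull_mono (by simp) hyr)
        obtain ⟨b', hb', hcb', hrb', hsubb⟩ := h.exists_lift hb hr' hy
          (convexHull_mono (by simp) hyr)
        refine ((ih a' ha' (hsr'.trans hra') (hca'.trans hca) hsuba).tail
          ⟨hb', hsr'.trans hrb', hcb'.trans hcb, ?_⟩).trans
          (h.chain_of_subset hpure hs' hb hb' hw' (hsr'.trans hrb') hsw' (hcb'.trans hcb) hcw'
            hsubb hsubw)
        rw [hk, ← hcr']
        exact Finset.card_le_card (Finset.subset_inter hra' hrb')
      · obtain rfl := eq_of_card_le_card_inter hca hcb hk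
        exact ih w' hw' hsw' hcw' hsubw

end SubdivisionInvariance

/-! ### Simplicial isomorphisms preserve normality. -/

section Isomorphism

open Classical Set Relation

variable {E F : Type*} [AddCommGroup E] [Module ℝ E] [AddCommGroup F] [Module ℝ F]
  {K : SimplicialComplex ℝ E} {L : SimplicialComplex ℝ F}

theorem coe_subset_vertices {s : Finset E} (hs : s ∈ K.faces) : (s : Set E) ⊆ K.vertices := by
  rw [SimplicialComplex.vertices_eq]
  exact subset_biUnion_of_mem (u := fun k : Finset E => (k : Set E)) hs

theorem exists_face_image_eq {f : E → F} (hf : BijOn f K.vertices L.vertices)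
    (h : ∀ s : Finset E, (s : Set E) ⊆ K.vertices → (s ∈ K.faces ↔ s.image f ∈ L.faces))
    {t : Finset F} (ht : t ∈ L.faces) : ∃ s ∈ K.faces, s.image f = t := by
  have : (t : Set F) ⊆ f '' K.vertices := (coe_subset_vertices ht).trans hf.surjOn
  obtain ⟨s, hs, hst⟩ := Finset.subset_set_image_iff.1 this
  have hst' : s.image f = t := by rw [← hst]
  exact ⟨s, (h s hs).2 (hst' ▸ ht), hst'⟩

theorem image_subset_image_iff_of_injOn {α β : Type*} {f : α → β} {V : Set α} (hf : InjOn f V)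
    {s t : Finset α}
    (hs : (s : Set α) ⊆ V) (ht : (t : Set α) ⊆ V) : s.image f ⊆ t.image f ↔ s ⊆ t := by
  refine ⟨fun h v hv => ?_, Finset.image_subset_image⟩
  obtain ⟨u, hu, huv⟩ := Finset.mem_image.1 (h (Finset.mem_image_of_mem f hv))
  rwa [← hf (ht hu) (hs hv) huv]

theorem SimpliciallyIsomorphic.isNormal {k : ℕ} (hiso : SimpliciallyIsomorphic K L)
    (hL : IsNormal k L) : IsNormal k K := by
  obtain ⟨f, hf, h⟩ := hiso
  have hinj := hf.injOn
  have hV : ∀ s ∈ K.faces, (s : Set E) ⊆ K.vertices := fun s hs => coe_subset_vertices hs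
  have hcard : ∀ s ∈ K.faces, (s.image f).card = s.card := fun s hs =>
    Finset.card_image_of_injOn (hinj.mono (hV s hs))
  have hmem : ∀ s ∈ K.faces, s.image f ∈ L.faces := fun s hs => (h s (hV s hs)).1 hs
  have hsub : ∀ s ∈ K.faces, ∀ t ∈ K.faces, (s.image f ⊆ t.image f ↔ s ⊆ t) := fun s hs t ht =>
    image_subset_image_iff_of_injOn hinj (hV s hs) (hV t ht)
  have heq : ∀ s ∈ K.faces, ∀ t ∈ K.faces, s.image f = t.image f → s = t := fun s hs t ht e =>
    ((hsub s hs t ht).1 e.subset).antisymm ((hsub t ht s hs).1 e.superset)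
  refine ⟨fun s hs => hcard s hs ▸ hL.card_le _ (hmem s hs), ?_, ?_, ?_⟩
  · intro s hs
    obtain ⟨t', ht', hst, hc⟩ := hL.pure _ (hmem s hs)
    obtain ⟨t, ht, rfl⟩ := exists_face_image_eq hf h ht'
    exact ⟨t, ht, (hsub s hs t ht).1 hst, (hcard t ht).symm.trans hc⟩
  · intro s hs hsk
    obtain ⟨t₁', ht₁', t₂', ht₂', hs₁, hs₂, hc₁, hc₂, hne, hu⟩ :=
      hL.panel _ (hmem s hs) ((hcard s hs).trans hsk)
    obtain ⟨t₁, ht₁, rfl⟩ := exists_face_image_eq hf h ht₁'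
    obtain ⟨t₂, ht₂, rfl⟩ := exists_face_image_eq hf h ht₂'
    rw [hcard _ ht₁] at hc₁
    rw [hcard _ ht₂] at hc₂
    refine ⟨t₁, ht₁, t₂, ht₂, (hsub s hs _ ht₁).1 hs₁, (hsub s hs _ ht₂).1 hs₂, hc₁, hc₂,
      fun e => hne (e ▸ rfl), fun t ht hst hct => ?_⟩
    exact (hu _ (hmem t ht) ((hsub s hs t ht).2 hst) ((hcard t ht).trans hct)).imp
      (heq t ht _ ht₁) (heq t ht _ ht₂)
  · intro s hs t ht u hu hst hsu hct hcu
    have hch := hL.conn _ (hmem s hs) _ (hmem t ht) _ (hmem u hu) ((hsub s hs t ht).2 hst)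
      ((hsub s hs u hu).2 hsu) ((hcard t ht).trans hct) ((hcard u hu).trans hcu)
    suffices ∀ w', ReflTransGen (fun u w => w ∈ L.faces ∧ s.image f ⊆ w ∧ w.card = k + 1 ∧
        k ≤ (u ∩ w).card) (t.image f) w' → ∃ w ∈ K.faces, w.image f = w' ∧ ReflTransGen
        (fun u w => w ∈ K.faces ∧ s ⊆ w ∧ w.card = k + 1 ∧ k ≤ (u ∩ w).card) t w by
      obtain ⟨w, hw, hwu, hch'⟩ := this _ hch
      rwa [heq w hw u hu hwu] at hch'
    intro w' hw'
    induction hw' with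
    | refl => exact ⟨t, ht, rfl, .refl⟩
    | @tail a' b' _ hab ih =>
      obtain ⟨a, ha, rfl, hta⟩ := ih
      obtain ⟨hb', hsb, hcb, hk⟩ := hab
      obtain ⟨b, hb, rfl⟩ := exists_face_image_eq hf h hb'
      refine ⟨b, hb, rfl, hta.tail ⟨hb, (hsub s hs b hb).1 hsb, (hcard b hb).symm.trans hcb, ?_⟩⟩
      have e : a.image f ∩ b.image f = (a ∩ b).image f := by
        refine (Finset.image_inter_of_injOn a b (hinj.mono ?_)).symm
        exact union_subset (hV a ha) (hV b hb)
      have := Finset.card_image_le (s := a ∩ b) (f := f)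
      rw [← e] at this
      omega

end Isomorphism

/-! ### The boundary of a simplex is normal. -/

section SimplexBoundary

open Classical Set Relation

theorem le_card_inter {V : Type*} {t u R : Finset V} (ht : t ⊆ R) (hu : u ⊆ R) :
    t.card + u.card ≤ R.card + (t ∩ u).card := by
  rw [← Finset.card_union_add_card_inter]
  exact Nat.add_le_add_right (Finset.card_le_card (Finset.union_subset ht hu)) _

/-- The vertices of the standard simplex. -/
noncomputable def simplexVertices (n : ℕ) : Finset (Fin (n + 1) → ℝ) :=
  Finset.univ.image fun i : Fin (n + 1) => (Pi.single i (1 : ℝ) : Fin (n + 1) → ℝ)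

theorem card_simplexVertices (n : ℕ) : (simplexVertices n).card = n + 1 := by
  rw [simplexVertices, Finset.card_image_of_injective, Finset.card_univ, Fintype.card_fin]
  intro i j hij
  by_contra hne
  have := congrFun hij i
  simp [hne] at this

theorem mem_simplexBoundary_iff {n : ℕ} {s : Finset (Fin (n + 1) → ℝ)} :
    s ∈ (simplexBoundary n).faces ↔ s.Nonempty ∧ s ⊂ simplexVertices n := by
  have : Set.range (fun i : Fin (n + 1) => (Pi.single i (1 : ℝ) : Fin (n + 1) → ℝ)) =
      (simplexVertices n : Set (Fin (n + 1) → ℝ)) := by simp [simplexVertices]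
  change s.Nonempty ∧ (s : Set (Fin (n + 1) → ℝ)) ⊂ _ ↔ _
  rw [this, Finset.coe_ssubset]

theorem finite_simplexBoundary (n : ℕ) : (simplexBoundary n).faces.Finite :=
  (simplexVertices n).powerset.finite_toSet.subset fun _ hs =>
    Finset.mem_coe.2 (Finset.mem_powerset.2 (mem_simplexBoundary_iff.1 hs).2.subset)

/-- Facets are the complements of single vertices. A wall omits two vertices, hence lies in two
facets, and any two facets share at least k vertices, so chains of length one suffice. -/
theorem isNormal_simplexBoundary (k : ℕ) : IsNormal k (simplexBoundary (k + 1)) := by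
  have hR := card_simplexVertices (k + 1)
  have herase : ∀ v ∈ simplexVertices (k + 1), ∀ s : Finset (Fin (k + 1 + 1) → ℝ), s.Nonempty →
      s ⊆ (simplexVertices (k + 1)).erase v →
      (simplexVertices (k + 1)).erase v ∈ (simplexBoundary (k + 1)).faces ∧
      ((simplexVertices (k + 1)).erase v).card = k + 1 := fun v hv s hs hsv =>
    ⟨mem_simplexBoundary_iff.2 ⟨hs.mono hsv, Finset.erase_ssubset hv⟩,
      by rw [Finset.card_erase_of_mem hv, hR]; rfl⟩
  refine ⟨fun s hs => ?_, fun s hs => ?_, fun s hs hsk => ?_, ?_⟩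
  · have := Finset.card_lt_card (mem_simplexBoundary_iff.1 hs).2
    omega
  · obtain ⟨hne, hss⟩ := mem_simplexBoundary_iff.1 hs
    obtain ⟨v, hv, hvs⟩ := Finset.exists_of_ssubset hss
    have hsub := Finset.subset_erase.2 ⟨hss.subset, hvs⟩
    exact ⟨_, (herase v hv s hne hsub).1, hsub, (herase v hv s hne hsub).2⟩
  · obtain ⟨hne, hss⟩ := mem_simplexBoundary_iff.1 hs
    have h2 : (simplexVertices (k + 1) \ s).card = 2 := by
      rw [Finset.card_sdiff_of_subset hss.subset, hR, hsk]; omega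
    obtain ⟨u, v, huv, hd⟩ := Finset.card_eq_two.1 h2
    have hu : u ∈ simplexVertices (k + 1) \ s := by simp [hd]
    have hv : v ∈ simplexVertices (k + 1) \ s := by simp [hd]
    rw [Finset.mem_sdiff] at hu hv
    have hsu := Finset.subset_erase.2 ⟨hss.subset, hu.2⟩
    have hsv := Finset.subset_erase.2 ⟨hss.subset, hv.2⟩
    refine ⟨_, (herase u hu.1 s hne hsu).1, _, (herase v hv.1 s hne hsv).1, hsu, hsv,
      (herase u hu.1 s hne hsu).2, (herase v hv.1 s hne hsv).2, fun e => ?_, fun t ht hst hct => ?_⟩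
    · have : u ∈ (simplexVertices (k + 1)).erase v := Finset.mem_erase.2 ⟨huv, hu.1⟩
      rw [← e] at this
      simp at this
    · obtain ⟨x, hx, hxt⟩ := Finset.exists_of_ssubset (mem_simplexBoundary_iff.1 ht).2
      have hte : t = (simplexVertices (k + 1)).erase x :=
        Finset.eq_of_subset_of_card_le
          (Finset.subset_erase.2 ⟨(mem_simplexBoundary_iff.1 ht).2.subset, hxt⟩)
          (by rw [Finset.card_erase_of_mem hx, hR, hct]; rfl)
      have : x ∈ simplexVertices (k + 1) \ s := Finset.mem_sdiff.2 ⟨hx, fun h => hxt (hst h)⟩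
      rw [hd, Finset.mem_insert, Finset.mem_singleton] at this
      rcases this with rfl | rfl
      · exact .inl hte
      · exact .inr hte
  · intro s hs t ht u hu hst hsu hct hcu
    refine .single ⟨hu, hsu, hcu, ?_⟩
    have := le_card_inter (mem_simplexBoundary_iff.1 ht).2.subset
      (mem_simplexBoundary_iff.1 hu).2.subset
    omega

theorem PLHomeomorphic.isNormal {E : Type*} [NormedAddCommGroup E] [NormedSpace ℝ E] {k : ℕ}
    {K : SimplicialComplex ℝ E} (h : PLHomeomorphic K (simplexBoundary (k + 1))) :
    IsNormal k K := by
  obtain ⟨K', L', hK', hL', hiso⟩ := h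
  exact hK'.isNormal_of_subdivision (hiso.isNormal (hL'.isNormal (isNormal_simplexBoundary k)))

end SimplexBoundary

/-! ### The Euler characteristic as a valuation on compact convex sets. -/

section EulerValuation

open Classical Set

/-- The indicator of a compact interval drops to the right of t exactly when t is its right end. A
non-empty interval has one right end, so counting drops counts non-empty intervals. -/
theorem eventually_indicator_jump {I : Set ℝ} (hI : IsCompact I) (hI' : Convex ℝ I) (t : ℝ) :
    ∀ᶠ δ : ℝ in nhdsWithin 0 (Ioi 0), ((if t ∈ I then 1 else 0) - (if t + δ ∈ I then 1 else 0) : ℤ)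
      = if I.Nonempty ∧ t = sSup I then 1 else 0 := by
  by_cases ht : t ∈ I
  · have hne : I.Nonempty := ⟨t, ht⟩
    have hle := le_csSup hI.bddAbove ht
    rcases hle.eq_or_lt with h | h
    · filter_upwards [self_mem_nhdsWithin] with δ hδ
      have : t + δ ∉ I := fun hm => by
        have := le_csSup hI.bddAbove hm
        have : (0 : ℝ) < δ := hδ
        linarith
      rw [if_pos ht, if_neg this, if_pos ⟨hne, h⟩, sub_zero]
    · filter_upwards [Ioo_mem_nhdsGT (sub_pos.2 h)] with δ hδ
      have : t + δ ∈ I := hI'.ordConnected.out ht (hI.sSup_mem hne)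
        ⟨by linarith [hδ.1], by linarith [hδ.2]⟩
      rw [if_pos ht, if_pos this, if_neg fun h' => h.ne h'.2, sub_self]
  · have : ∀ᶠ δ : ℝ in nhdsWithin 0 (Ioi 0), t + δ ∉ I := by
      refine Filter.Eventually.filter_mono nhdsWithin_le_nhds ?_
      have hc : Continuous fun δ : ℝ => t + δ := by fun_prop
      exact hc.continuousAt.eventually_mem (hI.isClosed.isOpen_compl.mem_nhds (by simpa using ht))
    filter_upwards [this] with δ hδ
    rw [if_neg ht, if_neg hδ, if_neg, sub_self]
    rintro ⟨hne, rfl⟩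
    exact ht (hI.sSup_mem hne)

/-- The relation between the indicators at t and just to the right of t gives one for the drops at
t. Summing over the finitely many right ends counts each non-empty interval once. -/
theorem sum_nonempty_eq_zero_real {ι : Type*} (T : Finset ι) (c : ι → ℤ) (I : ι → Set ℝ)
    (hI : ∀ i ∈ T, IsCompact (I i)) (hI' : ∀ i ∈ T, Convex ℝ (I i))
    (h : ∀ t, ∑ i ∈ T, c i * (if t ∈ I i then 1 else 0) = 0) :
    ∑ i ∈ T, c i * (if (I i).Nonempty then 1 else 0) = 0 := by
  have key : ∀ t, ∑ i ∈ T, c i * (if (I i).Nonempty ∧ t = sSup (I i) then 1 else 0) = 0 := by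
    intro t
    obtain ⟨δ, hδ⟩ := ((Filter.eventually_all_finset T).2
      fun i hi => eventually_indicator_jump (hI i hi) (hI' i hi) t).exists
    refine Eq.trans ?_ ((congrArg₂ (· - ·) (h t) (h (t + δ))).trans (sub_self 0))
    rw [← Finset.sum_sub_distrib]
    refine Finset.sum_congr rfl fun i hi => ?_
    rw [← hδ i hi, mul_sub]
  have := Finset.sum_eq_zero fun t (_ : t ∈ T.image fun i => sSup (I i)) => key t
  rw [Finset.sum_comm] at this
  refine Eq.trans ?_ this
  refine Finset.sum_congr rfl fun i hi => ?_
  rw [← Finset.mul_sum]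
  congr 1
  by_cases hne : (I i).Nonempty
  · simp only [hne, true_and, if_true]
    rw [Finset.sum_ite_eq_of_mem' _ _ _ (Finset.mem_image_of_mem _ hi)]
  · simp [hne]

variable {E : Type*} [NormedAddCommGroup E] [NormedSpace ℝ E]

/-- Induction on the functionals: the slices at level t of the first functional satisfy the
hypotheses for the remaining ones, which gives the relation for the image intervals at t, and the
one-dimensional case finishes. Separation replaces the dimension: with no functional left all the
sets lie in one point. -/
theorem sum_nonempty_eq_zero_of_separating {ι : Type*} (T : Finset ι) (c : ι → ℤ)
    (l : List (E →L[ℝ] ℝ)) : ∀ (C : ι → Set E), (∀ i ∈ T, IsCompact (C i)) →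
    (∀ i ∈ T, Convex ℝ (C i)) → (∀ x, ∑ i ∈ T, c i * (if x ∈ C i then 1 else 0) = 0) →
    (∀ i ∈ T, ∀ j ∈ T, ∀ x ∈ C i, ∀ y ∈ C j, (∀ φ ∈ l, φ x = φ y) → x = y) →
    ∑ i ∈ T, c i * (if (C i).Nonempty then 1 else 0) = 0 := by
  induction l with
  | nil =>
    intro C _ _ h hs
    by_cases hne : ∃ i ∈ T, (C i).Nonempty
    · obtain ⟨i, hi, x, hx⟩ := hne
      refine Eq.trans ?_ (h x)
      refine Finset.sum_congr rfl fun j hj => ?_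
      have : (C j).Nonempty ↔ x ∈ C j := by
        refine ⟨fun ⟨y, hy⟩ => ?_, fun hx => ⟨x, hx⟩⟩
        rwa [hs i hi j hj x hx y hy (by simp)]
      simp only [this]
    · push Not at hne
      exact Finset.sum_eq_zero fun i hi => by simp [hne i hi]
  | cons φ l ih =>
    intro C hc hv h hs
    have := sum_nonempty_eq_zero_real T c (fun i => φ '' C i)
      (fun i hi => (hc i hi).image φ.continuous)
      (fun i hi => (hv i hi).linear_image (φ : E →ₗ[ℝ] ℝ)) ?_
    · simpa only [image_nonempty] using this
    intro t
    have := ih (fun i => C i ∩ {x | φ x = t})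
      (fun i hi => (hc i hi).inter_right (isClosed_eq φ.continuous continuous_const))
      (fun i hi => (hv i hi).inter ((convex_singleton t).linear_preimage (φ : E →ₗ[ℝ] ℝ))) ?_ ?_
    · refine Eq.trans ?_ this
      refine Finset.sum_congr rfl fun i _ => ?_
      have : t ∈ φ '' C i ↔ (C i ∩ {x | φ x = t}).Nonempty := Iff.rfl
      simp only [this]
    · intro x
      by_cases hx : φ x = t
      · refine Eq.trans ?_ (h x)
        refine Finset.sum_congr rfl fun i _ => ?_
        simp [hx]
      · exact Finset.sum_eq_zero fun i _ => by simp [hx]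
    · intro i hi j hj x hx y hy hxy
      refine hs i hi j hj x hx.1 y hy.1 fun ψ hψ => ?_
      rcases List.mem_cons.1 hψ with rfl | hψ
      · exact hx.2.trans hy.2.symm
      · exact hxy ψ hψ

/-- The Euler characteristic is well defined on integer combinations of indicator functions of
compact convex sets. -/
theorem sum_nonempty_eq_zero [FiniteDimensional ℝ E] {ι : Type*} (T : Finset ι) (c : ι → ℤ)
    (C : ι → Set E) (hc : ∀ i ∈ T, IsCompact (C i)) (hv : ∀ i ∈ T, Convex ℝ (C i))
    (h : ∀ x, ∑ i ∈ T, c i * (if x ∈ C i then 1 else 0) = 0) :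
    ∑ i ∈ T, c i * (if (C i).Nonempty then 1 else 0) = 0 := by
  let b := Module.finBasis ℝ E
  refine sum_nonempty_eq_zero_of_separating T c
    (List.ofFn fun i => LinearMap.toContinuousLinearMap (b.coord i)) C hc hv h ?_
  intro i _ j _ x _ y _ hxy
  refine b.ext_elem fun k => ?_
  exact hxy _ ((List.mem_ofFn' _ _).2 ⟨k, rfl⟩)

variable {K L : SimplicialComplex ℝ E}

/-- The coefficient of the closed simplex `t` in the indicator function of the space of `K`. -/
noncomputable def spaceCoeff (hK : K.faces.Finite) (t : Finset E) : ℤ :=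
  ∑ s ∈ hK.toFinset, if t ⊆ s then (-1) ^ (s.card + t.card) else 0

theorem eulerChar_eq_sum (hK : K.faces.Finite) :
    eulerChar K = ∑ s ∈ hK.toFinset, (-1 : ℤ) ^ (s.card - 1) := by
  rw [eulerChar, finsum_mem_eq_finite_toFinset_sum _ hK]

/-- After exchanging the sums, the alternating sum over the non-empty subsets of s is -1. -/
theorem sum_spaceCoeff (hK : K.faces.Finite) :
    ∑ t ∈ hK.toFinset, spaceCoeff hK t = eulerChar K := by
  rw [eulerChar_eq_sum hK]
  simp only [spaceCoeff]
  rw [Finset.sum_comm]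
  refine Finset.sum_congr rfl fun s hs => ?_
  rw [Finite.mem_toFinset] at hs
  have hne := K.nonempty_of_mem_faces hs
  rw [← Finset.sum_filter]
  have hf : (hK.toFinset.filter fun t => t ⊆ s) = s.powerset.erase ∅ := by
    ext t
    simp only [Finset.mem_filter, Finite.mem_toFinset, Finset.mem_erase, Finset.mem_powerset]
    refine ⟨fun ⟨ht, hts⟩ => ⟨(K.nonempty_of_mem_faces ht).ne_empty, hts⟩, fun ⟨h0, hts⟩ =>
      ⟨K.down_closed hs hts (Finset.nonempty_iff_ne_empty.2 h0), hts⟩⟩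
  simp only [pow_add]
  rw [hf, ← Finset.mul_sum, Finset.sum_erase_eq_sub (Finset.empty_mem_powerset s),
    Finset.sum_powerset_neg_one_pow_card_of_nonempty hne]
  obtain ⟨n, hn⟩ := Nat.exists_eq_succ_of_ne_zero hne.card_pos.ne'
  rw [hn]
  simp [pow_succ]

/-- Möbius inversion: if s is the carrier of x, then x lies in t exactly when s ⊆ t, and the
alternating sum over the interval from s to r vanishes unless r = s. -/
theorem sum_spaceCoeff_mul_indicator (hK : K.faces.Finite) (x : E) :
    ∑ t ∈ hK.toFinset, spaceCoeff hK t * (if x ∈ convexHull ℝ (t : Set E) then 1 else 0) =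
      if x ∈ K.space then 1 else 0 := by
  by_cases hx : x ∈ K.space
  · rw [if_pos hx]
    obtain ⟨s, hs, hxs⟩ := exists_carrier hx
    have hiff : ∀ t ∈ hK.toFinset, (x ∈ convexHull ℝ (t : Set E) ↔ s ⊆ t) := fun t ht =>
      ⟨subset_of_mem_openHull hs ((Finite.mem_toFinset hK).1 ht) hxs,
        fun h => convexHull_mono (Finset.coe_subset.2 h) (openHull_subset_convexHull s hxs)⟩
    rw [Finset.sum_congr rfl fun t ht => by rw [if_congr (hiff t ht) rfl rfl]]
    simp only [spaceCoeff, mul_ite, mul_one, mul_zero]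
    rw [← Finset.sum_filter, Finset.sum_comm]
    have : ∀ r ∈ hK.toFinset, (∑ t ∈ hK.toFinset.filter (s ⊆ ·),
        if t ⊆ r then (-1 : ℤ) ^ (r.card + t.card) else 0) = if r = s then 1 else 0 := by
      intro r hr
      rw [Finite.mem_toFinset] at hr
      rw [← Finset.sum_filter, Finset.filter_filter]
      by_cases hsr : s ⊆ r
      · have hf : (hK.toFinset.filter fun t => s ⊆ t ∧ t ⊆ r) = Finset.Icc s r := by
          ext t
          simp only [Finset.mem_filter, Finite.mem_toFinset, Finset.mem_Icc]
          exact ⟨fun h => h.2, fun h =>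
            ⟨K.down_closed hr h.2 ((K.nonempty_of_mem_faces hs).mono h.1), h⟩⟩
        rw [hf, Finset.Icc_eq_image_powerset hsr, Finset.sum_image]
        · have : ∀ u ∈ (r \ s).powerset, (-1 : ℤ) ^ (r.card + (s ∪ u).card) =
              (-1) ^ (r.card + s.card) * (-1) ^ u.card := by
            intro u hu
            rw [Finset.card_union_of_disjoint
              (Finset.disjoint_of_subset_right (Finset.mem_powerset.1 hu) Finset.disjoint_sdiff),
              ← add_assoc, pow_add]
          rw [Finset.sum_congr rfl this, ← Finset.mul_sum, Finset.sum_powerset_neg_one_pow_card]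
          by_cases hrs : r = s
          · subst hrs
            simp [← two_mul]
          · rw [if_neg hrs, if_neg, mul_zero]
            exact fun h => hrs ((Finset.sdiff_eq_empty_iff_subset.1 h).antisymm hsr)
        · intro u hu u' hu' huu
          simp only [Finset.coe_powerset, mem_preimage, mem_powerset_iff, Finset.coe_subset] at hu hu'
          have e : ∀ u : Finset E, u ⊆ r \ s → (s ∪ u) \ s = u := fun u hu => by
            rw [Finset.union_sdiff_left, Finset.sdiff_eq_self_iff_disjoint]
            exact Finset.disjoint_of_subset_left hu Finset.sdiff_disjoint
          rw [← e u hu, ← e u' hu']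
          exact congrArg (· \ s) huu
      · rw [if_neg (fun h => hsr h.superset), Finset.sum_eq_zero]
        intro t ht
        simp only [Finset.mem_filter] at ht
        exact absurd (ht.2.1.trans ht.2.2) hsr
    rw [Finset.sum_congr rfl this, Finset.sum_ite_eq_of_mem']
    rwa [Finite.mem_toFinset]
  · rw [if_neg hx]
    refine Finset.sum_eq_zero fun t ht => ?_
    rw [if_neg, mul_zero]
    exact fun h => hx (SimplicialComplex.convexHull_subset_space ((Finite.mem_toFinset hK).1 ht) h)

/-- Both complexes express the indicator of the same space by closed simplices. The difference is a
vanishing combination of indicators, and counting non-empty sets in it yields the difference of the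
Euler characteristics. -/
theorem eulerChar_eq_of_space_eq [FiniteDimensional ℝ E] (hK : K.faces.Finite)
    (hL : L.faces.Finite) (h : K.space = L.space) : eulerChar K = eulerChar L := by
  have := sum_nonempty_eq_zero (hK.toFinset.disjSum hL.toFinset)
    (Sum.elim (spaceCoeff hK) fun t => - spaceCoeff hL t)
    (Sum.elim (fun t : Finset E => convexHull ℝ (t : Set E))
      fun t : Finset E => convexHull ℝ (t : Set E)) ?_ ?_ ?_
  · rw [Finset.sum_disjSum] at this
    replace this : ∑ t ∈ hK.toFinset, spaceCoeff hK t *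
        (if (convexHull ℝ (t : Set E)).Nonempty then 1 else 0) + ∑ t ∈ hL.toFinset,
        (- spaceCoeff hL t) * (if (convexHull ℝ (t : Set E)).Nonempty then 1 else 0) = 0 := this
    have hk : ∀ t ∈ hK.toFinset, (convexHull ℝ (t : Set E)).Nonempty := fun t ht => by
      simpa using K.nonempty_of_mem_faces ((Finite.mem_toFinset hK).1 ht)
    have hl : ∀ t ∈ hL.toFinset, (convexHull ℝ (t : Set E)).Nonempty := fun t ht => by
      simpa using L.nonempty_of_mem_faces ((Finite.mem_toFinset hL).1 ht)
    rw [Finset.sum_congr rfl fun t ht => by rw [if_pos (hk t ht), mul_one],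
      Finset.sum_congr (s₁ := hL.toFinset) rfl fun t ht => by rw [if_pos (hl t ht), mul_one],
      Finset.sum_neg_distrib, sum_spaceCoeff, sum_spaceCoeff] at this
    linarith
  · rintro (t | t) _
    · exact t.finite_toSet.isCompact_convexHull (𝕜 := ℝ)
    · exact t.finite_toSet.isCompact_convexHull (𝕜 := ℝ)
  · rintro (t | t) _ <;> exact convex_convexHull _ _
  · intro x
    rw [Finset.sum_disjSum]
    change ∑ t ∈ hK.toFinset, spaceCoeff hK t * (if x ∈ convexHull ℝ (t : Set E) then 1 else 0) +
      ∑ t ∈ hL.toFinset, (- spaceCoeff hL t) * (if x ∈ convexHull ℝ (t : Set E) then 1 else 0) = 0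
    simp only [neg_mul, Finset.sum_neg_distrib]
    rw [sum_spaceCoeff_mul_indicator, sum_spaceCoeff_mul_indicator, h, add_neg_cancel]

end EulerValuation

/-! ### PL invariance of the Euler characteristic. -/

section EulerInvariance

open Classical Set

theorem SimpliciallyIsomorphic.eulerChar_eq {E F : Type*} [AddCommGroup E] [Module ℝ E]
    [AddCommGroup F] [Module ℝ F] {K : SimplicialComplex ℝ E} {L : SimplicialComplex ℝ F}
    (hiso : SimpliciallyIsomorphic K L) : eulerChar K = eulerChar L := by
  obtain ⟨f, hf, h⟩ := hiso
  have hV : ∀ s ∈ K.faces, (s : Set E) ⊆ K.vertices := fun s hs => coe_subset_vertices hs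
  refine finsum_mem_eq_of_bijOn (fun s => s.image f) ⟨fun s hs => (h s (hV s hs)).1 hs, ?_, ?_⟩ ?_
  · intro s hs t ht hst
    exact ((image_subset_image_iff_of_injOn hf.injOn (hV s hs) (hV t ht)).1 (Eq.subset hst)).antisymm
      ((image_subset_image_iff_of_injOn hf.injOn (hV t ht) (hV s hs)).1 (Eq.superset hst))
  · intro t ht
    obtain ⟨s, hs, rfl⟩ := exists_face_image_eq hf h ht
    exact ⟨s, hs, rfl⟩
  · intro s hs
    rw [Finset.card_image_of_injOn (hf.injOn.mono (hV s hs))]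

theorem PLHomeomorphic.eulerChar_eq {E F : Type*} [NormedAddCommGroup E] [NormedSpace ℝ E]
    [FiniteDimensional ℝ E] [NormedAddCommGroup F] [NormedSpace ℝ F] [FiniteDimensional ℝ F]
    {K : SimplicialComplex ℝ E} {L : SimplicialComplex ℝ F}
    (h : PLHomeomorphic K L) (hK : K.faces.Finite) (hL : L.faces.Finite) :
    eulerChar K = eulerChar L := by
  obtain ⟨K', L', hK', hL', hiso⟩ := h
  rw [← eulerChar_eq_of_space_eq hK'.1 hK hK'.2.1, ← eulerChar_eq_of_space_eq hL'.1 hL hL'.2.1,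
    hiso.eulerChar_eq]

/-- The alternating sum over all subsets of a 5-set is zero, and the contributions of the two
omitted subsets, the empty and the full one, cancel. -/
theorem eulerChar_simplexBoundary_four : eulerChar (simplexBoundary 4) = 0 := by
  rw [eulerChar_eq_sum (finite_simplexBoundary 4)]
  have hR := card_simplexVertices 4
  have hf : (finite_simplexBoundary 4).toFinset =
      ((simplexVertices 4).powerset.erase ∅).erase (simplexVertices 4) := by
    ext s
    rw [Finite.mem_toFinset, mem_simplexBoundary_iff, Finset.mem_erase, Finset.mem_erase,
      Finset.mem_powerset, Finset.nonempty_iff_ne_empty, Finset.ssubset_iff_subset_ne]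
    tauto
  have hne : simplexVertices 4 ≠ ∅ := by
    intro h; rw [h] at hR; simp at hR
  have : ∀ s ∈ (finite_simplexBoundary 4).toFinset, (-1 : ℤ) ^ (s.card - 1) =
      - (-1) ^ s.card := by
    intro s hs
    rw [Finite.mem_toFinset] at hs
    obtain ⟨n, hn⟩ := Nat.exists_eq_succ_of_ne_zero
      ((simplexBoundary 4).nonempty_of_mem_faces hs).card_pos.ne'
    rw [hn]; simp [pow_succ]
  rw [Finset.sum_congr rfl this, Finset.sum_neg_distrib, hf,
    Finset.sum_erase_eq_sub (Finset.mem_erase.2 ⟨hne, Finset.mem_powerset_self _⟩),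
    Finset.sum_erase_eq_sub (Finset.empty_mem_powerset _),
    Finset.sum_powerset_neg_one_pow_card_of_nonempty (Finset.nonempty_iff_ne_empty.2 hne), hR]
  norm_num

end EulerInvariance

/-! ### Chamber systems and an inequality from linear algebra mod 2. -/

section Chambers

open Classical Set Relation

variable {Φ V : Type*}

/-- `F` and `F'` have the same vertices of the colours in `S`. -/
def AgreeOn (vx : Φ → Fin 5 → V) (S : Finset (Fin 5)) (F F' : Φ) : Prop :=
  ∀ i ∈ S, vx F i = vx F' i

/-- The facets of a strongly connected balanced normal pseudomanifold of dimension four, where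
`vx F i` is the vertex of colour `i` of the facet `F`. -/
structure IsChamberSystem (vx : Φ → Fin 5 → V) : Prop where
  color : ∀ F F' i j, vx F i = vx F' j → i = j
  inj : Function.Injective vx
  panel : ∀ F i, ∃! F', F' ≠ F ∧ AgreeOn vx (Finset.univ.erase i) F F'
  conn : ∀ S F F', AgreeOn vx S F F' →
    ReflTransGen (fun A B => ∃ i ∉ S, AgreeOn vx (Finset.univ.erase i) A B) F F'

/-- The number of simplices with colour set `S`. -/
noncomputable def faceCount (vx : Φ → Fin 5 → V) (S : Finset (Fin 5)) : ℕ :=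
  Nat.card (Set.range fun (F : Φ) (i : S) => vx F i)

theorem agreeOn_iff {vx : Φ → Fin 5 → V} {S : Finset (Fin 5)} {F F' : Φ} :
    AgreeOn vx S F F' ↔ (fun i : S => vx F i) = fun i : S => vx F' i :=
  ⟨fun h => funext fun i => h i i.2, fun h i hi => congrFun h ⟨i, hi⟩⟩

theorem AgreeOn.symm {vx : Φ → Fin 5 → V} {S : Finset (Fin 5)} {F F' : Φ}
    (h : AgreeOn vx S F F') : AgreeOn vx S F' F := fun i hi => (h i hi).symm

theorem AgreeOn.trans {vx : Φ → Fin 5 → V} {S : Finset (Fin 5)} {F F' F'' : Φ}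
    (h : AgreeOn vx S F F') (h' : AgreeOn vx S F' F'') : AgreeOn vx S F F'' :=
  fun i hi => (h i hi).trans (h' i hi)

theorem AgreeOn.mono {vx : Φ → Fin 5 → V} {S T : Finset (Fin 5)} (hST : S ⊆ T) {F F' : Φ}
    (h : AgreeOn vx T F F') : AgreeOn vx S F F' := fun i hi => h i (hST hi)

/-- The functions on the facets which depend only on the vertices with colours in `S`. -/
def colorFunctions (vx : Φ → Fin 5 → V) (S : Finset (Fin 5)) : Submodule (ZMod 2) (Φ → ZMod 2) where
  carrier := {x | ∀ F F', AgreeOn vx S F F' → x F = x F'}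
  add_mem' := fun hx hy F F' h => by simp only [Pi.add_apply, hx F F' h, hy F F' h]
  zero_mem' := fun _ _ _ => rfl
  smul_mem' := fun c x hx F F' h => by simp only [Pi.smul_apply, hx F F' h]

theorem finrank_colorFunctions [Finite Φ] (vx : Φ → Fin 5 → V) (S : Finset (Fin 5)) :
    Module.finrank (ZMod 2) (colorFunctions vx S) = faceCount vx S := by
  let φ : Φ → S → V := fun F i => vx F i
  let e : (Set.range φ → ZMod 2) →ₗ[ZMod 2] colorFunctions vx S :=
    { toFun := fun y => ⟨fun F => y ⟨φ F, F, rfl⟩, fun F F' h => by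
        exact congrArg y (Subtype.ext (agreeOn_iff.1 h))⟩
      map_add' := fun _ _ => rfl
      map_smul' := fun _ _ => rfl }
  have he : Function.Bijective e := by
    constructor
    · intro y y' h
      funext ⟨_, F, rfl⟩
      exact congrFun (congrArg Subtype.val h) F
    · rintro ⟨x, hx⟩
      refine ⟨fun p => x p.2.choose, Subtype.ext (funext fun F => ?_)⟩
      exact hx _ _ (agreeOn_iff.2 (Set.mem_range_self (f := φ) F).choose_spec)
  have : Fintype (Set.range φ) := Fintype.ofFinite _
  rw [← (LinearEquiv.ofBijective e he).finrank_eq, Module.finrank_fintype_fun_eq_card,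
    ← Nat.card_eq_fintype_card]
  rfl

variable {vx : Φ → Fin 5 → V}

theorem colorFunctions_mono {S T : Finset (Fin 5)} (h : S ⊆ T) :
    colorFunctions vx S ≤ colorFunctions vx T := fun _ hx F F' hF => hx F F' (hF.mono h)

namespace IsChamberSystem

variable (h : IsChamberSystem vx)
include h

/-- Facets agreeing on S ∩ T are joined by crossings of walls whose colour lies outside S or outside
T. Each crossing preserves a function that depends on S only and also on T only. -/
theorem colorFunctions_inf (S T : Finset (Fin 5)) :
    colorFunctions vx S ⊓ colorFunctions vx T = colorFunctions vx (S ∩ T) := by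
  refine le_antisymm ?_ (le_inf (colorFunctions_mono Finset.inter_subset_left)
    (colorFunctions_mono Finset.inter_subset_right))
  rintro x ⟨hS, hT⟩ F F' hF
  have := h.conn _ F F' hF
  induction this using ReflTransGen.head_induction_on with
  | refl => rfl
  | @head A B hAB _ ih =>
    obtain ⟨i, hi, hAB⟩ := hAB
    have : ∀ R : Finset (Fin 5), i ∉ R → R ⊆ Finset.univ.erase i := fun R hR =>
      Finset.subset_erase.2 ⟨Finset.subset_univ _, hR⟩
    refine Eq.trans ?_ (ih ?_)
    · rw [Finset.mem_inter, not_and_or] at hi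
      rcases hi with hi | hi
      · exact hS _ _ (hAB.mono (this S hi))
      · exact hT _ _ (hAB.mono (this T hi))
    · exact (hAB.mono (this _ hi)).symm.trans hF

/-- The facet on the other side of the wall of colour `i`. -/
noncomputable def cross (F : Φ) (i : Fin 5) : Φ := (h.panel F i).choose

theorem cross_ne (F : Φ) (i : Fin 5) : h.cross F i ≠ F := (h.panel F i).choose_spec.1.1

theorem agreeOn_cross (F : Φ) (i : Fin 5) : AgreeOn vx (Finset.univ.erase i) F (h.cross F i) :=
  (h.panel F i).choose_spec.1.2

theorem eq_cross {F F' : Φ} {i : Fin 5} (hne : F' ≠ F)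
    (ha : AgreeOn vx (Finset.univ.erase i) F F') : F' = h.cross F i :=
  (h.panel F i).choose_spec.2 F' ⟨hne, ha⟩

theorem eq_or_eq_cross {F F' : Φ} {i : Fin 5} (ha : AgreeOn vx (Finset.univ.erase i) F F') :
    F' = F ∨ F' = h.cross F i :=
  or_iff_not_imp_left.2 fun hne => h.eq_cross hne ha

theorem cross_cross (F : Φ) (i : Fin 5) : h.cross (h.cross F i) i = F :=
  (h.eq_cross (h.cross_ne F i).symm (h.agreeOn_cross F i).symm).symm

theorem vx_cross {F : Φ} {i j : Fin 5} (hij : j ≠ i) : vx (h.cross F i) j = vx F j :=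
  (h.agreeOn_cross F i j (Finset.mem_erase.2 ⟨hij, Finset.mem_univ _⟩)).symm

theorem vx_cross_ne (F : Φ) (i : Fin 5) : vx (h.cross F i) i ≠ vx F i := by
  intro e
  refine h.cross_ne F i (h.inj (funext fun j => ?_))
  by_cases hj : j = i
  · rw [hj, e]
  · exact h.vx_cross hj

theorem agreeOn_cross_of_notMem {S : Finset (Fin 5)} {i : Fin 5} (hi : i ∉ S) (F : Φ) :
    AgreeOn vx S F (h.cross F i) :=
  (h.agreeOn_cross F i).mono (Finset.subset_erase.2 ⟨Finset.subset_univ _, hi⟩)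

/-- Crossing the walls of colour i pairs the facets, and the product takes the same value on both
members of a pair. -/
theorem sum_mul_eq_zero [Fintype Φ] {S T : Finset (Fin 5)} {i : Fin 5} (hS : i ∉ S) (hT : i ∉ T)
    {x y : Φ → ZMod 2} (hx : x ∈ colorFunctions vx S) (hy : y ∈ colorFunctions vx T) :
    ∑ F, x F * y F = 0 := by
  refine Finset.sum_involution (fun F _ => h.cross F i) ?_ (fun F _ _ => h.cross_ne F i)
    (fun _ _ => Finset.mem_univ _) (fun F _ => h.cross_cross F i)
  intro F _
  rw [← hx _ _ (h.agreeOn_cross_of_notMem hS F), ← hy _ _ (h.agreeOn_cross_of_notMem hT F)]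
  exact CharTwo.add_self_eq_zero _

theorem faceCount_univ : faceCount vx Finset.univ = Nat.card Φ := by
  rw [faceCount]
  refine (Nat.card_congr (Equiv.ofInjective _ fun F F' hF => h.inj (funext fun i => ?_))).symm
  exact congrFun hF ⟨i, Finset.mem_univ i⟩

theorem two_mul_faceCount_erase [Finite Φ] (i : Fin 5) :
    2 * faceCount vx (Finset.univ.erase i) = Nat.card Φ := by
  have := Fintype.ofFinite Φ
  let φ : Φ → {j // j ∈ (Finset.univ.erase i : Finset (Fin 5))} → V := fun F j => vx F j
  have h2 := Finset.card_eq_sum_card_image φ Finset.univ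
  have h3 : ∀ b ∈ Finset.univ.image φ, (Finset.univ.filter fun F => φ F = b).card = 2 := by
    intro b hb
    obtain ⟨F, -, rfl⟩ := Finset.mem_image.1 hb
    rw [Finset.card_eq_two]
    refine ⟨F, h.cross F i, (h.cross_ne F i).symm, ?_⟩
    ext F'
    simp only [Finset.mem_filter, Finset.mem_univ, true_and, Finset.mem_insert,
      Finset.mem_singleton]
    constructor
    · exact fun e => h.eq_or_eq_cross (agreeOn_iff.2 e.symm)
    · rintro (rfl | rfl)
      · rfl
      · exact agreeOn_iff.1 (h.agreeOn_cross F i).symm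
  rw [Finset.sum_congr rfl h3, Finset.sum_const, smul_eq_mul, mul_comm] at h2
  rw [Nat.card_eq_fintype_card, ← Finset.card_univ, h2, faceCount, ← Set.ncard_coe_finset]
  congr 1
  rw [Finset.coe_image, Finset.coe_univ, Set.image_univ]
  rfl

/-- The surfaces which are the links of the edges with colours `a`, `b` have Euler characteristic
at most two. -/
theorem link_inequality [Finite Φ] {a b i j k : Fin 5} (hnd : [a, b, i, j, k].Nodup) :
    2 * (faceCount vx {a, b, i} + faceCount vx {a, b, j} + faceCount vx {a, b, k}) ≤
      Nat.card Φ + 4 * faceCount vx {a, b} := by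
  have := Fintype.ofFinite Φ
  simp only [List.nodup_cons, List.mem_cons, List.not_mem_nil, or_false, not_or,
    not_false_eq_true, List.nodup_nil, and_true] at hnd
  obtain ⟨⟨hab, hai, haj, hak⟩, ⟨hbi, hbj, hbk⟩, ⟨hij, hik⟩, hjk⟩ := hnd
  -- The spaces A + B and C + D are orthogonal, since each of the four products misses a colour.
  -- Their dimensions are f_{abi} + f_{abj} - f_{ab} and f_{abk} + N/2 - f_{ab}, where N is the
  -- number of facets, and their sum is at most N.
  let A := colorFunctions vx {a, b, i}
  let B := colorFunctions vx {a, b, j}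
  let C := colorFunctions vx {a, b, k}
  let D := colorFunctions vx (Finset.univ.erase k)
  have hAB : A ⊓ B = colorFunctions vx {a, b} := by
    rw [h.colorFunctions_inf]
    congr 1
    ext x; simp only [Finset.mem_inter, Finset.mem_insert, Finset.mem_singleton]
    constructor
    · rintro ⟨h1, h2⟩
      rcases h1 with h1 | h1 | h1 <;> rcases h2 with h2 | h2 | h2 <;> subst h1 <;> simp_all
    · rintro (h1 | h1) <;> simp [h1]
  have hCD : C ⊓ D = colorFunctions vx {a, b} := by
    rw [h.colorFunctions_inf]
    congr 1
    ext x; simp only [Finset.mem_inter, Finset.mem_insert, Finset.mem_singleton, Finset.mem_erase,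
      Finset.mem_univ, and_true]
    constructor
    · rintro ⟨h1, h2⟩
      rcases h1 with h1 | h1 | h1 <;> simp_all
    · rintro (h1 | h1) <;> subst h1 <;> simp_all
  have hfA := finrank_colorFunctions vx {a, b, i}
  have hfB := finrank_colorFunctions vx {a, b, j}
  have hfC := finrank_colorFunctions vx {a, b, k}
  have hfD := finrank_colorFunctions vx (Finset.univ.erase k)
  have hf2 := finrank_colorFunctions vx {a, b}
  have h1 := Submodule.finrank_sup_add_finrank_inf_eq A B
  have h2 := Submodule.finrank_sup_add_finrank_inf_eq C D
  rw [hAB] at h1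
  rw [hCD] at h2
  have horth : ∀ x ∈ A ⊔ B, ∀ y ∈ C ⊔ D, ∑ F, x F * y F = 0 := by
    intro x hx y hy
    obtain ⟨x₁, hx₁, x₂, hx₂, rfl⟩ := Submodule.mem_sup.1 hx
    obtain ⟨y₁, hy₁, y₂, hy₂, rfl⟩ := Submodule.mem_sup.1 hy
    have e1 := h.sum_mul_eq_zero (i := j) (by simp; tauto) (by simp; tauto) hx₁ hy₁
    have e2 := h.sum_mul_eq_zero (i := k) (by simp; tauto) (by simp) hx₁ hy₂
    have e3 := h.sum_mul_eq_zero (i := i) (by simp; tauto) (by simp; tauto) hx₂ hy₁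
    have e4 := h.sum_mul_eq_zero (i := k) (by simp; tauto) (by simp) hx₂ hy₂
    calc _ = ∑ F, (x₁ F * y₁ F + x₁ F * y₂ F + (x₂ F * y₁ F + x₂ F * y₂ F)) :=
          Finset.sum_congr rfl fun F _ => by simp only [Pi.add_apply]; ring
      _ = 0 := by
          rw [Finset.sum_add_distrib, Finset.sum_add_distrib, Finset.sum_add_distrib, e1, e2, e3, e4]
          simp
  have hdim : Module.finrank (ZMod 2) ↥(A ⊔ B) + Module.finrank (ZMod 2) ↥(C ⊔ D) ≤ Nat.card Φ := by
    have hle : (C ⊔ D).map (dotProductEquiv (ZMod 2) Φ : (Φ → ZMod 2) →ₗ[ZMod 2] _) ≤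
        (A ⊔ B).dualAnnihilator := by
      rintro _ ⟨y, hy, rfl⟩
      rw [Submodule.mem_dualAnnihilator]
      intro x hx
      refine Eq.trans ?_ (horth x hx y hy)
      simp only [LinearEquiv.coe_coe, dotProductEquiv_apply_apply, dotProduct]
      exact Finset.sum_congr rfl fun F _ => mul_comm _ _
    have h3 := Submodule.finrank_mono hle
    rw [LinearEquiv.finrank_map_eq] at h3
    have h4 := Subspace.finrank_add_finrank_dualAnnihilator_eq (A ⊔ B)
    rw [Module.finrank_fintype_fun_eq_card] at h4
    rw [Nat.card_eq_fintype_card]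
    omega
  have h5 := h.two_mul_faceCount_erase k
  simp only [A, B, C, D] at h1 h2 hdim
  omega

end IsChamberSystem

end Chambers

/-! ### Linear relations between the coloured face numbers. -/

section FaceNumbers

theorem sum_eq_list_sum {α : Type*} {s : Finset α} {l : List α} (h : s.val = (l : Multiset α))
    (g : α → ℤ) : ∑ x ∈ s, g x = (l.map g).sum := by
  rw [Finset.sum, h, Multiset.map_coe, Multiset.sum_coe]

/-- The Euler relation for the sum over the vertex links of colour `a`. -/
def VertexEuler (f : Finset (Fin 5) → ℤ) (a : Fin 5) : Prop :=
  ∑ S ∈ Finset.univ.filter (fun S : Finset (Fin 5) => a ∈ S ∧ 2 ≤ S.card),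
    (-1) ^ S.card * f S = 0

/-- The Euler characteristic of the surface `F_ε` in terms of the Euler characteristic and the
numbers of vertices and of edges joining non-consecutive colours. -/
theorem surface_formula {f : Finset (Fin 5) → ℤ} {N : ℤ} (hE : ∀ a, VertexEuler f a)
    (hI : ∀ a b i j k : Fin 5, [a, b, i, j, k].Nodup →
      2 * (f {a, b, i} + f {a, b, j} + f {a, b, k}) ≤ N + 4 * f {a, b})
    (h4 : ∀ k, 2 * f (Finset.univ.erase k) = N) (h5 : f Finset.univ = N) :
    2 * N - 5 * N + 2 * ∑ k : Fin 5, f ((Finset.univ.erase k).erase (k + 1)) =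
      -8 * ∑ S ∈ Finset.univ.filter (fun S : Finset (Fin 5) => S.Nonempty),
        (-1) ^ (S.card - 1) * f S + 8 * ∑ k : Fin 5, f {k} - 4 * ∑ k : Fin 5, f {k, k + 2} := by
  have e0 := hE 0
  rw [VertexEuler, sum_eq_list_sum (l := [{0, 1}, {0, 2}, {0, 3}, {0, 4}, {0, 1, 2}, {0, 1, 3}, {0, 1, 4}, {0, 2, 3}, {0, 2, 4}, {0,
    3, 4}, {0, 1, 2, 3}, {0, 1, 2, 4}, {0, 1, 3, 4}, {0, 2, 3, 4}, {0, 1, 2, 3, 4}]) (by decide)] at e0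
  have e1 := hE 1
  rw [VertexEuler, sum_eq_list_sum (l := [{0, 1}, {1, 2}, {1, 3}, {1, 4}, {0, 1, 2}, {0, 1, 3}, {0, 1, 4}, {1, 2, 3}, {1, 2, 4}, {1,
    3, 4}, {0, 1, 2, 3}, {0, 1, 2, 4}, {0, 1, 3, 4}, {1, 2, 3, 4}, {0, 1, 2, 3, 4}]) (by decide)] at e1
  have e2 := hE 2
  rw [VertexEuler, sum_eq_list_sum (l := [{0, 2}, {1, 2}, {2, 3}, {2, 4}, {0, 1, 2}, {0, 2, 3}, {0, 2, 4}, {1, 2, 3}, {1, 2, 4}, {2,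
    3, 4}, {0, 1, 2, 3}, {0, 1, 2, 4}, {0, 2, 3, 4}, {1, 2, 3, 4}, {0, 1, 2, 3, 4}]) (by decide)] at e2
  have e3 := hE 3
  rw [VertexEuler, sum_eq_list_sum (l := [{0, 3}, {1, 3}, {2, 3}, {3, 4}, {0, 1, 3}, {0, 2, 3}, {0, 3, 4}, {1, 2, 3}, {1, 3, 4}, {2,
    3, 4}, {0, 1, 2, 3}, {0, 1, 3, 4}, {0, 2, 3, 4}, {1, 2, 3, 4}, {0, 1, 2, 3, 4}]) (by decide)] at e3
  have e4 := hE 4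
  rw [VertexEuler, sum_eq_list_sum (l := [{0, 4}, {1, 4}, {2, 4}, {3, 4}, {0, 1, 4}, {0, 2, 4}, {0, 3, 4}, {1, 2, 4}, {1, 3, 4}, {2,
    3, 4}, {0, 1, 2, 4}, {0, 1, 3, 4}, {0, 2, 3, 4}, {1, 2, 3, 4}, {0, 1, 2, 3, 4}]) (by decide)] at e4
  simp only [Fin.sum_univ_five]
  rw [sum_eq_list_sum (l := ([{0}, {1}, {2}, {3}, {4}, {0, 1}, {0, 2}, {0, 3}, {0, 4}, {1, 2}, {1, 3}, {1, 4}, {2, 3}, {2,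
    4}, {3, 4}, {0, 1, 2}, {0, 1, 3}, {0, 1, 4}, {0, 2, 3}, {0, 2, 4}, {0, 3, 4}, {1, 2, 3}, {1,
    2, 4}, {1, 3, 4}, {2, 3, 4}, {0, 1, 2, 3}, {0, 1, 2, 4}, {0, 1, 3, 4}, {0, 2, 3, 4}, {1, 2,
    3, 4}, {0, 1, 2, 3, 4}] : List (Finset (Fin 5)))) (by decide)]
  have i01 := hI 0 1 2 3 4 (by decide)
  have i02 := hI 0 2 1 3 4 (by decide)
  rw [show ({0, 2, 1} : Finset (Fin 5)) = {0, 1, 2} from by decide] at i02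
  have i03 := hI 0 3 1 2 4 (by decide)
  rw [show ({0, 3, 1} : Finset (Fin 5)) = {0, 1, 3} from by decide,
    show ({0, 3, 2} : Finset (Fin 5)) = {0, 2, 3} from by decide] at i03
  have i04 := hI 0 4 1 2 3 (by decide)
  rw [show ({0, 4, 1} : Finset (Fin 5)) = {0, 1, 4} from by decide,
    show ({0, 4, 2} : Finset (Fin 5)) = {0, 2, 4} from by decide,
    show ({0, 4, 3} : Finset (Fin 5)) = {0, 3, 4} from by decide] at i04
  have i12 := hI 1 2 0 3 4 (by decide)
  rw [show ({1, 2, 0} : Finset (Fin 5)) = {0, 1, 2} from by decide] at i12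
  have i13 := hI 1 3 0 2 4 (by decide)
  rw [show ({1, 3, 0} : Finset (Fin 5)) = {0, 1, 3} from by decide,
    show ({1, 3, 2} : Finset (Fin 5)) = {1, 2, 3} from by decide] at i13
  have i14 := hI 1 4 0 2 3 (by decide)
  rw [show ({1, 4, 0} : Finset (Fin 5)) = {0, 1, 4} from by decide,
    show ({1, 4, 2} : Finset (Fin 5)) = {1, 2, 4} from by decide,
    show ({1, 4, 3} : Finset (Fin 5)) = {1, 3, 4} from by decide] at i14
  have i23 := hI 2 3 0 1 4 (by decide)
  rw [show ({2, 3, 0} : Finset (Fin 5)) = {0, 2, 3} from by decide,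
    show ({2, 3, 1} : Finset (Fin 5)) = {1, 2, 3} from by decide] at i23
  have i24 := hI 2 4 0 1 3 (by decide)
  rw [show ({2, 4, 0} : Finset (Fin 5)) = {0, 2, 4} from by decide,
    show ({2, 4, 1} : Finset (Fin 5)) = {1, 2, 4} from by decide,
    show ({2, 4, 3} : Finset (Fin 5)) = {2, 3, 4} from by decide] at i24
  have i34 := hI 3 4 0 1 2 (by decide)
  rw [show ({3, 4, 0} : Finset (Fin 5)) = {0, 3, 4} from by decide,
    show ({3, 4, 1} : Finset (Fin 5)) = {1, 3, 4} from by decide,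
    show ({3, 4, 2} : Finset (Fin 5)) = {2, 3, 4} from by decide] at i34
  have h0 := h4 0
  rw [show (Finset.univ.erase 0 : Finset (Fin 5)) = {1, 2, 3, 4} from by decide] at h0
  have h1 := h4 1
  rw [show (Finset.univ.erase 1 : Finset (Fin 5)) = {0, 2, 3, 4} from by decide] at h1
  have h2 := h4 2
  rw [show (Finset.univ.erase 2 : Finset (Fin 5)) = {0, 1, 3, 4} from by decide] at h2
  have h3 := h4 3
  rw [show (Finset.univ.erase 3 : Finset (Fin 5)) = {0, 1, 2, 4} from by decide] at h3
  have h4 := h4 4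
  rw [show (Finset.univ.erase 4 : Finset (Fin 5)) = {0, 1, 2, 3} from by decide] at h4
  rw [show (Finset.univ : Finset (Fin 5)) = {0, 1, 2, 3, 4} from by decide] at h5
  rw [show ((Finset.univ.erase 0).erase (0 + 1) : Finset (Fin 5)) = {2, 3, 4} from by decide,
    show ((Finset.univ.erase 1).erase (1 + 1) : Finset (Fin 5)) = {0, 3, 4} from by decide,
    show ((Finset.univ.erase 2).erase (2 + 1) : Finset (Fin 5)) = {0, 1, 4} from by decide,
    show ((Finset.univ.erase 3).erase (3 + 1) : Finset (Fin 5)) = {0, 1, 2} from by decide,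
    show ((Finset.univ.erase 4).erase (4 + 1) : Finset (Fin 5)) = {1, 2, 3} from by decide,
    show ({0, 0 + 2} : Finset (Fin 5)) = {0, 2} from by decide,
    show ({1, 1 + 2} : Finset (Fin 5)) = {1, 3} from by decide,
    show ({2, 2 + 2} : Finset (Fin 5)) = {2, 4} from by decide,
    show ({3, 3 + 2} : Finset (Fin 5)) = {0, 3} from by decide,
    show ({4, 4 + 2} : Finset (Fin 5)) = {1, 4} from by decide]
  simp only [List.map_cons, List.map_nil, List.sum_cons, List.sum_nil] at e0 e1 e2 e3 e4 ⊢
  simp only [show ({0} : Finset (Fin 5)).card = 1 from rfl,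
    show ({1} : Finset (Fin 5)).card = 1 from rfl,
    show ({2} : Finset (Fin 5)).card = 1 from rfl,
    show ({3} : Finset (Fin 5)).card = 1 from rfl,
    show ({4} : Finset (Fin 5)).card = 1 from rfl,
    show ({0, 1} : Finset (Fin 5)).card = 2 from rfl,
    show ({0, 2} : Finset (Fin 5)).card = 2 from rfl,
    show ({0, 3} : Finset (Fin 5)).card = 2 from rfl,
    show ({0, 4} : Finset (Fin 5)).card = 2 from rfl,
    show ({1, 2} : Finset (Fin 5)).card = 2 from rfl,
    show ({1, 3} : Finset (Fin 5)).card = 2 from rfl,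
    show ({1, 4} : Finset (Fin 5)).card = 2 from rfl,
    show ({2, 3} : Finset (Fin 5)).card = 2 from rfl,
    show ({2, 4} : Finset (Fin 5)).card = 2 from rfl,
    show ({3, 4} : Finset (Fin 5)).card = 2 from rfl,
    show ({0, 1, 2} : Finset (Fin 5)).card = 3 from rfl,
    show ({0, 1, 3} : Finset (Fin 5)).card = 3 from rfl,
    show ({0, 1, 4} : Finset (Fin 5)).card = 3 from rfl,
    show ({0, 2, 3} : Finset (Fin 5)).card = 3 from rfl,
    show ({0, 2, 4} : Finset (Fin 5)).card = 3 from rfl,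
    show ({0, 3, 4} : Finset (Fin 5)).card = 3 from rfl,
    show ({1, 2, 3} : Finset (Fin 5)).card = 3 from rfl,
    show ({1, 2, 4} : Finset (Fin 5)).card = 3 from rfl,
    show ({1, 3, 4} : Finset (Fin 5)).card = 3 from rfl,
    show ({2, 3, 4} : Finset (Fin 5)).card = 3 from rfl,
    show ({0, 1, 2, 3} : Finset (Fin 5)).card = 4 from rfl,
    show ({0, 1, 2, 4} : Finset (Fin 5)).card = 4 from rfl,
    show ({0, 1, 3, 4} : Finset (Fin 5)).card = 4 from rfl,
    show ({0, 2, 3, 4} : Finset (Fin 5)).card = 4 from rfl,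
    show ({1, 2, 3, 4} : Finset (Fin 5)).card = 4 from rfl,
    show ({0, 1, 2, 3, 4} : Finset (Fin 5)).card = 5 from rfl]
    at e0 e1 e2 e3 e4 ⊢
  norm_num at e0 e1 e2 e3 e4 ⊢
  -- For a fixed colour the four inequalities for the pairs containing it add up to an equality,
  -- namely the Euler relation at that colour. Hence every one of them is an equality.
  have j01 : 2 * (f {0, 1, 2} + f {0, 1, 3} + f {0, 1, 4}) = N + 4 * f {0, 1} := by linarith
  have j02 : 2 * (f {0, 1, 2} + f {0, 2, 3} + f {0, 2, 4}) = N + 4 * f {0, 2} := by linarith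
  have j03 : 2 * (f {0, 1, 3} + f {0, 2, 3} + f {0, 3, 4}) = N + 4 * f {0, 3} := by linarith
  have j04 : 2 * (f {0, 1, 4} + f {0, 2, 4} + f {0, 3, 4}) = N + 4 * f {0, 4} := by linarith
  have j12 : 2 * (f {0, 1, 2} + f {1, 2, 3} + f {1, 2, 4}) = N + 4 * f {1, 2} := by linarith
  have j13 : 2 * (f {0, 1, 3} + f {1, 2, 3} + f {1, 3, 4}) = N + 4 * f {1, 3} := by linarith
  have j14 : 2 * (f {0, 1, 4} + f {1, 2, 4} + f {1, 3, 4}) = N + 4 * f {1, 4} := by linarith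
  have j23 : 2 * (f {0, 2, 3} + f {1, 2, 3} + f {2, 3, 4}) = N + 4 * f {2, 3} := by linarith
  have j24 : 2 * (f {0, 2, 4} + f {1, 2, 4} + f {2, 3, 4}) = N + 4 * f {2, 4} := by linarith
  have j34 : 2 * (f {0, 3, 4} + f {1, 3, 4} + f {2, 3, 4}) = N + 4 * f {3, 4} := by linarith
  linarith

end FaceNumbers

/-! ### Realizations in barycentric coordinates and the homeomorphisms they give. -/

section Realization

open Classical Set

variable {V : Type*} [Fintype V]

/-- The geometric realization, in barycentric coordinates, of the abstract complex whose simplices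
are the nonempty subsets of the members of `𝓕`. -/
def geomReal (𝓕 : Set (Set V)) : Set (V → ℝ) :=
  {z | z ∈ stdSimplex ℝ V ∧ ∃ s ∈ 𝓕, ∀ v ∉ s, z v = 0}

theorem isCompact_geomReal (𝓕 : Set (Set V)) : IsCompact (geomReal 𝓕) := by
  have : geomReal 𝓕 = stdSimplex ℝ V ∩ ⋃ s ∈ 𝓕, {z | ∀ v ∉ s, z v = 0} := by
    ext z; simp [geomReal]
  rw [this]
  refine (isCompact_stdSimplex ℝ V).inter_right ((toFinite 𝓕).isClosed_biUnion fun s _ => ?_)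
  simp only [Set.ofPred_forall]
  exact isClosed_iInter fun v => isClosed_iInter fun _ =>
    isClosed_eq (continuous_apply v) continuous_const

section Complex

variable {E : Type*} [NormedAddCommGroup E] [NormedSpace ℝ E] {K : SimplicialComplex ℝ E}

/-- The simplices of `K` as subsets of a type `V` which labels the vertices. -/
def labelledFaces (K : SimplicialComplex ℝ E) (ι : V → E) : Set (Set V) :=
  {s | ∃ t ∈ K.faces, ∀ v ∈ s, ι v ∈ t}

/-- The point with given barycentric coordinates. -/
noncomputable def baryPoint (ι : V → E) (z : V → ℝ) : E := ∑ v, z v • ι v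

theorem baryPoint_mem_openHull {ι : V → E} (hι : Function.Injective ι) {z : V → ℝ}
    (hz : z ∈ stdSimplex ℝ V) :
    baryPoint ι z ∈ openHull ((Finset.univ.filter fun v => 0 < z v).image ι) ∧
      ∀ w : E → ℝ, (∀ v, w (ι v) = z v) →
        ∑ y ∈ (Finset.univ.filter fun v => 0 < z v).image ι, w y = 1 ∧
        ∑ y ∈ (Finset.univ.filter fun v => 0 < z v).image ι, w y • y = baryPoint ι z := by
  have hz0 : ∀ v, ¬ 0 < z v → z v = 0 := fun v hv => le_antisymm (not_lt.1 hv) (hz.1 v)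
  have key : ∀ w : E → ℝ, (∀ v, w (ι v) = z v) →
        ∑ y ∈ (Finset.univ.filter fun v => 0 < z v).image ι, w y = 1 ∧
        ∑ y ∈ (Finset.univ.filter fun v => 0 < z v).image ι, w y • y = baryPoint ι z := by
    intro w hw
    rw [Finset.sum_image hι.injOn, Finset.sum_image hι.injOn]
    simp only [hw]
    rw [baryPoint, ← hz.2]
    exact ⟨Finset.sum_subset (Finset.filter_subset _ _) fun v _ hv => hz0 v (by simpa using hv),
      Finset.sum_subset (Finset.filter_subset _ _) fun v _ hv => by
        rw [hz0 v (by simpa using hv), zero_smul]⟩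
  refine ⟨?_, key⟩
  have hw : ∀ v, Function.extend ι z 0 (ι v) = z v := hι.extend_apply z 0
  obtain ⟨h1, h2⟩ := key _ hw
  refine ⟨Function.extend ι z 0, fun y hy => ?_, h1, h2⟩
  obtain ⟨v, hv, rfl⟩ := Finset.mem_image.1 hy
  rw [hw v]
  exact (Finset.mem_filter.1 hv).2

theorem support_mem_faces {ι : V → E} (hι : Function.Injective ι) {z : V → ℝ}
    (hz : z ∈ geomReal (labelledFaces K ι)) :
    ((Finset.univ.filter fun v => 0 < z v).image ι) ∈ K.faces := by
  obtain ⟨hz, s, ⟨t, ht, hst⟩, hs⟩ := hz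
  refine K.down_closed ht ?_ (nonempty_of_mem_openHull (baryPoint_mem_openHull hι hz).1)
  intro y hy
  obtain ⟨v, hv, rfl⟩ := Finset.mem_image.1 hy
  refine hst v ?_
  by_contra hvs
  rw [Finset.mem_filter, hs v hvs] at hv
  exact lt_irrefl _ hv.2

/-- The supports of two coordinate vectors with the same point are both the carrier of that point,
and on an independent set weights are unique. -/
theorem baryPoint_injOn {ι : V → E} (hι : Function.Injective ι) :
    InjOn (baryPoint ι) (geomReal (labelledFaces K ι)) := by
  intro z hz z' hz' he
  obtain ⟨h1, h2⟩ := baryPoint_mem_openHull hι hz.1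
  obtain ⟨h1', h2'⟩ := baryPoint_mem_openHull hι hz'.1
  rw [he] at h1
  have heq := (subset_of_mem_openHull (support_mem_faces hι hz) (support_mem_faces hι hz') h1
    (openHull_subset_convexHull _ h1')).antisymm (subset_of_mem_openHull
    (support_mem_faces hι hz') (support_mem_faces hι hz) h1' (openHull_subset_convexHull _ h1))
  have hw : ∀ z : V → ℝ, ∀ v, Function.extend ι z 0 (ι v) = z v := fun z => hι.extend_apply z 0
  have a := h2 (Function.extend ι z 0) (hw z)
  have b := h2' (Function.extend ι z' 0) (hw z')
  rw [← heq] at b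
  have hu := weights_unique (K.indep (support_mem_faces hι hz)) (a.1.trans b.1.symm)
    (a.2.trans (he.trans b.2.symm))
  funext v
  by_cases hv : 0 < z v
  · have := hu (ι v) (Finset.mem_image_of_mem _ (by simpa using hv))
    rwa [hw z v, hw z' v] at this
  · have hv' : ¬ 0 < z' v := fun hv' => by
      have : ι v ∈ (Finset.univ.filter fun v => 0 < z v).image ι := by
        rw [heq]; exact Finset.mem_image_of_mem _ (by simpa using hv')
      obtain ⟨u, hu, huv⟩ := Finset.mem_image.1 this
      rw [hι huv] at hu
      exact hv (Finset.mem_filter.1 hu).2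
    rw [le_antisymm (not_lt.1 hv) (hz.1.1 v), le_antisymm (not_lt.1 hv') (hz'.1.1 v)]

theorem baryPoint_mem_space {ι : V → E} (hι : Function.Injective ι) {z : V → ℝ}
    (hz : z ∈ geomReal (labelledFaces K ι)) : baryPoint ι z ∈ K.space :=
  SimplicialComplex.convexHull_subset_space (support_mem_faces hι hz)
    (openHull_subset_convexHull _ (baryPoint_mem_openHull hι hz.1).1)

theorem exists_baryPoint_eq {ι : V → E} (hι : Function.Injective ι)
    (hV : K.vertices ⊆ range ι) {x : E} (hx : x ∈ K.space) :
    ∃ z ∈ geomReal (labelledFaces K ι), baryPoint ι z = x := by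
  obtain ⟨t, ht, hxt⟩ := SimplicialComplex.mem_space_iff.1 hx
  obtain ⟨w, h0, h1, h2⟩ := Finset.mem_convexHull'.1 hxt
  have himg : (Finset.univ.filter fun v => ι v ∈ t).image ι = t := by
    ext y
    simp only [Finset.mem_image, Finset.mem_filter, Finset.mem_univ, true_and]
    constructor
    · rintro ⟨v, hv, rfl⟩; exact hv
    · intro hy
      obtain ⟨v, rfl⟩ := hV (coe_subset_vertices ht hy)
      exact ⟨v, hy, rfl⟩
  rw [← himg, Finset.sum_image hι.injOn] at h1 h2
  refine ⟨fun v => if ι v ∈ t then w (ι v) else 0, ⟨⟨fun v => ?_, ?_⟩, {v | ι v ∈ t},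
    ⟨t, ht, fun v hv => hv⟩, fun v hv => if_neg hv⟩, ?_⟩
  · dsimp only
    split_ifs with h
    · exact h0 _ h
    · exact le_rfl
  · rw [← Finset.sum_filter, h1]
  · simp only [baryPoint, ite_smul, zero_smul]
    rw [← Finset.sum_filter, h2]

/-- The space of a complex is homeomorphic to its realization in barycentric coordinates. -/
theorem nonempty_homeomorph_geomReal {ι : V → E} (hι : Function.Injective ι)
    (hV : K.vertices ⊆ range ι) :
    ∃ e : geomReal (labelledFaces K ι) ≃ₜ K.space, ∀ z, (e z : E) = baryPoint ι z := by
  have : CompactSpace (geomReal (labelledFaces K ι)) :=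
    isCompact_iff_compactSpace.1 (isCompact_geomReal _)
  let f : geomReal (labelledFaces K ι) → K.space := fun z => ⟨baryPoint ι z, baryPoint_mem_space hι z.2⟩
  have hf : Function.Bijective f :=
    ⟨fun z z' h => Subtype.ext (baryPoint_injOn hι z.2 z'.2 (congrArg Subtype.val h)),
      fun x => by
        obtain ⟨z, hz, hzx⟩ := exists_baryPoint_eq hι hV x.2
        exact ⟨⟨z, hz⟩, Subtype.ext hzx⟩⟩
  have hc : Continuous f := by
    refine Continuous.subtype_mk ?_ _
    exact continuous_finsetSum _ fun v _ =>
      ((continuous_apply v).comp continuous_subtype_val).smul continuous_const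
  exact ⟨hc.homeoOfEquivCompactToT2 (f := Equiv.ofBijective f hf), fun _ => rfl⟩

theorem finite_vertices (hK : K.faces.Finite) : K.vertices.Finite := by
  rw [SimplicialComplex.vertices_eq]
  exact hK.biUnion fun s _ => s.finite_toSet

/-- Labelling the vertices of L by those of K through the isomorphism makes both spaces realizations
of one and the same family of subsets. -/
theorem SimpliciallyIsomorphic.nonempty_homeomorph {F : Type*} [NormedAddCommGroup F]
    [NormedSpace ℝ F] {L : SimplicialComplex ℝ F} (hK : K.faces.Finite)
    (hiso : SimpliciallyIsomorphic K L) : Nonempty (K.space ≃ₜ L.space) := by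
  obtain ⟨f, hf, h⟩ := hiso
  have := (finite_vertices hK).fintype
  obtain ⟨e, -⟩ := nonempty_homeomorph_geomReal (K := K) (ι := ((↑) : K.vertices → E))
    Subtype.val_injective (by simp)
  obtain ⟨e', -⟩ := nonempty_homeomorph_geomReal (K := L) (ι := fun v : K.vertices => f v)
    (fun u v huv => Subtype.ext (hf.injOn u.2 v.2 huv)) (by
      intro y hy
      obtain ⟨v, hv, rfl⟩ := hf.surjOn hy
      exact ⟨⟨v, hv⟩, rfl⟩)
  have heq : labelledFaces K ((↑) : K.vertices → E) =
      labelledFaces L (fun v : K.vertices => f v) := by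
    ext s
    constructor
    · rintro ⟨t, ht, hst⟩
      exact ⟨t.image f, (h t (coe_subset_vertices ht)).1 ht,
        fun v hv => Finset.mem_image_of_mem _ (hst v hv)⟩
    · rintro ⟨t', ht', hst⟩
      obtain ⟨t, ht, rfl⟩ := exists_face_image_eq hf h ht'
      refine ⟨t, ht, fun v hv => ?_⟩
      obtain ⟨u, hu, huv⟩ := Finset.mem_image.1 (hst v hv)
      rwa [← hf.injOn (coe_subset_vertices ht hu) v.2 huv]
  exact ⟨e.symm.trans ((Homeomorph.setCongr (congrArg geomReal heq)).trans e')⟩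

theorem PLHomeomorphic.nonempty_homeomorph {F : Type*} [NormedAddCommGroup F]
    [NormedSpace ℝ F] {L : SimplicialComplex ℝ F} (h : PLHomeomorphic K L) :
    Nonempty (K.space ≃ₜ L.space) := by
  obtain ⟨K', L', hK', hL', hiso⟩ := h
  obtain ⟨e⟩ := hiso.nonempty_homeomorph hK'.1
  exact ⟨(Homeomorph.setCongr hK'.2.1).symm.trans (e.trans (Homeomorph.setCongr hL'.2.1))⟩

end Complex

end Realization

/-! ### The boundary of the simplex is a topological sphere. -/

section Sphere

open Classical Set

/-- The standard simplex, with one of its vertices at the origin. -/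
def cornerSimplex (n : ℕ) : Set (EuclideanSpace ℝ (Fin n)) :=
  {y | (∀ i, 0 ≤ y i) ∧ ∑ i, y i ≤ 1}

theorem convex_cornerSimplex (n : ℕ) : Convex ℝ (cornerSimplex n) := by
  intro x hx y hy a b ha hb hab
  refine ⟨fun i => ?_, ?_⟩
  · have := mul_nonneg ha (hx.1 i)
    have := mul_nonneg hb (hy.1 i)
    simp only [PiLp.add_apply, PiLp.smul_apply, smul_eq_mul]
    linarith
  · simp only [PiLp.add_apply, PiLp.smul_apply, smul_eq_mul, Finset.sum_add_distrib,
      ← Finset.mul_sum]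
    nlinarith [mul_le_mul_of_nonneg_left hx.2 ha, mul_le_mul_of_nonneg_left hy.2 hb]

theorem isClosed_cornerSimplex (n : ℕ) : IsClosed (cornerSimplex n) := by
  rw [cornerSimplex, Set.ofPred_and, Set.ofPred_forall]
  exact (isClosed_iInter fun i => isClosed_le continuous_const (by fun_prop)).inter
    (isClosed_le (by fun_prop) continuous_const)

theorem isOpen_openCorner (n : ℕ) :
    IsOpen {y : EuclideanSpace ℝ (Fin n) | (∀ i, 0 < y i) ∧ ∑ i, y i < 1} := by
  rw [Set.ofPred_and, Set.ofPred_forall]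
  exact (isOpen_iInter_of_finite fun i => isOpen_lt continuous_const (by fun_prop)).inter
    (isOpen_lt (by fun_prop) continuous_const)

/-- An interior point can be moved a little both ways along each axis. Decreasing a coordinate shows
that it was positive; increasing one shows that the sum was below 1. -/
theorem interior_cornerSimplex (n : ℕ) [NeZero n] : interior (cornerSimplex n) =
    {y | (∀ i, 0 < y i) ∧ ∑ i, y i < 1} := by
  refine Subset.antisymm (fun y hy => ?_) (interior_maximal
    (fun y hy => ⟨fun i => (hy.1 i).le, hy.2.le⟩) (isOpen_openCorner n))
  have hmove : ∀ i : Fin n, ∃ ε : ℝ, 0 < ε ∧ y - ε • EuclideanSpace.single i (1 : ℝ) ∈ cornerSimplex n ∧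
      y + ε • EuclideanSpace.single i (1 : ℝ) ∈ cornerSimplex n := by
    intro i
    have hc : ∀ s : ℝ, ∀ᶠ ε : ℝ in nhdsWithin 0 (Ioi 0),
        y + (s * ε) • EuclideanSpace.single i (1 : ℝ) ∈ cornerSimplex n := by
      intro s
      refine Filter.Eventually.filter_mono nhdsWithin_le_nhds ?_
      have hcont : Continuous fun ε : ℝ => y + (s * ε) • EuclideanSpace.single i (1 : ℝ) := by
        fun_prop
      refine hcont.continuousAt.eventually_mem ?_
      simpa using mem_interior_iff_mem_nhds.1 hy
    obtain ⟨ε, ⟨h1, h2⟩, h3⟩ := (((hc (-1)).and (hc 1)).and self_mem_nhdsWithin).exists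
    refine ⟨ε, h3, ?_, by simpa using h2⟩
    convert h1 using 1
    simp [sub_eq_add_neg]
  refine ⟨fun i => ?_, ?_⟩
  · obtain ⟨ε, hε, h, -⟩ := hmove i
    have := h.1 i
    simp at this
    linarith
  · obtain ⟨ε, hε, -, h⟩ := hmove 0
    have := h.2
    simp [Finset.sum_add_distrib] at this
    linarith

theorem isBounded_cornerSimplex (n : ℕ) : Bornology.IsBounded (cornerSimplex n) := by
  refine (Metric.isBounded_iff_subset_closedBall 0).2 ⟨(n : ℝ), fun y hy => ?_⟩
  rw [mem_closedBall_zero_iff, EuclideanSpace.norm_eq, Real.sqrt_le_left (by positivity)]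
  have : ∀ i, y i ≤ 1 := fun i =>
    (Finset.single_le_sum (fun j _ => hy.1 j) (Finset.mem_univ i)).trans hy.2
  calc ∑ i, ‖y i‖ ^ 2 ≤ ∑ i : Fin n, 1 := Finset.sum_le_sum fun i _ => by
        rw [Real.norm_of_nonneg (hy.1 i)]
        exact pow_le_one₀ (hy.1 i) (this i)
    _ = (n : ℝ) := by simp
    _ ≤ (n : ℝ) ^ 2 := by exact_mod_cast Nat.le_self_pow two_ne_zero n

theorem nonempty_homeomorph_frontier (n : ℕ) [NeZero n] :
    Nonempty (frontier (cornerSimplex n) ≃ₜ Metric.sphere (0 : EuclideanSpace ℝ (Fin n)) 1) := by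
  have hne : (interior (cornerSimplex n)).Nonempty := by
    rw [interior_cornerSimplex]
    refine ⟨WithLp.toLp 2 fun _ => ((n : ℝ) + 1)⁻¹, fun i => by positivity, ?_⟩
    simp only [Finset.sum_const, Finset.card_univ, Fintype.card_fin, nsmul_eq_mul]
    rw [← div_eq_mul_inv, div_lt_one (by positivity)]
    linarith
  obtain ⟨h, -, -, hfr⟩ := exists_homeomorph_image_interior_closure_frontier_eq_unitBall
    (convex_cornerSimplex n) hne (isBounded_cornerSimplex n)
  exact ⟨(h.image _).trans (Homeomorph.setCongr hfr)⟩

theorem nonempty_homeomorph_simplexBoundary (n : ℕ) [NeZero n] :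
    Nonempty ((simplexBoundary n).space ≃ₜ Metric.sphere (0 : EuclideanSpace ℝ (Fin n)) 1) := by
  let ι : Fin (n + 1) → (Fin (n + 1) → ℝ) := fun i => Pi.single i 1
  have hι : Function.Injective ι := fun i j hij => by
    by_contra hne
    have := congrFun hij i
    simp [ι, hne] at this
  have hvert : ∀ t ∈ (simplexBoundary n).faces, ∀ y ∈ t, y ∈ range ι := fun t ht y hy =>
    ht.2.subset hy
  obtain ⟨e, -⟩ := nonempty_homeomorph_geomReal (K := simplexBoundary n) hι (by
    intro y hy
    exact hvert _ hy y (Finset.mem_singleton_self y))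
  have hset : geomReal (labelledFaces (simplexBoundary n) ι) =
      {z | z ∈ stdSimplex ℝ (Fin (n + 1)) ∧ ∃ i, z i = 0} := by
    ext z
    refine and_congr_right fun hz => ⟨?_, ?_⟩
    · rintro ⟨s, ⟨t, ht, hst⟩, hs⟩
      obtain ⟨y, ⟨i, rfl⟩, hi⟩ := exists_of_ssubset ht.2
      exact ⟨i, hs i fun h => hi (hst i h)⟩
    · rintro ⟨i, hi⟩
      refine ⟨{i}ᶜ, ⟨(Finset.univ.erase i).image ι, ⟨?_, ?_⟩, fun v hv => ?_⟩, fun v hv => ?_⟩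
      · obtain ⟨j, hj⟩ : ∃ j, j ≠ i := by
          have : Nontrivial (Fin (n + 1)) := Fin.nontrivial_iff_two_le.2
            (by have := NeZero.pos n; omega)
          exact exists_ne i
        exact ⟨ι j, Finset.mem_image_of_mem _ (by simpa using hj)⟩
      · refine ssubset_iff_subset_ne.2 ⟨?_, fun h => ?_⟩
        · rw [Finset.coe_image]; exact image_subset_range _ _
        · have : ι i ∈ (((Finset.univ.erase i).image ι : Finset _) : Set (Fin (n + 1) → ℝ)) := by
            rw [h]; exact ⟨i, rfl⟩
          obtain ⟨j, hj, hji⟩ := Finset.mem_image.1 (Finset.mem_coe.1 this)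
          rw [hι hji] at hj
          simp at hj
      · exact Finset.mem_image_of_mem _ (by simpa using hv)
      · simp only [mem_compl_iff, mem_singleton_iff, not_not] at hv
        rw [hv, hi]
  have hfr : frontier (cornerSimplex n) =
      {y | y ∈ cornerSimplex n ∧ ((∃ i, y i = 0) ∨ ∑ i, y i = 1)} := by
    rw [(isClosed_cornerSimplex n).frontier_eq, interior_cornerSimplex]
    ext y
    refine and_congr_right fun hy => ?_
    simp only [mem_ofPred_eq, not_and_or, not_forall, not_lt]
    exact or_congr (exists_congr fun i => ⟨fun h => le_antisymm h (hy.1 i), fun h => h.le⟩)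
      ⟨fun h => le_antisymm hy.2 h, fun h => h.ge⟩
  obtain ⟨e'⟩ := nonempty_homeomorph_frontier n
  -- Forget the coordinate 0, which is recovered as 1 minus the sum of the others. Its vanishing
  -- corresponds to the slanted face of the corner simplex.
  let g : {z | z ∈ stdSimplex ℝ (Fin (n + 1)) ∧ ∃ i, z i = 0} ≃ₜ
      {y | y ∈ cornerSimplex n ∧ ((∃ i, y i = 0) ∨ ∑ i, y i = 1)} :=
    { toFun := fun z => ⟨WithLp.toLp 2 fun i => z.1 i.succ, by
        obtain ⟨z, ⟨hz0, hz1⟩, i, hi⟩ := z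
        rw [Fin.sum_univ_succ] at hz1
        refine ⟨⟨fun i => hz0 _, ?_⟩, ?_⟩
        · have := hz0 0
          dsimp only
          linarith
        · refine Fin.cases (fun hi => ?_) (fun i hi => ?_) i hi
          · right
            dsimp only
            linarith
          · exact .inl ⟨i, hi⟩⟩
      invFun := fun y => ⟨Fin.cons (1 - ∑ i, y.1 i) fun i => y.1 i, by
        obtain ⟨y, ⟨hy0, hy1⟩, hy⟩ := y
        refine ⟨⟨fun i => ?_, ?_⟩, ?_⟩
        · refine Fin.cases ?_ (fun i => ?_) i
          · simpa using hy1
          · simpa using hy0 i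
        · rw [Fin.sum_univ_succ]
          simp
        · rcases hy with ⟨i, hi⟩ | hy
          · exact ⟨i.succ, by simpa using hi⟩
          · exact ⟨0, by simp only [Fin.cons_zero]; linarith⟩⟩
      left_inv := fun z => by
        obtain ⟨z, ⟨hz0, hz1⟩, i, hi⟩ := z
        rw [Fin.sum_univ_succ] at hz1
        refine Subtype.ext (funext fun j => ?_)
        refine Fin.cases ?_ (fun j => ?_) j
        · simp only [Fin.cons_zero]
          linarith
        · simp
      right_inv := fun y => by
        refine Subtype.ext ?_
        ext i
        simp
      continuous_toFun := by
        refine Continuous.subtype_mk ((PiLp.continuous_toLp 2 _).comp (continuous_pi fun i => ?_)) _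
        exact (continuous_apply i.succ).comp continuous_subtype_val
      continuous_invFun := by
        refine Continuous.subtype_mk (continuous_pi fun i => ?_) _
        refine Fin.cases ?_ (fun i => ?_) i
        · simp only [Fin.cons_zero]
          fun_prop
        · simp only [Fin.cons_succ]
          fun_prop }
  exact ⟨e.symm.trans ((Homeomorph.setCongr hset).trans (g.trans
    ((Homeomorph.setCongr hfr).symm.trans e')))⟩

end Sphere

/-! ### Closed combinatorial 4-manifolds are normal. -/

section Manifold

open Classical Set Relation

variable {E : Type*} [NormedAddCommGroup E] [NormedSpace ℝ E] {K : SimplicialComplex ℝ E}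

/-- The unions of the reachable and of the unreachable facets are closed and cover the connected
space, so they would meet. Two facets that meet share a simplex, and strong connectivity of its star
joins them. This supplies the connectivity over the empty simplex, which `IsNormal` does not
contain. -/
theorem IsNormal.exists_chain {k : ℕ} (h : IsNormal k K) (hK : K.faces.Finite)
    (hc : IsPreconnected K.space) {t t' : Finset E} (ht : t ∈ K.faces) (ht' : t' ∈ K.faces)
    (hcard : t.card = k + 1) (hcard' : t'.card = k + 1) :
    ReflTransGen (fun u w => w ∈ K.faces ∧ w.card = k + 1 ∧ k ≤ (u ∩ w).card) t t' := by
  set R : Finset E → Prop :=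
    ReflTransGen (fun u w => w ∈ K.faces ∧ w.card = k + 1 ∧ k ≤ (u ∩ w).card) t
  by_contra hR
  let A : Set E := ⋃ u ∈ {u | u ∈ K.faces ∧ u.card = k + 1 ∧ R u}, convexHull ℝ (u : Set E)
  let B : Set E := ⋃ u ∈ {u | u ∈ K.faces ∧ u.card = k + 1 ∧ ¬ R u}, convexHull ℝ (u : Set E)
  have hA : IsClosed A := (hK.subset fun u hu => hu.1).isClosed_biUnion fun u _ =>
    u.finite_toSet.isClosed_convexHull ℝ
  have hB : IsClosed B := (hK.subset fun u hu => hu.1).isClosed_biUnion fun u _ =>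
    u.finite_toSet.isClosed_convexHull ℝ
  have hcov : K.space ⊆ A ∪ B := by
    intro x hx
    obtain ⟨s, hs, hxs⟩ := SimplicialComplex.mem_space_iff.1 hx
    obtain ⟨u, hu, hsu, hcu⟩ := h.pure s hs
    have hxu := convexHull_mono (𝕜 := ℝ) (Finset.coe_subset.2 hsu) hxs
    by_cases hRu : R u
    · exact .inl (mem_biUnion (show u ∈ {u | _} from ⟨hu, hcu, hRu⟩) hxu)
    · exact .inr (mem_biUnion (show u ∈ {u | _} from ⟨hu, hcu, hRu⟩) hxu)
  have hmeet : ∀ u ∈ K.faces, (K.space ∩ convexHull ℝ (u : Set E)).Nonempty := fun u hu => by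
    obtain ⟨y, hy⟩ := SimplicialComplex.nonempty_of_mem_faces hu
    have := subset_convexHull ℝ (u : Set E) hy
    exact ⟨y, SimplicialComplex.convexHull_subset_space hu this, this⟩
  obtain ⟨x, -, hxA, hxB⟩ := isPreconnected_closed_iff.1 hc A B hA hB hcov
    ((hmeet t ht).mono (inter_subset_inter_right _ (subset_biUnion_of_mem
      (u := fun u : Finset E => convexHull ℝ (u : Set E)) (show t ∈ {u | u ∈ K.faces ∧ u.card = k + 1 ∧ R u} from ⟨ht, hcard, .refl⟩))))
    ((hmeet t' ht').mono (inter_subset_inter_right _ (subset_biUnion_of_mem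
      (u := fun u : Finset E => convexHull ℝ (u : Set E)) (show t' ∈ {u | u ∈ K.faces ∧ u.card = k + 1 ∧ ¬ R u} from ⟨ht', hcard', hR⟩))))
  obtain ⟨u, ⟨hu, hcu, hRu⟩, hxu⟩ := mem_iUnion₂.1 hxA
  obtain ⟨w, ⟨hw, hcw, hRw⟩, hxw⟩ := mem_iUnion₂.1 hxB
  have hx := K.inter_subset_convexHull hu hw ⟨hxu, hxw⟩
  rw [← Finset.coe_inter] at hx
  have hne : (u ∩ w).Nonempty := by
    rw [← Finset.coe_nonempty]
    exact convexHull_nonempty_iff.1 ⟨x, hx⟩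
  have := h.conn (u ∩ w) (K.down_closed hu Finset.inter_subset_left hne) u hu w hw
    Finset.inter_subset_left Finset.inter_subset_right hcu hcw
  exact hRw (hRu.trans (ReflTransGen.mono (fun a b hab => ⟨hab.1, hab.2.2.1, hab.2.2.2⟩) _ _ this))

theorem erase_mem_link {v : E} {t : Finset E} (ht : t ∈ K.faces) (hv : v ∈ t)
    (hne : (t.erase v).Nonempty) : t.erase v ∈ (link K v).faces :=
  ⟨K.down_closed ht (Finset.erase_subset v t) hne, Finset.notMem_erase v t, by
    rwa [Finset.insert_erase hv]⟩

theorem isPreconnected_link {v : E} (h : PLHomeomorphic (link K v) (simplexBoundary 4)) :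
    IsPreconnected (link K v).space := by
  obtain ⟨e⟩ := h.nonempty_homeomorph
  obtain ⟨e'⟩ := nonempty_homeomorph_simplexBoundary 4
  have hs : IsPreconnected (Metric.sphere (0 : EuclideanSpace ℝ (Fin 4)) 1) :=
    isPreconnected_sphere (by
      rw [rank_eq_card_basis (EuclideanSpace.basisFun (Fin 4) ℝ).toBasis]
      simp) 0 1
  have := Subtype.preconnectedSpace hs
  rw [← Subtype.range_coe (s := (link K v).space), ← (e.trans e').symm.surjective.range_comp]
  exact isPreconnected_range (continuous_subtype_val.comp (e.trans e').symm.continuous)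

theorem nonempty_link {v : E} (h : PLHomeomorphic (link K v) (simplexBoundary 4)) :
    (link K v).faces.Nonempty := by
  obtain ⟨e⟩ := h.nonempty_homeomorph
  obtain ⟨e'⟩ := nonempty_homeomorph_simplexBoundary 4
  obtain ⟨s, hs, -⟩ := SimplicialComplex.mem_space_iff.1
    ((e.trans e').symm ⟨EuclideanSpace.single 0 1, by simp⟩).2
  exact ⟨s, hs⟩

theorem finite_link (hK : K.faces.Finite) (v : E) : (link K v).faces.Finite :=
  hK.subset fun _ hs => hs.1

/-- A closed combinatorial four-manifold is a normal pseudomanifold. -/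
theorem IsCombinatorialManifold.isNormal (hK : IsCombinatorialManifold 4 K) : IsNormal 4 K := by
  have hl : ∀ v ∈ K.vertices, IsNormal 3 (link K v) := fun v hv => (hK.2 v hv).isNormal
  have hvert : ∀ s ∈ K.faces, ∀ v ∈ s, v ∈ K.vertices := fun s hs v hv =>
    coe_subset_vertices hs hv
  have hlink : ∀ s ∈ K.faces, ∀ v ∈ s, ∀ t ∈ (link K v).faces, s.erase v ⊆ t →
      insert v t ∈ K.faces ∧ s ⊆ insert v t ∧ (insert v t).card = t.card + 1 :=
    fun s hs v hv t ht hst => ⟨ht.2.2, Finset.subset_insert_iff.2 hst, Finset.card_insert_of_notMem ht.2.1⟩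
  have hne : ∀ (s : Finset E) (v : E), v ∈ s → 2 ≤ s.card → (s.erase v).Nonempty :=
    fun s v hv hc => by
      rw [← Finset.card_pos, Finset.card_erase_of_mem hv]; omega
  refine ⟨fun s hs => ?_, fun s hs => ?_, fun s hs hc => ?_, ?_⟩
  · obtain ⟨v, hv⟩ := SimplicialComplex.nonempty_of_mem_faces hs
    by_cases h2 : 2 ≤ s.card
    · have := (hl v (hvert s hs v hv)).card_le _ (erase_mem_link hs hv (hne s v hv h2))
      rw [Finset.card_erase_of_mem hv] at this
      omega
    · omega
  · obtain ⟨v, hv⟩ := SimplicialComplex.nonempty_of_mem_faces hs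
    have hv' := hvert s hs v hv
    -- For s = {v} the simplex s \ v is empty and not a face of the link; any face of the non-empty
    -- link serves instead.
    obtain ⟨r, hr, hsr⟩ : ∃ r ∈ (link K v).faces, s.erase v ⊆ r := by
      by_cases h2 : (s.erase v).Nonempty
      · exact ⟨_, erase_mem_link hs hv h2, subset_rfl⟩
      · obtain ⟨r, hr⟩ := nonempty_link (hK.2 v hv')
        exact ⟨r, hr, by rw [Finset.not_nonempty_iff_eq_empty.1 h2]; exact Finset.empty_subset _⟩
    obtain ⟨t, ht, hrt, hct⟩ := (hl v hv').pure r hr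
    obtain ⟨h1, h2, h3⟩ := hlink s hs v hv t ht (hsr.trans hrt)
    exact ⟨_, h1, h2, by omega⟩
  · obtain ⟨v, hv⟩ := SimplicialComplex.nonempty_of_mem_faces hs
    obtain ⟨t₁, ht₁, t₂, ht₂, hs₁, hs₂, hc₁, hc₂, h12, h⟩ := (hl v (hvert s hs v hv)).panel _
      (erase_mem_link hs hv (hne s v hv (by omega))) (by rw [Finset.card_erase_of_mem hv]; omega)
    obtain ⟨a1, a2, a3⟩ := hlink s hs v hv t₁ ht₁ hs₁
    obtain ⟨b1, b2, b3⟩ := hlink s hs v hv t₂ ht₂ hs₂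
    refine ⟨_, a1, _, b1, a2, b2, by omega, by omega, fun he => h12 ?_, fun t ht hst hct => ?_⟩
    · rw [← Finset.erase_insert ht₁.2.1, he, Finset.erase_insert ht₂.2.1]
    · rcases h (t.erase v) (erase_mem_link ht (hst hv) (hne t v (hst hv) (by omega)))
        (Finset.erase_subset_erase v hst) (by rw [Finset.card_erase_of_mem (hst hv)]; omega)
        with e | e
      · left; rw [← e, Finset.insert_erase (hst hv)]
      · right; rw [← e, Finset.insert_erase (hst hv)]
  · intro s hs t ht t' ht' hst hst' hct hct'
    obtain ⟨v, hv⟩ := SimplicialComplex.nonempty_of_mem_faces hs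
    have hv' := hvert s hs v hv
    have e1 := erase_mem_link ht (hst hv) (hne t v (hst hv) (by omega))
    have e2 := erase_mem_link ht' (hst' hv) (hne t' v (hst' hv) (by omega))
    have c1 : (t.erase v).card = 3 + 1 := by rw [Finset.card_erase_of_mem (hst hv)]; omega
    have c2 : (t'.erase v).card = 3 + 1 := by rw [Finset.card_erase_of_mem (hst' hv)]; omega
    have hchain : ReflTransGen (fun u w => w ∈ (link K v).faces ∧ s.erase v ⊆ w ∧
        w.card = 3 + 1 ∧ 3 ≤ (u ∩ w).card) (t.erase v) (t'.erase v) := by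
      by_cases h2 : (s.erase v).Nonempty
      · exact (hl v hv').conn _ (erase_mem_link hs hv h2) _ e1 _ e2
          (Finset.erase_subset_erase v hst) (Finset.erase_subset_erase v hst') c1 c2
      -- For s = {v} the chain has to connect arbitrary facets of the link, which needs the
      -- connectedness of the 3-sphere.
      · rw [Finset.not_nonempty_iff_eq_empty.1 h2]
        exact ReflTransGen.mono (fun u w h => ⟨h.1, Finset.empty_subset _, h.2⟩) _ _
          ((hl v hv').exists_chain (finite_link hK.1 v) (isPreconnected_link (hK.2 v hv')) e1 e2
            c1 c2)
    have := ReflTransGen.lift (p := fun u w => w ∈ K.faces ∧ s ⊆ w ∧ w.card = 4 + 1 ∧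
      4 ≤ (u ∩ w).card) (fun u => insert v u) (fun u w h => ?_) _ _ hchain
    · simp only [Function.onFun] at this
      rwa [Finset.insert_erase (hst hv), Finset.insert_erase (hst' hv)] at this
    · obtain ⟨a1, a2, a3⟩ := hlink s hs v hv w h.1 h.2.1
      refine ⟨a1, a2, a3.trans (by rw [h.2.2.1]), ?_⟩
      rw [← Finset.insert_inter_distrib, Finset.card_insert_of_notMem fun hvm =>
        h.1.2.1 (Finset.mem_of_mem_inter_right hvm)]
      omega

end Manifold

/-! ### The facets of a balanced manifold as a chamber system. -/

section ColoredFacets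

open Classical Set Relation

variable {E : Type*} [NormedAddCommGroup E] [NormedSpace ℝ E] {Δ : SimplicialComplex ℝ E}

/-- The vertex of colour `i` of a facet. -/
noncomputable def colorVertex (κ : E → Fin 5) (F : Δ.facets) (i : Fin 5) : E :=
  if h : ∃ v ∈ F.1, κ v = i then h.choose else 0

variable (hN : IsNormal 4 Δ) {κ : E → Fin 5} (hκ : IsBalancedColoring Δ κ)

include hN in
theorem IsNormal.mem_facets_iff {t : Finset E} : t ∈ Δ.facets ↔ t ∈ Δ.faces ∧ t.card = 5 := by
  constructor
  · rintro ⟨ht, hmax⟩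
    obtain ⟨u, hu, htu, hc⟩ := hN.pure t ht
    obtain rfl := hmax hu htu
    exact ⟨ht, hc⟩
  · rintro ⟨ht, hc⟩
    exact ⟨ht, fun u hu htu => Finset.eq_of_subset_of_card_le htu (by
      have := hN.card_le u hu; omega)⟩

include hN hκ

theorem exists_mem_facet_color (F : Δ.facets) (i : Fin 5) : ∃ v ∈ F.1, κ v = i := by
  have hF := hN.mem_facets_iff.1 F.2
  have : F.1.image κ = Finset.univ := by
    rw [← Finset.card_eq_iff_eq_univ, Finset.card_image_of_injOn (hκ _ hF.1), hF.2]
    rfl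
  have hi : i ∈ F.1.image κ := by rw [this]; exact Finset.mem_univ i
  simpa using hi

theorem colorVertex_mem (F : Δ.facets) (i : Fin 5) : colorVertex κ F i ∈ F.1 := by
  have h := exists_mem_facet_color hN hκ F i
  rw [colorVertex, dif_pos h]
  exact h.choose_spec.1

theorem color_colorVertex (F : Δ.facets) (i : Fin 5) : κ (colorVertex κ F i) = i := by
  have h := exists_mem_facet_color hN hκ F i
  rw [colorVertex, dif_pos h]
  exact h.choose_spec.2

theorem colorVertex_color {F : Δ.facets} {v : E} (hv : v ∈ F.1) : colorVertex κ F (κ v) = v :=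
  hκ _ F.2.1 (colorVertex_mem hN hκ F _) hv (color_colorVertex hN hκ F _)

theorem colorVertex_eq_iff {F : Δ.facets} {v : E} {i : Fin 5} :
    colorVertex κ F i = v ↔ v ∈ F.1 ∧ κ v = i := by
  constructor
  · rintro rfl
    exact ⟨colorVertex_mem hN hκ F i, color_colorVertex hN hκ F i⟩
  · rintro ⟨hv, rfl⟩
    exact colorVertex_color hN hκ hv

theorem colorVertex_eq_iff_mem {F F' : Δ.facets} {i : Fin 5} :
    colorVertex κ F i = colorVertex κ F' i ↔ colorVertex κ F i ∈ F'.1 := by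
  rw [eq_comm, colorVertex_eq_iff hN hκ]
  exact and_iff_left (color_colorVertex hN hκ F i)

theorem colorVertex_injective : Function.Injective (colorVertex κ : Δ.facets → Fin 5 → E) := by
  have key : ∀ F F' : Δ.facets, colorVertex κ F = colorVertex κ F' → F.1 ⊆ F'.1 := by
    intro F F' h v hv
    rw [← colorVertex_color hN hκ hv, h]
    exact colorVertex_mem hN hκ F' _
  exact fun F F' h => Subtype.ext ((key F F' h).antisymm (key F' F h.symm))

theorem agreeOn_erase_of_card {F F' : Δ.facets} (hc : (F.1 ∩ F'.1).card = 4) :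
    ∃ i, AgreeOn (colorVertex κ) (Finset.univ.erase i) F F' ∧ colorVertex κ F i ∉ F'.1 := by
  have hF := hN.mem_facets_iff.1 F.2
  have h1 : (F.1 \ F'.1).card = 1 := by
    have := Finset.card_sdiff_add_card_inter F.1 F'.1
    omega
  obtain ⟨v, hv⟩ := Finset.card_eq_one.1 h1
  have hvm : v ∈ F.1 \ F'.1 := by rw [hv]; exact Finset.mem_singleton_self v
  refine ⟨κ v, fun j hj => (colorVertex_eq_iff_mem hN hκ).2 ?_, ?_⟩
  · by_contra hn
    have : colorVertex κ F j ∈ F.1 \ F'.1 :=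
      Finset.mem_sdiff.2 ⟨colorVertex_mem hN hκ F j, hn⟩
    rw [hv, Finset.mem_singleton] at this
    rw [← this, color_colorVertex hN hκ] at hj
    simp at hj
  · rw [colorVertex_color hN hκ (Finset.mem_sdiff.1 hvm).1]
    exact (Finset.mem_sdiff.1 hvm).2

theorem card_inter_of_agreeOn {F F' : Δ.facets} {i : Fin 5} (hne : F' ≠ F)
    (h : AgreeOn (colorVertex κ) (Finset.univ.erase i) F F') : (F.1 ∩ F'.1).card = 4 := by
  have hF := hN.mem_facets_iff.1 F.2
  have hF' := hN.mem_facets_iff.1 F'.2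
  have hle : 4 ≤ (F.1 ∩ F'.1).card := by
    have hsub : (Finset.univ.erase i).image (colorVertex κ F) ⊆ F.1 ∩ F'.1 := by
      intro v hv
      obtain ⟨j, hj, rfl⟩ := Finset.mem_image.1 hv
      exact Finset.mem_inter.2 ⟨colorVertex_mem hN hκ F j,
        (colorVertex_eq_iff_mem hN hκ).1 (h j hj)⟩
    have := Finset.card_le_card hsub
    rwa [Finset.card_image_of_injective _ (fun a b hab => by
      rw [← color_colorVertex hN hκ F a, hab, color_colorVertex hN hκ F b]),
      Finset.card_erase_of_mem (Finset.mem_univ i)] at this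
  refine le_antisymm ?_ hle
  by_contra! hlt
  have e1 := Finset.eq_of_subset_of_card_le (Finset.inter_subset_left (s₁ := F.1) (s₂ := F'.1))
    (by omega)
  have e2 := Finset.eq_of_subset_of_card_le (Finset.inter_subset_right (s₁ := F.1) (s₂ := F'.1))
    (by omega)
  exact hne (Subtype.ext (e2.symm.trans e1))

/-- The colour classes of a simplex of a facet are the simplices of the complex. -/
theorem image_colorVertex_mem {F : Δ.facets} {S : Finset (Fin 5)} (hS : S.Nonempty) :
    S.image (colorVertex κ F) ∈ Δ.faces :=
  Δ.down_closed F.2.1 (fun v hv => by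
    obtain ⟨j, -, rfl⟩ := Finset.mem_image.1 hv
    exact colorVertex_mem hN hκ F j) (hS.image _)

theorem image_colorVertex_eq {F : Δ.facets} {s : Finset E} (hs : s ⊆ F.1) :
    (s.image κ).image (colorVertex κ F) = s := by
  rw [Finset.image_image]
  refine (Finset.image_congr fun v hv => ?_).trans Finset.image_id
  exact colorVertex_color hN hκ (hs hv)

/-- The facets of a balanced connected combinatorial manifold form a chamber system. -/
theorem isChamberSystem_colorVertex (hfin : Δ.faces.Finite) (hc : IsPreconnected Δ.space) :
    IsChamberSystem (colorVertex κ : Δ.facets → Fin 5 → E) := by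
  refine ⟨fun F F' i j h => ?_, colorVertex_injective hN hκ, fun F i => ?_, fun S F F' h => ?_⟩
  · rw [← color_colorVertex hN hκ F i, h, color_colorVertex hN hκ]
  · set s := (Finset.univ.erase i).image (colorVertex κ F) with hs
    have hinj : Function.Injective (colorVertex κ F) := fun a b hab => by
      rw [← color_colorVertex hN hκ F a, hab, color_colorVertex hN hκ F b]
    have hsF : s ∈ Δ.faces := image_colorVertex_mem hN hκ
      (by rw [← Finset.card_pos, Finset.card_erase_of_mem (Finset.mem_univ i)]; simp)
    have hsc : s.card = 4 := by
      rw [hs, Finset.card_image_of_injective _ hinj, Finset.card_erase_of_mem (Finset.mem_univ i)]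
      rfl
    have hagree : ∀ G : Δ.facets, AgreeOn (colorVertex κ) (Finset.univ.erase i) F G ↔
        s ⊆ G.1 := by
      intro G
      constructor
      · intro hG v hv
        obtain ⟨j, hj, rfl⟩ := Finset.mem_image.1 hv
        exact (colorVertex_eq_iff_mem hN hκ).1 (hG j hj)
      · exact fun hG j hj => (colorVertex_eq_iff_mem hN hκ).2
          (hG (Finset.mem_image_of_mem _ hj))
    obtain ⟨t₁, h₁, t₂, h₂, hs₁, hs₂, hc₁, hc₂, h12, hall⟩ := hN.panel s hsF hsc
    have hF := hN.mem_facets_iff.1 F.2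
    have key : ∀ t t' : Finset E, t' ∈ Δ.faces → s ⊆ t' → t'.card = 4 + 1 → t ≠ t' →
        (∀ u ∈ Δ.faces, s ⊆ u → u.card = 4 + 1 → u = t ∨ u = t') → F.1 = t →
        ∃! F', F' ≠ F ∧ AgreeOn (colorVertex κ) (Finset.univ.erase i) F F' := by
      intro t t' ht' hst' hct' hne hall hFt
      refine ⟨⟨t', hN.mem_facets_iff.2 ⟨ht', hct'⟩⟩, ⟨fun e => hne ?_, (hagree _).2 hst'⟩,
        fun G hG => Subtype.ext ?_⟩
      · rw [← hFt, ← e]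
      · have hG' := hN.mem_facets_iff.1 G.2
        rcases hall G.1 hG'.1 ((hagree G).1 hG.2) hG'.2 with e | e
        · exact absurd (Subtype.ext (e.trans hFt.symm)) hG.1
        · exact e
    rcases hall F.1 hF.1 ((hagree F).1 fun _ _ => rfl) hF.2 with e | e
    · exact key t₁ t₂ h₂ hs₂ hc₂ h12 hall e
    · exact key t₂ t₁ h₁ hs₁ hc₁ h12.symm (fun u a b c => (hall u a b c).symm) e
  · have hF := hN.mem_facets_iff.1 F.2
    have hF' := hN.mem_facets_iff.1 F'.2
    have hchain : ReflTransGen (fun u w : Finset E => w ∈ Δ.faces ∧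
        S.image (colorVertex κ F) ⊆ w ∧ w.card = 4 + 1 ∧ 4 ≤ (u ∩ w).card) F.1 F'.1 := by
      by_cases hS : S.Nonempty
      · refine hN.conn _ (image_colorVertex_mem hN hκ hS) _ hF.1 _ hF'.1 ?_ ?_ hF.2 hF'.2
        · intro v hv
          obtain ⟨j, hj, rfl⟩ := Finset.mem_image.1 hv
          exact colorVertex_mem hN hκ F j
        · intro v hv
          obtain ⟨j, hj, rfl⟩ := Finset.mem_image.1 hv
          exact (colorVertex_eq_iff_mem hN hκ).1 (h j hj)
      -- With no prescribed colours the chain comes from the connectedness of the whole space.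
      · rw [Finset.not_nonempty_iff_eq_empty.1 hS, Finset.image_empty]
        exact ReflTransGen.mono (fun u w h => ⟨h.1, Finset.empty_subset _, h.2⟩) _ _
          (hN.exists_chain hfin hc hF.1 hF'.1 hF.2 hF'.2)
    have gen : ∀ w : Finset E, ReflTransGen (fun u w : Finset E => w ∈ Δ.faces ∧
        S.image (colorVertex κ F) ⊆ w ∧ w.card = 4 + 1 ∧ 4 ≤ (u ∩ w).card) F.1 w →
        ∃ hw : w ∈ Δ.facets, ReflTransGen (fun A B => ∃ i ∉ S,
          AgreeOn (colorVertex κ) (Finset.univ.erase i) A B) F ⟨w, hw⟩ ∧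
          S.image (colorVertex κ F) ⊆ w := by
      intro w hw
      induction hw with
      | refl =>
        refine ⟨F.2, .refl, fun v hv => ?_⟩
        obtain ⟨j, -, rfl⟩ := Finset.mem_image.1 hv
        exact colorVertex_mem hN hκ F j
      | @tail u w _ huw ih =>
        obtain ⟨hu, ih, hSu⟩ := ih
        have hw := hN.mem_facets_iff.2 ⟨huw.1, huw.2.2.1⟩
        refine ⟨hw, ?_, huw.2.1⟩
        by_cases he : u = w
        · subst he; exact ih
        have hu' := hN.mem_facets_iff.1 hu
        have hc4 : (u ∩ w).card = 4 := by
          refine le_antisymm ?_ huw.2.2.2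
          by_contra! hlt
          refine he (Finset.eq_of_subset_of_card_le (Finset.inter_eq_left.1
            (Finset.eq_of_subset_of_card_le Finset.inter_subset_left (by omega))) ?_)
          rw [hu'.2, huw.2.2.1]
        obtain ⟨i, hi, hiw⟩ := agreeOn_erase_of_card hN hκ (F := ⟨u, hu⟩) (F' := ⟨w, hw⟩) hc4
        -- The crossed wall cannot have a colour in S, since the vertices with colours in S belong
        -- to all facets of the chain.
        refine ih.tail ⟨i, fun hiS => hiw ?_, hi⟩
        have h2 : colorVertex κ ⟨u, hu⟩ i = colorVertex κ F i := (colorVertex_eq_iff hN hκ).2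
          ⟨hSu (Finset.mem_image_of_mem _ hiS), color_colorVertex hN hκ F i⟩
        rw [h2]
        exact huw.2.1 (Finset.mem_image_of_mem _ hiS)
    exact (gen _ hchain).2.1

end ColoredFacets

/-- Crossing the wall of colour i changes exactly the vertex of colour i. This makes the dual graph
5-regular. -/
theorem IsChamberSystem.cross_injective {Φ V : Type*} {vx : Φ → Fin 5 → V}
    (h : IsChamberSystem vx) (F : Φ) : Function.Injective (h.cross F) := by
  intro i j hij
  by_contra hne
  exact h.vx_cross_ne F i (by rw [hij]; exact h.vx_cross hne)

/-! ### Counting faces by colours; the genus formula. -/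

section Counting

open Classical Set Relation

variable {E : Type*} [NormedAddCommGroup E] [NormedSpace ℝ E] {Δ : SimplicialComplex ℝ E}
  (hN : IsNormal 4 Δ) {κ : E → Fin 5} (hκ : IsBalancedColoring Δ κ) (hfin : Δ.faces.Finite)

include hN in
theorem IsNormal.exists_facet {s : Finset E} (hs : s ∈ Δ.faces) : ∃ F : Δ.facets, s ⊆ F.1 := by
  obtain ⟨t, ht, hst, hc⟩ := hN.pure s hs
  exact ⟨⟨t, hN.mem_facets_iff.2 ⟨ht, hc⟩⟩, hst⟩

include hκ in
theorem card_image_color {s : Finset E} (hs : s ∈ Δ.faces) : (s.image κ).card = s.card :=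
  Finset.card_image_of_injOn (hκ s hs)

include hN hκ

/-- A simplex is determined by the vertices of its colours, and by purity each simplex with colour
set S extends to a facet. S has to be non-empty because the empty simplex is not a face. -/
theorem faceCount_colorVertex {S : Finset (Fin 5)} (hS : S.Nonempty) :
    faceCount (colorVertex κ : Δ.facets → Fin 5 → E) S =
      (hfin.toFinset.filter fun s => s.image κ = S).card := by
  rw [faceCount, Nat.card_coe_set_eq, ← Set.ncard_coe_finset]
  have himg : ∀ F : Δ.facets, Finset.univ.image (fun i : S => colorVertex κ F i) =
      S.image (colorVertex κ F) := fun F => by ext v; simp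
  have hb : BijOn (fun g : S → E => Finset.univ.image g)
      (range fun (F : Δ.facets) (i : S) => colorVertex κ F i)
      (hfin.toFinset.filter fun s => s.image κ = S : Finset (Finset E)) := by
    refine ⟨?_, ?_, ?_⟩
    · rintro _ ⟨F, rfl⟩
      dsimp only
      rw [himg, Finset.mem_coe, Finset.mem_filter, Finite.mem_toFinset]
      refine ⟨image_colorVertex_mem hN hκ hS, ?_⟩
      rw [Finset.image_image]
      refine (Finset.image_congr fun i _ => ?_).trans Finset.image_id
      exact color_colorVertex hN hκ F i
    · rintro _ ⟨F, rfl⟩ _ ⟨F', rfl⟩ h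
      dsimp only at h
      rw [himg, himg] at h
      refine agreeOn_iff.1 fun i hi => (colorVertex_eq_iff_mem hN hκ).2 ?_
      have : colorVertex κ F i ∈ S.image (colorVertex κ F') := by
        rw [← h]; exact Finset.mem_image_of_mem _ hi
      obtain ⟨j, -, hj⟩ := Finset.mem_image.1 this
      rw [← hj]
      exact colorVertex_mem hN hκ F' j
    · intro s hs
      rw [Finset.mem_coe, Finset.mem_filter, Finite.mem_toFinset] at hs
      obtain ⟨F, hF⟩ := hN.exists_facet hs.1
      refine ⟨_, ⟨F, rfl⟩, ?_⟩
      dsimp only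
      rw [himg, ← hs.2, image_colorVertex_eq hN hκ hF]
  rw [← hb.image_eq, hb.injOn.ncard_image]

/-- Sums over the simplices of functions of the colour set. -/
theorem sum_faces_eq (P : Finset (Fin 5) → Prop) (g : Finset (Fin 5) → ℤ) :
    ∑ s ∈ hfin.toFinset.filter (fun s => P (s.image κ)), g (s.image κ) =
      ∑ S ∈ Finset.univ.filter (fun S : Finset (Fin 5) => S.Nonempty ∧ P S),
        g S * (faceCount (colorVertex κ : Δ.facets → Fin 5 → E) S : ℤ) := by
  rw [← Finset.sum_fiberwise_of_maps_to (g := fun s : Finset E => s.image κ)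
    (t := Finset.univ.filter (fun S : Finset (Fin 5) => S.Nonempty ∧ P S))]
  · refine Finset.sum_congr rfl fun S hS => ?_
    rw [Finset.mem_filter] at hS
    rw [faceCount_colorVertex hN hκ hfin hS.2.1, Finset.sum_congr rfl (g := fun _ => g S)
      fun s hs => by rw [(Finset.mem_filter.1 hs).2], Finset.sum_const, nsmul_eq_mul, mul_comm,
      Finset.filter_filter]
    congr 3
    refine Finset.filter_congr fun s _ => ⟨fun h => h.2, fun h => ⟨h ▸ hS.2.2, h⟩⟩
  · intro s hs
    rw [Finset.mem_filter, Finite.mem_toFinset] at hs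
    exact Finset.mem_filter.2 ⟨Finset.mem_univ _,
      (SimplicialComplex.nonempty_of_mem_faces hs.1).image κ, hs.2⟩

include hfin in
theorem eulerChar_eq_sum_faceCount : eulerChar Δ =
    ∑ S ∈ Finset.univ.filter (fun S : Finset (Fin 5) => S.Nonempty),
      (-1) ^ (S.card - 1) * (faceCount (colorVertex κ : Δ.facets → Fin 5 → E) S : ℤ) := by
  have := sum_faces_eq hN hκ hfin (fun _ => True) (fun S => (-1) ^ (S.card - 1))
  simp only [and_true, Finset.filter_true] at this
  rw [← this, eulerChar_eq_sum hfin]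
  refine Finset.sum_congr rfl fun s hs => ?_
  rw [card_image_color hκ (hfin.mem_toFinset.1 hs)]

include hfin in
-- A simplex using the colour a has exactly one vertex v of that colour. Deleting v matches the
-- simplices with at least two vertices with the simplices of the links, where the exponent of the
-- sign drops by two. The sum is therefore the sum of the Euler characteristics of these links.
theorem vertexEuler_of_link (hl : ∀ v ∈ Δ.vertices, eulerChar (link Δ v) = 0) (a : Fin 5) :
    VertexEuler (fun S => (faceCount (colorVertex κ : Δ.facets → Fin 5 → E) S : ℤ)) a := by
  have h1 := sum_faces_eq hN hκ hfin (fun S => a ∈ S ∧ 2 ≤ S.card) (fun S => (-1) ^ S.card)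
  refine ((Finset.sum_congr ?_ fun _ _ => rfl).trans h1.symm).trans ?_
  · ext S
    simp only [Finset.mem_filter, Finset.mem_univ, true_and]
    exact ⟨fun h => ⟨⟨a, h.1⟩, h⟩, fun h => h.2⟩
  set T := hfin.toFinset.filter (fun s => a ∈ s.image κ ∧ 2 ≤ (s.image κ).card) with hT
  set W := (finite_vertices hfin).toFinset.filter fun v => κ v = a with hW
  have hone : ∀ s ∈ T, ∑ v ∈ W, (if v ∈ s then (1 : ℤ) else 0) = 1 := by
    intro s hs
    rw [hT, Finset.mem_filter, Finite.mem_toFinset] at hs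
    obtain ⟨u, hu, hua⟩ := Finset.mem_image.1 hs.2.1
    rw [Finset.sum_eq_single u]
    · rw [if_pos hu]
    · intro v hv hvu
      refine if_neg fun hvs => hvu (hκ s hs.1 hvs hu ?_)
      rw [(Finset.mem_filter.1 hv).2, hua]
    · intro hn
      rw [hW, Finset.mem_filter, Finite.mem_toFinset] at hn
      exact absurd ⟨coe_subset_vertices hs.1 hu, hua⟩ hn
  have h3 : ∑ s ∈ T, (-1 : ℤ) ^ (s.image κ).card =
      ∑ v ∈ W, ∑ s ∈ T, if v ∈ s then (-1 : ℤ) ^ s.card else 0 := by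
    rw [Finset.sum_comm]
    refine Finset.sum_congr rfl fun s hs => ?_
    rw [card_image_color hκ (hfin.mem_toFinset.1 (Finset.mem_filter.1 hs).1)]
    refine (mul_one ((-1 : ℤ) ^ s.card)).symm.trans ?_
    rw [← hone s hs, Finset.mul_sum]
    exact Finset.sum_congr rfl fun v _ => by
      split_ifs
      · exact mul_one _
      · exact mul_zero _
  refine (Finset.sum_congr (by ext s; simp [hT]) fun _ _ => rfl).trans (h3.trans ?_)
  refine Finset.sum_eq_zero fun v hv => ?_
  rw [hW, Finset.mem_filter, Finite.mem_toFinset] at hv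
  have h4 := hl v hv.1
  rw [eulerChar_eq_sum (finite_link hfin v)] at h4
  rw [← Finset.sum_filter]
  refine Eq.trans ?_ h4
  refine Finset.sum_bij' (fun s _ => s.erase v) (fun s _ => insert v s) ?_ ?_ ?_ ?_ ?_
  · intro s hs
    rw [Finset.mem_filter, hT, Finset.mem_filter, Finite.mem_toFinset] at hs
    rw [Finite.mem_toFinset]
    refine erase_mem_link hs.1.1 hs.2 ?_
    rw [← Finset.card_pos, Finset.card_erase_of_mem hs.2,
      ← card_image_color hκ hs.1.1]
    omega
  · intro s hs
    rw [Finite.mem_toFinset] at hs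
    rw [Finset.mem_filter, hT, Finset.mem_filter, Finite.mem_toFinset]
    refine ⟨⟨hs.2.2, ?_, ?_⟩, Finset.mem_insert_self v s⟩
    · rw [← hv.2]; exact Finset.mem_image_of_mem κ (Finset.mem_insert_self v s)
    · rw [card_image_color hκ hs.2.2, Finset.card_insert_of_notMem hs.2.1]
      have := (SimplicialComplex.nonempty_of_mem_faces hs.1).card_pos
      omega
  · exact fun s hs => Finset.insert_erase (Finset.mem_filter.1 hs).2
  · exact fun s hs => Finset.erase_insert ((Finite.mem_toFinset _).1 hs).2.1
  · intro s hs
    rw [Finset.mem_filter, hT, Finset.mem_filter, Finite.mem_toFinset] at hs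
    have h5 := card_image_color hκ hs.1.1
    have h6 := hs.1.2.2
    rw [h5] at h6
    rw [Finset.card_erase_of_mem hs.2]
    obtain ⟨m, hm⟩ := Nat.exists_eq_add_of_le h6
    rw [hm, show 2 + m - 1 - 1 = m by omega, pow_add]
    norm_num

variable (hS : IsChamberSystem (colorVertex κ : Δ.facets → Fin 5 → E))

include hS

theorem dualGraph_adj_iff {F F' : Δ.facets} :
    (dualGraph 4 Δ).Adj F F' ↔ ∃ i, F' = hS.cross F i := by
  constructor
  · rintro ⟨hne, hc⟩
    obtain ⟨i, hi, -⟩ := agreeOn_erase_of_card hN hκ hc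
    exact ⟨i, hS.eq_cross hne.symm hi⟩
  · rintro ⟨i, rfl⟩
    exact ⟨(hS.cross_ne F i).symm,
      card_inter_of_agreeOn hN hκ (hS.cross_ne F i) (hS.agreeOn_cross F i)⟩

include hfin in
theorem two_mul_card_edgeSet :
    2 * Nat.card (dualGraph 4 Δ).edgeSet = 5 * Nat.card Δ.facets := by
  have : Finite Δ.facets := (hfin.subset fun _ h => h.1).to_subtype
  have := Fintype.ofFinite Δ.facets
  have hdeg : ∀ F : Δ.facets, (dualGraph 4 Δ).degree F = 5 := by
    intro F
    have : (dualGraph 4 Δ).neighborFinset F = Finset.univ.image (hS.cross F) := by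
      ext F'
      rw [SimpleGraph.mem_neighborFinset, dualGraph_adj_iff hN hκ hS]
      simp [eq_comm]
    rw [← SimpleGraph.card_neighborFinset_eq_degree, this,
      Finset.card_image_of_injective _ (hS.cross_injective F)]
    rfl
  have h := (dualGraph 4 Δ).sum_degrees_eq_twice_card_edges
  simp only [hdeg, Finset.sum_const, smul_eq_mul] at h
  rw [Nat.card_eq_fintype_card, Nat.card_eq_fintype_card, ← SimpleGraph.edgeFinset_card, ← h,
    Finset.card_univ, mul_comm]

theorem edgeHasColor_cross {F : Δ.facets} {i c : Fin 5} :
    EdgeHasColor κ F (hS.cross F i) c ↔ c = i := by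
  have : (F.1 ∩ (hS.cross F i).1).image κ = Finset.univ.erase i := by
    ext j
    simp only [Finset.mem_image, Finset.mem_inter, Finset.mem_erase, Finset.mem_univ, and_true]
    constructor
    · rintro ⟨v, ⟨h1, h2⟩, rfl⟩ he
      refine hS.vx_cross_ne F i ?_
      rw [(colorVertex_eq_iff hN hκ).2 ⟨h1, he⟩, (colorVertex_eq_iff hN hκ).2 ⟨h2, he⟩]
    · intro hj
      refine ⟨colorVertex κ F j, ⟨colorVertex_mem hN hκ F j, ?_⟩, color_colorVertex hN hκ F j⟩
      rw [← hS.vx_cross hj]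
      exact colorVertex_mem hN hκ _ j
  rw [EdgeHasColor]
  constructor
  · intro h
    by_contra hc
    have h1 : c ∈ Finset.univ.erase i := Finset.mem_erase.2 ⟨hc, Finset.mem_univ _⟩
    rw [← this] at h1
    have h2 : c ∈ Finset.univ.erase c := by rw [← h]; convert h1
    simp at h2
  · rintro rfl
    convert this

theorem bicoloredGraph_adj_iff {F F' : Δ.facets} {i j : Fin 5} :
    (bicoloredGraph Δ κ i j).Adj F F' ↔ F' = hS.cross F i ∨ F' = hS.cross F j := by
  constructor
  · rintro ⟨hadj, hc⟩
    obtain ⟨c, rfl⟩ := (dualGraph_adj_iff hN hκ hS).1 hadj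
    rcases hc with hc | hc
    · left; rw [(edgeHasColor_cross hN hκ hS).1 hc]
    · right; rw [(edgeHasColor_cross hN hκ hS).1 hc]
  · rintro (rfl | rfl)
    · exact ⟨(dualGraph_adj_iff hN hκ hS).2 ⟨i, rfl⟩,
        .inl ((edgeHasColor_cross hN hκ hS).2 rfl)⟩
    · exact ⟨(dualGraph_adj_iff hN hκ hS).2 ⟨j, rfl⟩,
        .inr ((edgeHasColor_cross hN hκ hS).2 rfl)⟩

/-- Crossings of the colours i and j keep the other three vertices; conversely, strong connectivity
of the star of their triangle joins all facets containing it. So a bi-coloured cycle is the same as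
a triangle. -/
theorem reachable_bicolored_iff {F F' : Δ.facets} {i j : Fin 5} :
    (bicoloredGraph Δ κ i j).Reachable F F' ↔
      AgreeOn (colorVertex κ) ((Finset.univ.erase i).erase j) F F' := by
  constructor
  · rintro ⟨p⟩
    induction p with
    | nil => exact fun _ _ => rfl
    | cons h _ ih =>
      refine AgreeOn.trans ?_ ih
      rcases (bicoloredGraph_adj_iff hN hκ hS).1 h with rfl | rfl
      · exact hS.agreeOn_cross_of_notMem (by simp) _
      · exact hS.agreeOn_cross_of_notMem (by simp) _
  · intro h
    have := hS.conn _ F F' h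
    induction this with
    | refl => exact SimpleGraph.Reachable.refl _
    | @tail A B _ hAB ih =>
      obtain ⟨c, hc, hAB⟩ := hAB
      have hstep : AgreeOn (colorVertex κ) ((Finset.univ.erase i).erase j) A B :=
        hAB.mono (Finset.subset_erase.2 ⟨Finset.subset_univ _, hc⟩)
      refine (ih (h.trans hstep.symm)).trans ?_
      rcases hS.eq_or_eq_cross hAB with rfl | rfl
      · exact SimpleGraph.Reachable.refl _
      · refine SimpleGraph.Adj.reachable ((bicoloredGraph_adj_iff hN hκ hS).2 ?_)
        simp only [Finset.mem_erase, Finset.mem_univ, and_true, not_and_or, not_not] at hc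
        rcases hc with rfl | rfl
        · exact .inr rfl
        · exact .inl rfl

theorem card_bicolored_components (i j : Fin 5) :
    Nat.card (bicoloredGraph Δ κ i j).ConnectedComponent =
      faceCount (colorVertex κ : Δ.facets → Fin 5 → E) ((Finset.univ.erase i).erase j) := by
  set S : Finset (Fin 5) := (Finset.univ.erase i).erase j
  let φ : Δ.facets → S → E := fun F c => colorVertex κ F c
  let f : (bicoloredGraph Δ κ i j).ConnectedComponent → range φ :=
    Quot.lift (fun F => ⟨φ F, F, rfl⟩) fun F F' h =>
      Subtype.ext (agreeOn_iff.1 ((reachable_bicolored_iff hN hκ hS).1 h))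
  refine Nat.card_congr (Equiv.ofBijective f ⟨?_, ?_⟩)
  · intro c c'
    refine c.ind fun F => c'.ind fun F' h => ?_
    exact SimpleGraph.ConnectedComponent.sound ((reachable_bicolored_iff hN hκ hS).2
      (agreeOn_iff.2 (congrArg Subtype.val h)))
  · rintro ⟨_, F, rfl⟩
    exact ⟨(bicoloredGraph Δ κ i j).connectedComponentMk F, rfl⟩

include hfin in
/-- The genus with respect to the standard cyclic order of the colours. -/
theorem epsilonGenus_one (hl : ∀ v ∈ Δ.vertices, eulerChar (link Δ v) = 0) :
    epsilonGenus Δ κ 1 = 1 + 2 * (eulerChar Δ : ℝ) + ∑ k : Fin 5,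
      ((faceCount (colorVertex κ : Δ.facets → Fin 5 → E) {k, k + 2} : ℝ) -
        2 * faceCount (colorVertex κ : Δ.facets → Fin 5 → E) {k}) := by
  have : Finite Δ.facets := (hfin.subset fun _ h => h.1).to_subtype
  have h := surface_formula (N := Nat.card Δ.facets)
    (f := fun S => (faceCount (colorVertex κ : Δ.facets → Fin 5 → E) S : ℤ)) (vertexEuler_of_link hN hκ hfin hl)
    (fun a b i j k hnd => by exact_mod_cast hS.link_inequality hnd)
    (fun k => by exact_mod_cast hS.two_mul_faceCount_erase k)
    (by exact_mod_cast hS.faceCount_univ)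
  rw [← eulerChar_eq_sum_faceCount hN hκ hfin] at h
  -- With 2E = 5N, where E and N count the edges and vertices of the dual graph, the left side of
  -- the surface formula is 2χ(F_ε), and ρ = 1 - χ(F_ε)/2 is read off.
  have h2 := two_mul_card_edgeSet hN hκ hfin hS
  rw [epsilonGenus, surfaceEulerChar]
  simp only [Equiv.Perm.coe_one, id_eq, card_bicolored_components hN hκ hS]
  rw [Finset.sum_sub_distrib, ← Finset.mul_sum]
  have h' : (2 * (Nat.card Δ.facets : ℝ) - 5 * Nat.card Δ.facets + 2 * ∑ k : Fin 5,
      (faceCount (colorVertex κ : Δ.facets → Fin 5 → E) ((Finset.univ.erase k).erase (k + 1)) : ℝ)) =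
      -8 * eulerChar Δ + 8 * ∑ k : Fin 5, (faceCount (colorVertex κ : Δ.facets → Fin 5 → E) {k} : ℝ)
      - 4 * ∑ k : Fin 5, (faceCount (colorVertex κ : Δ.facets → Fin 5 → E) {k, k + 2} : ℝ) := by
    exact_mod_cast h
  have h2' : 2 * (Nat.card (dualGraph 4 Δ).edgeSet : ℝ) = 5 * Nat.card Δ.facets := by
    exact_mod_cast h2
  push_cast
  linarith

end Counting

/-! ### Reduction to the standard cyclic order. -/

section Permutation

open Classical

variable {E : Type*} [AddCommGroup E] [Module ℝ E] {Δ : SimplicialComplex ℝ E}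

/-- Renaming the colours by the inverse of ε makes ε k into k and changes neither the dual graph nor
its bi-coloured components. -/
theorem epsilonGenus_comp (κ : E → Fin 5) (ε : Equiv.Perm (Fin 5)) :
    epsilonGenus Δ κ ε = epsilonGenus Δ (ε.symm ∘ κ) 1 := by
  have hc : ∀ (σ τ : Δ.facets) c, EdgeHasColor κ σ τ (ε c) ↔ EdgeHasColor (ε.symm ∘ κ) σ τ c := by
    intro σ τ c
    rw [EdgeHasColor, EdgeHasColor, ← Finset.image_image]
    have : (Finset.univ.erase (ε c)).image ε.symm = Finset.univ.erase c := by
      ext j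
      simp only [Finset.mem_image, Finset.mem_erase, Finset.mem_univ, and_true]
      constructor
      · rintro ⟨i, hi, rfl⟩ he
        exact hi (by rw [← he, Equiv.apply_symm_apply])
      · exact fun hj => ⟨ε j, fun he => hj (ε.injective he), ε.symm_apply_apply j⟩
    constructor
    · intro h
      rw [h, ← this]
    · intro h
      rw [← this] at h
      exact Finset.image_injective ε.symm.injective h
  have hg : ∀ i j, bicoloredGraph Δ κ (ε i) (ε j) = bicoloredGraph Δ (ε.symm ∘ κ) i j := by
    intro i j
    ext σ τ
    exact and_congr_right fun _ => or_congr (hc σ τ i) (hc σ τ j)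
  simp only [epsilonGenus, surfaceEulerChar, hg, Equiv.Perm.coe_one, id_eq]

theorem IsBalancedColoring.comp {κ : E → Fin 5} (h : IsBalancedColoring Δ κ)
    (ε : Equiv.Perm (Fin 5)) : IsBalancedColoring Δ (ε ∘ κ) := fun s hs =>
  ε.injective.comp_injOn (h s hs)

end Permutation

/-! ### Holonomy in graphs with group-valued edges. -/

section Voltage

open Classical

variable {V ℰ Q : Type*} [Group Q]

/-- `Hol src tgt g H u v q`: some walk from `u` to `v` along the edges in `H`, traversed in either
direction, has holonomy `q`. -/
inductive Hol (src tgt : ℰ → V) (g : ℰ → Q) (H : Set ℰ) : V → V → Q → Prop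
  | nil (v : V) : Hol src tgt g H v v 1
  | fwd {e : ℰ} {w : V} {q : Q} (he : e ∈ H) (h : Hol src tgt g H (tgt e) w q) :
      Hol src tgt g H (src e) w (g e * q)
  | bwd {e : ℰ} {w : V} {q : Q} (he : e ∈ H) (h : Hol src tgt g H (src e) w q) :
      Hol src tgt g H (tgt e) w ((g e)⁻¹ * q)

variable {src tgt : ℰ → V} {g : ℰ → Q} {H H' : Set ℰ} {u v w : V} {q r : Q}

namespace Hol

theorem trans (h : Hol src tgt g H u v q) (h' : Hol src tgt g H v w r) :
    Hol src tgt g H u w (q * r) := by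
  induction h with
  | nil => simpa using h'
  | fwd he _ ih => rw [mul_assoc]; exact .fwd he (ih h')
  | bwd he _ ih => rw [mul_assoc]; exact .bwd he (ih h')

theorem edge {e : ℰ} (he : e ∈ H) : Hol src tgt g H (src e) (tgt e) (g e) := by
  simpa using Hol.fwd (g := g) he (Hol.nil (tgt e))

theorem edge_symm {e : ℰ} (he : e ∈ H) : Hol src tgt g H (tgt e) (src e) (g e)⁻¹ := by
  simpa using Hol.bwd (g := g) he (Hol.nil (src e))

theorem symm (h : Hol src tgt g H u v q) : Hol src tgt g H v u q⁻¹ := by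
  induction h with
  | nil => simpa using Hol.nil _
  | fwd he _ ih => rw [mul_inv_rev]; exact ih.trans (edge_symm he)
  | bwd he _ ih => rw [mul_inv_rev, inv_inv]; exact ih.trans (edge he)

/-- Edges can be replaced by walks with the same holonomy. -/
theorem replace (hH : ∀ e ∈ H, Hol src tgt g H' (src e) (tgt e) (g e))
    (h : Hol src tgt g H u v q) : Hol src tgt g H' u v q := by
  induction h with
  | nil => exact .nil _
  | fwd he _ ih => exact (hH _ he).trans ih
  | bwd he _ ih => exact (hH _ he).symm.trans ih

theorem mono (hH : H ⊆ H') (h : Hol src tgt g H u v q) : Hol src tgt g H' u v q :=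
  h.replace fun _ he => edge (hH he)

end Hol

theorem Hol.exists_exit {W : Set V} (h : Hol src tgt g H u v q) (hu : u ∈ W) (hv : v ∉ W) :
    ∃ e ∈ H, src e ∈ W ∧ tgt e ∉ W ∨ tgt e ∈ W ∧ src e ∉ W := by
  induction h with
  | nil => exact absurd hu hv
  | @fwd e _ _ he _ ih =>
    by_cases h : tgt e ∈ W
    · exact ih h hv
    · exact ⟨e, he, .inl ⟨hu, h⟩⟩
  | @bwd e _ _ he _ ih =>
    by_cases h : src e ∈ W
    · exact ih h hv
    · exact ⟨e, he, .inr ⟨hu, h⟩⟩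

/-- A tree T with k edges is grown from b together with a potential r that trivializes g on it. As
long as some vertex of W₀ is missing, a walk to it leaves W along an edge that can be added. The
tree need not lie in W₀; only its size matters. -/
theorem Hol.exists_potential {b : V} {W₀ : Finset V}
    (hb : ∀ v ∈ W₀, ∃ q, Hol src tgt g H b v q) (k : ℕ) (hk : k + 1 ≤ W₀.card) :
    ∃ W : Finset V, W.card = k + 1 ∧ b ∈ W ∧ ∃ r : V → Q, r b = 1 ∧ ∃ T : Finset ℰ, ↑T ⊆ H ∧
      T.card = k ∧ ∀ e ∈ T, src e ∈ W ∧ tgt e ∈ W ∧ r (src e) * g e = r (tgt e) := by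
  induction k with
  | zero => exact ⟨{b}, rfl, Finset.mem_singleton_self b, 1, rfl, ∅, by simp, rfl, by simp⟩
  | succ k ih =>
    obtain ⟨W, hW, hbW, r, hr, T, hT, hTc, hTe⟩ := ih (by omega)
    obtain ⟨v, hv, hvW⟩ : ∃ v ∈ W₀, v ∉ W := by
      by_contra! hcon
      have := Finset.card_le_card (show W₀ ⊆ W from hcon)
      omega
    obtain ⟨q, hq⟩ := hb v hv
    obtain ⟨e, heH, he⟩ := hq.exists_exit (W := W) (by exact_mod_cast hbW) (by exact_mod_cast hvW)
    simp only [Finset.mem_coe] at he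
    obtain ⟨x, hxW, y, hxy⟩ : ∃ x, x ∉ W ∧ ∃ y : Q, (src e ∈ W ∧ tgt e = x ∧ r (src e) * g e = y) ∨
        (tgt e ∈ W ∧ src e = x ∧ y * g e = r (tgt e)) := by
      rcases he with he | he
      · exact ⟨_, he.2, _, .inl ⟨he.1, rfl, rfl⟩⟩
      · exact ⟨_, he.2, r (tgt e) * (g e)⁻¹, .inr ⟨he.1, rfl, by simp⟩⟩
    have heT : e ∉ T := fun h => by
      obtain ⟨h1, h2, -⟩ := hTe e h
      rcases hxy with ⟨-, rfl, -⟩ | ⟨-, rfl, -⟩ <;> contradiction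
    have hupd : ∀ z ∈ W, Function.update r x y z = r z := fun z hz =>
      Function.update_of_ne (by rintro rfl; exact hxW hz) _ _
    refine ⟨insert x W, by rw [Finset.card_insert_of_notMem hxW, hW],
      Finset.mem_insert_of_mem hbW, Function.update r x y, by rw [hupd b hbW, hr], insert e T,
      ?_, by rw [Finset.card_insert_of_notMem heT, hTc], fun e' he' => ?_⟩
    · rw [Finset.coe_insert]
      exact Set.insert_subset heH hT
    · rcases Finset.mem_insert.1 he' with rfl | he'
      · rcases hxy with ⟨h1, rfl, h3⟩ | ⟨h1, rfl, h3⟩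
        · exact ⟨Finset.mem_insert_of_mem h1, Finset.mem_insert_self _ _, by
            rw [hupd _ h1, h3, Function.update_self]⟩
        · exact ⟨Finset.mem_insert_self _ _, Finset.mem_insert_of_mem h1, by
            rw [hupd _ h1, ← h3, Function.update_self]⟩
      · obtain ⟨h1, h2, h3⟩ := hTe e' he'
        exact ⟨Finset.mem_insert_of_mem h1, Finset.mem_insert_of_mem h2, by
          rw [hupd _ h1, hupd _ h2, h3]⟩

/-- A group which is the holonomy group of a finite graph is generated by as many elements as
there are edges outside of a spanning tree. -/
theorem rank_add_card_le (H : Finset ℰ) {b : V} {W₀ : Finset V} (hne : W₀.Nonempty)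
    (hb : ∀ v ∈ W₀, ∃ q, Hol src tgt g (H : Set ℰ) b v q)
    (hfull : ∀ q, Hol src tgt g (H : Set ℰ) b b q) :
    ∃ _ : Group.FG Q, Group.rank Q + W₀.card ≤ H.card + 1 := by
  obtain ⟨k, hk⟩ := Nat.exists_eq_add_of_lt hne.card_pos
  rw [zero_add] at hk
  obtain ⟨W, -, -, r, hr, T, hT, hTc, hTe⟩ := Hol.exists_potential hb k hk.ge
  -- After the change of gauge by r the tree edges carry the identity, so every holonomy at b, where
  -- r = 1, is a word in the values on the remaining edges.
  let S : Finset Q := (H \ T).image fun e => r (src e) * g e * (r (tgt e))⁻¹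
  have hgen : ∀ e ∈ H, r (src e) * g e * (r (tgt e))⁻¹ ∈ Subgroup.closure (S : Set Q) := by
    intro e he
    by_cases heT : e ∈ T
    · rw [(hTe e heT).2.2, mul_inv_cancel]
      exact one_mem _
    · exact Subgroup.subset_closure (Finset.mem_coe.2 (Finset.mem_image_of_mem _
        (Finset.mem_sdiff.2 ⟨he, heT⟩)))
  have key : ∀ u v q, Hol src tgt g (H : Set ℰ) u v q →
      r u * q * (r v)⁻¹ ∈ Subgroup.closure (S : Set Q) := by
    intro u v q h
    induction h with
    | nil => simp
    | @fwd e w q he _ ih =>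
      have := mul_mem (hgen e he) ih
      simpa [mul_assoc] using this
    | @bwd e w q he _ ih =>
      have := mul_mem (inv_mem (hgen e he)) ih
      simpa [mul_assoc] using this
  have htop : Subgroup.closure (S : Set Q) = ⊤ := by
    rw [eq_top_iff]
    intro q _
    simpa [hr] using key b b q (hfull q)
  have hFG : Group.FG Q := Group.fg_iff.2 ⟨S, htop, S.finite_toSet⟩
  refine ⟨hFG, ?_⟩
  have h1 := Group.rank_le htop
  have h2 : S.card ≤ (H \ T).card := Finset.card_image_le
  have h3 := Finset.card_sdiff_add_card_eq_card (s := T) (t := H) (by exact_mod_cast hT)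
  omega

end Voltage

/-! ### The fundamental group from a good open cover. -/

section Nerve

open Classical Set CategoryTheory

variable {X : Type*} [TopologicalSpace X] {V : Type*} {U : V → Set X}

/-- The homotopy class of a path, as an arrow in the fundamental groupoid. -/
noncomputable def pathArrow {y y' : X} (γ : Path y y') :
    FundamentalGroupoid.mk y ⟶ FundamentalGroupoid.mk y' := Path.Homotopic.Quotient.mk γ

/-- Path components are unions of members of the cover, hence open and closed. -/
theorem pathConnectedSpace_of_cover [ConnectedSpace X] (ho : ∀ v, IsOpen (U v))
    (hc : ∀ y, ∃ v, y ∈ U v) (hs : ∀ v, IsPathConnected (U v)) : PathConnectedSpace X := by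
  have hcl : ∀ x : X, IsClopen (pathComponent x) := by
    intro x
    constructor
    · rw [← isOpen_compl_iff, isOpen_iff_mem_nhds]
      intro y hy
      obtain ⟨v, hv⟩ := hc y
      refine Filter.mem_of_superset ((ho v).mem_nhds hv) fun w hw hwx => hy ?_
      exact mem_pathComponent_iff.2 ((mem_pathComponent_iff.1 hwx).trans
        ((hs v).joinedIn w hw y hv).joined)
    · rw [isOpen_iff_mem_nhds]
      intro y hy
      obtain ⟨v, hv⟩ := hc y
      refine Filter.mem_of_superset ((ho v).mem_nhds hv) fun w hw => ?_
      exact mem_pathComponent_iff.2 ((mem_pathComponent_iff.1 hy).trans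
        ((hs v).joinedIn y hv w hw).joined)
  refine ⟨inferInstance, fun x y => ?_⟩
  have : y ∈ pathComponent x := by
    rw [(hcl x).eq_univ ⟨x, mem_pathComponent_self x⟩]; trivial
  exact mem_pathComponent_iff.1 this

/-- Each set of a cover by simply connected sets carries paths from the base point, compatible
with the paths inside of the set. -/
theorem exists_arrows [PathConnectedSpace X] (hs : ∀ v, SimplyConnectedSpace (U v)) (x : X) :
    ∃ α : ∀ (_ : V) (y : X), FundamentalGroupoid.mk x ⟶ FundamentalGroupoid.mk y,
      ∀ v, ∀ y y' (γ : Path y y'), (∀ t, γ t ∈ U v) → α v y ≫ pathArrow γ = α v y' := by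
  have hne : ∀ v, Nonempty (U v) := fun v => inferInstance
  let c : ∀ v, U v := fun v => (hne v).some
  let i : ∀ v, C(U v, X) := fun v => ⟨Subtype.val, continuous_subtype_val⟩
  -- Go from x to a fixed centre of U v and then inside U v to y; simple connectivity makes the
  -- second part canonical. For y outside U v the value is an arbitrary path that plays no role.
  refine ⟨fun v y => if hy : y ∈ U v then
    pathArrow (PathConnectedSpace.somePath x (c v)) ≫
      pathArrow ((PathConnectedSpace.somePath (c v) ⟨y, hy⟩).map (i v).continuous)
    else pathArrow (PathConnectedSpace.somePath x y), fun v y y' γ hγ => ?_⟩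
  have hy : y ∈ U v := by simpa using hγ 0
  have hy' : y' ∈ U v := by simpa using hγ 1
  simp only [dif_pos hy, dif_pos hy', Category.assoc]
  congr 1
  let γ' : Path (⟨y, hy⟩ : U v) ⟨y', hy'⟩ :=
    { toFun := fun t => ⟨γ t, hγ t⟩
      continuous_toFun := γ.continuous.subtype_mk _
      source' := Subtype.ext γ.source
      target' := Subtype.ext γ.target }
  have h1 := (SimplyConnectedSpace.paths_homotopic
    ((PathConnectedSpace.somePath (c v) ⟨y, hy⟩).trans γ')
    (PathConnectedSpace.somePath (c v) ⟨y', hy'⟩)).map (i v)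
  have h2 := Path.Homotopic.Quotient.eq.2 h1
  refine Eq.trans ?_ h2
  rw [Path.map_trans]
  rfl

/-- The fundamental group in terms of a good cover: it is the holonomy group of a cocycle on the
nerve. -/
theorem exists_cocycle_of_cover [ConnectedSpace X] (ho : ∀ v, IsOpen (U v))
    (hc : ∀ y, ∃ v, y ∈ U v) (hs : ∀ v, SimplyConnectedSpace (U v))
    (hi : ∀ u v, (U u ∩ U v).Nonempty → IsPathConnected (U u ∩ U v)) (x : X) :
    ∃ g : V → V → FundamentalGroup X x,
      (∀ u v w, (U u ∩ U v ∩ U w).Nonempty → g u v * g v w = g u w) ∧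
      ∃ b, ∀ q, Hol Prod.fst Prod.snd (fun e : V × V => g e.1 e.2)
        {e | (U e.1 ∩ U e.2).Nonempty} b b q := by
  have hpc : PathConnectedSpace X := pathConnectedSpace_of_cover ho hc fun v =>
    isPathConnected_iff_pathConnectedSpace.2 inferInstance
  obtain ⟨α, hα⟩ := exists_arrows hs x
  let y : V → V → X := fun u v => if h : (U u ∩ U v).Nonempty then h.some else x
  -- Transition from the arrows of U u to those of U v. The product of the fundamental group
  -- composes arrows in the opposite order, which is why α v comes first.
  let g : V → V → FundamentalGroup X x := fun u v => α v (y u v) ≫ Groupoid.inv (α u (y u v))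
  -- The chosen point does not matter, because the intersection is path connected and both families
  -- of arrows are compatible with paths inside it.
  have hg : ∀ u v z, z ∈ U u ∩ U v → g u v = α v z ≫ Groupoid.inv (α u z) := by
    intro u v z hz
    have hne : (U u ∩ U v).Nonempty := ⟨z, hz⟩
    have hy : y u v ∈ U u ∩ U v := by
      simp only [y, dif_pos hne]; exact hne.some_mem
    obtain ⟨γ, hγ⟩ := (hi u v hne).joinedIn _ hy z hz
    have h1 := hα u _ _ γ fun t => (hγ t).1
    have h2 := hα v _ _ γ fun t => (hγ t).2
    rw [← h1, ← h2]
    simp only [g, Groupoid.inv_eq_inv, IsIso.inv_comp, Category.assoc, IsIso.hom_inv_id_assoc]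
  have hcoc : ∀ u v w, (U u ∩ U v ∩ U w).Nonempty → g u v * g v w = g u w := by
    rintro u v w ⟨z, ⟨hu, hv⟩, hw⟩
    rw [hg u v z ⟨hu, hv⟩, hg v w z ⟨hv, hw⟩, hg u w z ⟨hu, hw⟩]
    change (α w z ≫ Groupoid.inv (α v z)) ≫ (α v z ≫ Groupoid.inv (α u z)) = _
    simp
  obtain ⟨b, hb⟩ := hc x
  refine ⟨g, hcoc, b, ?_⟩
  set H : Set (V × V) := {e | (U e.1 ∩ U e.2).Nonempty}
  have loop : ∀ γ : Path x x, ∃ q : FundamentalGroup X x,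
      Hol Prod.fst Prod.snd (fun e : V × V => g e.1 e.2) H b b q ∧
      α b x ≫ pathArrow γ = q⁻¹ ≫ α b x := by
    intro γ
    -- Lebesgue subdivision: each piece of the loop lies in one member of the cover, and passing to
    -- the next member multiplies the holonomy by one value of g.
    obtain ⟨t, ht0, htm, ⟨n, hn⟩, hcov⟩ := exists_monotone_Icc_subset_open_cover_unitInterval
      (c := fun v => γ ⁻¹' U v) (fun v => (ho v).preimage γ.continuous)
      (fun s _ => mem_iUnion.2 (hc (γ s)))
    have hx0 : γ (t 0) = x := by rw [ht0, γ.source]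
    have step : ∀ m, ∃ (v : V) (q : FundamentalGroup X x), γ (t m) ∈ U v ∧
        Hol Prod.fst Prod.snd (fun e : V × V => g e.1 e.2) H b v q ∧
        α b (γ (t 0)) ≫ pathArrow (γ.subpath (t 0) (t m)) = q⁻¹ ≫ α v (γ (t m)) := by
      intro m
      induction m with
      | zero =>
        refine ⟨b, 1, by rw [hx0]; exact hb, .nil b, ?_⟩
        rw [inv_one, Path.subpath_self]
        change _ ≫ 𝟙 _ = 𝟙 _ ≫ _
        simp
      | succ m ih =>
        obtain ⟨v, q, hv, hH, he⟩ := ih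
        obtain ⟨w, hw⟩ := hcov m
        have hwm : γ (t m) ∈ U w := hw ⟨le_rfl, htm (Nat.le_succ m)⟩
        refine ⟨w, q * g v w, hw ⟨htm (Nat.le_succ m), le_rfl⟩,
          hH.trans (Hol.edge (src := Prod.fst) (tgt := Prod.snd)
            (g := fun e : V × V => g e.1 e.2) (e := (v, w)) ⟨_, hv, hwm⟩), ?_⟩
        have h1 : pathArrow (γ.subpath (t 0) (t m)) ≫ pathArrow (γ.subpath (t m) (t (m + 1))) =
            pathArrow (γ.subpath (t 0) (t (m + 1))) :=
          Path.Homotopic.Quotient.eq.2 ⟨Path.Homotopy.subpathTransSubpath γ _ _ _⟩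
        have h2 := hα w _ _ (γ.subpath (t m) (t (m + 1))) fun s => by
          have : γ.subpath (t m) (t (m + 1)) s ∈ range (γ.subpath (t m) (t (m + 1))) :=
            mem_range_self s
          rw [Path.range_subpath_of_le _ _ _ (htm (Nat.le_succ m))] at this
          obtain ⟨r, hr, hre⟩ := this
          rw [← hre]
          exact hw hr
        have h3 : (q * g v w)⁻¹ = (g v w)⁻¹ * q⁻¹ := mul_inv_rev _ _
        rw [← h1, ← Category.assoc, he, ← h2, h3, hg v w _ ⟨hv, hwm⟩]
        change _ = (q⁻¹ ≫ Groupoid.inv (α w (γ (t m)) ≫ Groupoid.inv (α v (γ (t m))))) ≫ _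
        simp
    obtain ⟨v, q, hv, hH, he⟩ := step n
    rw [ht0, hn n le_rfl, Path.subpath_zero_one] at he
    rw [hn n le_rfl, γ.target] at hv
    have hcast : ∀ {y y' : X} (h : y = x) (h' : y' = x),
        α b y ≫ pathArrow (γ.cast h h') = q⁻¹ ≫ α v y' →
        α b x ≫ pathArrow γ = q⁻¹ ≫ α v x := by
      rintro _ _ rfl rfl h
      exact h
    refine ⟨q * g v b, hH.trans (Hol.edge (src := Prod.fst) (tgt := Prod.snd)
      (g := fun e : V × V => g e.1 e.2) (e := (v, b)) ⟨_, hv, hb⟩), ?_⟩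
    have h3 : (q * g v b)⁻¹ = (g v b)⁻¹ * q⁻¹ := mul_inv_rev _ _
    rw [hcast _ _ he, h3, hg v b x ⟨hv, hb⟩]
    change _ = (q⁻¹ ≫ Groupoid.inv (α b x ≫ Groupoid.inv (α v x))) ≫ _
    simp
  intro q
  -- To realize q, take a loop that represents the conjugate of q⁻¹ by the arrow from x to itself
  -- belonging to b.
  obtain ⟨γ, hγ⟩ := Path.Homotopic.Quotient.mk_surjective
    (Groupoid.inv (α b x) ≫ (q⁻¹ : FundamentalGroup X x) ≫ α b x : _ ⟶ _)
  obtain ⟨q', hq', he⟩ := loop γ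
  have h1 : α b x ≫ (Groupoid.inv (α b x) ≫ (q⁻¹ : FundamentalGroup X x) ≫ α b x) =
      (q'⁻¹ : FundamentalGroup X x) ≫ α b x := by
    rw [← he]
    exact congrArg (fun z => α b x ≫ z) hγ.symm
  have h2 : (q⁻¹ : FundamentalGroup X x) = q'⁻¹ := by
    have h3 : (q⁻¹ : FundamentalGroup X x) ≫ α b x = (q'⁻¹ : FundamentalGroup X x) ≫ α b x := by
      rw [← h1]; simp
    exact (cancel_mono (α b x)).1 h3
  rwa [inv_injective h2]

end Nerve

/-! ### Open vertex stars form a good cover. -/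

section OpenStars

open Classical Set

variable {V : Type*} [Fintype V] {E : Type*} [NormedAddCommGroup E] [NormedSpace ℝ E]
  {K : SimplicialComplex ℝ E}

/-- The centre is the barycentre of A. Mixing it with z does not enlarge the support, which contains
A already. -/
theorem starConvex_openStars {𝓕 : Set (Set V)} {A : Finset V} (hA : A.Nonempty) :
    StarConvex ℝ (fun v => if v ∈ A then (A.card : ℝ)⁻¹ else 0)
      {z | z ∈ geomReal 𝓕 ∧ ∀ v ∈ A, 0 < z v} := by
  rintro z ⟨⟨hz, s, hs, hzs⟩, hzA⟩ a b ha hb hab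
  have hpos : (0 : ℝ) < A.card := by exact_mod_cast hA.card_pos
  have hm : (fun v => if v ∈ A then (A.card : ℝ)⁻¹ else 0) ∈ stdSimplex ℝ V := by
    refine ⟨fun v => by dsimp only; split_ifs <;> positivity, ?_⟩
    rw [Finset.sum_ite_mem, Finset.univ_inter, Finset.sum_const, nsmul_eq_mul,
      mul_inv_cancel₀ hpos.ne']
  refine ⟨⟨convex_stdSimplex ℝ V hm hz ha hb hab, s, hs, fun v hv => ?_⟩, fun v hv => ?_⟩
  · have : v ∉ A := fun h => (hzA v h).ne' (hzs v hv)
    simp [this, hzs v hv]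
  · have h1 := hzA v hv
    simp only [Pi.add_apply, Pi.smul_apply, if_pos hv, smul_eq_mul]
    rcases ha.eq_or_lt with rfl | ha
    · obtain rfl : b = 1 := by linarith
      simpa using h1
    · have := mul_nonneg hb h1.le
      have := mul_pos ha (inv_pos.2 hpos)
      linarith

theorem contractibleSpace_openStars {𝓕 : Set (Set V)} {M : Type*} [TopologicalSpace M]
    (h : geomReal 𝓕 ≃ₜ M) {A : Finset V} (hA : A.Nonempty)
    (hne : {y | ∀ v ∈ A, 0 < (h.symm y).1 v}.Nonempty) :
    ContractibleSpace {y | ∀ v ∈ A, 0 < (h.symm y).1 v} := by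
  let W : Set (V → ℝ) := {z | z ∈ geomReal 𝓕 ∧ ∀ v ∈ A, 0 < z v}
  have hW : ContractibleSpace W := (starConvex_openStars hA).contractibleSpace (by
    obtain ⟨y, hy⟩ := hne
    exact ⟨(h.symm y).1, (h.symm y).2, hy⟩)
  let e : W ≃ₜ {y | ∀ v ∈ A, 0 < (h.symm y).1 v} :=
    { toFun := fun z => ⟨h ⟨z.1, z.2.1⟩, by simpa using z.2.2⟩
      invFun := fun y => ⟨(h.symm y.1).1, (h.symm y.1).2, y.2⟩
      left_inv := fun z => by simp
      right_inv := fun y => by simp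
      continuous_toFun := by
        refine Continuous.subtype_mk (h.continuous.comp ?_) _
        exact continuous_subtype_val.subtype_mk fun z : W => z.2.1
      continuous_invFun := by
        refine Continuous.subtype_mk (continuous_subtype_val.comp ?_) _
        exact h.symm.continuous.comp continuous_subtype_val }
  exact e.contractibleSpace_iff.1 hW

/-- The fundamental group of a triangulated space is the holonomy group of a cocycle on the edges
of the triangulation. -/
theorem exists_cocycle (hK : K.faces.Finite) {M : Type*} [TopologicalSpace M] [ConnectedSpace M]
    (e : K.space ≃ₜ M) (x : M) :
    ∃ g : K.vertices → K.vertices → FundamentalGroup M x,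
      (∀ t ∈ K.faces, ∀ u v w : K.vertices, ↑u ∈ t → ↑v ∈ t → ↑w ∈ t → g u v * g v w = g u w) ∧
      ∃ b, ∀ q, Hol Prod.fst Prod.snd (fun e : K.vertices × K.vertices => g e.1 e.2)
        {e | ∃ t ∈ K.faces, ↑e.1 ∈ t ∧ ↑e.2 ∈ t} b b q := by
  have := (finite_vertices hK).fintype
  obtain ⟨e₀, -⟩ := nonempty_homeomorph_geomReal (K := K) (ι := ((↑) : K.vertices → E))
    Subtype.val_injective (by simp)
  let h := e₀.trans e
  let U : K.vertices → Set M := fun v => {y | 0 < (h.symm y).1 v}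
  have hcon : ∀ A : Finset K.vertices, A.Nonempty →
      {y | ∀ v ∈ A, 0 < (h.symm y).1 v}.Nonempty →
      ContractibleSpace {y | ∀ v ∈ A, 0 < (h.symm y).1 v} :=
    fun A hA hne => contractibleSpace_openStars h hA hne
  have hbary : ∀ t ∈ K.faces, ∃ y, ∀ v : K.vertices, ↑v ∈ t → y ∈ U v := by
    intro t ht
    let A : Finset K.vertices := Finset.univ.filter fun v => ↑v ∈ t
    have hA : A.Nonempty := by
      obtain ⟨v, hv⟩ := SimplicialComplex.nonempty_of_mem_faces ht
      exact ⟨⟨v, coe_subset_vertices ht hv⟩, by simpa [A] using hv⟩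
    have hpos : (0 : ℝ) < A.card := by exact_mod_cast hA.card_pos
    have hz : (fun v => if v ∈ A then (A.card : ℝ)⁻¹ else 0) ∈
        geomReal (labelledFaces K ((↑) : K.vertices → E)) := by
      refine ⟨⟨fun v => by dsimp only; split_ifs <;> positivity, ?_⟩, {v | v ∈ A},
        ⟨t, ht, fun v hv => by simpa [A] using hv⟩, fun v hv => if_neg hv⟩
      rw [Finset.sum_ite_mem, Finset.univ_inter, Finset.sum_const, nsmul_eq_mul,
        mul_inv_cancel₀ hpos.ne']
    refine ⟨h ⟨_, hz⟩, fun v hv => ?_⟩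
    have hvA : v ∈ A := by simpa [A] using hv
    simp only [U, mem_ofPred_eq, Homeomorph.symm_apply_apply, if_pos hvA]
    positivity
  have hvert : ∀ v : K.vertices, (U v).Nonempty := by
    intro v
    obtain ⟨y, hy⟩ := hbary {↑v} v.2
    exact ⟨y, hy v (Finset.mem_singleton_self _)⟩
  obtain ⟨g, hg, b, hb⟩ := exists_cocycle_of_cover (U := U)
    (fun v => isOpen_lt continuous_const ((continuous_apply v).comp
      (continuous_subtype_val.comp h.symm.continuous)))
    (fun y => by
      by_contra! hy
      have h0 : ∀ v, (h.symm y).1 v ≤ 0 := fun v => not_lt.1 (hy v)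
      have h1 := (h.symm y).2.1.2
      have h2 := Finset.sum_nonpos fun v (_ : v ∈ Finset.univ) => h0 v
      linarith)
    (fun v => by
      have h1 : U v = {y | ∀ u ∈ ({v} : Finset K.vertices), 0 < (h.symm y).1 u} := by
        ext y; simp [U]
      have := hcon {v} (Finset.singleton_nonempty v) (h1 ▸ hvert v)
      rw [h1]
      infer_instance)
    (fun u v hne => by
      have h1 : U u ∩ U v = {y | ∀ w ∈ ({u, v} : Finset K.vertices), 0 < (h.symm y).1 w} := by
        ext y; simp [U]
      have := hcon {u, v} (Finset.insert_nonempty u {v}) (h1 ▸ hne)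
      rw [h1]
      exact isPathConnected_iff_pathConnectedSpace.2 inferInstance) x
  refine ⟨g, fun t ht u v w hu hv hw => hg u v w ?_, b, fun q => (hb q).mono ?_⟩
  · obtain ⟨y, hy⟩ := hbary t ht
    exact ⟨y, ⟨hy u hu, hy v hv⟩, hy w hw⟩
  · rintro ⟨u, v⟩ ⟨y, hu, hv⟩
    obtain ⟨-, s, ⟨t, ht, hst⟩, hs⟩ := (h.symm y).2
    refine ⟨t, ht, hst u ?_, hst v ?_⟩
    · by_contra hn
      exact (ne_of_gt hu) (hs u hn)
    · by_contra hn
      exact (ne_of_gt hv) (hs v hn)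

/-- Only finiteness is wanted here, so all pairs of vertices serve as edges and a single vertex as
W₀. -/
theorem fundamentalGroup_fg (hK : K.faces.Finite) {M : Type*} [TopologicalSpace M]
    [ConnectedSpace M] (e : K.space ≃ₜ M) (x : M) : Group.FG (FundamentalGroup M x) := by
  obtain ⟨g, -, b, hb⟩ := exists_cocycle hK e x
  have := (finite_vertices hK).fintype
  obtain ⟨h, -⟩ := rank_add_card_le (H := Finset.univ) (Finset.singleton_nonempty b)
    (fun v hv => ⟨1, by rw [Finset.mem_singleton.1 hv]; exact .nil b⟩)
    (fun q => (hb q).mono fun _ _ => Finset.mem_coe.2 (Finset.mem_univ _))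
  exact h

end OpenStars

/-! ### The graph of the edges with two colours carries the whole fundamental group. -/

section EdgeGraph

open Classical Set Relation

variable {Φ V : Type*} {vx : Φ → Fin 5 → V} {a b : Fin 5}

/-- The edge of the facet `F` with colours `a` and `b`. -/
def colorEdge (vx : Φ → Fin 5 → V) (a b : Fin 5) (F : Φ) : V × V := (vx F a, vx F b)

/-- The edges with colours `a`, `b` in the link of the triangle of the other vertices of `F`. -/
def linkEdges (vx : Φ → Fin 5 → V) (a b : Fin 5) (F : Φ) : Set (V × V) :=
  {e | ∃ F', AgreeOn vx ((Finset.univ.erase a).erase b) F F' ∧ colorEdge vx a b F' = e}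

theorem linkEdges_subset_range (F : Φ) : linkEdges vx a b F ⊆ range (colorEdge vx a b) := by
  rintro _ ⟨F', -, rfl⟩
  exact ⟨F', rfl⟩

theorem colorEdge_mem_linkEdges (F : Φ) : colorEdge vx a b F ∈ linkEdges vx a b F :=
  ⟨F, fun _ _ => rfl, rfl⟩

theorem linkEdges_eq {F F' : Φ} (h : AgreeOn vx ((Finset.univ.erase a).erase b) F F') :
    linkEdges vx a b F = linkEdges vx a b F' := by
  ext e
  exact ⟨fun ⟨G, hG, he⟩ => ⟨G, h.symm.trans hG, he⟩, fun ⟨G, hG, he⟩ => ⟨G, h.trans hG, he⟩⟩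

theorem even_card_of_involution {α : Type*} (A : Finset α) (f : α → α)
    (h1 : ∀ x ∈ A, f x ∈ A) (h2 : ∀ x ∈ A, f (f x) = x) (h3 : ∀ x ∈ A, f x ≠ x) :
    Even A.card := by
  have : ∑ _x ∈ A, (1 : ZMod 2) = 0 :=
    Finset.sum_involution (fun x _ => f x) (fun _ _ => CharTwo.add_self_eq_zero 1)
      (fun x hx _ => h3 x hx) (fun x hx => h1 x hx) (fun x hx => h2 x hx)
  rw [Finset.sum_const, nsmul_eq_mul, mul_one] at this
  exact (ZMod.natCast_eq_zero_iff_even).1 this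

namespace IsChamberSystem

variable (h : IsChamberSystem vx)
include h

theorem eq_of_agreeOn {F F' : Φ} (hR : AgreeOn vx ((Finset.univ.erase a).erase b) F F')
    (he : colorEdge vx a b F = colorEdge vx a b F') : F = F' := by
  refine h.inj (funext fun i => ?_)
  by_cases ha : i = a
  · subst ha; exact congrArg Prod.fst he
  by_cases hb : i = b
  · subst hb; exact congrArg Prod.snd he
  exact hR i (by simp [ha, hb])

theorem agreeOn_cross_left (F : Φ) :
    AgreeOn vx ((Finset.univ.erase a).erase b) F (h.cross F a) :=
  h.agreeOn_cross_of_notMem (by simp) F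

theorem agreeOn_cross_right (F : Φ) :
    AgreeOn vx ((Finset.univ.erase a).erase b) F (h.cross F b) :=
  h.agreeOn_cross_of_notMem (by simp) F

variable {Q : Type*} [Group Q] {g : V → V → Q}
  (hg : ∀ F i j k, g (vx F i) (vx F j) * g (vx F j) (vx F k) = g (vx F i) (vx F k))

omit h in
include hg in
theorem cocycle_self (F : Φ) (i : Fin 5) : g (vx F i) (vx F i) = 1 := by
  simpa using hg F i i i

omit h in
include hg in
theorem cocycle_symm (F : Φ) (i j : Fin 5) : g (vx F j) (vx F i) = (g (vx F i) (vx F j))⁻¹ := by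
  rw [eq_inv_iff_mul_eq_one, hg, cocycle_self hg]

/-- Holonomy of walks along a set of edges, for the cocycle `g`. -/
abbrev _root_.BalancedGenus.EdgeHol {V Q : Type*} [Group Q] (g : V → V → Q) (H : Set (V × V)) :
    V → V → Q → Prop :=
  Hol Prod.fst Prod.snd (fun e : V × V => g e.1 e.2) H

omit h in
theorem edgeHol_colorEdge {H : Set (V × V)} {F : Φ} (hF : colorEdge vx a b F ∈ H) :
    EdgeHol g H (vx F a) (vx F b) (g (vx F a) (vx F b)) :=
  Hol.edge (src := Prod.fst) (tgt := Prod.snd) (g := fun e : V × V => g e.1 e.2) hF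

variable (hab : a ≠ b)

omit h in
include hg hab in
-- If i = a, walk through the common vertex of colour b; otherwise the vertex of colour a stays. By
-- the cocycle identity the holonomy is the same as that of a detour through any common vertex.
theorem edgeHol_step {A B : Φ} {i : Fin 5} (hAB : AgreeOn vx (Finset.univ.erase i) A B) :
    ∃ q, EdgeHol g (range (colorEdge vx a b)) (vx A a) (vx B a) q ∧
      ∀ c ≠ i, q = g (vx A a) (vx A c) * g (vx B c) (vx B a) := by
  by_cases hi : i = a
  · subst hi
    have hb : vx A b = vx B b := hAB b (by simp [hab.symm])
    have h1 : EdgeHol g (range (colorEdge vx i b)) (vx A i) (vx A b) _ :=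
      edgeHol_colorEdge (mem_range_self A)
    have h2 : EdgeHol g (range (colorEdge vx i b)) (vx B i) (vx B b) _ :=
      edgeHol_colorEdge (mem_range_self B)
    rw [hb] at h1
    refine ⟨_, h1.trans h2.symm, fun c hc => ?_⟩
    have hcv : vx A c = vx B c := hAB c (by simp [hc])
    rw [← hb, ← hg A i c b, mul_assoc, hb, hcv, ← cocycle_symm hg, hg B c b i]
  · have ha : vx A a = vx B a := hAB a (by simp [Ne.symm hi])
    refine ⟨1, ha ▸ .nil _, fun c hc => ?_⟩
    have hcv : vx A c = vx B c := hAB c (by simp [hc])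
    rw [ha, hcv, hg B a c a, cocycle_self hg]

include hg hab in
-- Walk through the star of the common vertex of colour c; the detours through this vertex
-- telescope.
theorem edgeHol_around {A B : Φ} {c : Fin 5} (hAB : AgreeOn vx {c} A B) :
    EdgeHol g (range (colorEdge vx a b)) (vx A a) (vx B a)
      (g (vx A a) (vx A c) * g (vx B c) (vx B a)) := by
  have := h.conn _ A B hAB
  induction this with
  | refl => rw [hg, cocycle_self hg]; exact .nil _
  | @tail B C _ hBC ih =>
    obtain ⟨i, hi, hBC⟩ := hBC
    have hci : c ≠ i := fun e => hi (by simp [e])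
    have hcv : vx B c = vx C c := hBC c (by simp [hci])
    obtain ⟨q, hq, hqc⟩ := edgeHol_step (a := a) hg hab hBC
    have := (ih (hAB.trans fun j hj => by
      rw [Finset.mem_singleton.1 hj]; exact hcv.symm)).trans hq
    rw [hqc c hci] at this
    convert this using 1
    rw [mul_assoc, ← mul_assoc (g (vx B c) (vx B a)), hg B c a c, cocycle_self hg, one_mul]

include hg hab in
theorem exists_edgeHol (A B : Φ) :
    ∃ q, EdgeHol g (range (colorEdge vx a b)) (vx A a) (vx B a) q := by
  have := h.conn ∅ A B fun _ hi => absurd hi (Finset.notMem_empty _)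
  induction this with
  | refl => exact ⟨1, .nil _⟩
  | tail _ hBC ih =>
    obtain ⟨i, -, hBC⟩ := hBC
    obtain ⟨q, hq⟩ := ih
    obtain ⟨r, hr, -⟩ := edgeHol_step (a := a) hg hab hBC
    exact ⟨_, hq.trans hr⟩

include hg hab in
-- A walk in the 1-skeleton is pushed into the graph by replacing each of its vertices with the
-- vertex of colour a of a facet containing it. `edgeHol_around` handles the change of facet at a
-- vertex.
theorem edgeHol_transport {u v : V} {q : Q}
    (hq : EdgeHol g {e | ∃ F i j, vx F i = e.1 ∧ vx F j = e.2} u v q) :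
    ∀ F i F' j, vx F i = u → vx F' j = v → EdgeHol g (range (colorEdge vx a b)) (vx F a)
      (vx F' a) (g (vx F a) u * q * g v (vx F' a)) := by
  have around : ∀ F i F' j, vx F i = vx F' j → EdgeHol g (range (colorEdge vx a b)) (vx F a)
      (vx F' a) (g (vx F a) (vx F i) * g (vx F' j) (vx F' a)) := by
    intro F i F' j he
    obtain rfl := h.color _ _ _ _ he
    exact h.edgeHol_around hg hab fun c hc => by rw [Finset.mem_singleton.1 hc]; exact he
  induction hq with
  | nil v =>
    intro F i F' j hu hv
    have := around F i F' j (hu.trans hv.symm)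
    rwa [hu, hv, ← mul_one (g (vx F a) v)] at this
  | @fwd e w q he hH ih =>
    obtain ⟨G, k, l, hk, hl⟩ := he
    intro F i F' j hu hv
    have := (around F i G k (hu.trans hk.symm)).trans (ih G l F' j hl hv)
    convert this using 1
    rw [hu, ← hl, ← hk, ← hg G k a l]
    simp only [mul_assoc]
  | @bwd e w q he hH ih =>
    obtain ⟨G, k, l, hk, hl⟩ := he
    intro F i F' j hu hv
    have := (around F i G l (hu.trans hl.symm)).trans (ih G k F' j hk hv)
    convert this using 1
    rw [hu, ← hl, ← hk, ← cocycle_symm hg, ← hg G l a k]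
    simp only [mul_assoc]

include hg hab in
/-- The fundamental group is the holonomy group of the graph of the edges with two given
colours. -/
theorem edgeHol_full (hV : ∀ v, ∃ F i, vx F i = v) {v₀ : V}
    (hfull : ∀ q, EdgeHol g {e | ∃ F i j, vx F i = e.1 ∧ vx F j = e.2} v₀ v₀ q) :
    ∃ F, ∀ q, EdgeHol g (range (colorEdge vx a b)) (vx F a) (vx F a) q := by
  obtain ⟨F, i, hF⟩ := hV v₀
  refine ⟨F, fun q => ?_⟩
  have := h.edgeHol_transport hg hab (hfull (g v₀ (vx F a) * q * g (vx F a) v₀)) F i F i hF hF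
  convert this using 1
  rw [← hF]
  simp only [mul_assoc, hg]
  rw [cocycle_self hg, mul_one, ← mul_assoc, hg, cocycle_self hg, one_mul]

omit h in
include hg in
/-- The holonomy along edges which are all joined to the vertex `r`. -/
theorem edgeHol_eq {H : Set (V × V)} {r : V} {c : Fin 5}
    (hH : ∀ e ∈ H, ∃ G, colorEdge vx a b G = e ∧ vx G c = r) {u v : V} {q : Q}
    (hq : EdgeHol g H u v q) (hu : ∃ i, ∃ F', vx F' i = u ∧ vx F' c = r) :
    q = g u r * g r v := by
  induction hq with
  | nil =>
    obtain ⟨i, F', rfl, rfl⟩ := hu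
    rw [hg, cocycle_self hg]
  | @fwd e w q he _ ih =>
    obtain ⟨G, rfl, rfl⟩ := hH e he
    rw [ih ⟨b, G, rfl, rfl⟩, ← mul_assoc]
    congr 1
    exact hg G a b c
  | @bwd e w q he _ ih =>
    obtain ⟨G, rfl, rfl⟩ := hH e he
    rw [ih ⟨a, G, rfl, rfl⟩, ← mul_assoc]
    congr 1
    change (g (vx G a) (vx G b))⁻¹ * g (vx G a) (vx G c) = _
    rw [← cocycle_symm hg, hg]
    rfl

include hab in
-- In a graph whose vertices all have degree two no edge is a bridge, which is seen by parity.
theorem exists_edgeHol_sdiff [Finite Φ] (F : Φ) : ∃ q, EdgeHol g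
    (linkEdges vx a b F \ {colorEdge vx a b F}) (vx F a) (vx F b) q := by
  have := Fintype.ofFinite Φ
  have hmem : ∀ {X}, X ≠ F → AgreeOn vx ((Finset.univ.erase a).erase b) F X →
      colorEdge vx a b X ∈ linkEdges vx a b F \ {colorEdge vx a b F} := fun hne hX =>
    ⟨⟨_, hX, rfl⟩, fun he => hne (h.eq_of_agreeOn hX.symm he)⟩
  have hba : h.cross F a ≠ h.cross F b := fun e => h.vx_cross_ne F a (by rw [e, h.vx_cross hab])
  set r : Φ → Φ → Prop := fun X Y => (Y = h.cross X a ∨ Y = h.cross X b) ∧ Y ≠ F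
  let A : Finset Φ := Finset.univ.filter fun X => ReflTransGen r (h.cross F a) X
  have hA : ∀ X, X ∈ A ↔ ReflTransGen r (h.cross F a) X := fun X => by simp [A]
  have hAF : F ∉ A := by
    intro hF
    rcases ReflTransGen.cases_tail ((hA F).1 hF) with e | ⟨_, -, e⟩
    · exact h.cross_ne F a e.symm
    · exact e.2 rfl
  have haA : h.cross F a ∈ A := (hA _).2 .refl
  -- Otherwise crossing b would be a fixed-point-free involution of A, and crossing a one of A
  -- without `h.cross F a`, whose partner F is excluded. Then both A and A minus one element would
  -- have even size.
  have hbA : h.cross F b ∈ A := by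
    by_contra hb
    have h1 : Even A.card := by
      refine even_card_of_involution A (fun X => h.cross X b) (fun X hX => ?_)
        (fun X _ => h.cross_cross X b) (fun X _ => h.cross_ne X b)
      refine (hA _).2 (((hA X).1 hX).tail ⟨.inr rfl, fun e => hb ?_⟩)
      rwa [← e, h.cross_cross]
    have h2 : Even (A.erase (h.cross F a)).card := by
      refine even_card_of_involution _ (fun X => h.cross X a) (fun X hX => ?_)
        (fun X _ => h.cross_cross X a) (fun X _ => h.cross_ne X a)
      obtain ⟨hX1, hX2⟩ := Finset.mem_erase.1 hX
      refine Finset.mem_erase.2 ⟨fun e => hAF ?_, (hA _).2 (((hA X).1 hX2).tail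
        ⟨.inl rfl, fun e => hX1 ?_⟩)⟩
      · rwa [← h.cross_cross F a, ← e, h.cross_cross]
      · rw [← e, h.cross_cross]
    rw [Finset.card_erase_of_mem haA] at h2
    have := Finset.card_pos.2 ⟨_, haA⟩
    rcases h1 with ⟨m, hm⟩
    rcases h2 with ⟨k, hk⟩
    omega
  have hgen : ∀ X, ReflTransGen r (h.cross F a) X → X ≠ F ∧
      AgreeOn vx ((Finset.univ.erase a).erase b) F X ∧ ∃ q, EdgeHol g
        (linkEdges vx a b F \ {colorEdge vx a b F}) (vx F b) (vx X b) q := by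
    intro X hX
    induction hX with
    | refl =>
      refine ⟨h.cross_ne F a, h.agreeOn_cross_left F, 1, ?_⟩
      rw [h.vx_cross hab.symm]
      exact .nil _
    | @tail X Y _ hXY ih =>
      obtain ⟨h1, h2, q, hq⟩ := ih
      obtain ⟨rfl | rfl, hYF⟩ := hXY
      · refine ⟨hYF, h2.trans (h.agreeOn_cross_left X), q, ?_⟩
        rwa [h.vx_cross hab.symm]
      · have h3 := h2.trans (h.agreeOn_cross_right X)
        have h4 := edgeHol_colorEdge (g := g) (hmem hYF h3)
        rw [h.vx_cross hab] at h4
        exact ⟨hYF, h3, _, hq.trans ((edgeHol_colorEdge (g := g) (hmem h1 h2)).symm.trans h4)⟩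
  obtain ⟨h1, h2, q, hq⟩ := hgen _ ((hA _).1 hbA)
  have h4 := edgeHol_colorEdge (g := g) (hmem h1 h2)
  rw [h.vx_cross hab] at h4
  exact ⟨_, (hq.trans h4.symm).symm⟩

include hg hab in
/-- An edge of a link cycle in a set of edges may be removed without changing the holonomy. -/
theorem edgeHol_eliminate [Finite Φ] {H : Set (V × V)} {F : Φ} {e : V × V}
    (hF : linkEdges vx a b F ⊆ H) (he : e ∈ linkEdges vx a b F) {u v : V} {q : Q}
    (hq : EdgeHol g H u v q) : EdgeHol g (H \ {e}) u v q := by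
  obtain ⟨F', hF', rfl⟩ := he
  rw [linkEdges_eq hF'] at hF
  -- The vertex of colour c belongs to the triangle and is joined to all edges of its link. By
  -- `edgeHol_eq` the detour around the cycle has the same holonomy as the removed edge.
  obtain ⟨c, hca, hcb⟩ := (by decide : ∀ a b : Fin 5, ∃ c, c ≠ a ∧ c ≠ b) a b
  refine hq.replace fun e he => ?_
  by_cases hee : e = colorEdge vx a b F'
  · subst hee
    obtain ⟨r, hr⟩ := h.exists_edgeHol_sdiff (g := g) hab F'
    have := edgeHol_eq hg (c := c) (r := vx F' c) (a := a) (b := b) (fun e he => by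
      obtain ⟨G, hG, rfl⟩ := he.1
      exact ⟨G, rfl, (hG c (by simp [hca, hcb])).symm⟩) hr ⟨a, F', rfl, rfl⟩
    rw [hg] at this
    rw [this] at hr
    exact hr.mono (sdiff_subset_sdiff_left hF)
  · exact Hol.edge (src := Prod.fst) (tgt := Prod.snd) (g := fun e : V × V => g e.1 e.2) ⟨he, hee⟩

end IsChamberSystem

end EdgeGraph

/-! ### How the link cycles overlap. -/

section CycleFamily

open Classical Set Relation

variable {Φ V : Type*} {vx : Φ → Fin 5 → V} {a b : Fin 5}

theorem faceCount_singleton (a : Fin 5) :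
    faceCount vx {a} = (range fun F => vx F a).ncard := by
  rw [faceCount, Nat.card_coe_set_eq]
  have : (range fun F => vx F a) = (fun φ : ({a} : Finset (Fin 5)) → V =>
      φ ⟨a, Finset.mem_singleton_self a⟩) '' range fun (F : Φ) (i : ({a} : Finset (Fin 5))) =>
        vx F i := by
    rw [← range_comp]; rfl
  rw [this, InjOn.ncard_image]
  rintro _ ⟨F, rfl⟩ _ ⟨F', rfl⟩ he
  funext ⟨i, hi⟩
  obtain rfl := Finset.mem_singleton.1 hi
  exact he

theorem faceCount_pair (a b : Fin 5) :
    faceCount vx {a, b} = (range (colorEdge vx a b)).ncard := by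
  rw [faceCount, Nat.card_coe_set_eq]
  have : range (colorEdge vx a b) = (fun φ : ({a, b} : Finset (Fin 5)) → V =>
      (φ ⟨a, by simp⟩, φ ⟨b, by simp⟩)) '' range fun (F : Φ) (i : ({a, b} : Finset (Fin 5))) =>
        vx F i := by
    rw [← range_comp]; rfl
  rw [this, InjOn.ncard_image]
  rintro _ ⟨F, rfl⟩ _ ⟨F', rfl⟩ he
  funext ⟨i, hi⟩
  rcases Finset.mem_insert.1 hi with rfl | hi
  · exact congrArg Prod.fst he
  · obtain rfl := Finset.mem_singleton.1 hi
    exact congrArg Prod.snd he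

/-- The vertex `v` is an end of the edge `e`. -/
def IsEnd (v : V) (e : V × V) : Prop := v = e.1 ∨ v = e.2

namespace IsChamberSystem

variable (h : IsChamberSystem vx)
include h

theorem disjoint_range (hab : a ≠ b) :
    Disjoint (range fun F => vx F a) (range fun F => vx F b) := by
  rw [disjoint_left]
  rintro _ ⟨F, rfl⟩ ⟨F', hF'⟩
  exact hab (h.color _ _ _ _ hF'.symm)

theorem ncard_vertices [Finite Φ] (hab : a ≠ b) :
    ((range fun F => vx F a) ∪ range fun F => vx F b).ncard =
      faceCount vx {a} + faceCount vx {b} := by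
  rw [ncard_union_eq (h.disjoint_range hab), faceCount_singleton, faceCount_singleton]

variable {Q : Type*} [Group Q] {g : V → V → Q}
  (hg : ∀ F i j k, g (vx F i) (vx F j) * g (vx F j) (vx F k) = g (vx F i) (vx F k))

include hg in
-- Remove an edge of the third cycle outside the other two, then one of the second cycle outside the
-- first, then one of the first: each time the cycle that makes the edge redundant is still
-- complete. Counting generators outside a spanning tree then gains three.
theorem exists_rank_le_of_three [Finite Φ] (hab : a ≠ b) {F₀ : Φ}
    (hfull : ∀ q, EdgeHol g (range (colorEdge vx a b)) (vx F₀ a) (vx F₀ a) q) {F₁ F₂ F₃ : Φ}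
    (h2 : ¬ linkEdges vx a b F₂ ⊆ linkEdges vx a b F₁)
    (h3 : ¬ linkEdges vx a b F₃ ⊆ linkEdges vx a b F₁ ∪ linkEdges vx a b F₂) :
    ∃ _ : Group.FG Q,
      Group.rank Q + faceCount vx {a} + faceCount vx {b} + 2 ≤ faceCount vx {a, b} := by
  obtain ⟨e₂, he₂, hn₂⟩ := not_subset.1 h2
  obtain ⟨e₃, he₃, hn₃⟩ := not_subset.1 h3
  rw [mem_union, not_or] at hn₃
  set H := ((range (colorEdge vx a b) \ {e₃}) \ {e₂}) \ {colorEdge vx a b F₁} with hH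
  have helim : ∀ {u v q}, EdgeHol g (range (colorEdge vx a b)) u v q → EdgeHol g H u v q := by
    intro u v q hq
    have k3 := h.edgeHol_eliminate hg hab (linkEdges_subset_range F₃) he₃ hq
    have k2 := h.edgeHol_eliminate hg hab (F := F₂)
      (H := range (colorEdge vx a b) \ {e₃}) (fun e he =>
      ⟨linkEdges_subset_range _ he, by rintro rfl; exact hn₃.2 he⟩) he₂ k3
    exact h.edgeHol_eliminate hg hab (F := F₁)
      (H := (range (colorEdge vx a b) \ {e₃}) \ {e₂}) (fun e he => ⟨⟨linkEdges_subset_range _ he,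
      by rintro rfl; exact hn₃.1 he⟩, by rintro rfl; exact hn₂ he⟩) (colorEdge_mem_linkEdges F₁) k2
  have hfin : H.Finite := toFinite _
  have hWfin : ((range fun F => vx F a) ∪ range fun F => vx F b).Finite := toFinite _
  obtain ⟨hFG, hr⟩ := rank_add_card_le (src := Prod.fst) (tgt := Prod.snd)
    (g := fun e : V × V => g e.1 e.2) (H := hfin.toFinset)
    (b := vx F₀ a) (W₀ := hWfin.toFinset) ⟨vx F₀ a, by simp⟩ (fun v hv => by
      rw [Finite.mem_toFinset] at hv
      rw [Finite.coe_toFinset]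
      obtain ⟨F, rfl⟩ | ⟨F, rfl⟩ := hv
      · obtain ⟨q, hq⟩ := h.exists_edgeHol hg hab F₀ F
        exact ⟨q, helim hq⟩
      · obtain ⟨q, hq⟩ := h.exists_edgeHol hg hab F₀ F
        exact ⟨_, helim (hq.trans (edgeHol_colorEdge (mem_range_self F)))⟩)
    (fun q => by rw [Finite.coe_toFinset]; exact helim (hfull q))
  refine ⟨hFG, ?_⟩
  rw [← ncard_eq_toFinset_card _ hWfin, h.ncard_vertices hab, ← ncard_eq_toFinset_card _ hfin] at hr
  have m3 : e₃ ∈ range (colorEdge vx a b) := linkEdges_subset_range _ he₃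
  have m2 : e₂ ∈ range (colorEdge vx a b) \ {e₃} :=
    ⟨linkEdges_subset_range _ he₂, by rintro rfl; exact hn₃.2 he₂⟩
  have m1 : colorEdge vx a b F₁ ∈ (range (colorEdge vx a b) \ {e₃}) \ {e₂} :=
    ⟨⟨mem_range_self _, fun e => hn₃.1 (e ▸ colorEdge_mem_linkEdges F₁)⟩,
      fun e => hn₂ (e ▸ colorEdge_mem_linkEdges F₁)⟩
  have c3 := ncard_sdiff_singleton_add_one m3
  have c2 := ncard_sdiff_singleton_add_one m2
  have c1 := ncard_sdiff_singleton_add_one m1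
  rw [← hH] at c1
  rw [faceCount_pair]
  omega

/-- The link cycles are two-regular. -/
theorem exists_other_edge (hab : a ≠ b) {X : Φ} {v : V} {e : V × V} (he : e ∈ linkEdges vx a b X)
    (hv : IsEnd v e) : ∃ e' ∈ linkEdges vx a b X, e' ≠ e ∧ IsEnd v e' ∧
      ∀ e'' ∈ linkEdges vx a b X, IsEnd v e'' → e'' = e ∨ e'' = e' := by
  obtain ⟨F, hF, rfl⟩ := he
  rcases hv with hv | hv
  · have hne : colorEdge vx a b (h.cross F b) ≠ colorEdge vx a b F := fun e =>
      h.vx_cross_ne F b (congrArg Prod.snd e)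
    refine ⟨colorEdge vx a b (h.cross F b), ⟨_, hF.trans (h.agreeOn_cross_right F), rfl⟩, hne,
      .inl (hv.trans (h.vx_cross hab).symm), ?_⟩
    rintro _ ⟨F', hF', rfl⟩ hv'
    have hv'' : vx F' a = vx F a := by
      rcases hv' with hv' | hv'
      · exact hv'.symm.trans hv
      · exact absurd (h.color _ _ _ _ (hv.symm.trans hv')) hab
    have : AgreeOn vx (Finset.univ.erase b) F F' := fun i hi => by
      by_cases hia : i = a
      · rw [hia, hv'']
      · exact (hF.symm.trans hF') i (by
          simp only [Finset.mem_erase, Finset.mem_univ, and_true] at hi ⊢; exact ⟨hi, hia⟩)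
    rcases h.eq_or_eq_cross this with rfl | rfl
    · exact .inl rfl
    · exact .inr rfl
  · have hne : colorEdge vx a b (h.cross F a) ≠ colorEdge vx a b F := fun e =>
      h.vx_cross_ne F a (congrArg Prod.fst e)
    refine ⟨colorEdge vx a b (h.cross F a), ⟨_, hF.trans (h.agreeOn_cross_left F), rfl⟩, hne,
      .inr (hv.trans (h.vx_cross hab.symm).symm), ?_⟩
    rintro _ ⟨F', hF', rfl⟩ hv'
    have hv'' : vx F' b = vx F b := by
      rcases hv' with hv' | hv'
      · exact absurd (h.color _ _ _ _ (hv.symm.trans hv')) hab.symm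
      · exact hv'.symm.trans hv
    have : AgreeOn vx (Finset.univ.erase a) F F' := fun i hi => by
      by_cases hib : i = b
      · rw [hib, hv'']
      · exact (hF.symm.trans hF') i (by
          simp only [Finset.mem_erase, Finset.mem_univ, and_true] at hi ⊢; exact ⟨hib, hi⟩)
    rcases h.eq_or_eq_cross this with rfl | rfl
    · exact .inl rfl
    · exact .inr rfl

/-- A link cycle is connected, because the star of its triangle is strongly connected and each
crossing keeps at least one end of the edge. -/
theorem linkEdges_chain (hab : a ≠ b) {X : Φ} {P : V × V → Prop} {e e' : V × V} (he : e ∈ linkEdges vx a b X)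
    (he' : e' ∈ linkEdges vx a b X) (hP : P e)
    (hstep : ∀ e₁ ∈ linkEdges vx a b X, ∀ e₂ ∈ linkEdges vx a b X, ∀ v, IsEnd v e₁ → IsEnd v e₂ →
      P e₁ → P e₂) : P e' := by
  obtain ⟨F, hF, rfl⟩ := he
  obtain ⟨F', hF', rfl⟩ := he'
  have := h.conn _ F F' (hF.symm.trans hF')
  have key : ∀ G, ReflTransGen (fun A B => ∃ i ∉ (Finset.univ.erase a).erase b,
      AgreeOn vx (Finset.univ.erase i) A B) F G →
      AgreeOn vx ((Finset.univ.erase a).erase b) X G ∧ P (colorEdge vx a b G) := by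
    intro G hG
    induction hG with
    | refl => exact ⟨hF, hP⟩
    | @tail A B _ hAB ih =>
      obtain ⟨i, hi, hAB⟩ := hAB
      have hB : AgreeOn vx ((Finset.univ.erase a).erase b) X B :=
        ih.1.trans (hAB.mono (Finset.subset_erase.2 ⟨Finset.subset_univ _, hi⟩))
      refine ⟨hB, ?_⟩
      by_cases hia : i = a
      · exact hstep _ ⟨A, ih.1, rfl⟩ _ ⟨B, hB, rfl⟩ (vx A b) (.inr rfl)
          (.inr (hAB b (by simp [hia, hab.symm]))) ih.2
      · exact hstep _ ⟨A, ih.1, rfl⟩ _ ⟨B, hB, rfl⟩ (vx A a) (.inl rfl)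
          (.inl (hAB a (by simp [Ne.symm hia]))) ih.2
  exact (key F' this).2

/-- At each vertex of the smaller cycle its two edges are already the two edges of the larger one,
and the larger cycle is connected. -/
theorem linkEdges_eq_of_subset (hab : a ≠ b) {F F' : Φ}
    (hs : linkEdges vx a b F' ⊆ linkEdges vx a b F) :
    linkEdges vx a b F' = linkEdges vx a b F := by
  refine hs.antisymm fun e he => ?_
  refine h.linkEdges_chain hab (P := fun e => e ∈ linkEdges vx a b F')
    (hs (colorEdge_mem_linkEdges F')) he (colorEdge_mem_linkEdges F') ?_
  intro e₁ h₁ e₂ h₂ v hv₁ hv₂ hP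
  obtain ⟨e', -, -, -, hall⟩ := h.exists_other_edge hab h₁ hv₁
  obtain ⟨e'', h'', hne, hv'', -⟩ := h.exists_other_edge hab hP hv₁
  rcases hall e₂ h₂ hv₂ with rfl | rfl
  · exact hP
  · rcases hall e'' (hs h'') hv'' with rfl | rfl
    · exact absurd rfl hne
    · exact h''

/-- Between two triangles one can move through facets containing e, which lies in both link cycles.
Each crossing of a third colour keeps an arbitrary edge f in the link cycle. -/
theorem linkEdges_eq_of_forall_mem {e : V × V}
    (he : ∀ F, e ∈ linkEdges vx a b F) (F F' : Φ) : linkEdges vx a b F = linkEdges vx a b F' := by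
  suffices hsub : ∀ F F', linkEdges vx a b F ⊆ linkEdges vx a b F' from
    (hsub F F').antisymm (hsub F' F)
  intro F F' f hf
  obtain ⟨Z₀, hZ₀, he₀⟩ := he F
  obtain ⟨Z', hZ', he'⟩ := he F'
  have hchain := h.conn {a, b} Z₀ Z' fun i hi => by
    rcases Finset.mem_insert.1 hi with rfl | hi
    · exact congrArg Prod.fst (he₀.trans he'.symm)
    · rw [Finset.mem_singleton.1 hi]
      exact congrArg Prod.snd (he₀.trans he'.symm)
  have key : ∀ Z, ReflTransGen (fun A B => ∃ i ∉ ({a, b} : Finset (Fin 5)),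
      AgreeOn vx (Finset.univ.erase i) A B) Z₀ Z →
      colorEdge vx a b Z = e ∧ f ∈ linkEdges vx a b Z := by
    intro Z hZ
    induction hZ with
    | refl => exact ⟨he₀, linkEdges_eq hZ₀ ▸ hf⟩
    | @tail Z B _ hZB ih =>
      obtain ⟨i, hi, hZB⟩ := hZB
      simp only [Finset.mem_insert, Finset.mem_singleton, not_or] at hi
      obtain ⟨heZ, X, hX, rfl⟩ := ih
      rcases h.eq_or_eq_cross hZB with rfl | rfl
      · exact ⟨heZ, X, hX, rfl⟩
      refine ⟨?_, ?_⟩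
      · rw [colorEdge, h.vx_cross (Ne.symm hi.1), h.vx_cross (Ne.symm hi.2)]
        exact heZ
      have hXe : colorEdge vx a b (h.cross X i) = colorEdge vx a b X := by
        rw [colorEdge, h.vx_cross (Ne.symm hi.1), h.vx_cross (Ne.symm hi.2)]
        rfl
      -- The facet W joins e to the triangle of `h.cross X i` and agrees with Z off colour i. It is
      -- not Z, as then X would equal its own neighbour; so W is the neighbour of Z, whose triangle
      -- is therefore that of `h.cross X i`.
      obtain ⟨W, hW, heW⟩ := he (h.cross X i)
      have hZW : AgreeOn vx (Finset.univ.erase i) Z W := fun j hj => by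
        by_cases hja : j = a
        · rw [hja]; exact congrArg Prod.fst (heZ.trans heW.symm)
        by_cases hjb : j = b
        · rw [hjb]; exact congrArg Prod.snd (heZ.trans heW.symm)
        have hjR : j ∈ (Finset.univ.erase a).erase b := by simp [hja, hjb]
        rw [hX j hjR, ← hW j hjR, h.vx_cross (Finset.ne_of_mem_erase hj)]
      rcases h.eq_or_eq_cross hZW with rfl | rfl
      · exact absurd (h.eq_of_agreeOn (hX.symm.trans hW.symm) hXe.symm).symm (h.cross_ne X i)
      · exact ⟨h.cross X i, hW.symm, hXe⟩
  rw [linkEdges_eq hZ']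
  exact (key Z' hchain).2

/-- Any two facets are joined by crossings, and crossings of the colours a and b leave the link
cycle unchanged. -/
theorem exists_linkEdges_cross_ne {F F' : Φ} (hne : linkEdges vx a b F ≠ linkEdges vx a b F') :
    ∃ X i, i ≠ a ∧ i ≠ b ∧ linkEdges vx a b X ≠ linkEdges vx a b (h.cross X i) := by
  by_contra! hcon
  refine hne ?_
  have := h.conn ∅ F F' fun _ hi => absurd hi (Finset.notMem_empty _)
  induction this with
  | refl => exact absurd rfl hne
  | @tail A B _ hAB ih =>
    obtain ⟨i, -, hAB⟩ := hAB
    have h1 : linkEdges vx a b A = linkEdges vx a b B := by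
      rcases h.eq_or_eq_cross hAB with rfl | rfl
      · rfl
      by_cases hia : i = a
      · subst hia; exact linkEdges_eq (h.agreeOn_cross_left A)
      by_cases hib : i = b
      · subst hib; exact linkEdges_eq (h.agreeOn_cross_right A)
      exact hcon A i hia hib
    by_cases h2 : linkEdges vx a b F = linkEdges vx a b A
    · exact h2.trans h1
    · exact (ih h2).trans h1

include hg in
/-- If the link cycles of two adjacent triangles cover all edges, then the group is trivial. -/
theorem subsingleton_of_cover {X F₀ : Φ} {i : Fin 5}
    (hcov : range (colorEdge vx a b) ⊆ linkEdges vx a b X ∪ linkEdges vx a b (h.cross X i))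
    (hfull : ∀ q, EdgeHol g (range (colorEdge vx a b)) (vx F₀ a) (vx F₀ a) q) :
    ∀ q : Q, q = 1 := by
  -- The two triangles share their vertex of colour c, so every edge of the graph is joined to this
  -- one vertex and all closed holonomies are trivial.
  obtain ⟨c, hca, hcb, hci⟩ := (by decide : ∀ a b i : Fin 5, ∃ c, c ≠ a ∧ c ≠ b ∧ c ≠ i) a b i
  have hr : ∀ e ∈ range (colorEdge vx a b), ∃ G, colorEdge vx a b G = e ∧ vx G c = vx X c := by
    intro e he
    have hcR : c ∈ (Finset.univ.erase a).erase b := by simp [hca, hcb]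
    obtain ⟨G, hG, rfl⟩ | ⟨G, hG, rfl⟩ := hcov he
    · exact ⟨G, rfl, (hG c hcR).symm⟩
    · exact ⟨G, rfl, (hG c hcR).symm.trans (h.vx_cross hci)⟩
  intro q
  obtain ⟨G, hG, hGc⟩ := hr _ (mem_range_self F₀)
  have hGa : vx G a = vx F₀ a := congrArg Prod.fst hG
  have := edgeHol_eq hg hr (hfull q) ⟨a, G, hGa, hGc⟩
  rw [← hGa, ← hGc, hg, cocycle_self hg] at this
  exact this

end IsChamberSystem

end CycleFamily

/-! ### Either enough independent cycles exist or the edges form a spindle. -/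

section Spindle

open Classical Set Relation

variable {Φ V : Type*} {vx : Φ → Fin 5 → V} {a b : Fin 5}

/-- The edges with colours `a`, `b` form paths from `p` to `q`, one for each label, and the link of
an edge depends only on its label. -/
structure IsSpindle (vx : Φ → Fin 5 → V) (a b : Fin 5) {J : Type*} (ℓ : V × V → J) (p q : V) :
    Prop where
  join : ∀ F X, ℓ (colorEdge vx a b F) = ℓ (colorEdge vx a b X) →
    colorEdge vx a b F ∈ linkEdges vx a b X
  ne : p ≠ q
  exists_ne : ∀ i : J, ∃ j, i ≠ j
  pole : ∀ r, r = p ∨ r = q → ∀ j, ∃ e ∈ range (colorEdge vx a b), ℓ e = j ∧ IsEnd r e ∧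
    ∀ e' ∈ range (colorEdge vx a b), IsEnd r e' → ℓ e' = j → e' = e
  other : ∀ v, v ≠ p → v ≠ q → ∀ e ∈ range (colorEdge vx a b), IsEnd v e →
    ∃ e' ∈ range (colorEdge vx a b), IsEnd v e' ∧ e' ≠ e ∧ ℓ e' = ℓ e ∧
      ∀ f ∈ range (colorEdge vx a b), IsEnd v f → f = e ∨ f = e'
  conn : ∀ i j, i ≠ j → ∃ X, ∀ e, e ∈ linkEdges vx a b X ↔
    e ∈ range (colorEdge vx a b) ∧ (ℓ e = i ∨ ℓ e = j)

/-- Meant for the edges S at one vertex, where the edges with label other than j are those of the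
cycle j, and a cycle passes a vertex along two edges. So either S is a pair with equal labels, or it
consists of three edges whose labels are distinct and are all the labels. -/
theorem label_cases {α J : Type*} {S : Set α} {ℓ : α → J}
    (h2 : ∀ j, ∀ e ∈ S, ℓ e ≠ j → ∃ e' ∈ S, ℓ e' ≠ j ∧ e' ≠ e ∧
      ∀ f ∈ S, ℓ f ≠ j → f = e ∨ f = e')
    (h3 : ∀ i : J, ∃ j k, i ≠ j ∧ i ≠ k ∧ j ≠ k) {e : α} (he : e ∈ S) :
    (∃ e' ∈ S, e' ≠ e ∧ ℓ e' = ℓ e ∧ ∀ f ∈ S, f = e ∨ f = e') ∨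
    ∃ e' ∈ S, ∃ e'' ∈ S, ℓ e ≠ ℓ e' ∧ ℓ e ≠ ℓ e'' ∧ ℓ e' ≠ ℓ e'' ∧
      (∀ f ∈ S, f = e ∨ f = e' ∨ f = e'') ∧ ∀ j, j = ℓ e ∨ j = ℓ e' ∨ j = ℓ e'' := by
  obtain ⟨j, k, hj, hk, hjk⟩ := h3 (ℓ e)
  obtain ⟨e', he', hj', hne', hall'⟩ := h2 j e he hj
  obtain ⟨e'', he'', hk'', hne'', hall''⟩ := h2 k e he hk
  by_cases hee : e' = e''
  · subst hee
    have hall : ∀ f ∈ S, f = e ∨ f = e' := by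
      intro f hf
      by_cases hfj : ℓ f = j
      · exact hall'' f hf (fun hfk => hjk (hfj.symm.trans hfk))
      · exact hall' f hf hfj
    refine .inl ⟨e', he', hne', ?_, hall⟩
    by_contra hl
    obtain ⟨e₃, h₃, hl₃, hne₃, -⟩ := h2 (ℓ e) e' he' hl
    rcases hall e₃ h₃ with rfl | rfl
    · exact hl₃ rfl
    · exact hne₃ rfl
  · have hl'' : ℓ e'' = j := by
      by_contra hl
      rcases hall' e'' he'' hl with e | e
      · exact hne'' e
      · exact hee e.symm
    have hl' : ℓ e' = k := by
      by_contra hl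
      rcases hall'' e' he' hl with e | e
      · exact hne' e
      · exact hee e
    refine .inr ⟨e', he', e'', he'', hl' ▸ hk, hl'' ▸ hj, by rw [hl', hl'']; exact hjk.symm,
      fun f hf => ?_, fun m => ?_⟩
    · by_cases hfj : ℓ f = j
      · rcases hall'' f hf (fun hfk => hjk (hfj.symm.trans hfk)) with e | e
        · exact .inl e
        · exact .inr (.inr e)
      · rcases hall' f hf hfj with e | e
        · exact .inl e
        · exact .inr (.inl e)
    · by_contra! hm
      obtain ⟨g, -, -, -, hg⟩ := h2 m e he hm.1.symm
      rcases hg e' he' hm.2.1.symm with e | e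
      · exact hne' e
      rcases hg e'' he'' hm.2.2.symm with e₁ | e₁
      · exact hne'' e₁
      · exact hee (e.trans e₁.symm)

namespace IsChamberSystem

variable (h : IsChamberSystem vx)
include h

/-- The graph is a single cycle. Its two paths are one edge e₀ and the rest; the poles are the ends
of e₀. -/
theorem isSpindle_of_forall_eq (hab : a ≠ b) (F₀ : Φ)
    (heq : ∀ F F', linkEdges vx a b F = linkEdges vx a b F') :
    ∃ (ℓ : V × V → Bool) (p q : V), IsSpindle vx a b ℓ p q := by
  have hall : ∀ F, linkEdges vx a b F = range (colorEdge vx a b) := fun F =>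
    (linkEdges_subset_range F).antisymm (by
      rintro _ ⟨F', rfl⟩
      rw [heq F F']
      exact colorEdge_mem_linkEdges F')
  set e₀ := colorEdge vx a b F₀ with he₀
  have h₀ : e₀ ∈ range (colorEdge vx a b) := ⟨F₀, rfl⟩
  have hdeg : ∀ v, ∀ e ∈ range (colorEdge vx a b), IsEnd v e →
      ∃ e' ∈ range (colorEdge vx a b), e' ≠ e ∧ IsEnd v e' ∧
        ∀ f ∈ range (colorEdge vx a b), IsEnd v f → f = e ∨ f = e' := by
    intro v e he hv
    rw [← hall F₀] at he ⊢
    exact h.exists_other_edge hab he hv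
  refine ⟨fun e => decide (e = e₀), e₀.1, e₀.2, fun F X _ => ?_, fun e => ?_,
    fun i => ⟨!i, by simp⟩, ?_, ?_, ?_⟩
  · rw [hall X]; exact ⟨F, rfl⟩
  · exact hab (h.color F₀ F₀ a b e)
  · intro r hr j
    obtain ⟨e', he', hne, hre', hf⟩ := hdeg r e₀ h₀ hr
    cases j with
    | true => exact ⟨e₀, h₀, by simp, hr, fun f _ _ hfl => by simpa using hfl⟩
    | false =>
      refine ⟨e', he', by simpa using hne, hre', fun f hfr hrf hfl => ?_⟩
      exact (hf f hfr hrf).resolve_left (by simpa using hfl)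
  · intro v hp hq e he hv
    obtain ⟨e', he', hne, hre', hf⟩ := hdeg v e he hv
    have key : ∀ f, IsEnd v f → f ≠ e₀ := by
      rintro f hf rfl
      exact hf.elim hp hq
    exact ⟨e', he', hre', hne, by simp [key e hv, key e' hre'], hf⟩
  · intro i j hij
    refine ⟨F₀, fun e => ?_⟩
    rw [hall F₀]
    refine (and_iff_left ?_).symm
    revert hij
    generalize decide (e = e₀) = k
    revert i j k
    decide

theorem isEnd_iff_of_mem_left (hab : a ≠ b) {v : V} (hv : v ∈ range fun F => vx F a) {e : V × V}
    (he : e ∈ range (colorEdge vx a b)) : IsEnd v e ↔ e.1 = v := by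
  obtain ⟨F, rfl⟩ := hv
  obtain ⟨G, rfl⟩ := he
  refine ⟨fun hv => ?_, fun hv => .inl hv.symm⟩
  rcases hv with hv | hv
  · exact hv.symm
  · exact absurd (h.color _ _ _ _ hv) hab

theorem isEnd_iff_of_mem_right (hab : a ≠ b) {v : V} (hv : v ∈ range fun F => vx F b) {e : V × V}
    (he : e ∈ range (colorEdge vx a b)) : IsEnd v e ↔ e.2 = v := by
  obtain ⟨F, rfl⟩ := hv
  obtain ⟨G, rfl⟩ := he
  refine ⟨fun hv => ?_, fun hv => .inr hv.symm⟩
  rcases hv with hv | hv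
  · exact absurd (h.color _ _ _ _ hv).symm hab
  · exact hv.symm

/-- Double counting of the edges with colours `a` and `b`. -/
theorem sum_ncard_isEnd [Finite Φ] (hab : a ≠ b)
    (hfin : ((range fun F => vx F a) ∪ range fun F => vx F b).Finite) :
    ∑ v ∈ hfin.toFinset, {e ∈ range (colorEdge vx a b) | IsEnd v e}.ncard =
      2 * faceCount vx {a, b} := by
  have hA : (range fun F => vx F a).Finite := toFinite _
  have hB : (range fun F => vx F b).Finite := toFinite _
  have hE : (range (colorEdge vx a b)).Finite := toFinite _
  have hu : hfin.toFinset = hA.toFinset ∪ hB.toFinset := by ext; simp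
  have hd : Disjoint hA.toFinset hB.toFinset := by
    rw [Finite.disjoint_toFinset]; exact h.disjoint_range hab
  have hn : faceCount vx {a, b} = hE.toFinset.card := by
    rw [faceCount_pair, ncard_eq_toFinset_card _ hE]
  have h1 : ∀ v ∈ hA.toFinset, {e ∈ range (colorEdge vx a b) | IsEnd v e}.ncard =
      (hE.toFinset.filter fun e => e.1 = v).card := by
    intro v hv
    rw [← ncard_coe_finset]
    congr 1
    ext e
    simp only [Finset.coe_filter, Finite.mem_toFinset, mem_ofPred_eq]
    exact and_congr_right fun he => h.isEnd_iff_of_mem_left hab (by simpa using hv) he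
  have h2 : ∀ v ∈ hB.toFinset, {e ∈ range (colorEdge vx a b) | IsEnd v e}.ncard =
      (hE.toFinset.filter fun e => e.2 = v).card := by
    intro v hv
    rw [← ncard_coe_finset]
    congr 1
    ext e
    simp only [Finset.coe_filter, Finite.mem_toFinset, mem_ofPred_eq]
    exact and_congr_right fun he => h.isEnd_iff_of_mem_right hab (by simpa using hv) he
  have e1 := Finset.card_eq_sum_card_fiberwise (f := Prod.fst) (s := hE.toFinset)
    (t := hA.toFinset) fun e he => by
      obtain ⟨F, rfl⟩ := hE.mem_toFinset.1 he
      exact hA.mem_toFinset.2 ⟨F, rfl⟩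
  have e2 := Finset.card_eq_sum_card_fiberwise (f := Prod.snd) (s := hE.toFinset)
    (t := hB.toFinset) fun e he => by
      obtain ⟨F, rfl⟩ := hE.mem_toFinset.1 he
      exact hB.mem_toFinset.2 ⟨F, rfl⟩
  rw [hu, Finset.sum_union hd, Finset.sum_congr rfl h1, Finset.sum_congr rfl h2, ← e1, ← e2, hn,
    two_mul]

/-- Every edge is missed by some cycle, by `linkEdges_eq_of_forall_mem`, and by only one since two
distinct cycles cover the graph. Labelling edges by the missing cycle makes the cycle j the set of
edges with label other than j. By `label_cases` all vertices then have degree 2 or 3, and the number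
of vertices of degree 3 decides. -/
theorem isSpindle_or_le_of_cover [Finite Φ] (hab : a ≠ b) {F₁ F₂ : Φ}
    (hne : linkEdges vx a b F₁ ≠ linkEdges vx a b F₂)
    (hcov : ∀ F F', linkEdges vx a b F ≠ linkEdges vx a b F' →
      range (colorEdge vx a b) ⊆ linkEdges vx a b F ∪ linkEdges vx a b F') :
    (∃ (ℓ : V × V → range (linkEdges vx a b)) (p q : V), IsSpindle vx a b ℓ p q) ∨
      faceCount vx {a} + faceCount vx {b} + 2 ≤ faceCount vx {a, b} := by
  have hav : ∀ e, ∃ F, e ∉ linkEdges vx a b F := by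
    intro e
    by_contra! hcon
    exact hne (h.linkEdges_eq_of_forall_mem hcon F₁ F₂)
  choose A hA using hav
  let ℓ : V × V → range (linkEdges vx a b) := fun e => ⟨linkEdges vx a b (A e), A e, rfl⟩
  have hmem : ∀ e ∈ range (colorEdge vx a b), ∀ j : range (linkEdges vx a b),
      e ∈ j.1 ↔ ℓ e ≠ j := by
    rintro e he ⟨_, F, rfl⟩
    constructor
    · intro hF hl
      have : linkEdges vx a b (A e) = linkEdges vx a b F := congrArg Subtype.val hl
      exact hA e (this ▸ hF)
    · intro hl
      exact (hcov (A e) F (fun hl' => hl (Subtype.ext hl')) he).resolve_left (hA e)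
  have hlab : ∀ j, ∃ e ∈ range (colorEdge vx a b), ℓ e = j := by
    rintro ⟨_, F, rfl⟩
    obtain ⟨F', hF'⟩ : ∃ F', linkEdges vx a b F' ≠ linkEdges vx a b F := by
      by_contra! hcon
      exact hne ((hcon F₁).trans (hcon F₂).symm)
    obtain ⟨e, he, hn⟩ := not_subset.1 fun hs => hF' (h.linkEdges_eq_of_subset hab hs)
    have he' := linkEdges_subset_range _ he
    exact ⟨e, he', not_not.1 fun hl => hn ((hmem e he' ⟨_, F, rfl⟩).2 hl)⟩
  have h3 : ∀ i : range (linkEdges vx a b), ∃ j k, i ≠ j ∧ i ≠ k ∧ j ≠ k := by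
    -- Three labels exist: two distinct cycles on both sides of a wall of X, and the label of the
    -- edge of X, which belongs to both of these cycles.
    obtain ⟨X, i, hia, hib, hX⟩ := h.exists_linkEdges_cross_ne hne
    have hr : colorEdge vx a b X ∈ range (colorEdge vx a b) := ⟨X, rfl⟩
    have e1 := (hmem _ hr ⟨_, X, rfl⟩).1 (colorEdge_mem_linkEdges X)
    have e2 : ℓ (colorEdge vx a b X) ≠ ⟨_, h.cross X i, rfl⟩ := by
      refine (hmem _ hr ⟨_, h.cross X i, rfl⟩).1 ⟨h.cross X i, fun _ _ => rfl, ?_⟩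
      rw [colorEdge, h.vx_cross (Ne.symm hia), h.vx_cross (Ne.symm hib)]
      rfl
    have e3 : (⟨_, X, rfl⟩ : range (linkEdges vx a b)) ≠ ⟨_, h.cross X i, rfl⟩ := fun e =>
      hX (congrArg Subtype.val e)
    generalize (⟨_, X, rfl⟩ : range (linkEdges vx a b)) = x at *
    generalize (⟨_, h.cross X i, rfl⟩ : range (linkEdges vx a b)) = y at *
    generalize ℓ (colorEdge vx a b X) = z at *
    intro m
    by_cases hmx : m = x
    · subst hmx; exact ⟨y, z, e3, e1.symm, e2.symm⟩
    by_cases hmy : m = y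
    · subst hmy; exact ⟨x, z, hmx, e2.symm, e1.symm⟩
    · exact ⟨x, y, hmx, hmy, e3⟩
  have hcases := fun v e he => label_cases (S := {e ∈ range (colorEdge vx a b) | IsEnd v e})
    (ℓ := ℓ) (e := e) (fun j e he hl => by
      obtain ⟨_, X, rfl⟩ := j
      obtain ⟨e', he', hne', hv', hall⟩ := h.exists_other_edge hab
        ((hmem e he.1 ⟨_, X, rfl⟩).2 hl) he.2
      refine ⟨e', ⟨linkEdges_subset_range _ he', hv'⟩,
        (hmem e' (linkEdges_subset_range _ he') ⟨_, X, rfl⟩).1 he', hne', fun f hf hlf => ?_⟩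
      exact hall f ((hmem f hf.1 ⟨_, X, rfl⟩).2 hlf) hf.2) h3 he
  have hfin : ((range fun F => vx F a) ∪ range fun F => vx F b).Finite := toFinite _
  let d : V → ℕ := fun v => {e ∈ range (colorEdge vx a b) | IsEnd v e}.ncard
  have two : ∀ v e, e ∈ {e ∈ range (colorEdge vx a b) | IsEnd v e} → ∀ e',
      e' ∈ {e ∈ range (colorEdge vx a b) | IsEnd v e} → e' ≠ e →
      (∀ f ∈ {e ∈ range (colorEdge vx a b) | IsEnd v e}, f = e ∨ f = e') → d v = 2 := by
    intro v e he e' he' hne hall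
    refine ncard_eq_two.2 ⟨e, e', hne.symm, Subset.antisymm (fun f hf => hall f hf) ?_⟩
    rintro f (rfl | rfl)
    · exact he
    · exact he'
  have three : ∀ v e, e ∈ {e ∈ range (colorEdge vx a b) | IsEnd v e} → ∀ e',
      e' ∈ {e ∈ range (colorEdge vx a b) | IsEnd v e} → ∀ e'',
      e'' ∈ {e ∈ range (colorEdge vx a b) | IsEnd v e} → ℓ e ≠ ℓ e' → ℓ e ≠ ℓ e'' → ℓ e' ≠ ℓ e'' →
      (∀ f ∈ {e ∈ range (colorEdge vx a b) | IsEnd v e}, f = e ∨ f = e' ∨ f = e'') → d v = 3 := by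
    intro v e he e' he' e'' he'' l1 l2 l3 hall
    refine ncard_eq_three.2 ⟨e, e', e'', fun h => l1 (h ▸ rfl), fun h => l2 (h ▸ rfl),
      fun h => l3 (h ▸ rfl), Subset.antisymm (fun f hf => hall f hf) ?_⟩
    rintro f (rfl | rfl | rfl)
    · exact he
    · exact he'
    · exact he''
  have hd : ∀ v ∈ hfin.toFinset, d v = 2 + if d v = 3 then 1 else 0 := by
    intro v hv
    obtain ⟨e, he⟩ : ∃ e, e ∈ {e ∈ range (colorEdge vx a b) | IsEnd v e} := by
      obtain ⟨F, rfl⟩ | ⟨F, rfl⟩ := hfin.mem_toFinset.1 hv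
      · exact ⟨_, ⟨F, rfl⟩, .inl rfl⟩
      · exact ⟨_, ⟨F, rfl⟩, .inr rfl⟩
    obtain ⟨e', he', hne, -, hall⟩ | ⟨e', he', e'', he'', l1, l2, l3, hall, -⟩ := hcases v e he
    · rw [two v e he e' he' hne hall]; rfl
    · rw [three v e he e' he' e'' he'' l1 l2 l3 hall]; rfl
  have hd2 : ∀ v, d v ≠ 3 → ∀ e ∈ range (colorEdge vx a b), IsEnd v e →
      ∃ e' ∈ range (colorEdge vx a b), IsEnd v e' ∧ e' ≠ e ∧ ℓ e' = ℓ e ∧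
        ∀ f ∈ range (colorEdge vx a b), IsEnd v f → f = e ∨ f = e' := by
    intro v hv e he hve
    obtain ⟨e', he', hne, hl, hall⟩ | ⟨e', he', e'', he'', l1, l2, l3, hall, -⟩ :=
      hcases v e ⟨he, hve⟩
    · exact ⟨e', he'.1, he'.2, hne, hl, fun f hf hvf => hall f ⟨hf, hvf⟩⟩
    · exact absurd (three v e ⟨he, hve⟩ e' he' e'' he'' l1 l2 l3 hall) hv
  have hd3 : ∀ v, d v = 3 → ∀ j, ∃ e ∈ range (colorEdge vx a b), ℓ e = j ∧ IsEnd v e ∧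
    ∀ e' ∈ range (colorEdge vx a b), IsEnd v e' → ℓ e' = j → e' = e := by
    intro v hv j
    obtain ⟨e, he⟩ : {e ∈ range (colorEdge vx a b) | IsEnd v e}.Nonempty := by
      by_contra hn
      rw [not_nonempty_iff_eq_empty] at hn
      simp only [d, hn, ncard_empty] at hv
      omega
    obtain ⟨e', he', hne, hl, hall⟩ | ⟨e', he', e'', he'', l1, l2, l3, hall, hj⟩ := hcases v e he
    · have := two v e he e' he' hne hall
      omega
    · rcases hj j with rfl | rfl | rfl
      · refine ⟨e, he.1, rfl, he.2, fun f hf hvf hl => ?_⟩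
        rcases hall f ⟨hf, hvf⟩ with rfl | rfl | rfl
        · rfl
        · exact absurd hl.symm l1
        · exact absurd hl.symm l2
      · refine ⟨e', he'.1, rfl, he'.2, fun f hf hvf hl => ?_⟩
        rcases hall f ⟨hf, hvf⟩ with rfl | rfl | rfl
        · exact absurd hl l1
        · rfl
        · exact absurd hl.symm l3
      · refine ⟨e'', he''.1, rfl, he''.2, fun f hf hvf hl => ?_⟩
        rcases hall f ⟨hf, hvf⟩ with rfl | rfl | rfl
        · exact absurd hl l2
        · exact absurd hl l3
        · rfl
  have hsum := h.sum_ncard_isEnd hab hfin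
  rw [Finset.sum_congr rfl hd, Finset.sum_add_distrib, Finset.sum_const, smul_eq_mul,
    ← Finset.card_filter, ← ncard_eq_toFinset_card _ hfin, h.ncard_vertices hab] at hsum
  -- Twice the number of edges is twice the number of vertices plus the number of vertices of degree
  -- 3. The latter is even, so three of them force four.
  by_cases hT : 3 ≤ (hfin.toFinset.filter fun v => d v = 3).card
  · right; omega
  left
  have hT2 : (hfin.toFinset.filter fun v => d v = 3).card = 0 ∨
      (hfin.toFinset.filter fun v => d v = 3).card = 2 := by omega
  rcases hT2 with hT0 | hT2
  -- Without vertices of degree 3 the edges at each vertex have equal labels, so by connectedness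
  -- there would be only one label.
  · exfalso
    have hno : ∀ v ∈ hfin.toFinset, d v ≠ 3 := fun v hv h3 => by
      have := Finset.card_eq_zero.1 hT0 ▸ Finset.mem_filter.2 ⟨hv, h3⟩
      exact absurd this (Finset.notMem_empty v)
    have hshare : ∀ v ∈ hfin.toFinset, ∀ e ∈ range (colorEdge vx a b), IsEnd v e →
        ∀ f ∈ range (colorEdge vx a b), IsEnd v f → ℓ f = ℓ e := by
      intro v hv e he hve f hf hvf
      obtain ⟨e', -, -, -, hl, hall⟩ := hd2 v (hno v hv) e he hve
      rcases hall f hf hvf with rfl | rfl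
      · rfl
      · exact hl
    have hconst : ∀ A B, ℓ (colorEdge vx a b B) = ℓ (colorEdge vx a b A) := by
      intro A B
      have := h.conn ∅ A B fun _ hi => absurd hi (Finset.notMem_empty _)
      induction this with
      | refl => rfl
      | @tail B C _ hBC ih =>
        obtain ⟨i, -, hBC⟩ := hBC
        refine Eq.trans ?_ ih
        by_cases hia : i = a
        · exact hshare (vx B b) (by simp) _ ⟨B, rfl⟩ (.inr rfl) _ ⟨C, rfl⟩
            (.inr (hBC b (by simp [hia, hab.symm])))
        · exact hshare (vx B a) (by simp) _ ⟨B, rfl⟩ (.inl rfl) _ ⟨C, rfl⟩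
            (.inl (hBC a (by simp [Ne.symm hia])))
    obtain ⟨_, ⟨A, rfl⟩, hlA⟩ := hlab ⟨_, F₁, rfl⟩
    obtain ⟨_, ⟨B, rfl⟩, hlB⟩ := hlab ⟨_, F₂, rfl⟩
    exact hne (congrArg Subtype.val (hlA.symm.trans ((hconst A B).symm.trans hlB)))
  · obtain ⟨p, q, hpq, hTpq⟩ := Finset.card_eq_two.1 hT2
    have hTiff : ∀ v, v ∈ hfin.toFinset ∧ d v = 3 ↔ v = p ∨ v = q := fun v => by
      simpa only [Finset.mem_filter, Finset.mem_insert, Finset.mem_singleton]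
        using Finset.ext_iff.1 hTpq v
    refine ⟨ℓ, p, q, fun F X hl => ?_, hpq,
      fun i => let ⟨j, _, hj, _⟩ := h3 i; ⟨j, hj⟩, fun r hr j => hd3 r ((hTiff r).2 hr).2 j,
      fun v hvp hvq e he hve => hd2 v (fun h3 => ?_) e he hve, fun i j hij => ?_⟩
    · have h1 := (hmem _ ⟨X, rfl⟩ ⟨_, X, rfl⟩).1 (colorEdge_mem_linkEdges X)
      exact (hmem _ ⟨F, rfl⟩ ⟨_, X, rfl⟩).2 (hl ▸ h1)
    · refine ((hTiff v).1 ⟨?_, h3⟩).elim hvp hvq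
      obtain ⟨F, rfl⟩ := he
      rcases hve with rfl | rfl
      · simp [colorEdge]
      · simp [colorEdge]
    · obtain ⟨e₀, he₀, -, hpe₀, -⟩ := hd3 p ((hTiff p).2 (.inl rfl)).2 i
      have hexh : ∃ x y z, ∀ m : range (linkEdges vx a b), m = x ∨ m = y ∨ m = z := by
        obtain ⟨e', he', hne', -, hall⟩ | ⟨e', -, e'', -, -, -, -, -, hj⟩ :=
          hcases p e₀ ⟨he₀, hpe₀⟩
        · have := two p e₀ ⟨he₀, hpe₀⟩ e' he' hne' hall
          have := ((hTiff p).2 (.inl rfl)).2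
          omega
        · exact ⟨_, _, _, hj⟩
      -- A pole shows that there are only three labels, so the edges labelled i or j form exactly
      -- the cycle of the third label k.
      obtain ⟨k, hki, hkj⟩ : ∃ k, k ≠ i ∧ k ≠ j := by
        obtain ⟨x, y, hx, hy, hxy⟩ := h3 i
        by_cases hxj : x = j
        · exact ⟨y, hy.symm, fun e => hxy (hxj.trans e.symm)⟩
        · exact ⟨x, hx.symm, hxj⟩
      obtain ⟨_, X, rfl⟩ := k
      refine ⟨X, fun e => ⟨fun heX => ?_, fun ⟨he, hl⟩ => ?_⟩⟩
      · have he := linkEdges_subset_range _ heX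
        have hlk := (hmem e he ⟨_, X, rfl⟩).1 heX
        refine ⟨he, ?_⟩
        obtain ⟨x, y, z, hxyz⟩ := hexh
        generalize (⟨_, X, rfl⟩ : range (linkEdges vx a b)) = k at *
        generalize ℓ e = l at *
        by_contra! hcon
        have h1 := hxyz i
        have h2 := hxyz j
        have h4 := hxyz k
        have h5 := hxyz l
        grind
      · refine (hmem e he ⟨_, X, rfl⟩).2 fun hle => ?_
        rcases hl with hl | hl
        · exact hki (hle.symm.trans hl)
        · exact hkj (hle.symm.trans hl)

/-- Either the edges with colours `a` and `b` leave room for the generators of the group of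
holonomies, or they form a spindle. -/
theorem exists_rank_le_or_isSpindle [Finite Φ] {Q : Type*} [Group Q] {g : V → V → Q}
    (hg : ∀ F i j k, g (vx F i) (vx F j) * g (vx F j) (vx F k) = g (vx F i) (vx F k))
    (hab : a ≠ b) {F₀ : Φ}
    (hfull : ∀ q, EdgeHol g (range (colorEdge vx a b)) (vx F₀ a) (vx F₀ a) q) :
    (∃ _ : Group.FG Q, Group.rank Q + faceCount vx {a} + faceCount vx {b} + 2 ≤
      faceCount vx {a, b}) ∨
    (∃ (ℓ : V × V → Bool) (p q : V), IsSpindle vx a b ℓ p q) ∨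
    ∃ (ℓ : V × V → range (linkEdges vx a b)) (p q : V), IsSpindle vx a b ℓ p q := by
  by_cases hA : ∃ F₁ F₂ F₃, ¬linkEdges vx a b F₂ ⊆ linkEdges vx a b F₁ ∧
      ¬linkEdges vx a b F₃ ⊆ linkEdges vx a b F₁ ∪ linkEdges vx a b F₂
  · obtain ⟨F₁, F₂, F₃, h2, h3⟩ := hA
    exact .inl (h.exists_rank_le_of_three hg hab hfull h2 h3)
  push Not at hA
  by_cases heq : ∀ F F', linkEdges vx a b F = linkEdges vx a b F'
  · exact .inr (.inl (h.isSpindle_of_forall_eq hab F₀ heq))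
  push Not at heq
  obtain ⟨F₁, F₂, hne⟩ := heq
  have hcov : ∀ F F', linkEdges vx a b F ≠ linkEdges vx a b F' →
      range (colorEdge vx a b) ⊆ linkEdges vx a b F ∪ linkEdges vx a b F' := by
    rintro F F' hFF _ ⟨G, rfl⟩
    exact hA F F' G (fun hs => hFF (h.linkEdges_eq_of_subset hab hs).symm)
      (colorEdge_mem_linkEdges G)
  rcases h.isSpindle_or_le_of_cover hab hne hcov with hs | hle
  · exact .inr (.inr hs)
  left
  -- Two distinct cycles across a wall cover the graph, so the group is trivial, its rank is 0, and
  -- the edge count alone gives the bound.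
  obtain ⟨X, i, -, -, hX⟩ := h.exists_linkEdges_cross_ne hne
  have htriv := h.subsingleton_of_cover hg (hcov _ _ hX) hfull
  have hcl : Subgroup.closure ((∅ : Finset Q) : Set Q) = ⊤ :=
    (Subgroup.eq_top_iff' _).2 fun q => htriv q ▸ one_mem _
  have hFG : Group.FG Q := ⟨⟨∅, hcl⟩⟩
  have hr : Group.rank Q ≤ 0 := Group.rank_le hcl
  exact ⟨hFG, by omega⟩

end IsChamberSystem

end Spindle

/-! ### Paths in graphs of degree two with two ends. -/

section Arcs

open Classical Set

variable {V : Type*}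

theorem IsEnd.eq_or_eq_or_eq {e : V × V} {u v x : V} (hu : IsEnd u e) (hv : IsEnd v e)
    (hx : IsEnd x e) : u = v ∨ u = x ∨ v = x := by
  unfold IsEnd at *
  grind

/-- A path of edges in `D` starting at `p`. -/
structure IsArc (D : Set (V × V)) (p : V) (n : ℕ) (w : ℕ → V) : Prop where
  zero : w 0 = p
  inj : ∀ i, i ≤ n → ∀ j, j ≤ n → w i = w j → i = j
  edge : ∀ k, k < n → ∃ e ∈ D, IsEnd (w k) e ∧ IsEnd (w (k + 1)) e

variable {D : Set (V × V)} {p q : V}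

/-- The arc uses one edge at p and two at each later vertex before its last, and the degree
conditions leave no other. -/
theorem IsArc.exists_edge_of_lt {n : ℕ} {w : ℕ → V} (hw : IsArc D p n w)
    (hp : ∃ e ∈ D, IsEnd p e ∧ ∀ f ∈ D, IsEnd p f → f = e)
    (hq : ∃ e ∈ D, IsEnd q e ∧ ∀ f ∈ D, IsEnd q f → f = e)
    (hv : ∀ v, v ≠ p → v ≠ q → ∀ e ∈ D, IsEnd v e → ∃ e' ∈ D, IsEnd v e' ∧ e' ≠ e ∧
      ∀ f ∈ D, IsEnd v f → f = e ∨ f = e')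
    {i : ℕ} (hi : i < n) {f : V × V} (hf : f ∈ D) (hif : IsEnd (w i) f) :
    ∃ k, k < n ∧ IsEnd (w k) f ∧ IsEnd (w (k + 1)) f := by
  obtain ⟨e, he, h1, h2⟩ := hw.edge i hi
  rcases Nat.eq_zero_or_pos i with rfl | hi0
  · obtain ⟨e₀, -, -, hall⟩ := hp
    rw [hw.zero] at h1 hif
    rw [← hw.zero] at h1
    have : f = e := (hall f hf hif).trans (hall e he (hw.zero ▸ h1)).symm
    exact ⟨0, hi, this ▸ h1, this ▸ h2⟩
  obtain ⟨i, rfl⟩ : ∃ j, i = j + 1 := ⟨i - 1, by omega⟩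
  obtain ⟨e', he', h1', h2'⟩ := hw.edge i (by omega)
  have hee : e' ≠ e := by
    rintro rfl
    rcases h1'.eq_or_eq_or_eq h1 h2 with e | e | e
    · have := hw.inj _ (by omega) _ (by omega) e; omega
    · have := hw.inj _ (by omega) _ (by omega) e; omega
    · have := hw.inj _ (by omega) _ (by omega) e; omega
  have hwp : w (i + 1) ≠ p := fun e => by
    have := hw.inj _ (by omega) 0 (by omega) (e.trans hw.zero.symm); omega
  have hwq : w (i + 1) ≠ q := by
    rintro e₁
    obtain ⟨e₀, -, -, hall⟩ := hq
    exact hee ((hall _ he' (e₁ ▸ h2')).trans (hall _ he (e₁ ▸ h1)).symm)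
  obtain ⟨e'', -, -, -, hall⟩ := hv _ hwp hwq e he h1
  have h3 : e' = e'' := (hall e' he' h2').resolve_left hee
  rcases hall f hf hif with rfl | rfl
  · exact ⟨i + 1, hi, h1, h2⟩
  · exact ⟨i, by omega, h3 ▸ h1', h3 ▸ h2'⟩

/-- A longest arc from p cannot be extended. An edge at its last vertex leads back to the arc, hence
is an arc edge by `IsArc.exists_edge_of_lt`; so the last vertex has degree one and is q. -/
theorem exists_arc [Finite V] (hD : ∀ e ∈ D, e.1 ≠ e.2)
    (hu : ∀ e ∈ D, ∀ f ∈ D, ∀ u w, u ≠ w → IsEnd u e → IsEnd w e → IsEnd u f → IsEnd w f → e = f)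
    (hp : ∃ e ∈ D, IsEnd p e ∧ ∀ f ∈ D, IsEnd p f → f = e)
    (hq : ∃ e ∈ D, IsEnd q e ∧ ∀ f ∈ D, IsEnd q f → f = e)
    (hv : ∀ v, v ≠ p → v ≠ q → ∀ e ∈ D, IsEnd v e → ∃ e' ∈ D, IsEnd v e' ∧ e' ≠ e ∧
      ∀ f ∈ D, IsEnd v f → f = e ∨ f = e') :
    ∃ n w, IsArc D p n w ∧ w n = q ∧ ∀ i, i ≤ n → ∀ f ∈ D, IsEnd (w i) f →
      ∃ k, k < n ∧ IsEnd (w k) f ∧ IsEnd (w (k + 1)) f := by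
  have hotherEnd : ∀ e ∈ D, ∀ v, IsEnd v e → ∃ x, x ≠ v ∧ IsEnd x e := by
    rintro e he v (rfl | rfl)
    · exact ⟨e.2, (hD e he).symm, .inr rfl⟩
    · exact ⟨e.1, hD e he, .inl rfl⟩
  have hbound : ∀ n w, IsArc D p n w → n ≤ Nat.card V := fun n w hw => by
    have : Function.Injective fun i : Fin (n + 1) => w i := fun i j hij =>
      Fin.ext (hw.inj i (by omega) j (by omega) hij)
    have := Nat.card_le_card_of_injective _ this
    simp at this
    omega
  have hex : ∃ n, ∃ w, IsArc D p n w :=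
    ⟨0, fun _ => p, rfl, fun i hi j hj _ => by omega, fun k hk => by omega⟩
  obtain ⟨n, ⟨w, hw⟩, hmax⟩ : ∃ n, (∃ w, IsArc D p n w) ∧ ∀ m, (∃ w, IsArc D p m w) → m ≤ n := by
    refine ⟨Nat.findGreatest (fun n => ∃ w, IsArc D p n w) (Nat.card V), ?_, fun m hm => ?_⟩
    · obtain ⟨n, hn⟩ := hex
      exact Nat.findGreatest_spec (P := fun n => ∃ w, IsArc D p n w)
        (hbound n _ hn.choose_spec) hn
    · exact Nat.le_findGreatest (hbound m _ hm.choose_spec) hm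
  have hext : ∀ x e, e ∈ D → IsEnd (w n) e → IsEnd x e → ∃ i, i ≤ n ∧ w i = x := by
    intro x e he h1 h2
    by_contra! hx
    have : n + 1 ≤ n := hmax _ ⟨fun k => if k ≤ n then w k else x, ?_, fun i hi j hj => ?_,
      fun k hk => ?_⟩
    · omega
    · simp [hw.zero]
    · by_cases h3 : i ≤ n <;> by_cases h4 : j ≤ n <;> simp only [h3, h4, if_true, if_false]
      · exact hw.inj i h3 j h4
      · exact fun e => absurd e (hx i h3)
      · exact fun e => absurd e.symm (hx j h4)
      · intro; omega
    · by_cases h3 : k + 1 ≤ n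
      · simpa [h3, (by omega : k ≤ n)] using hw.edge k (by omega)
      · obtain rfl : k = n := by omega
        exact ⟨e, he, by simpa using h1, by simpa using h2⟩
  have hn : 0 < n := by
    by_contra hn
    obtain ⟨e, he, hpe, -⟩ := hp
    obtain ⟨x, hxp, hx⟩ := hotherEnd e he p hpe
    obtain rfl : n = 0 := by omega
    obtain ⟨i, hi, hix⟩ := hext x e he (hw.zero.symm ▸ hpe) hx
    obtain rfl : i = 0 := by omega
    exact hxp (hix.symm.trans hw.zero)
  obtain ⟨n, rfl⟩ : ∃ m, n = m + 1 := ⟨n - 1, by omega⟩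
  obtain ⟨e, he, h1, h2⟩ := hw.edge n (by omega)
  have hlast : ∀ f ∈ D, IsEnd (w (n + 1)) f → f = e := by
    intro f hf hnf
    obtain ⟨x, hxw, hx⟩ := hotherEnd f hf _ hnf
    obtain ⟨i, hi, rfl⟩ := hext x f hf hnf hx
    have hin : i < n + 1 := lt_of_le_of_ne hi fun e => hxw (e ▸ rfl)
    obtain ⟨k, hk, hk1, hk2⟩ := hw.exists_edge_of_lt hp hq hv hin hf hx
    have hnk : n + 1 = k + 1 := by
      rcases hnf.eq_or_eq_or_eq hk1 hk2 with e | e | e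
      · have := hw.inj _ le_rfl _ (by omega) e; omega
      · exact hw.inj _ le_rfl _ (by omega) e
      · have := hw.inj _ (by omega) _ (by omega) e; omega
    obtain rfl : n = k := by omega
    exact hu f hf e he _ _ (fun e => by have := hw.inj _ (by omega) _ (by omega) e; omega)
      hk1 hk2 h1 h2
  have hwq : w (n + 1) = q := by
    by_contra hne
    have hwp : w (n + 1) ≠ p := fun e => by
      have := hw.inj _ (by omega) 0 (by omega) (e.trans hw.zero.symm); omega
    obtain ⟨e', he', hve', hne', -⟩ := hv _ hwp hne e he h2
    exact hne' (hlast e' he' hve')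
  refine ⟨n + 1, w, hw, hwq, fun i hi f hf hif => ?_⟩
  rcases Nat.lt_or_ge i (n + 1) with hin | hin
  · exact hw.exists_edge_of_lt hp hq hv hin hf hif
  · obtain rfl : i = n + 1 := by omega
    obtain rfl := hlast f hf hif
    exact ⟨n, by omega, h1, h2⟩

end Arcs

/-! ### Heights along the paths of a spindle. -/

section Heights

open Classical Set

variable {Φ V J : Type*} {vx : Φ → Fin 5 → V} {a b : Fin 5} {ℓ : V × V → J} {p q : V}

theorem IsChamberSystem.colorEdge_ne (h : IsChamberSystem vx) (hab : a ≠ b) {e : V × V}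
    (he : e ∈ range (colorEdge vx a b)) : e.1 ≠ e.2 := by
  obtain ⟨F, rfl⟩ := he
  exact fun e => hab (h.color F F a b e)

theorem IsChamberSystem.edge_eq_of_isEnd (h : IsChamberSystem vx) (hab : a ≠ b) {e f : V × V}
    (he : e ∈ range (colorEdge vx a b)) (hf : f ∈ range (colorEdge vx a b)) {u w : V}
    (huw : u ≠ w) (h1 : IsEnd u e) (h2 : IsEnd w e) (h3 : IsEnd u f) (h4 : IsEnd w f) : e = f := by
  have hd : ∀ x ∈ range (colorEdge vx a b), ∀ y ∈ range (colorEdge vx a b), x.1 ≠ y.2 := by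
    rintro _ ⟨F, rfl⟩ _ ⟨G, rfl⟩ e
    exact hab (h.color F G a b e)
  have d1 := hd e he f hf
  have d2 := hd f hf e he
  unfold IsEnd at *
  refine Prod.ext ?_ ?_ <;> grind

/-- Each label of a spindle singles out a path between the poles. -/
theorem IsSpindle.exists_arcs [Finite V] (hs : IsSpindle vx a b ℓ p q) (h : IsChamberSystem vx)
    (hab : a ≠ b) :
    ∃ (n : J → ℕ) (w : J → ℕ → V),
      (∀ j, IsArc {e ∈ range (colorEdge vx a b) | ℓ e = j} p (n j) (w j) ∧ w j (n j) = q) ∧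
      (∀ e ∈ range (colorEdge vx a b),
        ∃ k, k < n (ℓ e) ∧ IsEnd (w (ℓ e) k) e ∧ IsEnd (w (ℓ e) (k + 1)) e) ∧
      ∀ i j k l, k ≤ n i → l ≤ n j → w i k = w j l → (k : ℝ) / n i = (l : ℝ) / n j := by
  have hpole : ∀ r, r = p ∨ r = q → ∀ j, ∃ e ∈ {e ∈ range (colorEdge vx a b) | ℓ e = j},
      IsEnd r e ∧ ∀ f ∈ {e ∈ range (colorEdge vx a b) | ℓ e = j}, IsEnd r f → f = e := by
    intro r hr j
    obtain ⟨e, he, hl, hre, hall⟩ := hs.pole r hr j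
    exact ⟨e, ⟨he, hl⟩, hre, fun f hf hrf => hall f hf.1 hrf hf.2⟩
  have hex := fun j => exists_arc (D := {e ∈ range (colorEdge vx a b) | ℓ e = j}) (p := p) (q := q)
    (fun e he => h.colorEdge_ne hab he.1)
    (fun e he f hf u w huw => h.edge_eq_of_isEnd hab he.1 hf.1 huw)
    (hpole p (.inl rfl) j) (hpole q (.inr rfl) j) (fun v hvp hvq e he hve => by
      obtain ⟨e', he', hve', hne, hl, hall⟩ := hs.other v hvp hvq e he.1 hve
      exact ⟨e', ⟨he', hl.trans he.2⟩, hve', hne, fun f hf => hall f hf.1⟩)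
  choose n w hw hwq hcl using hex
  have hn : ∀ j, 0 < n j := fun j => by
    by_contra hn
    have : n j = 0 := by omega
    exact hs.ne ((hw j).zero.symm.trans (this ▸ hwq j))
  have hcl' : ∀ f ∈ range (colorEdge vx a b), ∀ i, i ≤ n (ℓ f) → IsEnd (w (ℓ f) i) f →
      ∃ k, k < n (ℓ f) ∧ IsEnd (w (ℓ f) k) f ∧ IsEnd (w (ℓ f) (k + 1)) f := fun f hf i hi hif =>
    hcl _ i hi f ⟨hf, rfl⟩ hif
  refine ⟨n, w, fun j => ⟨hw j, hwq j⟩, fun f hf => ?_, fun i j k l hk hl e => ?_⟩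
  · obtain ⟨j, hj⟩ := hs.exists_ne (ℓ f)
    obtain ⟨X, hX⟩ := hs.conn _ j hj
    obtain ⟨e₀, ⟨he₀, hl₀⟩, hpe₀, -⟩ := hpole p (.inl rfl) j
    -- The cycle with the labels of f and j contains the edge of label j at p, which lies on its
    -- arc. Along this cycle the property of lying on the arc of one's own label spreads, at the
    -- poles because all arcs pass there.
    refine h.linkEdges_chain hab (X := X) (P := fun f => ∃ k, k < n (ℓ f) ∧
        IsEnd (w (ℓ f) k) f ∧ IsEnd (w (ℓ f) (k + 1)) f) ((hX e₀).2 ⟨he₀, .inr hl₀⟩)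
      ((hX f).2 ⟨hf, .inl rfl⟩) (hcl' e₀ he₀ 0 (Nat.zero_le _) ((hw _).zero.symm ▸ hpe₀)) ?_
    intro e₁ h₁ e₂ h₂ v hv₁ hv₂ ⟨k, hk, hk1, hk2⟩
    replace h₁ := ((hX _).1 h₁).1
    replace h₂ := ((hX _).1 h₂).1
    by_cases hvp : v = p
    · exact hcl' e₂ h₂ 0 (Nat.zero_le _) ((hw _).zero.symm ▸ hvp ▸ hv₂)
    by_cases hvq : v = q
    · exact hcl' e₂ h₂ _ le_rfl ((hwq _).symm ▸ hvq ▸ hv₂)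
    have hl : ℓ e₂ = ℓ e₁ := by
      obtain ⟨e', -, -, -, hl, hall⟩ := hs.other v hvp hvq e₁ h₁ hv₁
      rcases hall e₂ h₂ hv₂ with rfl | rfl
      · rfl
      · exact hl
    rcases hv₁.eq_or_eq_or_eq hk1 hk2 with e | e | e
    · exact hcl' e₂ h₂ k (hl ▸ hk.le) (hl ▸ e ▸ hv₂)
    · exact hcl' e₂ h₂ (k + 1) (hl ▸ hk) (hl ▸ e ▸ hv₂)
    · have := (hw _).inj _ hk.le _ hk e
      omega
  -- Distinct arcs meet only in the poles, where the relative positions are 0 and 1, so the relative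
  -- position depends on the vertex alone.
  · have hni : (n i : ℝ) ≠ 0 := by exact_mod_cast (hn i).ne'
    have hnj : (n j : ℝ) ≠ 0 := by exact_mod_cast (hn j).ne'
    by_cases hkp : w i k = p
    · have e1 := (hw i).inj k hk 0 (Nat.zero_le _) (hkp.trans (hw i).zero.symm)
      have e2 := (hw j).inj l hl 0 (Nat.zero_le _) (e.symm.trans (hkp.trans (hw j).zero.symm))
      simp [e1, e2]
    by_cases hkq : w i k = q
    · have e1 := (hw i).inj k hk _ le_rfl (hkq.trans (hwq i).symm)
      have e2 := (hw j).inj l hl _ le_rfl (e.symm.trans (hkq.trans (hwq j).symm))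
      rw [e1, e2, div_self hni, div_self hnj]
    have hk' : k < n i := lt_of_le_of_ne hk fun e => hkq (e ▸ hwq i)
    have hl' : l < n j := lt_of_le_of_ne hl fun e' => hkq (e.trans (e' ▸ hwq j))
    obtain ⟨f, ⟨hf, hfi⟩, hf1, -⟩ := (hw i).edge k hk'
    obtain ⟨g, ⟨hg, hgj⟩, hg1, -⟩ := (hw j).edge l hl'
    have hij : j = i := by
      obtain ⟨e', -, -, -, hl, hall⟩ := hs.other _ hkp hkq f hf hf1
      rcases hall g hg (e ▸ hg1) with rfl | rfl
      · exact hgj.symm.trans hfi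
      · exact hgj.symm.trans (hl.trans hfi)
    subst hij
    rw [(hw _).inj k hk l hl e]

/-- A height function along the paths of a spindle. -/
structure IsHeight (vx : Φ → Fin 5 → V) (a b : Fin 5) (ℓ : V × V → J) (p q : V) (ht : V → ℝ) :
    Prop where
  left : ht p = 1
  right : ht q = -1
  abs_lt : ∀ e ∈ range (colorEdge vx a b), ∀ v, IsEnd v e → v ≠ p → v ≠ q → |ht v| < 1
  inj : ∀ e ∈ range (colorEdge vx a b), ∀ f ∈ range (colorEdge vx a b), ℓ e = ℓ f →
    ∀ u v, IsEnd u e → IsEnd v f → ht u = ht v → u = v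
  exists_eq : ∀ j, ∀ c, |c| ≤ 1 → ∃ e ∈ range (colorEdge vx a b), ℓ e = j ∧
    ∃ t : ℝ, 0 ≤ t ∧ t ≤ 1 ∧ c = t * ht e.1 + (1 - t) * ht e.2
  separated : ∀ e ∈ range (colorEdge vx a b), ∀ f ∈ range (colorEdge vx a b), ℓ e = ℓ f → e ≠ f →
    ∃ c, (∀ v, IsEnd v e → ht v ≤ c) ∧ (∀ v, IsEnd v f → c ≤ ht v) ∨
      (∀ v, IsEnd v f → ht v ≤ c) ∧ (∀ v, IsEnd v e → c ≤ ht v)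

theorem IsSpindle.exists_height [Finite V] [Nonempty J] (hs : IsSpindle vx a b ℓ p q) (h : IsChamberSystem vx)
    (hab : a ≠ b) : ∃ ht : V → ℝ, IsHeight vx a b ℓ p q ht := by
  obtain ⟨n, w, hw, hcov, hwd⟩ := hs.exists_arcs h hab
  have hn : ∀ j, 0 < n j := fun j => by
    by_contra hn
    have : n j = 0 := by omega
    exact hs.ne ((hw j).1.zero.symm.trans (this ▸ (hw j).2))
  have hn' : ∀ j, (0 : ℝ) < n j := fun j => by exact_mod_cast hn j
  -- The height falls in equal steps from 1 at p to -1 at q. Vertices on no arc receive the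
  -- irrelevant value 0.
  let ht : V → ℝ := fun v => if hv : ∃ x : J × ℕ, x.2 ≤ n x.1 ∧ w x.1 x.2 = v then
    1 - 2 * (hv.choose.2 / n hv.choose.1 : ℝ) else 0
  have hht : ∀ j k, k ≤ n j → ht (w j k) = 1 - 2 * (k / n j : ℝ) := by
    intro j k hk
    have hv : ∃ x : J × ℕ, x.2 ≤ n x.1 ∧ w x.1 x.2 = w j k := ⟨(j, k), hk, rfl⟩
    simp only [ht, dif_pos hv]
    rw [hwd _ _ _ _ hv.choose_spec.1 hk hv.choose_spec.2]
  have hends : ∀ e ∈ range (colorEdge vx a b), ∀ v, IsEnd v e → ∃ k, k ≤ n (ℓ e) ∧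
      w (ℓ e) k = v := by
    intro e he v hv
    obtain ⟨k, hk, h1, h2⟩ := hcov e he
    rcases hv.eq_or_eq_or_eq h1 h2 with e | e | e
    · exact ⟨k, hk.le, e.symm⟩
    · exact ⟨k + 1, hk, e.symm⟩
    · have := (hw _).1.inj _ hk.le _ hk e
      omega
  obtain ⟨j₀⟩ := ‹Nonempty J›
  have hfrac : ∀ j (k l : ℕ), k ≤ l → (k / n j : ℝ) ≤ l / n j := fun j k l hkl =>
    div_le_div_of_nonneg_right (by exact_mod_cast hkl) (hn' j).le
  have hsep : ∀ e ∈ range (colorEdge vx a b), ∀ f ∈ range (colorEdge vx a b), ℓ e = ℓ f →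
      ∀ k l, k < l → l < n (ℓ f) → IsEnd (w (ℓ e) k) e → IsEnd (w (ℓ e) (k + 1)) e →
      IsEnd (w (ℓ f) l) f → IsEnd (w (ℓ f) (l + 1)) f →
      ∃ c, (∀ v, IsEnd v f → ht v ≤ c) ∧ ∀ v, IsEnd v e → c ≤ ht v := by
    intro e he f hf hl k l hkl hln h1 h2 h3 h4
    rw [hl] at h1 h2
    refine ⟨ht (w (ℓ f) l), fun v hv => ?_, fun v hv => ?_⟩
    · rcases hv.eq_or_eq_or_eq h3 h4 with e | e | e
      · rw [e]
      · rw [e, hht _ _ hln, hht _ _ hln.le]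
        linarith [hfrac (ℓ f) l (l + 1) (by omega)]
      · have := (hw _).1.inj _ hln.le _ hln e
        omega
    · rcases hv.eq_or_eq_or_eq h1 h2 with e | e | e
      · rw [e, hht _ _ hln.le, hht _ _ (by omega)]
        linarith [hfrac (ℓ f) k l (by omega)]
      · rw [e, hht _ _ hln.le, hht _ _ (by omega)]
        linarith [hfrac (ℓ f) (k + 1) l (by omega)]
      · have := (hw _).1.inj k (by omega) (k + 1) (by omega) e
        omega
  refine ⟨ht, ?_, ?_, fun e he v hv hvp hvq => ?_, fun e he f hf hl u v hu hv huv => ?_,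
    fun j c hc => ?_, fun e he f hf hl hef => ?_⟩
  · rw [← (hw j₀).1.zero, hht _ _ (Nat.zero_le _)]
    simp
  · rw [← (hw j₀).2, hht _ _ le_rfl, div_self (hn' _).ne']
    norm_num
  · obtain ⟨k, hk, rfl⟩ := hends e he v hv
    have hk0 : 0 < k := Nat.pos_of_ne_zero fun e => hvp (e ▸ (hw _).1.zero)
    have hkn : k < n (ℓ e) := lt_of_le_of_ne hk fun h => hvq (h ▸ (hw _).2)
    rw [hht _ _ hk, abs_lt]
    have h1 : (0 : ℝ) < k / n (ℓ e) := div_pos (by exact_mod_cast hk0) (hn' _)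
    have h2 : (k / n (ℓ e) : ℝ) < 1 := (div_lt_one (hn' _)).2 (by exact_mod_cast hkn)
    constructor <;> linarith
  · obtain ⟨k, hk, rfl⟩ := hends e he u hu
    obtain ⟨l, hl', rfl⟩ := hends f hf v hv
    rw [hl] at hk huv ⊢
    rw [hht _ _ hk, hht _ _ hl'] at huv
    have : (k : ℝ) / n (ℓ f) = l / n (ℓ f) := by linarith
    rw [div_left_inj' (hn' _).ne', Nat.cast_inj] at this
    rw [this]
  · have hex : ∃ k : ℕ, 1 - 2 * ((k + 1 : ℕ) / n j : ℝ) ≤ c := by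
      refine ⟨n j - 1, ?_⟩
      rw [Nat.sub_add_cancel (hn j), div_self (hn' _).ne']
      linarith [(abs_le.1 hc).1]
    -- The first edge whose lower end has height at most c; minimality keeps its upper end at height
    -- at least c.
    obtain ⟨k, hk, hmin⟩ : ∃ k : ℕ, 1 - 2 * ((k + 1 : ℕ) / n j : ℝ) ≤ c ∧
        ∀ m : ℕ, m < k → ¬ 1 - 2 * ((m + 1 : ℕ) / n j : ℝ) ≤ c :=
      ⟨Nat.find hex, Nat.find_spec hex, fun m hm => Nat.find_min hex hm⟩
    have hkn : k < n j := by
      by_contra hcon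
      refine hmin (n j - 1) (by have := hn j; omega) ?_
      rw [Nat.sub_add_cancel (hn j), div_self (hn' _).ne']
      linarith [(abs_le.1 hc).1]
    have hk' : c ≤ 1 - 2 * (k / n j : ℝ) := by
      rcases Nat.eq_zero_or_pos k with rfl | hk0
      · simpa using (abs_le.1 hc).2
      · have := hmin (k - 1) (by omega)
        rw [Nat.sub_add_cancel hk0] at this
        exact (not_le.1 this).le
    obtain ⟨e, ⟨he, hl⟩, h1, h2⟩ := (hw j).1.edge k hkn
    have hA := hht j k hkn.le
    have hB := hht j (k + 1) hkn
    have hAB : ht (w j k) - ht (w j (k + 1)) = 2 / n j := by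
      rw [hA, hB]; push_cast; ring
    have hpos : (0 : ℝ) < 2 / n j := div_pos two_pos (hn' j)
    rw [← hA] at hk'
    rw [← hB] at hk
    have hne : w j k ≠ w j (k + 1) := fun e => by
      have := (hw j).1.inj _ hkn.le _ hkn e
      omega
    have key : ∃ s : ℝ, 0 ≤ s ∧ s ≤ 1 ∧ c = s * ht (w j k) + (1 - s) * ht (w j (k + 1)) := by
      refine ⟨(c - ht (w j (k + 1))) / (ht (w j k) - ht (w j (k + 1))), ?_, ?_, ?_⟩
      · exact div_nonneg (by linarith) (by linarith)
      · exact div_le_one_of_le₀ (by linarith) (by linarith)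
      · have : ht (w j k) - ht (w j (k + 1)) ≠ 0 := by linarith
        field_simp
        ring
    obtain ⟨s, hs0, hs1, hs⟩ := key
    refine ⟨e, he, hl, ?_⟩
    rcases h1 with h1 | h1 <;> rcases h2 with h2 | h2
    · exact absurd (h1.trans h2.symm) hne
    · exact ⟨s, hs0, hs1, by rw [← h1, ← h2]; exact hs⟩
    · exact ⟨1 - s, by linarith, by linarith, by rw [← h1, ← h2]; linarith⟩
    · exact absurd (h1.trans h2.symm) hne
  · obtain ⟨k, hk, hk1, hk2⟩ := hcov e he
    obtain ⟨l, hl', hl1, hl2⟩ := hcov f hf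
    rcases lt_trichotomy k l with hkl | hkl | hkl
    · obtain ⟨c, hc⟩ := hsep e he f hf hl k l hkl hl' hk1 hk2 hl1 hl2
      exact ⟨c, .inr hc⟩
    · subst hkl
      rw [hl] at hk1 hk2
      refine absurd (h.edge_eq_of_isEnd hab he hf (fun e => ?_) hk1 hk2 hl1 hl2) hef
      have := (hw _).1.inj _ hl'.le _ hl' e
      omega
    · obtain ⟨c, hc⟩ := hsep f hf e he hl.symm l k hkl hk hl1 hl2 hk1 hk2
      exact ⟨c, .inl hc⟩

end Heights

/-! ### Continuous invariants of points of the complex. -/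

section Coordinates

open Classical Set

variable {Φ V J : Type*} {vx : Φ → Fin 5 → V} {a b : Fin 5} {ℓ : V × V → J} {p q : V} {ht : V → ℝ}

/-- The vertices with colour `a` or `b`. -/
def edgeVertices (vx : Φ → Fin 5 → V) (a b : Fin 5) : Set V :=
  {v | ∃ e ∈ range (colorEdge vx a b), IsEnd v e}

/-- The coordinates which belong to the colours other than `a` and `b`. -/
noncomputable def offEdge (vx : Φ → Fin 5 → V) (a b : Fin 5) (z : V → ℝ) (v : V) : ℝ :=
  if v ∈ edgeVertices vx a b then 0 else z v

/-- The total height of the coordinates with colours `a` and `b`. -/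
noncomputable def totalHeight [Fintype V] (vx : Φ → Fin 5 → V) (a b : Fin 5) (ht : V → ℝ)
    (z : V → ℝ) : ℝ :=
  ∑ v, if v ∈ edgeVertices vx a b then z v * ht v else 0

/-- The part of the mass on an edge which is not accounted for by the height. -/
noncomputable def edgeExcess (ht : V → ℝ) (z : V → ℝ) (e : V × V) : ℝ :=
  z e.1 + z e.2 - |z e.1 * ht e.1 + z e.2 * ht e.2|

/-- The excess on the path with the label `j`. -/
noncomputable def pathExcess (vx : Φ → Fin 5 → V) (a b : Fin 5) (ℓ : V × V → J) (ht : V → ℝ)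
    (z : V → ℝ) (j : J) : ℝ :=
  ⨆ e : {e : V × V // e ∈ range (colorEdge vx a b) ∧ ℓ e = j}, edgeExcess ht z e

theorem mem_edgeVertices_of_isEnd {v : V} {F : Φ} (h : IsEnd v (colorEdge vx a b F)) :
    v ∈ edgeVertices vx a b := ⟨_, ⟨F, rfl⟩, h⟩

theorem mem_range_of_isEnd {v : V} {F : Φ} (h : IsEnd v (colorEdge vx a b F)) :
    v ∈ range (vx F) := by
  rcases h with rfl | rfl
  exacts [⟨a, rfl⟩, ⟨b, rfl⟩]

namespace IsChamberSystem

variable (h : IsChamberSystem vx)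
include h

theorem isEnd_of_mem_edgeVertices {v : V} (hv : v ∈ edgeVertices vx a b) {F : Φ}
    (hF : v ∈ range (vx F)) : IsEnd v (colorEdge vx a b F) := by
  obtain ⟨_, ⟨G, rfl⟩, hG⟩ := hv
  obtain ⟨i, rfl⟩ := hF
  rcases hG with hG | hG
  · exact .inl (h.color _ _ _ _ hG ▸ rfl)
  · exact .inr (h.color _ _ _ _ hG ▸ rfl)

omit h in
theorem mem_range_of_agreeOn {F F' : Φ} (hF : AgreeOn vx ((Finset.univ.erase a).erase b) F F')
    {v : V} (hv : v ∉ edgeVertices vx a b) (hvF : v ∈ range (vx F)) : v ∈ range (vx F') := by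
  obtain ⟨i, rfl⟩ := hvF
  refine ⟨i, (hF i ?_).symm⟩
  simp only [Finset.mem_erase, Finset.mem_univ, and_true]
  constructor
  · rintro rfl
    exact hv (mem_edgeVertices_of_isEnd (F := F) (.inr rfl))
  · rintro rfl
    exact hv (mem_edgeVertices_of_isEnd (F := F) (.inl rfl))

variable [Fintype V]

/-- A facet has exactly one vertex of colour a and one of colour b. -/
theorem sum_edgeVertices (hab : a ≠ b) {F : Φ} {z : V → ℝ} (hz : ∀ v ∉ range (vx F), z v = 0)
    (g : V → ℝ) : ∑ v, (if v ∈ edgeVertices vx a b then z v * g v else 0) =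
      z (vx F a) * g (vx F a) + z (vx F b) * g (vx F b) := by
  have hA : vx F a ∈ edgeVertices vx a b := mem_edgeVertices_of_isEnd (F := F) (.inl rfl)
  have hB : vx F b ∈ edgeVertices vx a b := mem_edgeVertices_of_isEnd (F := F) (.inr rfl)
  rw [Finset.sum_eq_add (vx F a) (vx F b) (fun e => hab (h.color _ _ _ _ e)), if_pos hA, if_pos hB]
  · rintro v - ⟨hva, hvb⟩
    split_ifs with hv
    · rw [hz v fun hvF => ?_, zero_mul]
      exact (h.isEnd_of_mem_edgeVertices hv hvF).elim hva hvb
    · rfl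
  · exact fun h => absurd (Finset.mem_univ _) h
  · exact fun h => absurd (Finset.mem_univ _) h

theorem sum_eq_add_offEdge (hab : a ≠ b) {F : Φ} {z : V → ℝ} (hz : ∀ v ∉ range (vx F), z v = 0) :
    ∑ v, z v = z (vx F a) + z (vx F b) + ∑ v, offEdge vx a b z v := by
  have := h.sum_edgeVertices hab hz 1
  simp only [Pi.one_apply, mul_one] at this
  rw [← this, ← Finset.sum_add_distrib]
  refine Finset.sum_congr rfl fun v _ => ?_
  unfold offEdge
  split_ifs <;> simp

theorem totalHeight_eq (hab : a ≠ b) {F : Φ} {z : V → ℝ} (hz : ∀ v ∉ range (vx F), z v = 0) :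
    totalHeight vx a b ht z = z (vx F a) * ht (vx F a) + z (vx F b) * ht (vx F b) :=
  h.sum_edgeVertices hab hz ht

theorem edgeExcess_eq (hab : a ≠ b) {F : Φ} {z : V → ℝ} (hz : ∀ v ∉ range (vx F), z v = 0) :
    edgeExcess ht z (colorEdge vx a b F) =
      z (vx F a) + z (vx F b) - |totalHeight vx a b ht z| := by
  rw [h.totalHeight_eq hab hz]
  rfl

end IsChamberSystem

theorem IsHeight.abs_le (hh : IsHeight vx a b ℓ p q ht) {v : V} (hv : v ∈ edgeVertices vx a b) :
    |ht v| ≤ 1 := by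
  obtain ⟨e, he, hv⟩ := hv
  by_cases hp : v = p
  · rw [hp, hh.left, abs_one]
  by_cases hq : v = q
  · rw [hq, hh.right, abs_neg, abs_one]
  · exact (hh.abs_lt e he v hv hp hq).le

/-- By the triangle inequality the excess is at least the sum of z(1 - |height|) over both ends, and
these terms are non-negative. -/
theorem IsHeight.mul_le_edgeExcess (hh : IsHeight vx a b ℓ p q ht) {z : V → ℝ} (hz : ∀ v, 0 ≤ z v)
    {e : V × V} (he : e ∈ range (colorEdge vx a b)) {v : V} (hv : IsEnd v e) :
    z v * (1 - |ht v|) ≤ edgeExcess ht z e := by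
  have h1 : ∀ u, IsEnd u e → 0 ≤ z u * (1 - |ht u|) := fun u hu =>
    mul_nonneg (hz u) (by linarith [hh.abs_le ⟨e, he, hu⟩])
  have h2 : z e.1 * (1 - |ht e.1|) + z e.2 * (1 - |ht e.2|) ≤ edgeExcess ht z e := by
    have := abs_add_le (z e.1 * ht e.1) (z e.2 * ht e.2)
    rw [abs_mul, abs_mul, abs_of_nonneg (hz _), abs_of_nonneg (hz _)] at this
    unfold edgeExcess
    linarith
  have h3 := h1 e.1 (.inl rfl)
  have h4 := h1 e.2 (.inr rfl)
  rcases hv with rfl | rfl <;> linarith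

theorem IsHeight.edgeExcess_nonneg (hh : IsHeight vx a b ℓ p q ht) {z : V → ℝ} (hz : ∀ v, 0 ≤ z v)
    {e : V × V} (he : e ∈ range (colorEdge vx a b)) : 0 ≤ edgeExcess ht z e :=
  (mul_nonneg (hz e.1) (by linarith [hh.abs_le ⟨e, he, .inl rfl⟩])).trans
    (hh.mul_le_edgeExcess hz he (.inl rfl))

theorem IsHeight.eq_zero_of_edgeExcess (hh : IsHeight vx a b ℓ p q ht) (h : IsChamberSystem vx)
    {z : V → ℝ} (hz : ∀ v, 0 ≤ z v) {F : Φ} (hzF : ∀ v ∉ range (vx F), z v = 0)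
    (h0 : edgeExcess ht z (colorEdge vx a b F) = 0) {v : V} (hv : v ∈ edgeVertices vx a b)
    (hp : v ≠ p) (hq : v ≠ q) : z v = 0 := by
  by_contra hne
  have hvF := h.isEnd_of_mem_edgeVertices hv (not_not.1 fun hn => hne (hzF v hn))
  have h1 := hh.mul_le_edgeExcess hz ⟨F, rfl⟩ hvF
  have h2 := hh.abs_lt _ ⟨F, rfl⟩ v hvF hp hq
  have h3 : 0 < z v * (1 - |ht v|) := mul_pos (lt_of_le_of_ne (hz v) (Ne.symm hne)) (by linarith)
  linarith

/-- An edge other than that of F has at most one end in common with it, so it sees the mass of at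
most one vertex. -/
theorem edgeExcess_eq_of_ne (h : IsChamberSystem vx) (hab : a ≠ b) {z : V → ℝ}
    (hz : ∀ v, 0 ≤ z v) {F : Φ} (hzF : ∀ v ∉ range (vx F), z v = 0) {e : V × V}
    (he : e ∈ range (colorEdge vx a b)) (hne : e ≠ colorEdge vx a b F) :
    edgeExcess ht z e = 0 ∨ ∃ v, IsEnd v e ∧ IsEnd v (colorEdge vx a b F) ∧
      edgeExcess ht z e = z v * (1 - |ht v|) := by
  have key : ∀ v, IsEnd v e → IsEnd v (colorEdge vx a b F) ∨ z v = 0 := by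
    intro v hv
    by_cases hvF : v ∈ range (vx F)
    · exact .inl (h.isEnd_of_mem_edgeVertices ⟨e, he, hv⟩ hvF)
    · exact .inr (hzF v hvF)
  have h0 : z e.1 = 0 ∨ z e.2 = 0 := by
    rcases key e.1 (.inl rfl) with h1 | h1
    · rcases key e.2 (.inr rfl) with h2 | h2
      · exact absurd (h.edge_eq_of_isEnd hab he ⟨F, rfl⟩ (h.colorEdge_ne hab he) (.inl rfl)
          (.inr rfl) h1 h2) hne
      · exact .inr h2
    · exact .inl h1
  unfold edgeExcess
  rcases h0 with h0 | h0
  · rcases key e.2 (.inr rfl) with h2 | h2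
    · refine .inr ⟨e.2, .inr rfl, h2, ?_⟩
      rw [h0, zero_mul, zero_add, zero_add, abs_mul, abs_of_nonneg (hz _)]
      ring
    · left; simp [h0, h2]
  · rcases key e.1 (.inl rfl) with h2 | h2
    · refine .inr ⟨e.1, .inl rfl, h2, ?_⟩
      rw [h0, zero_mul, add_zero, add_zero, abs_mul, abs_of_nonneg (hz _)]
      ring
    · left; simp [h0, h2]

theorem IsSpindle.exists_label (hs : IsSpindle vx a b ℓ p q) (j : J) :
    ∃ e ∈ range (colorEdge vx a b), ℓ e = j :=
  let ⟨e, he, hl, _⟩ := hs.pole p (.inl rfl) j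
  ⟨e, he, hl⟩

/-- Another edge of the same path sees one end of the edge of F and has no larger excess. An edge
with a different label shares only a pole, where 1 - |height| = 0. So the supremum over a path,
which is continuous and does not refer to F, returns the excess on the right path and 0 elsewhere.
-/
theorem IsSpindle.pathExcess_eq [Finite Φ] (hs : IsSpindle vx a b ℓ p q)
    (hh : IsHeight vx a b ℓ p q ht) (h : IsChamberSystem vx) (hab : a ≠ b) {z : V → ℝ}
    (hz : ∀ v, 0 ≤ z v) {F : Φ} (hzF : ∀ v ∉ range (vx F), z v = 0) (j : J) :
    pathExcess vx a b ℓ ht z j =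
      if ℓ (colorEdge vx a b F) = j then edgeExcess ht z (colorEdge vx a b F) else 0 := by
  have hfin : Finite {e : V × V // e ∈ range (colorEdge vx a b) ∧ ℓ e = j} :=
    ((toFinite (range (colorEdge vx a b))).subset fun e he => he.1 :
      {e | e ∈ range (colorEdge vx a b) ∧ ℓ e = j}.Finite).to_subtype
  have hne : Nonempty {e : V × V // e ∈ range (colorEdge vx a b) ∧ ℓ e = j} :=
    let ⟨e, he, hl⟩ := hs.exists_label j
    ⟨e, he, hl⟩
  unfold pathExcess
  split_ifs with hj
  · refine le_antisymm (ciSup_le fun e => ?_) (le_ciSup (f := fun e :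
      {e : V × V // e ∈ range (colorEdge vx a b) ∧ ℓ e = j} => edgeExcess ht z e)
      (finite_range _).bddAbove ⟨colorEdge vx a b F, ⟨F, rfl⟩, hj⟩)
    by_cases heF : (e : V × V) = colorEdge vx a b F
    · rw [heF]
    rcases edgeExcess_eq_of_ne (ht := ht) h hab hz hzF e.2.1 heF with h0 | ⟨v, -, hvF, h0⟩
    · rw [h0]
      exact hh.edgeExcess_nonneg hz ⟨F, rfl⟩
    · rw [h0]
      exact hh.mul_le_edgeExcess hz ⟨F, rfl⟩ hvF
  · have : ∀ e : {e : V × V // e ∈ range (colorEdge vx a b) ∧ ℓ e = j},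
        edgeExcess ht z e = 0 := by
      rintro ⟨e, he, rfl⟩
      rcases edgeExcess_eq_of_ne (ht := ht) h hab hz hzF he fun e' => hj (e' ▸ rfl) with
        h0 | ⟨v, hv, hvF, h0⟩
      · exact h0
      by_cases hvp : v = p
      · rw [h0, hvp, hh.left]; simp
      by_cases hvq : v = q
      · rw [h0, hvq, hh.right]; simp
      obtain ⟨e', -, -, -, hl, hall⟩ := hs.other v hvp hvq e he hv
      rcases hall _ ⟨F, rfl⟩ hvF with h1 | h1
      · exact absurd (h1 ▸ rfl) hj
      · exact absurd (h1 ▸ hl) hj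
    simp only [this, ciSup_const]

theorem continuous_edgeExcess (e : V × V) : Continuous fun z : V → ℝ => edgeExcess ht z e := by
  unfold edgeExcess
  fun_prop

theorem continuous_pathExcess [Finite Φ] (hs : IsSpindle vx a b ℓ p q) (j : J) :
    Continuous fun z : V → ℝ => pathExcess vx a b ℓ ht z j := by
  have hfin : Finite {e : V × V // e ∈ range (colorEdge vx a b) ∧ ℓ e = j} :=
    ((toFinite (range (colorEdge vx a b))).subset fun e he => he.1 :
      {e | e ∈ range (colorEdge vx a b) ∧ ℓ e = j}.Finite).to_subtype
  have := Fintype.ofFinite {e : V × V // e ∈ range (colorEdge vx a b) ∧ ℓ e = j}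
  have hne : Nonempty {e : V × V // e ∈ range (colorEdge vx a b) ∧ ℓ e = j} :=
    let ⟨e, he, hl⟩ := hs.exists_label j
    ⟨e, he, hl⟩
  unfold pathExcess
  simp only [← Finset.sup'_univ_eq_ciSup]
  exact Continuous.finset_sup'_apply _ fun e _ => continuous_edgeExcess _

theorem continuous_totalHeight [Fintype V] : Continuous (totalHeight vx a b ht) := by
  unfold totalHeight
  refine continuous_finsetSum _ fun v _ => ?_
  split_ifs <;> fun_prop

theorem continuous_offEdge : Continuous (offEdge vx a b) := by
  refine continuous_pi fun v => ?_
  unfold offEdge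
  split_ifs <;> fun_prop

end Coordinates

/-! ### The invariants determine the point. -/

section Injectivity

open Classical Set

variable {Φ V J : Type*} {vx : Φ → Fin 5 → V} {a b : Fin 5} {ℓ : V × V → J} {p q : V} {ht : V → ℝ}

theorem IsHeight.ne_of_ne (hh : IsHeight vx a b ℓ p q ht) (h : IsChamberSystem vx) (hab : a ≠ b)
    (F : Φ) : ht (vx F a) ≠ ht (vx F b) := fun e =>
  hab (h.color _ _ _ _ (hh.inj _ ⟨F, rfl⟩ _ ⟨F, rfl⟩ rfl _ _ (.inl rfl) (.inr rfl) e))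

theorem IsChamberSystem.eq_zero_of_not_isEnd (h : IsChamberSystem vx) {z : V → ℝ} {F : Φ}
    (hzF : ∀ v ∉ range (vx F), z v = 0) {v : V} (hv : v ∈ edgeVertices vx a b)
    (hvF : ¬IsEnd v (colorEdge vx a b F)) : z v = 0 :=
  hzF v fun hr => hvF (h.isEnd_of_mem_edgeVertices hv hr)

/-- If the mean height of the mass on an edge is extremal then the mass is concentrated in a
vertex. -/
theorem IsHeight.exists_eq_ite (hh : IsHeight vx a b ℓ p q ht) (h : IsChamberSystem vx)
    (hab : a ≠ b) {z : V → ℝ} (hz : ∀ v, 0 ≤ z v) {F : Φ} (hzF : ∀ v ∉ range (vx F), z v = 0)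
    {c : ℝ} (hT : 0 < z (vx F a) + z (vx F b))
    (hS : z (vx F a) * ht (vx F a) + z (vx F b) * ht (vx F b) = c * (z (vx F a) + z (vx F b)))
    (hc : (∀ v, IsEnd v (colorEdge vx a b F) → ht v ≤ c) ∨
      ∀ v, IsEnd v (colorEdge vx a b F) → c ≤ ht v) :
    ∃ v₀, IsEnd v₀ (colorEdge vx a b F) ∧ ht v₀ = c ∧
      ∀ v ∈ edgeVertices vx a b, z v = if v = v₀ then z (vx F a) + z (vx F b) else 0 := by
  have hne := hh.ne_of_ne h hab F
  have hv : vx F a ≠ vx F b := fun e => hab (h.color _ _ _ _ e)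
  have hza := hz (vx F a)
  have hzb := hz (vx F b)
  have hA : z (vx F a) * (ht (vx F a) - c) = 0 := by
    rcases hc with hc | hc
    · have h1 := mul_nonneg hza (sub_nonneg.2 (hc _ (.inl rfl)))
      have h2 := mul_nonneg hzb (sub_nonneg.2 (hc _ (.inr rfl)))
      simp only [colorEdge] at h1 h2
      linarith
    · have h1 := mul_nonneg hza (sub_nonneg.2 (hc _ (.inl rfl)))
      have h2 := mul_nonneg hzb (sub_nonneg.2 (hc _ (.inr rfl)))
      simp only [colorEdge] at h1 h2
      linarith
  have hB : z (vx F b) * (ht (vx F b) - c) = 0 := by linarith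
  rcases mul_eq_zero.1 hA with hA | hA
  · have hB' : z (vx F b) ≠ 0 := fun e => by linarith
    refine ⟨vx F b, .inr rfl, by linarith [(mul_eq_zero.1 hB).resolve_left hB'], fun v hvU => ?_⟩
    split_ifs with e
    · rw [e, hA, zero_add]
    · by_cases hvF : IsEnd v (colorEdge vx a b F)
      · rcases hvF with rfl | rfl
        · exact hA
        · exact absurd rfl e
      · exact h.eq_zero_of_not_isEnd hzF hvU hvF
  · have hB' : z (vx F b) = 0 := (mul_eq_zero.1 hB).resolve_right fun e => hne (by linarith)
    refine ⟨vx F a, .inl rfl, by linarith, fun v hvU => ?_⟩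
    split_ifs with e
    · rw [e, hB', add_zero]
    · by_cases hvF : IsEnd v (colorEdge vx a b F)
      · rcases hvF with rfl | rfl
        · exact absurd rfl e
        · exact hB'
      · exact h.eq_zero_of_not_isEnd hzF hvU hvF

variable [Fintype V]

theorem sum_edgeVertices_of_poles (hpq : p ≠ q) (hp : p ∈ edgeVertices vx a b)
    (hq : q ∈ edgeVertices vx a b) {z : V → ℝ}
    (hz : ∀ v ∈ edgeVertices vx a b, v ≠ p → v ≠ q → z v = 0) (g : V → ℝ) :
    ∑ v, (if v ∈ edgeVertices vx a b then z v * g v else 0) = z p * g p + z q * g q := by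
  rw [Finset.sum_eq_add p q hpq, if_pos hp, if_pos hq]
  · rintro v - ⟨hvp, hvq⟩
    split_ifs with hv
    · rw [hz v hv hvp hvq, zero_mul]
    · rfl
  · exact fun h => absurd (Finset.mem_univ _) h
  · exact fun h => absurd (Finset.mem_univ _) h

omit [Fintype V] in
theorem IsSpindle.mem_edgeVertices [Nonempty J] (hs : IsSpindle vx a b ℓ p q) {r : V}
    (hr : r = p ∨ r = q) : r ∈ edgeVertices vx a b := by
  obtain ⟨j⟩ := ‹Nonempty J›
  obtain ⟨e, he, -, hre, -⟩ := hs.pole r hr j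
  exact ⟨e, he, hre⟩

/-- The mass outside the edge gives the mass on it. With excess 0 that mass sits at the poles and is
fixed by total and height. With positive excess the path is known, and on a single edge total and
height fix both weights because the ends have different heights. -/
theorem IsSpindle.eq_of_invariants [Finite Φ] [Nonempty J] (hs : IsSpindle vx a b ℓ p q)
    (hh : IsHeight vx a b ℓ p q ht) (h : IsChamberSystem vx) (hab : a ≠ b) {z z' : V → ℝ}
    (hz : ∀ v, 0 ≤ z v) (hz' : ∀ v, 0 ≤ z' v) {F F' : Φ} (hzF : ∀ v ∉ range (vx F), z v = 0)
    (hzF' : ∀ v ∉ range (vx F'), z' v = 0) (hsum : ∑ v, z v = ∑ v, z' v)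
    (h1 : totalHeight vx a b ht z = totalHeight vx a b ht z')
    (h2 : offEdge vx a b z = offEdge vx a b z')
    (h3 : pathExcess vx a b ℓ ht z = pathExcess vx a b ℓ ht z') : z = z' := by
  have hT : z (vx F a) + z (vx F b) = z' (vx F' a) + z' (vx F' b) := by
    rw [h.sum_eq_add_offEdge hab hzF, h.sum_eq_add_offEdge hab hzF', h2] at hsum
    linarith
  have hE : edgeExcess ht z (colorEdge vx a b F) = edgeExcess ht z' (colorEdge vx a b F') := by
    rw [h.edgeExcess_eq hab hzF, h.edgeExcess_eq hab hzF', hT, h1]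
  suffices hU : ∀ v ∈ edgeVertices vx a b, z v = z' v by
    funext v
    by_cases hv : v ∈ edgeVertices vx a b
    · exact hU v hv
    · simpa only [offEdge, if_neg hv] using congrFun h2 v
  by_cases h0 : edgeExcess ht z (colorEdge vx a b F) = 0
  · have hv := fun v => hh.eq_zero_of_edgeExcess h hz hzF h0 (v := v)
    have hv' := fun v => hh.eq_zero_of_edgeExcess h hz' hzF' (hE ▸ h0) (v := v)
    have hp := hs.mem_edgeVertices (.inl rfl)
    have hq := hs.mem_edgeVertices (.inr rfl)
    have s1 := sum_edgeVertices_of_poles hs.ne hp hq hv 1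
    have s2 := sum_edgeVertices_of_poles hs.ne hp hq hv' 1
    have s3 := sum_edgeVertices_of_poles hs.ne hp hq hv ht
    have s4 := sum_edgeVertices_of_poles hs.ne hp hq hv' ht
    rw [h.sum_edgeVertices hab hzF] at s1
    rw [h.sum_edgeVertices hab hzF'] at s2
    change totalHeight vx a b ht z = _ at s3
    change totalHeight vx a b ht z' = _ at s4
    rw [hh.left, hh.right] at s3 s4
    simp only [Pi.one_apply, mul_one] at s1 s2
    intro v hvU
    by_cases hvp : v = p
    · rw [hvp]; linarith
    by_cases hvq : v = q
    · rw [hvq]; linarith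
    rw [hv v hvU hvp hvq, hv' v hvU hvp hvq]
  have hpos : 0 < edgeExcess ht z (colorEdge vx a b F) :=
    lt_of_le_of_ne (hh.edgeExcess_nonneg hz ⟨F, rfl⟩) (Ne.symm h0)
  have hTpos : 0 < z (vx F a) + z (vx F b) := by
    rw [h.edgeExcess_eq hab hzF] at hpos
    linarith [abs_nonneg (totalHeight vx a b ht z)]
  have hl : ℓ (colorEdge vx a b F') = ℓ (colorEdge vx a b F) := by
    have e1 := congrFun h3 (ℓ (colorEdge vx a b F))
    rw [hs.pathExcess_eq hh h hab hz hzF, hs.pathExcess_eq hh h hab hz' hzF', if_pos rfl] at e1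
    by_contra hne
    rw [if_neg hne] at e1
    exact h0 e1
  have S1 := h.totalHeight_eq hab hzF (ht := ht)
  have S2 := h.totalHeight_eq hab hzF' (ht := ht)
  by_cases hff : colorEdge vx a b F = colorEdge vx a b F'
  · have ea : vx F' a = vx F a := (congrArg Prod.fst hff).symm
    have eb : vx F' b = vx F b := (congrArg Prod.snd hff).symm
    rw [ea, eb] at S2 hT
    have hne := sub_ne_zero.2 (hh.ne_of_ne h hab F)
    have hA : z (vx F a) = z' (vx F a) := by
      refine sub_eq_zero.1 ((mul_eq_zero.1 ?_).resolve_right hne)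
      have : z (vx F b) = z' (vx F a) + z' (vx F b) - z (vx F a) := by linarith
      rw [h1, S2, this] at S1
      linarith
    intro v hvU
    by_cases hvF : IsEnd v (colorEdge vx a b F)
    · rcases hvF with rfl | rfl
      · exact hA
      · simp only [colorEdge]; linarith
    · rw [h.eq_zero_of_not_isEnd hzF hvU hvF, h.eq_zero_of_not_isEnd hzF' hvU (hff ▸ hvF)]
  -- Different edges of one path lie on different sides of a level c. Equal mean heights must both
  -- be c, so both masses are concentrated in a vertex of height c, which is the same for both.
  · obtain ⟨c, hc⟩ := hh.separated _ ⟨F, rfl⟩ _ ⟨F', rfl⟩ hl.symm hff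
    have hza := hz (vx F a)
    have hzb := hz (vx F b)
    have hza' := hz' (vx F' a)
    have hzb' := hz' (vx F' b)
    have hcc : totalHeight vx a b ht z = c * (z (vx F a) + z (vx F b)) := by
      rcases hc with ⟨hc, hc'⟩ | ⟨hc', hc⟩
      · have i1 := mul_nonneg hza (sub_nonneg.2 (hc _ (.inl rfl)))
        have i2 := mul_nonneg hzb (sub_nonneg.2 (hc _ (.inr rfl)))
        have i3 := mul_nonneg hza' (sub_nonneg.2 (hc' _ (.inl rfl)))
        have i4 := mul_nonneg hzb' (sub_nonneg.2 (hc' _ (.inr rfl)))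
        simp only [colorEdge] at i1 i2 i3 i4
        have hT' : c * (z (vx F a) + z (vx F b)) = c * (z' (vx F' a) + z' (vx F' b)) := by rw [hT]
        linarith
      · have i1 := mul_nonneg hza (sub_nonneg.2 (hc _ (.inl rfl)))
        have i2 := mul_nonneg hzb (sub_nonneg.2 (hc _ (.inr rfl)))
        have i3 := mul_nonneg hza' (sub_nonneg.2 (hc' _ (.inl rfl)))
        have i4 := mul_nonneg hzb' (sub_nonneg.2 (hc' _ (.inr rfl)))
        simp only [colorEdge] at i1 i2 i3 i4
        have hT' : c * (z (vx F a) + z (vx F b)) = c * (z' (vx F' a) + z' (vx F' b)) := by rw [hT]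
        linarith
    obtain ⟨v₁, hv₁, hc₁, hall₁⟩ := hh.exists_eq_ite h hab hz hzF hTpos (S1.symm.trans hcc)
      (hc.imp And.left And.right)
    obtain ⟨v₂, hv₂, hc₂, hall₂⟩ := hh.exists_eq_ite h hab hz' hzF' (hT ▸ hTpos)
      (S2.symm.trans (h1.symm.trans (hT ▸ hcc))) (hc.imp And.right And.left).symm
    obtain rfl := hh.inj _ ⟨F, rfl⟩ _ ⟨F', rfl⟩ hl.symm _ _ hv₁ hv₂ (hc₁.trans hc₂.symm)
    intro v hv
    rw [hall₁ v hv, hall₂ v hv, hT]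

end Injectivity

/-! ### Points of the complex against points of the suspension of the link of a pole. -/

section PoleLink

open Classical Set

variable {Φ V J : Type*} {vx : Φ → Fin 5 → V} {a b : Fin 5} {ℓ : V × V → J} {p q : V} {ht : V → ℝ}

/-- The faces of the complex with the given facets. -/
def chamberFaces (vx : Φ → Fin 5 → V) : Set (Set V) := {s | ∃ F, s ⊆ range (vx F)}

/-- The faces of the link of `p`. -/
def poleLink (vx : Φ → Fin 5 → V) (p : V) : Set (Set V) :=
  {s | ∃ F, p ∈ range (vx F) ∧ ∀ v ∈ s, v ∈ range (vx F) ∧ v ≠ p}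

/-- `fst j` is the neighbour of `p` on the path with the label `j`. -/
def IsFirst (vx : Φ → Fin 5 → V) (a b : Fin 5) (ℓ : V × V → J) (p : V) (fst : J → V) : Prop :=
  ∀ j, ∃ e ∈ range (colorEdge vx a b), ℓ e = j ∧ IsEnd p e ∧ IsEnd (fst j) e ∧ fst j ≠ p

theorem mem_geomReal_chamberFaces [Fintype V] {z : V → ℝ} :
    z ∈ geomReal (chamberFaces vx) ↔
      z ∈ stdSimplex ℝ V ∧ ∃ F, ∀ v ∉ range (vx F), z v = 0 := by
  refine and_congr_right fun _ => ⟨?_, ?_⟩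
  · rintro ⟨s, ⟨F, hF⟩, hs⟩
    exact ⟨F, fun v hv => hs v fun h => hv (hF h)⟩
  · rintro ⟨F, hF⟩
    exact ⟨_, ⟨F, Subset.rfl⟩, hF⟩

theorem mem_geomReal_poleLink [Fintype V] {z : V → ℝ} :
    z ∈ geomReal (poleLink vx p) ↔
      z ∈ stdSimplex ℝ V ∧ ∃ F, p ∈ range (vx F) ∧ z p = 0 ∧ ∀ v ∉ range (vx F), z v = 0 := by
  refine and_congr_right fun _ => ⟨?_, ?_⟩
  · rintro ⟨s, ⟨F, hp, hF⟩, hs⟩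
    exact ⟨F, hp, hs p fun h => (hF p h).2 rfl, fun v hv => hs v fun h => hv (hF v h).1⟩
  · rintro ⟨F, hp, hzp, hF⟩
    refine ⟨range (vx F) \ {p}, ⟨F, hp, fun v hv => ⟨hv.1, hv.2⟩⟩, fun v hv => ?_⟩
    by_cases hvp : v = p
    · rw [hvp, hzp]
    · exact hF v fun h => hv ⟨h, hvp⟩

theorem IsSpindle.exists_isFirst (hs : IsSpindle vx a b ℓ p q) (h : IsChamberSystem vx)
    (hab : a ≠ b) : ∃ fst : J → V, IsFirst vx a b ℓ p fst := by
  refine ⟨_, fun j => (Classical.choose_spec (p := fun v => ∃ e ∈ range (colorEdge vx a b),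
    ℓ e = j ∧ IsEnd p e ∧ IsEnd v e ∧ v ≠ p) ?_)⟩
  obtain ⟨e, he, hl, hpe, -⟩ := hs.pole p (.inl rfl) j
  have hne := h.colorEdge_ne hab he
  rcases hpe with hp | hp
  · exact ⟨e.2, e, he, hl, .inl hp, .inr rfl, hp ▸ hne.symm⟩
  · exact ⟨e.1, e, he, hl, .inr hp, .inl rfl, hp ▸ hne⟩

theorem IsFirst.mem_edgeVertices {fst : J → V} (hf : IsFirst vx a b ℓ p fst) (j : J) :
    fst j ∈ edgeVertices vx a b :=
  let ⟨e, he, _, _, hj, _⟩ := hf j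
  ⟨e, he, hj⟩

theorem IsFirst.injective {fst : J → V} (hf : IsFirst vx a b ℓ p fst) (h : IsChamberSystem vx)
    (hab : a ≠ b) : Function.Injective fst := by
  intro i j hij
  obtain ⟨e, he, hl, hp, hi, hne⟩ := hf i
  obtain ⟨e', he', hl', hp', hj, -⟩ := hf j
  rw [← hl, ← hl', h.edge_eq_of_isEnd hab he he' hne hi hp (hij ▸ hj) hp']

theorem IsFirst.eq_or_eq {fst : J → V} (hf : IsFirst vx a b ℓ p fst)
    (hs : IsSpindle vx a b ℓ p q) {e : V × V} (he : e ∈ range (colorEdge vx a b))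
    (hp : IsEnd p e) {v : V} (hv : IsEnd v e) : v = p ∨ v = fst (ℓ e) := by
  obtain ⟨e₀, -, -, -, hall⟩ := hs.pole p (.inl rfl) (ℓ e)
  obtain ⟨e', he', hl', hp', hf', hne⟩ := hf (ℓ e)
  obtain rfl : e' = e := (hall e' he' hp' hl').trans (hall e he hp rfl).symm
  rcases hv.eq_or_eq_or_eq hp hf' with h | h | h
  · exact .inl h
  · exact .inr h
  · exact absurd h.symm hne

variable [Fintype V]

omit [Fintype V] in
/-- In the link of `p` the mass on the vertices with colours `a`, `b` lies in one vertex. -/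
theorem IsFirst.eq_zero {fst : J → V} (hf : IsFirst vx a b ℓ p fst) (hs : IsSpindle vx a b ℓ p q)
    (h : IsChamberSystem vx) {x : V → ℝ} {F : Φ} (hp : IsEnd p (colorEdge vx a b F))
    (hxp : x p = 0) (hxF : ∀ v ∉ range (vx F), x v = 0) {v : V}
    (hv : v ∈ edgeVertices vx a b) (hvf : v ≠ fst (ℓ (colorEdge vx a b F))) : x v = 0 := by
  by_cases hvF : IsEnd v (colorEdge vx a b F)
  · rcases hf.eq_or_eq hs ⟨F, rfl⟩ hp hvF with e | e
    · rw [e, hxp]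
    · exact absurd e hvf
  · exact h.eq_zero_of_not_isEnd hxF hv hvF

theorem IsFirst.sum_eq {fst : J → V} (hf : IsFirst vx a b ℓ p fst) (hs : IsSpindle vx a b ℓ p q)
    (h : IsChamberSystem vx) (hab : a ≠ b) {x : V → ℝ} {F : Φ}
    (hp : IsEnd p (colorEdge vx a b F)) (hxp : x p = 0) (hxF : ∀ v ∉ range (vx F), x v = 0) :
    ∑ v, x v = x (fst (ℓ (colorEdge vx a b F))) + ∑ v, offEdge vx a b x v := by
  rw [h.sum_eq_add_offEdge hab hxF]
  have hne := h.colorEdge_ne hab ⟨F, rfl⟩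
  rcases hp with hp | hp
  · have e := (hf.eq_or_eq hs ⟨F, rfl⟩ (.inl hp) (.inr rfl)).resolve_left
      fun e => hne (hp.symm.trans e.symm)
    rw [← e]
    change x (colorEdge vx a b F).1 + _ + _ = _
    rw [← hp, hxp, zero_add]
    rfl
  · have e := (hf.eq_or_eq hs ⟨F, rfl⟩ (.inr hp) (.inl rfl)).resolve_left
      fun e => hne (e.trans hp)
    rw [← e]
    change _ + x (colorEdge vx a b F).2 + _ = _
    rw [← hp, hxp, add_zero]
    rfl

/-- The invariants of a point of the complex are those of a point of the suspension. -/
theorem IsSpindle.exists_poleLink [Finite Φ] [Nonempty J] (hs : IsSpindle vx a b ℓ p q)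
    (hh : IsHeight vx a b ℓ p q ht) (h : IsChamberSystem vx) (hab : a ≠ b) {fst : J → V}
    (hf : IsFirst vx a b ℓ p fst) (hL : (geomReal (poleLink vx p)).Nonempty)
    {z : V → ℝ} (hz : z ∈ geomReal (chamberFaces vx)) :
    ∃ s : ℝ, |s| ≤ 1 ∧ ∃ x ∈ geomReal (poleLink vx p), totalHeight vx a b ht z = s ∧
      offEdge vx a b z = (1 - |s|) • offEdge vx a b x ∧
      ∀ j, pathExcess vx a b ℓ ht z j = (1 - |s|) * x (fst j) := by
  obtain ⟨⟨hz0, hz1⟩, F, hzF⟩ := mem_geomReal_chamberFaces.1 hz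
  have hE := h.edgeExcess_eq hab hzF (ht := ht)
  have hE0 := hh.edgeExcess_nonneg hz0 ⟨F, rfl⟩
  have hP := hs.pathExcess_eq hh h hab hz0 hzF
  have hsum := h.sum_eq_add_offEdge hab hzF
  rw [hz1] at hsum
  have hoff : ∀ v, 0 ≤ offEdge vx a b z v := fun v => by
    unfold offEdge; split_ifs; exacts [le_rfl, hz0 v]
  have hoff' := Finset.sum_nonneg fun v (_ : v ∈ Finset.univ) => hoff v
  set s := totalHeight vx a b ht z
  set E := edgeExcess ht z (colorEdge vx a b F)
  have hs1 : |s| ≤ 1 := by linarith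
  refine ⟨s, hs1, ?_⟩
  -- At |s| = 1 there is neither mass outside the edge nor excess, and every point of the link has
  -- these invariants.
  rcases hs1.eq_or_lt with hs1 | hs1
  · obtain ⟨x, hx⟩ := hL
    refine ⟨x, hx, rfl, ?_, fun j => ?_⟩
    · rw [hs1, sub_self, zero_smul]
      funext v
      exact (Finset.sum_eq_zero_iff_of_nonneg fun v _ => hoff v).1 (by linarith) v
        (Finset.mem_univ v)
    · rw [hs1, sub_self, zero_mul, hP]
      split_ifs
      · linarith
      · rfl
  have hpos : 0 < 1 - |s| := by linarith
  set j := ℓ (colorEdge vx a b F) with hj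
  obtain ⟨_, ⟨X, rfl⟩, hlX, hpX, hfX, hfp⟩ := hf j
  obtain ⟨F', hFF', hXF'⟩ := hs.join X F hlX
  have hpF' : IsEnd p (colorEdge vx a b F') := hXF' ▸ hpX
  -- The excess is moved to the neighbour of p on the same path and everything is rescaled to total
  -- 1. By `join` the triangle of F together with the edge from p to that neighbour is a facet.
  let x : V → ℝ := fun v => (if v ∈ edgeVertices vx a b then (if v = fst j then E else 0)
    else z v) / (1 - |s|)
  have hxU : ∀ v ∈ edgeVertices vx a b, x v = if v = fst j then E / (1 - |s|) else 0 := by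
    intro v hv
    simp only [x, if_pos hv]
    split_ifs <;> simp
  have hxn : ∀ v, v ∉ edgeVertices vx a b → x v = z v / (1 - |s|) := by
    intro v hv
    simp only [x, if_neg hv]
  have hxp : x p = 0 := by
    rw [hxU p (hs.mem_edgeVertices (.inl rfl)), if_neg hfp.symm]
  have hxF' : ∀ v ∉ range (vx F'), x v = 0 := by
    intro v hv
    by_cases hvU : v ∈ edgeVertices vx a b
    · rw [hxU v hvU, if_neg]
      rintro rfl
      exact hv (mem_range_of_isEnd (hXF' ▸ hfX))
    · rw [hxn v hvU, hzF v fun hvF => hv (IsChamberSystem.mem_range_of_agreeOn hFF' hvU hvF),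
        zero_div]
  have hoffx : offEdge vx a b z = (1 - |s|) • offEdge vx a b x := by
    funext v
    simp only [offEdge, Pi.smul_apply, smul_eq_mul]
    split_ifs with hv
    · rw [mul_zero]
    · rw [hxn v hv, mul_div_cancel₀ _ hpos.ne']
  refine ⟨x, mem_geomReal_poleLink.2 ⟨⟨fun v => ?_, ?_⟩, F', mem_range_of_isEnd hpF', hxp, hxF'⟩,
    rfl, hoffx, fun i => ?_⟩
  · refine div_nonneg ?_ hpos.le
    split_ifs
    exacts [hE0, le_rfl, hz0 v]
  · rw [hf.sum_eq hs h hab hpF' hxp hxF', hXF', hlX, hxU _ (hf.mem_edgeVertices j), if_pos rfl]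
    have h2 : ∑ v, offEdge vx a b z v = (1 - |s|) * ∑ v, offEdge vx a b x v := by
      rw [Finset.mul_sum]
      exact Finset.sum_congr rfl fun v _ => congrFun hoffx v
    rw [div_add' _ _ _ hpos.ne', div_eq_one_iff_eq hpos.ne']
    linarith
  · rw [hP, hxU _ (hf.mem_edgeVertices i)]
    by_cases hij : j = i
    · rw [if_pos hij, if_pos (by rw [hij]), mul_div_cancel₀ _ hpos.ne']
    · rw [if_neg hij, if_neg fun e => hij (hf.injective h hab e).symm, mul_zero]

/-- Each point of the suspension occurs. -/
theorem IsSpindle.exists_chamberFaces [Finite Φ] [Nonempty J] (hs : IsSpindle vx a b ℓ p q)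
    (hh : IsHeight vx a b ℓ p q ht) (h : IsChamberSystem vx) (hab : a ≠ b) {fst : J → V}
    (hf : IsFirst vx a b ℓ p fst) {s : ℝ} (hs1 : |s| ≤ 1) {x : V → ℝ}
    (hx : x ∈ geomReal (poleLink vx p)) :
    ∃ z ∈ geomReal (chamberFaces vx), totalHeight vx a b ht z = s ∧
      offEdge vx a b z = (1 - |s|) • offEdge vx a b x ∧
      ∀ j, pathExcess vx a b ℓ ht z j = (1 - |s|) * x (fst j) := by
  obtain ⟨⟨hx0, hx1⟩, F, hp, hxp, hxF⟩ := mem_geomReal_poleLink.1 hx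
  replace hp := h.isEnd_of_mem_edgeVertices (hs.mem_edgeVertices (.inl rfl)) hp
  have hsum := hf.sum_eq hs h hab hp hxp hxF
  rw [hx1] at hsum
  have hfz := fun v => hf.eq_zero hs h hp hxp hxF (v := v)
  set j := ℓ (colorEdge vx a b F) with hj
  have hpos : 0 ≤ 1 - |s| := by linarith
  set M := (1 - |s|) * x (fst j) with hM
  have hM0 : 0 ≤ M := mul_nonneg hpos (hx0 _)
  have hT0 : 0 ≤ M + |s| := by linarith [abs_nonneg s]
  -- The edge must carry the mass M + |s|, since M is the excess, and c is its mean height. If this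
  -- mass is 0 then s = 0 and any height will do.
  obtain ⟨c, hc, hTc⟩ : ∃ c, |c| ≤ 1 ∧ (M + |s|) * c = s := by
    rcases hT0.eq_or_lt with hT | hT
    · refine ⟨0, by simp, ?_⟩
      have : |s| = 0 := le_antisymm (by linarith) (abs_nonneg s)
      rw [mul_zero, abs_eq_zero.1 this]
    · refine ⟨s / (M + |s|), ?_, mul_div_cancel₀ _ hT.ne'⟩
      rw [abs_div, abs_of_pos hT, div_le_one hT]
      linarith
  obtain ⟨_, ⟨X, rfl⟩, hlX, t, ht0, ht1, hct⟩ := hh.exists_eq j c hc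
  obtain ⟨F', hFF', hXF'⟩ := hs.join X F hlX
  rw [← hXF'] at hlX hct
  have hv : vx F' b ≠ vx F' a := fun e => hab (h.color _ _ _ _ e).symm
  have hA : vx F' a ∈ edgeVertices vx a b := mem_edgeVertices_of_isEnd (F := F') (.inl rfl)
  have hB : vx F' b ∈ edgeVertices vx a b := mem_edgeVertices_of_isEnd (F := F') (.inr rfl)
  let z : V → ℝ := fun v => if v ∈ edgeVertices vx a b then
    (if v = vx F' a then (M + |s|) * t else if v = vx F' b then (M + |s|) * (1 - t) else 0)
    else (1 - |s|) * x v
  have hzA : z (vx F' a) = (M + |s|) * t := by simp only [z, if_pos hA, if_true]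
  have hzB : z (vx F' b) = (M + |s|) * (1 - t) := by
    simp only [z, if_pos hB, if_neg hv, if_true]
  have hz0 : ∀ v, 0 ≤ z v := by
    intro v
    simp only [z]
    split_ifs
    exacts [mul_nonneg hT0 ht0, mul_nonneg hT0 (by linarith), le_rfl, mul_nonneg hpos (hx0 v)]
  have hzF' : ∀ v ∉ range (vx F'), z v = 0 := by
    intro v hv
    simp only [z]
    split_ifs with h1 h2 h3
    · exact absurd ⟨a, h2.symm⟩ hv
    · exact absurd ⟨b, h3.symm⟩ hv
    · rfl
    · rw [hxF v fun hvF => hv (IsChamberSystem.mem_range_of_agreeOn hFF' h1 hvF), mul_zero]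
  have hoff : offEdge vx a b z = (1 - |s|) • offEdge vx a b x := by
    funext v
    simp only [offEdge, Pi.smul_apply, smul_eq_mul]
    split_ifs with hv
    · rw [mul_zero]
    · simp only [z, if_neg hv]
  have hS : totalHeight vx a b ht z = s := by
    rw [h.totalHeight_eq hab hzF', hzA, hzB]
    refine Eq.trans ?_ hTc
    rw [hct]
    simp only [colorEdge]
    ring
  refine ⟨z, mem_geomReal_chamberFaces.2 ⟨⟨hz0, ?_⟩, F', hzF'⟩, hS, hoff, fun i => ?_⟩
  · have h2 : ∑ v, offEdge vx a b z v = (1 - |s|) * ∑ v, offEdge vx a b x v := by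
      rw [Finset.mul_sum]
      exact Finset.sum_congr rfl fun v _ => congrFun hoff v
    have h3 : ∑ v, offEdge vx a b x v = 1 - x (fst j) := by linarith
    rw [h.sum_eq_add_offEdge hab hzF', hzA, hzB, h2, h3, hM]
    ring
  · rw [hs.pathExcess_eq hh h hab hz0 hzF', hlX, h.edgeExcess_eq hab hzF', hS, hzA, hzB]
    split_ifs with hij
    · rw [← hij, ← hM]
      ring
    · rw [hfz _ (hf.mem_edgeVertices i) fun e => hij (hf.injective h hab e).symm, mul_zero]

/-- A point of the link of p has edge mass only at the neighbours of p, one for each label. -/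
theorem IsFirst.ext {fst : J → V} (hf : IsFirst vx a b ℓ p fst) (hs : IsSpindle vx a b ℓ p q)
    (h : IsChamberSystem vx) [Nonempty J] {x x' : V → ℝ} (hx : x ∈ geomReal (poleLink vx p))
    (hx' : x' ∈ geomReal (poleLink vx p)) (h1 : offEdge vx a b x = offEdge vx a b x')
    (h2 : ∀ j, x (fst j) = x' (fst j)) : x = x' := by
  obtain ⟨-, F, hp, hxp, hxF⟩ := mem_geomReal_poleLink.1 hx
  obtain ⟨-, F', hp', hxp', hxF'⟩ := mem_geomReal_poleLink.1 hx'
  have hpU := hs.mem_edgeVertices (.inl rfl : p = p ∨ p = q)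
  replace hp := h.isEnd_of_mem_edgeVertices hpU hp
  replace hp' := h.isEnd_of_mem_edgeVertices hpU hp'
  funext v
  by_cases hv : v ∈ edgeVertices vx a b
  · by_cases h3 : v = fst (ℓ (colorEdge vx a b F))
    · rw [h3, h2]
    by_cases h4 : v = fst (ℓ (colorEdge vx a b F'))
    · rw [h4, h2]
    rw [hf.eq_zero hs h hp hxp hxF hv h3, hf.eq_zero hs h hp' hxp' hxF' hv h4]
  · simpa only [offEdge, if_neg hv] using congrFun h1 v

end PoleLink

/-! ### Gluing along fibres, and the sphere as a suspension. -/

section Suspension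

open Set

/-- Both A and the image of γ are the quotient of the compact space X by the same fibres, and f
identifies Z with that image. The map from Z to A is continuous because the preimage of a closed set
is the f-preimage of the γ-image of a compact set. -/
theorem nonempty_homeomorph_of_fibers {X A B Z : Type*} [TopologicalSpace X] [TopologicalSpace A]
    [TopologicalSpace B] [TopologicalSpace Z] [CompactSpace X] [CompactSpace Z] [T2Space A]
    [T2Space B] {α : X → A} {γ : X → B} {f : Z → B} (hα : Continuous α)
    (hαs : Function.Surjective α) (hγ : Continuous γ) (hf : Continuous f)
    (hfi : Function.Injective f) (hr : range f = range γ)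
    (hfib : ∀ x x', α x = α x' ↔ γ x = γ x') : Nonempty (Z ≃ₜ A) := by
  have hex : ∀ z, ∃ x, γ x = f z := fun z => by
    have : f z ∈ range γ := hr ▸ mem_range_self z
    exact this
  choose k hk using hex
  have hpre : ∀ C : Set A, (fun z => α (k z)) ⁻¹' C = f ⁻¹' (γ '' (α ⁻¹' C)) := by
    intro C
    ext z
    constructor
    · exact fun hz => ⟨k z, hz, hk z⟩
    · rintro ⟨x, hx, hxz⟩
      change α (k z) ∈ C
      rwa [(hfib (k z) x).2 ((hk z).trans hxz.symm)]
  have hcont : Continuous fun z => α (k z) := by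
    refine continuous_iff_isClosed.2 fun C hC => ?_
    rw [hpre]
    exact (((hC.preimage hα).isCompact.image hγ).isClosed).preimage hf
  have hbij : Function.Bijective fun z => α (k z) := by
    constructor
    · intro z z' hzz
      exact hfi ((hk z).symm.trans (((hfib _ _).1 hzz).trans (hk z')))
    · intro y
      obtain ⟨x, rfl⟩ := hαs y
      obtain ⟨z, hz⟩ : γ x ∈ range f := hr ▸ mem_range_self x
      exact ⟨z, (hfib _ _).2 ((hk z).trans hz)⟩
  exact ⟨hcont.homeoOfEquivCompactToT2 (f := Equiv.ofBijective _ hbij)⟩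

/-- The sphere as a suspension. -/
noncomputable def suspend (n : ℕ) (s : ℝ) (y : EuclideanSpace ℝ (Fin n)) :
    EuclideanSpace ℝ (Fin (n + 1)) :=
  WithLp.toLp 2 (Fin.cons s fun i => √(1 - s ^ 2) * y i)

theorem norm_suspend_sq (n : ℕ) (s : ℝ) (hs : |s| ≤ 1) (y : EuclideanSpace ℝ (Fin n)) :
    ‖suspend n s y‖ ^ 2 = s ^ 2 + (1 - s ^ 2) * ‖y‖ ^ 2 := by
  have h : 0 ≤ 1 - s ^ 2 := by
    have := (sq_le_one_iff_abs_le_one s).2 hs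
    linarith
  rw [EuclideanSpace.real_norm_sq_eq, EuclideanSpace.real_norm_sq_eq, Fin.sum_univ_succ,
    Finset.mul_sum]
  simp [suspend, mul_pow, Real.sq_sqrt h]

theorem continuous_suspend (n : ℕ) :
    Continuous fun x : ℝ × EuclideanSpace ℝ (Fin n) => suspend n x.1 x.2 := by
  unfold suspend
  refine (PiLp.continuous_toLp 2 _).comp (continuous_pi fun i => ?_)
  refine Fin.cases ?_ (fun i => ?_) i
  · simpa using continuous_fst
  · simp only [Fin.cons_succ]
    fun_prop

/-- The first coordinate recovers s, and the radius √(1 - s²) vanishes only at the two poles. -/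
theorem suspend_eq_iff (n : ℕ) {s s' : ℝ} (hs : |s| ≤ 1) {y y' : EuclideanSpace ℝ (Fin n)} :
    suspend n s y = suspend n s' y' ↔ s = s' ∧ (|s| = 1 ∨ y = y') := by
  constructor
  · intro h
    have h0 : s = s' := by simpa [suspend] using congrArg (fun x => x 0) h
    refine ⟨h0, or_iff_not_imp_left.2 fun h1 => ?_⟩
    have hlt : 0 < 1 - s ^ 2 := by
      have := (sq_lt_one_iff_abs_lt_one s).2 (lt_of_le_of_ne hs h1)
      linarith
    ext i
    have := congrArg (fun x => x i.succ) h
    simp only [suspend, Fin.cons_succ, ← h0] at this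
    exact mul_left_cancel₀ (Real.sqrt_pos.2 hlt).ne' this
  · rintro ⟨rfl, h | rfl⟩
    · have : 1 - s ^ 2 = 0 := by rw [← sq_abs, h]; norm_num
      simp [suspend, this]
    · rfl

theorem exists_suspend_eq (n : ℕ) [NeZero n] {x : EuclideanSpace ℝ (Fin (n + 1))} (hx : ‖x‖ = 1) :
    ∃ s, |s| ≤ 1 ∧ ∃ y : EuclideanSpace ℝ (Fin n), ‖y‖ = 1 ∧ suspend n s y = x := by
  have hsq : x 0 ^ 2 + ∑ i : Fin n, x i.succ ^ 2 = 1 := by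
    rw [← Fin.sum_univ_succ (f := fun i => x i ^ 2), ← EuclideanSpace.real_norm_sq_eq, hx, one_pow]
  have hle : |x 0| ≤ 1 := by
    rw [← sq_le_one_iff_abs_le_one]
    linarith [Finset.sum_nonneg fun (i : Fin n) (_ : i ∈ Finset.univ) => sq_nonneg (x i.succ)]
  refine ⟨x 0, hle, ?_⟩
  rcases hle.eq_or_lt with h1 | h1
  · have h0 : 1 - x 0 ^ 2 = 0 := by rw [← sq_abs, h1]; norm_num
    refine ⟨EuclideanSpace.single 0 1, by simp, ?_⟩
    ext i
    refine Fin.cases ?_ (fun i => ?_) i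
    · simp [suspend]
    · have := (Finset.sum_eq_zero_iff_of_nonneg fun (i : Fin n) (_ : i ∈ Finset.univ) =>
        sq_nonneg (x i.succ)).1 (by linarith) i (Finset.mem_univ i)
      simp [suspend, h0, pow_eq_zero_iff two_ne_zero |>.1 this]
  · have hpos : 0 < 1 - x 0 ^ 2 := by
      have := (sq_lt_one_iff_abs_lt_one _).2 h1
      linarith
    have hsqrt := (Real.sqrt_pos.2 hpos).ne'
    have hxy : suspend n (x 0) (WithLp.toLp 2 fun i => x i.succ / √(1 - x 0 ^ 2)) = x := by
      ext i
      refine Fin.cases ?_ (fun i => ?_) i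
      · simp [suspend]
      · simp [suspend, mul_div_cancel₀ _ hsqrt]
    refine ⟨_, ?_, hxy⟩
    have := norm_suspend_sq n (x 0) hle (WithLp.toLp 2 fun i => x i.succ / √(1 - x 0 ^ 2))
    rw [hxy, hx] at this
    have h2 : ‖(WithLp.toLp 2 fun i => x i.succ / √(1 - x 0 ^ 2) : EuclideanSpace ℝ (Fin n))‖ ^ 2
        = 1 := mul_left_cancel₀ hpos.ne' (by linarith)
    exact (pow_eq_one_iff_of_nonneg (norm_nonneg _) two_ne_zero).1 h2

end Suspension

/-! ### A spindle makes the complex a 4-sphere. -/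

section Sphere

open Classical Set

variable {Φ V J : Type*} {vx : Φ → Fin 5 → V} {a b : Fin 5} {ℓ : V × V → J} {p q : V}

/-- A complex containing a spindle is the suspension of the link of a pole. -/
theorem IsSpindle.nonempty_homeomorph_sphere [Finite Φ] [Fintype V] [Nonempty J]
    (hs : IsSpindle vx a b ℓ p q) (h : IsChamberSystem vx) (hab : a ≠ b)
    (φ : geomReal (poleLink vx p) ≃ₜ Metric.sphere (0 : EuclideanSpace ℝ (Fin 4)) 1) :
    Nonempty (geomReal (chamberFaces vx) ≃ₜ
      Metric.sphere (0 : EuclideanSpace ℝ (Fin 5)) 1) := by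
  obtain ⟨ht, hh⟩ := hs.exists_height h hab
  obtain ⟨fst, hf⟩ := hs.exists_isFirst h hab
  have hc1 : CompactSpace (geomReal (poleLink vx p)) :=
    isCompact_iff_compactSpace.1 (isCompact_geomReal _)
  have hc2 : CompactSpace (geomReal (chamberFaces vx)) :=
    isCompact_iff_compactSpace.1 (isCompact_geomReal _)
  have hI : ∀ s : Icc (-1 : ℝ) 1, |(s : ℝ)| ≤ 1 := fun s => abs_le.2 s.2
  have hL : (geomReal (poleLink vx p)).Nonempty :=
    ⟨_, (φ.symm ⟨EuclideanSpace.single 0 1, by simp⟩).2⟩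
  have hφ : ∀ x, ‖(φ x : EuclideanSpace ℝ (Fin 4))‖ = 1 := fun x => by simp
  -- The map α presents the sphere as a quotient of the cylinder over the link, γ gives the
  -- invariants of a point of the suspension, and f gives those of a point of the complex. Only the
  -- two ends of the cylinder are collapsed, by α as well as by γ.
  let α : Icc (-1 : ℝ) 1 × geomReal (poleLink vx p) →
      Metric.sphere (0 : EuclideanSpace ℝ (Fin 5)) 1 := fun x =>
    ⟨suspend 4 x.1 (φ x.2), by
      rw [mem_sphere_zero_iff_norm, ← pow_eq_one_iff_of_nonneg (norm_nonneg _) two_ne_zero,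
        norm_suspend_sq 4 _ (hI _), hφ]
      ring⟩
  let γ : Icc (-1 : ℝ) 1 × geomReal (poleLink vx p) → ℝ × (V → ℝ) × (J → ℝ) := fun x =>
    (x.1, (1 - |(x.1 : ℝ)|) • offEdge vx a b x.2, fun j => (1 - |(x.1 : ℝ)|) * x.2.1 (fst j))
  let f : geomReal (chamberFaces vx) → ℝ × (V → ℝ) × (J → ℝ) := fun z =>
    (totalHeight vx a b ht z, offEdge vx a b z, pathExcess vx a b ℓ ht z)
  refine nonempty_homeomorph_of_fibers (α := α) (γ := γ) (f := f) ?_ ?_ ?_ ?_ ?_ ?_ ?_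
  · refine Continuous.subtype_mk ?_ _
    exact (continuous_suspend 4).comp ((continuous_subtype_val.comp continuous_fst).prodMk
      (continuous_subtype_val.comp (φ.continuous.comp continuous_snd)))
  · rintro ⟨x, hx⟩
    obtain ⟨s, hs1, y, hy, rfl⟩ := exists_suspend_eq 4 (mem_sphere_zero_iff_norm.1 hx)
    refine ⟨(⟨s, abs_le.1 hs1⟩, φ.symm ⟨y, mem_sphere_zero_iff_norm.2 hy⟩), Subtype.ext ?_⟩
    simp [α]
  · refine (continuous_subtype_val.comp continuous_fst).prodMk (Continuous.prodMk ?_ ?_)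
    · exact (continuous_const.sub (continuous_subtype_val.comp continuous_fst).abs).smul
        (continuous_offEdge.comp (continuous_subtype_val.comp continuous_snd))
    · refine continuous_pi fun j => ?_
      exact (continuous_const.sub (continuous_subtype_val.comp continuous_fst).abs).mul
        ((continuous_apply _).comp (continuous_subtype_val.comp continuous_snd))
  · exact ((continuous_totalHeight.comp continuous_subtype_val).prodMk
      ((continuous_offEdge.comp continuous_subtype_val).prodMk
        (continuous_pi fun j => (continuous_pathExcess hs j).comp continuous_subtype_val)))
  · rintro ⟨z, hz⟩ ⟨z', hz'⟩ hzz
    obtain ⟨⟨hz0, hz1⟩, F, hzF⟩ := mem_geomReal_chamberFaces.1 hz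
    obtain ⟨⟨hz0', hz1'⟩, F', hzF'⟩ := mem_geomReal_chamberFaces.1 hz'
    simp only [f, Prod.mk.injEq] at hzz
    exact Subtype.ext (hs.eq_of_invariants hh h hab hz0 hz0' hzF hzF' (hz1.trans hz1'.symm)
      hzz.1 hzz.2.1 hzz.2.2)
  · refine Subset.antisymm ?_ ?_
    · rintro _ ⟨⟨z, hz⟩, rfl⟩
      obtain ⟨s, hs1, x, hx, h1, h2, h3⟩ := hs.exists_poleLink hh h hab hf hL hz
      exact ⟨(⟨s, abs_le.1 hs1⟩, ⟨x, hx⟩), Prod.ext h1.symm (Prod.ext h2.symm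
        (funext fun j => (h3 j).symm))⟩
    · rintro _ ⟨⟨s, x, hx⟩, rfl⟩
      obtain ⟨z, hz, h1, h2, h3⟩ := hs.exists_chamberFaces hh h hab hf (hI s) hx
      exact ⟨⟨z, hz⟩, Prod.ext h1 (Prod.ext h2 (funext h3))⟩
  · rintro ⟨s, x, hx⟩ ⟨s', x', hx'⟩
    simp only [α, γ, Subtype.mk.injEq, Prod.mk.injEq]
    rw [suspend_eq_iff 4 (hI s)]
    refine and_congr_right fun hss => ?_
    rw [← hss]
    constructor
    · rintro (h1 | h1)
      · simp [h1]
      · have := φ.injective (Subtype.ext h1)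
        rw [Subtype.mk.injEq] at this
        subst this
        exact ⟨rfl, rfl⟩
    · rintro ⟨h1, h2⟩
      refine or_iff_not_imp_left.2 fun h0 => ?_
      have hpos : 1 - |(s : ℝ)| ≠ 0 := fun e => h0 (by linarith)
      have := hf.ext hs h hx hx' (smul_right_injective _ hpos h1)
        fun j => mul_left_cancel₀ hpos (congrFun h2 j)
      subst this
      rfl

end Sphere

/-! ### The lower bound for edges with two given colours. -/

section Bound

open Classical Set

variable {E : Type*} [NormedAddCommGroup E] [NormedSpace ℝ E]
  {Δ : SimplicialComplex ℝ E} {κ : E → Fin 5}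

theorem IsNormal.colorVertex_mem_vertices (hN : IsNormal 4 Δ) (hκ : IsBalancedColoring Δ κ) (F : Δ.facets)
    (i : Fin 5) : colorVertex κ F i ∈ Δ.vertices :=
  coe_subset_vertices F.2.1 (colorVertex_mem hN hκ F i)

variable (hN : IsNormal 4 Δ) (hκ : IsBalancedColoring Δ κ)
include hN hκ

theorem mem_range_iff_mem_facet {vx : Δ.facets → Fin 5 → Δ.vertices}
    (hvx : ∀ F i, (vx F i : E) = colorVertex κ F i) (F : Δ.facets) (v : Δ.vertices) :
    v ∈ range (vx F) ↔ (v : E) ∈ F.1 := by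
  constructor
  · rintro ⟨i, rfl⟩
    rw [hvx]
    exact colorVertex_mem hN hκ F i
  · exact fun hv => ⟨κ v, Subtype.ext ((hvx F _).trans (colorVertex_color hN hκ hv))⟩

theorem labelledFaces_eq_chamberFaces {vx : Δ.facets → Fin 5 → Δ.vertices}
    (hvx : ∀ F i, (vx F i : E) = colorVertex κ F i) :
    labelledFaces Δ ((↑) : Δ.vertices → E) = chamberFaces vx := by
  have hr := mem_range_iff_mem_facet hN hκ hvx
  ext s
  constructor
  · rintro ⟨t, ht, hst⟩
    obtain ⟨F, hF⟩ := hN.exists_facet ht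
    exact ⟨F, fun v hv => (hr F v).2 (hF (hst v hv))⟩
  · rintro ⟨F, hF⟩
    exact ⟨F.1, F.2.1, fun v hv => (hr F v).1 (hF hv)⟩

theorem labelledFaces_link_eq_poleLink {vx : Δ.facets → Fin 5 → Δ.vertices}
    (hvx : ∀ F i, (vx F i : E) = colorVertex κ F i) (p : Δ.vertices) :
    labelledFaces (link Δ p) ((↑) : Δ.vertices → E) = poleLink vx p := by
  have hr := mem_range_iff_mem_facet hN hκ hvx
  ext s
  constructor
  · rintro ⟨t, ⟨-, hpt, hins⟩, hst⟩
    obtain ⟨F, hF⟩ := hN.exists_facet hins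
    refine ⟨F, (hr F p).2 (hF (Finset.mem_insert_self _ _)), fun v hv => ⟨(hr F v).2
      (hF (Finset.mem_insert_of_mem (hst v hv))), ?_⟩⟩
    rintro rfl
    exact hpt (hst v hv)
  · rintro ⟨F, hp, hF⟩
    refine ⟨F.1.erase p, erase_mem_link F.2.1 ((hr F p).1 hp) ?_, fun v hv => Finset.mem_erase.2
      ⟨fun e => (hF v hv).2 (Subtype.ext e), (hr F v).1 (hF v hv).1⟩⟩
    rw [← Finset.card_pos, Finset.card_erase_of_mem ((hr F p).1 hp),
      (hN.mem_facets_iff.1 F.2).2]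
    norm_num

omit hN hκ

/-- Used to replace the ambient vector space by the finite type of vertices, on which barycentric
coordinates are defined. -/
theorem IsChamberSystem.of_comp {Φ V W : Type*} {vx : Φ → Fin 5 → V} {ι : V → W}
    (hι : Function.Injective ι) (h : IsChamberSystem fun F i => ι (vx F i)) :
    IsChamberSystem vx := by
  have hA : ∀ S F F', AgreeOn vx S F F' ↔ AgreeOn (fun F i => ι (vx F i)) S F F' := fun S F F' =>
    forall₂_congr fun i _ => hι.eq_iff.symm
  refine ⟨fun F F' i j e => h.color F F' i j (congrArg ι e), fun F F' e => h.inj ?_, fun F i => ?_,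
    fun S F F' hF => ?_⟩
  · simp only [e]
  · simpa only [hA] using h.panel F i
  · simpa only [hA] using h.conn S F F' ((hA S F F').1 hF)

theorem faceCount_comp {Φ V W : Type*} {vx : Φ → Fin 5 → V} {ι : V → W}
    (hι : Function.Injective ι) (S : Finset (Fin 5)) :
    faceCount (fun F i => ι (vx F i)) S = faceCount vx S := by
  unfold faceCount
  have : (range fun (F : Φ) (i : S) => ι (vx F i)) =
      (fun u : S → V => ι ∘ u) '' range fun (F : Φ) (i : S) => vx F i := by
    rw [← range_comp]
    rfl
  rw [this]
  exact Nat.card_image_of_injective hι.comp_left _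

/-- The lower bound for the number of edges with two given colours. -/
theorem faceCount_add_rank_le (hΔ : IsCombinatorialManifold 4 Δ) (hκ : IsBalancedColoring Δ κ)
    {M : Type*} [TopologicalSpace M] [ConnectedSpace M]
    (hM : ¬ Nonempty (M ≃ₜ Metric.sphere (0 : EuclideanSpace ℝ (Fin 5)) 1))
    (e : Δ.space ≃ₜ M) (x : M) [Group.FG (FundamentalGroup M x)] {a b : Fin 5} (hab : a ≠ b) :
    Group.rank (FundamentalGroup M x) + faceCount (colorVertex κ : Δ.facets → Fin 5 → E) {a} +
      faceCount (colorVertex κ : Δ.facets → Fin 5 → E) {b} + 2 ≤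
      faceCount (colorVertex κ : Δ.facets → Fin 5 → E) {a, b} := by
  have hN := hΔ.isNormal
  have hfin := hΔ.1
  have : Finite Δ.facets := (hfin.subset fun _ h => h.1).to_subtype
  have := (finite_vertices hfin).fintype
  have hc : IsPreconnected Δ.space := by
    have : ConnectedSpace Δ.space := e.symm.surjective.connectedSpace e.symm.continuous
    exact isPreconnected_iff_preconnectedSpace.2 inferInstance
  let vx : Δ.facets → Fin 5 → Δ.vertices := fun F i =>
    ⟨colorVertex κ F i, hN.colorVertex_mem_vertices hκ F i⟩
  have h : IsChamberSystem vx :=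
    .of_comp Subtype.val_injective (isChamberSystem_colorVertex hN hκ hfin hc)
  have hr := mem_range_iff_mem_facet hN hκ (vx := vx) fun _ _ => rfl
  obtain ⟨g, hg, v₀, hfull⟩ := exists_cocycle hfin e x
  have hg' : ∀ F i j k, g (vx F i) (vx F j) * g (vx F j) (vx F k) = g (vx F i) (vx F k) :=
    fun F i j k => hg F.1 F.2.1 _ _ _ ((hr F _).1 ⟨i, rfl⟩) ((hr F _).1 ⟨j, rfl⟩)
      ((hr F _).1 ⟨k, rfl⟩)
  have hV : ∀ v, ∃ F i, vx F i = v := by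
    rintro ⟨v, hv⟩
    obtain ⟨F, hF⟩ := hN.exists_facet (SimplicialComplex.mem_vertices.1 hv)
    obtain ⟨i, hi⟩ := (hr F ⟨v, hv⟩).2 (hF (Finset.mem_singleton_self v))
    exact ⟨F, i, hi⟩
  obtain ⟨F₀, hF₀⟩ := h.edgeHol_full hg' hab hV (v₀ := v₀) fun q => (hfull q).mono (by
    rintro ⟨u, v⟩ ⟨t, ht, hu, hv⟩
    obtain ⟨F, hF⟩ := hN.exists_facet ht
    obtain ⟨i, hi⟩ := (hr F u).2 (hF hu)
    obtain ⟨j, hj⟩ := (hr F v).2 (hF hv)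
    exact ⟨F, i, j, hi, hj⟩)
  have hsph : ¬ Nonempty (geomReal (chamberFaces vx) ≃ₜ
      Metric.sphere (0 : EuclideanSpace ℝ (Fin 5)) 1) := by
    rintro ⟨e₂⟩
    obtain ⟨e₁, -⟩ := nonempty_homeomorph_geomReal (K := Δ) (ι := ((↑) : Δ.vertices → E))
      Subtype.val_injective (by simp)
    rw [← labelledFaces_eq_chamberFaces hN hκ (vx := vx) fun _ _ => rfl] at e₂
    exact hM ⟨e.symm.trans (e₁.symm.trans e₂)⟩
  have hlink : ∀ p : Δ.vertices, Nonempty (geomReal (poleLink vx p) ≃ₜ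
      Metric.sphere (0 : EuclideanSpace ℝ (Fin 4)) 1) := by
    intro p
    obtain ⟨e₁, -⟩ := nonempty_homeomorph_geomReal (K := link Δ p) (ι := ((↑) : Δ.vertices → E))
      Subtype.val_injective (by
        intro v hv
        rw [Subtype.range_coe]
        exact SimplicialComplex.mem_vertices.2 (SimplicialComplex.mem_vertices.1 hv).1)
    obtain ⟨e₂⟩ := (hΔ.2 p p.2).nonempty_homeomorph
    obtain ⟨e₃⟩ := nonempty_homeomorph_simplexBoundary 4
    rw [← labelledFaces_link_eq_poleLink hN hκ (vx := vx) fun _ _ => rfl]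
    exact ⟨e₁.trans (e₂.trans e₃)⟩
  have hcount : ∀ S, faceCount (colorVertex κ : Δ.facets → Fin 5 → E) S = faceCount vx S :=
    fun S => faceCount_comp (vx := vx) Subtype.val_injective S
  simp only [hcount]
  rcases h.exists_rank_le_or_isSpindle hg' hab hF₀ with ⟨_, hle⟩ | ⟨ℓ, p, q, hs⟩ | ⟨ℓ, p, q, hs⟩
  · exact hle
  · obtain ⟨φ⟩ := hlink p
    exact absurd (hs.nonempty_homeomorph_sphere h hab φ) hsph
  · obtain ⟨φ⟩ := hlink p
    have : Nonempty (range (linkEdges vx a b)) := ⟨⟨_, F₀, rfl⟩⟩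
    exact absurd (hs.nonempty_homeomorph_sphere h hab φ) hsph

end Bound

/-! ### Summing the edge bounds over non-consecutive colours. -/

open Classical in
-- In the pairs {k, k+2} every colour occurs twice, so the vertex terms of the genus formula cancel
-- against the five edge bounds, which leaves 1 + 5(m + 2) = 5m + 11 beside 2χ.
theorem complexGenus_ge {E : Type*} [NormedAddCommGroup E] [NormedSpace ℝ E]
    [FiniteDimensional ℝ E] {Δ : SimplicialComplex ℝ E} {κ : E → Fin 5}
    (hΔ : IsCombinatorialManifold 4 Δ) (hκ : IsBalancedColoring Δ κ)
    {M : Type*} [TopologicalSpace M] [ConnectedSpace M]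
    (hM : ¬ Nonempty (M ≃ₜ Metric.sphere (0 : EuclideanSpace ℝ (Fin 5)) 1))
    (e : Δ.space ≃ₜ M) (x : M) [Group.FG (FundamentalGroup M x)] :
    2 * (eulerChar Δ : ℝ) + 5 * (Group.rank (FundamentalGroup M x) : ℝ) + 11 ≤
      complexGenus Δ κ := by
  refine Finset.le_inf' _ _ fun ε _ => ?_
  rw [epsilonGenus_comp]
  have hκ' : IsBalancedColoring Δ (ε.symm ∘ κ) := hκ.comp ε.symm
  have hc : IsPreconnected Δ.space := by
    have : ConnectedSpace Δ.space := e.symm.surjective.connectedSpace e.symm.continuous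
    exact isPreconnected_iff_preconnectedSpace.2 inferInstance
  have hl : ∀ v ∈ Δ.vertices, eulerChar (link Δ v) = 0 := fun v hv => by
    rw [(hΔ.2 v hv).eulerChar_eq (finite_link hΔ.1 v) (finite_simplexBoundary 4),
      eulerChar_simplexBoundary_four]
  rw [epsilonGenus_one hΔ.isNormal hκ' hΔ.1
    (isChamberSystem_colorVertex hΔ.isNormal hκ' hΔ.1 hc) hl]
  have key : ∀ k : Fin 5, (Group.rank (FundamentalGroup M x) : ℝ) +
      faceCount (colorVertex (ε.symm ∘ κ) : Δ.facets → Fin 5 → E) {k} +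
      faceCount (colorVertex (ε.symm ∘ κ) : Δ.facets → Fin 5 → E) {k + 2} + 2 ≤
      faceCount (colorVertex (ε.symm ∘ κ) : Δ.facets → Fin 5 → E) {k, k + 2} := fun k => by
    exact_mod_cast faceCount_add_rank_le hΔ hκ' hM e x (by revert k; decide : k ≠ k + 2)
  have h0 := key 0
  have h1 := key 1
  have h2 := key 2
  have h3 := key 3
  have h4 := key 4
  rw [Fin.sum_univ_five]
  simp only [(by decide : (0 : Fin 5) + 2 = 2), (by decide : (1 : Fin 5) + 2 = 3),
    (by decide : (2 : Fin 5) + 2 = 4), (by decide : (3 : Fin 5) + 2 = 0),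
    (by decide : (4 : Fin 5) + 2 = 1)] at *
  linarith

end BalancedGenus

theorem theorem1p2 {M : Type*} [TopologicalSpace M] [ConnectedSpace M]
    (P : BalancedGenus.PLStructure 4 M)
    (hM : ¬ Nonempty (M ≃ₜ Metric.sphere (0 : EuclideanSpace ℝ (Fin 5)) 1))
    (x : M) :
    ∃ _ : Group.FG (FundamentalGroup M x),
      (((2 * (P.euler : ℝ) + 5 * (Group.rank (FundamentalGroup M x) : ℝ) + 11 : ℝ)) : EReal)
        ≤ P.balancedGenus := by
  have hFG := BalancedGenus.fundamentalGroup_fg P.isManifold.1 P.homeo x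
  refine ⟨hFG, ?_⟩
  unfold BalancedGenus.PLStructure.balancedGenus
  -- Each balanced triangulation is treated separately: the PL homeomorphism to the given complex
  -- transports the Euler characteristic and identifies the space with M.
  refine le_iInf fun n => le_iInf fun Δ => le_iInf fun κ => le_iInf fun hΔ => ?_
  obtain ⟨e⟩ := hΔ.plHomeomorphic.nonempty_homeomorph
  rw [BalancedGenus.PLStructure.euler,
    ← hΔ.plHomeomorphic.eulerChar_eq hΔ.isManifold.1 P.isManifold.1, EReal.coe_le_coe_iff]
  exact BalancedGenus.complexGenus_ge hΔ.isManifold hΔ.isBalanced hM (e.trans P.homeo) x
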